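/- Let $d\ge 2$ and $\alpha>0$. For $\varkappa>0$ let $\mathbb{H}^d(\varkappa)$ be the $d$-dimensional hyperbolic space of constant sectional curvature $-\varkappa$, with distance $d_\varkappa$ and volume measure $\mathcal{H}^d_\varkappa$, let $o\in\mathbb{H}^d(\varkappa)$ be a fixed point, $B^d(o,R)$ the open ball of radius $R$ around $o$, and $V_\varkappa(R):=\mathcal{H}^d_\varkappa(B^d(o,R))$. Let $\eta$ be a stationary Poisson process on $\mathbb{H}^d(\varkappa)$ with intensity $\gamma>0$, that is, a Poisson process with intensity measure $\gamma\mathcal{H}^d_\varkappa$. For $x\in\eta\setminus\{o\}$ let $\ell_\varkappa(x,\eta)$ be the distance from $x$ to its radial nearest neighbour, i.e. the minimum of $d_\varkappa(x,y)$ over all $y\in\eta\cup\{o\}$ with $d_\varkappa(o,y)<d_\varkappa(o,x)$, and for $R>0$ let $$\mathcal{L}^{(\alpha)}_{R,\gamma,\varkappa}:=\sum_{x\in\eta\cap B^d(o,R)}\ell_\varkappa(x,\eta)^\alpha$$ be the edge-length functional of the radial spanning tree on $\eta$ (a square-integrable random variable). (a) For all $\gamma,\varkappa>0$, $$\lim_{R\to\infty}\frac{\mathbb{E}[\mathcal{L}^{(\alpha)}_{R,\gamma,\varkappa}]}{V_\varkappa(R)}=\gamma\int_0^\infty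 e^{-\gamma\varkappa^{-d/2}G(\sqrt{\varkappa}\,u^{1/\alpha})}\,\mathrm{d}u<\infty,$$ where $$G(u):=\kappa_{d-1}\int_0^u\big[2e^{-t}\big(\cosh(u)-\cosh(t)\big)\big]^{\frac{d-1}{2}}\,\mathrm{d}t$$ and $\kappa_{k}=\frac{2\pi^{k/2}}{k\,\Gamma(k/2)}$ is the volume of the $k$-dimensional Euclidean unit ball. (b) For all $\gamma,\varkappa>0$ the limit $$\mathbb{V}^{(\alpha)}_{\gamma,\varkappa}:=\lim_{R\to\infty}\frac{\operatorname{Var}[\mathcal{L}^{(\alpha)}_{R,\gamma,\varkappa}]}{V_\varkappa(R)}$$ exists. Moreover, for every $c_0>0$ there are constants $\underline{c},\overline{c}>0$ depending only on $\alpha$, $d$ and $c_0$ such that $$\underline{c}\le\gamma^{\frac{2\alpha}{d}-1}\,\mathbb{V}^{(\alpha)}_{\gamma,\varkappa}\le\overline{c}$$ for all $\gamma>0$ and $\varkappa>0$ with $\varkappa^{-d/2}\gamma\ge c_0$. -/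

import Mathlib

open MeasureTheory ProbabilityTheory Filter Set
open scoped ENNReal NNReal Topology

universe u

namespace HypRST

/-- The upper half-space `{(x', x_d) : x' ∈ ℝ^{d-1}, x_d > 0}` (for `d ≥ 1`), the underlying set
of the model of `d`-dimensional hyperbolic space. The Borel structure is the Euclidean one. -/
abbrev HypSpace (d : ℕ) : Type :=
  {x : EuclideanSpace ℝ (Fin (d - 1)) × ℝ // 0 < x.2}

/-- The Riemannian distance on the upper half-space for the metric
`κ⁻¹ (dx_1² + ⋯ + dx_d²) / x_d²` of constant curvature `-κ`:
`d_κ(x, y) = κ^{-1/2} arcosh (1 + |x - y|² / (2 x_d y_d))`. -/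
noncomputable def hdist {d : ℕ} (κ : ℝ) (x y : HypSpace d) : ℝ :=
  1 / Real.sqrt κ *
    Real.arcosh (1 + (‖x.1.1 - y.1.1‖ ^ 2 + (x.1.2 - y.1.2) ^ 2) / (2 * x.1.2 * y.1.2))

/-- The open hyperbolic ball of radius `r` around `x`. -/
def hball {d : ℕ} (κ : ℝ) (x : HypSpace d) (r : ℝ) : Set (HypSpace d) :=
  {y | hdist κ x y < r}

/-- The hyperbolic volume (the Riemannian volume, i.e. the `d`-dimensional Hausdorff measure in
its usual normalisation) of the metric `κ⁻¹ (dx_1² + ⋯ + dx_d²) / x_d²`: it has density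
`κ^{-d/2} x_d^{-d}` with respect to Lebesgue measure. -/
noncomputable def hvol (d : ℕ) (κ : ℝ) : Measure (HypSpace d) :=
  (Measure.comap Subtype.val
    (volume : Measure (EuclideanSpace ℝ (Fin (d - 1)) × ℝ))).withDensity
      (fun x => ENNReal.ofReal (κ ^ (-(d : ℝ) / 2) / x.1.2 ^ d))

/-- The volume `V_κ(R)` of a hyperbolic ball of radius `R` around `o`. -/
noncomputable def ballVol {d : ℕ} (κ : ℝ) (o : HypSpace d) (R : ℝ) : ℝ :=
  (hvol d κ (hball κ o R)).toReal

/-- `η` is a Poisson process with intensity measure `μ` on the hyperbolic space of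
curvature `-κ`, defined on the probability space `(Ω, P)`: a random locally finite set such that
the number of points in a Borel set `B` is Poisson distributed with mean `μ B` (almost surely
infinite if `μ B = ∞`) and the numbers of points in disjoint Borel sets are independent. -/
structure IsPoissonProcess {d : ℕ} (κ : ℝ) (μ : Measure (HypSpace d))
    {Ω : Type u} [MeasurableSpace Ω] (P : Measure Ω) (η : Ω → Set (HypSpace d)) : Prop where
  locallyFinite : ∀ ω x r, (η ω ∩ hball κ x r).Finite
  measurable_count : ∀ B, MeasurableSet B → Measurable fun ω => (η ω ∩ B).encard
  poisson_count : ∀ B, MeasurableSet B → μ B ≠ ∞ → ∀ k : ℕ,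
    P {ω | (η ω ∩ B).encard = k} = poissonMeasure (μ B).toNNReal {k}
  infinite_count : ∀ B, MeasurableSet B → μ B = ∞ → ∀ᵐ ω ∂P, (η ω ∩ B).encard = ⊤
  indep_count : ∀ (k : ℕ) (B : Fin k → Set (HypSpace d)), (∀ i, MeasurableSet (B i)) →
    Pairwise (fun i j => Disjoint (B i) (B j)) →
    iIndepFun (fun i ω => (η ω ∩ B i).encard) P

/-- The vertices of the radial spanning tree on `ξ` with root `o` that are strictly closer to
`o` than `x` is. -/
def closerVertices {d : ℕ} (κ : ℝ) (o : HypSpace d) (ξ : Set (HypSpace d)) (x : HypSpace d) :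
    Set (HypSpace d) :=
  {y | y ∈ insert o ξ ∧ hdist κ o y < hdist κ o x}

/-- `y` is a radial nearest neighbour of `x` in the radial spanning tree on `ξ` with root `o`:
a nearest one to `x` among the vertices that are closer to `o` than `x`. -/
def IsRadialNearest {d : ℕ} (κ : ℝ) (o : HypSpace d) (ξ : Set (HypSpace d))
    (x y : HypSpace d) : Prop :=
  y ∈ closerVertices κ o ξ x ∧ ∀ z ∈ closerVertices κ o ξ x, hdist κ x y ≤ hdist κ x z

/-- The length `ℓ_κ(x, ξ)` of the edge from `x` to its radial nearest neighbour. -/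
noncomputable def edgeLength {d : ℕ} (κ : ℝ) (o : HypSpace d) (ξ : Set (HypSpace d))
    (x : HypSpace d) : ℝ :=
  sInf (hdist κ x '' closerVertices κ o ξ x)

/-- `ℓ_κ(x, ξ)` is the distance from `x` to its radial nearest neighbour. -/
theorem edgeLength_eq {d : ℕ} {κ : ℝ} {o : HypSpace d} {ξ : Set (HypSpace d)}
    {x y : HypSpace d} (h : IsRadialNearest κ o ξ x y) :
    edgeLength κ o ξ x = hdist κ x y := by
  refine IsLeast.csInf_eq ⟨mem_image_of_mem _ h.1, ?_⟩
  rintro _ ⟨z, hz, rfl⟩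
  exact h.2 z hz

/-- The edge-length functional `L_R^{(α)} = ∑_{x ∈ ξ ∩ B(o, R)} ℓ_κ(x, ξ)^α`
(a finite sum, for locally finite `ξ`). -/
noncomputable def edgeFunctional {d : ℕ} (κ : ℝ) (o : HypSpace d) (α R : ℝ)
    (ξ : Set (HypSpace d)) : ℝ :=
  ∑ᶠ x ∈ ξ ∩ hball κ o R, edgeLength κ o ξ x ^ α

/-- The volume `κ_k = ω_k / k`, with `ω_k = 2 π^{k/2} / Γ(k/2)`, of the Euclidean unit ball in
`ℝ^k`, `k ≥ 1`. -/
noncomputable def unitBallVol (k : ℕ) : ℝ :=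
  (2 * Real.pi ^ ((k : ℝ) / 2) / Real.Gamma ((k : ℝ) / 2)) / k

/-- `G(u) = κ_{d-1} ∫_0^u [2 e^{-t} (cosh u - cosh t)]^{(d-1)/2} dt`. -/
noncomputable def G (d : ℕ) (u : ℝ) : ℝ :=
  unitBallVol (d - 1) *
    ∫ t in (0 : ℝ)..u,
      (2 * Real.exp (-t) * (Real.cosh u - Real.cosh t)) ^ (((d : ℝ) - 1) / 2)

end HypRST

/-! Changing the curvature only rescales lengths and volumes, so everything reduces to curvature
$-1$ with intensity $g=\gamma\varkappa^{-d/2}$; the exponent is called `β` below. An edge at `x` has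
length at least `s` exactly when `s` is at most the distance to the root and the lens `lens o x s`
(points near `x` and closer to `o`) contains no point of the process. Hence the Mecke formulas for
one and two points write the mean and the variance as integrals over `x ∈ B(o,R)` of explicit
densities (`IsPoissonLaw.integral_edgeSum`, `IsPoissonLaw.variance_edgeSum`).

The limits. Translations and dilations of the half-space are isometries acting transitively, so a
density at `x` depends only on the root as seen from `x`, the point `iact x o`. Outside a Euclidean
cone, whose volume inside the ball grows only linearly in `R` while the ball grows faster, this root
is close to the ideal point at infinity. There the lens becomes the part of a ball inside the
horoball through its centre, of volume `G` (`hvol_horoball_inter_hball`). Averages over balls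
therefore converge to the value of the density at the ideal point (`tendsto_average`). The variance
density passes to the limit, and is bounded above, because edges at `x` and `y` are independent when
their balls are disjoint, and otherwise one of the two edges is long, which is exponentially
unlikely (`abs_covKernel_le`).

The lower bound. The functional is tested against the compensated number of points around which the
configuration shows a fixed local pattern of size $\rho\sim g^{-1/d}$. Integration by parts turns
the covariance into the mean add-one cost on the pattern, the compensated count has variance of the
order of the volume, and Cauchy–Schwarz concludes (`IsPoissonLaw.le_variance`). It remains to
exhibit a pattern on which the add-one cost has a definite sign. For `β ≥ 1`, the new point has a
short edge and shortens two longer edges substantially, so the functional drops. For `β < 1`, the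
new point sits beside a single old point at a distance far below the typical spacing; by concavity
the shortening of other edges costs little compared with the new edge, so the functional grows in
the mean. -/

namespace HypRST

/-! ### Geometry of the half-space: distance, transitive isometries, triangle inequality, geodesics.
-/

variable {d : ℕ}

/-- The hyperbolic cosine of the distance in curvature `-1`. -/
noncomputable def chd (x y : HypSpace d) : ℝ :=
  1 + (‖x.1.1 - y.1.1‖ ^ 2 + (x.1.2 - y.1.2) ^ 2) / (2 * x.1.2 * y.1.2)

lemma one_le_chd (x y : HypSpace d) : 1 ≤ chd x y := by
  have hx : 0 < x.1.2 := x.2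
  have hy : 0 < y.1.2 := y.2
  unfold chd
  have : 0 ≤ (‖x.1.1 - y.1.1‖ ^ 2 + (x.1.2 - y.1.2) ^ 2) / (2 * x.1.2 * y.1.2) := by positivity
  linarith

lemma hdist_one (x y : HypSpace d) : hdist 1 x y = Real.arcosh (chd x y) := by
  simp [hdist, chd]

lemma cosh_hdist (x y : HypSpace d) : Real.cosh (hdist 1 x y) = chd x y := by
  rw [hdist_one, Real.cosh_arcosh (one_le_chd x y)]

lemma hdist_nonneg (x y : HypSpace d) : 0 ≤ hdist 1 x y := by
  rw [hdist_one]; exact Real.arcosh_nonneg (one_le_chd x y)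

lemma chd_comm (x y : HypSpace d) : chd x y = chd y x := by
  unfold chd
  rw [norm_sub_rev]
  ring

lemma hdist_comm (x y : HypSpace d) : hdist 1 x y = hdist 1 y x := by
  rw [hdist_one, hdist_one, chd_comm]

lemma hdist_self (x : HypSpace d) : hdist 1 x x = 0 := by
  rw [hdist_one]; simp [chd]

lemma hdist_lt_iff (x y : HypSpace d) {s : ℝ} (hs : 0 ≤ s) :
    hdist 1 x y < s ↔ chd x y < Real.cosh s := by
  rw [← cosh_hdist, Real.cosh_lt_cosh, abs_of_nonneg hs, abs_of_nonneg (hdist_nonneg x y)]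

lemma hdist_le_iff (x y : HypSpace d) {s : ℝ} (hs : 0 ≤ s) :
    hdist 1 x y ≤ s ↔ chd x y ≤ Real.cosh s := by
  rw [← cosh_hdist, Real.cosh_le_cosh, abs_of_nonneg hs, abs_of_nonneg (hdist_nonneg x y)]

lemma hdist_lt_hdist_iff (x y z w : HypSpace d) :
    hdist 1 x y < hdist 1 z w ↔ chd x y < chd z w := by
  rw [hdist_lt_iff x y (hdist_nonneg z w), cosh_hdist]

lemma hdist_eq_zero {x y : HypSpace d} : hdist 1 x y = 0 ↔ x = y := by
  refine ⟨fun h => ?_, fun h => h ▸ hdist_self x⟩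
  have h1 := cosh_hdist x y
  rw [h, Real.cosh_zero] at h1
  have hx : 0 < x.1.2 := x.2
  have hy : 0 < y.1.2 := y.2
  have h2 : (‖x.1.1 - y.1.1‖ ^ 2 + (x.1.2 - y.1.2) ^ 2) / (2 * x.1.2 * y.1.2) = 0 := by
    unfold chd at h1; linarith
  have h3 : ‖x.1.1 - y.1.1‖ ^ 2 + (x.1.2 - y.1.2) ^ 2 = 0 := by
    rcases div_eq_zero_iff.1 h2 with h | h
    · exact h
    · exact absurd h (by positivity)
  have h4 : ‖x.1.1 - y.1.1‖ ^ 2 = 0 := by nlinarith [sq_nonneg ‖x.1.1 - y.1.1‖, sq_nonneg (x.1.2 - y.1.2)]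
  have h5 : (x.1.2 - y.1.2) ^ 2 = 0 := by nlinarith [sq_nonneg ‖x.1.1 - y.1.1‖, sq_nonneg (x.1.2 - y.1.2)]
  have h6 : x.1.1 = y.1.1 := by
    rw [← sub_eq_zero, ← norm_eq_zero]; exact pow_eq_zero_iff (two_ne_zero) |>.1 h4
  have h7 : x.1.2 = y.1.2 := by
    rw [← sub_eq_zero]; exact pow_eq_zero_iff (two_ne_zero) |>.1 h5
  exact Subtype.ext (Prod.ext h6 h7)

lemma hdist_pos {x y : HypSpace d} (h : x ≠ y) : 0 < hdist 1 x y :=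
  lt_of_le_of_ne (hdist_nonneg x y) fun h' => h (hdist_eq_zero.1 h'.symm)

/-- The base point `(0, 1)`. -/
def base (d : ℕ) : HypSpace d := ⟨(0, 1), one_pos⟩

/-- The similarity of the half-space which takes the base point to `x`. -/
def act (x y : HypSpace d) : HypSpace d :=
  ⟨(x.1.1 + x.1.2 • y.1.1, x.1.2 * y.1.2), mul_pos x.2 y.2⟩

/-- The inverse of `act x`. -/
noncomputable def iact (x y : HypSpace d) : HypSpace d :=
  ⟨(x.1.2⁻¹ • (y.1.1 - x.1.1), x.1.2⁻¹ * y.1.2), mul_pos (inv_pos.2 x.2) y.2⟩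

lemma act_iact (x y : HypSpace d) : act x (iact x y) = y := by
  have hx : x.1.2 ≠ 0 := x.2.ne'
  apply Subtype.ext
  apply Prod.ext
  · simp [act, iact, smul_smul, hx]
  · simp [act, iact, hx]

lemma iact_act (x y : HypSpace d) : iact x (act x y) = y := by
  have hx : x.1.2 ≠ 0 := x.2.ne'
  apply Subtype.ext
  apply Prod.ext
  · simp [act, iact, smul_smul, hx]
  · simp [act, iact, hx]

lemma act_base (x : HypSpace d) : act x (base d) = x := by
  apply Subtype.ext
  apply Prod.ext <;> simp [act, base]

lemma iact_self (x : HypSpace d) : iact x x = base d := by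
  conv_lhs => rw [← act_base x]
  rw [act_base]
  nth_rw 2 [← act_base x]
  rw [iact_act]

lemma chd_act (x y z : HypSpace d) : chd (act x y) (act x z) = chd y z := by
  have hx : 0 < x.1.2 := x.2
  have hy : 0 < y.1.2 := y.2
  have hz : 0 < z.1.2 := z.2
  unfold chd act
  simp only
  rw [add_sub_add_left_eq_sub, ← smul_sub, norm_smul, Real.norm_of_nonneg hx.le]
  field_simp

lemma hdist_act (x y z : HypSpace d) : hdist 1 (act x y) (act x z) = hdist 1 y z := by
  rw [hdist_one, hdist_one, chd_act]

lemma hdist_iact (x y z : HypSpace d) : hdist 1 (iact x y) (iact x z) = hdist 1 y z := by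
  rw [← hdist_act x, act_iact, act_iact]

lemma hdist_base_iact (x z : HypSpace d) : hdist 1 (base d) (iact x z) = hdist 1 x z := by
  rw [← iact_self x, hdist_iact]

lemma chd_base (x : HypSpace d) :
    chd (base d) x = (‖x.1.1‖ ^ 2 + x.1.2 ^ 2 + 1) / (2 * x.1.2) := by
  have hx : 0 < x.1.2 := x.2
  simp only [chd, base, zero_sub, norm_neg]
  field_simp
  ring

lemma chd_eq (x y : HypSpace d) :
    chd x y = (‖x.1.1 - y.1.1‖ ^ 2 + x.1.2 ^ 2 + y.1.2 ^ 2) / (2 * x.1.2 * y.1.2) := by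
  have hx : 0 < x.1.2 := x.2
  have hy : 0 < y.1.2 := y.2
  simp only [chd]
  field_simp
  ring

/-- Here `p`, `q` are the norms of the horizontal parts, `a`, `b` the heights, `I` the inner
product, and the right side is `cosh (r + s)` expanded. With `X = p² + a²`, `Y = q² + b²` the claim
becomes Cauchy–Schwarz for the vectors `(X - 1, 2x')` and `(Y - 1, 2y')`. -/
lemma hyp_triangle_aux {a b p q I : ℝ} (ha : 0 < a) (hb : 0 < b) (hcs : |I| ≤ p * q) :
    (p ^ 2 - 2 * I + q ^ 2 + a ^ 2 + b ^ 2) / (2 * a * b) ≤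
      (p ^ 2 + a ^ 2 + 1) / (2 * a) * ((q ^ 2 + b ^ 2 + 1) / (2 * b)) +
      √(((p ^ 2 + a ^ 2 + 1) / (2 * a)) ^ 2 - 1) * √(((q ^ 2 + b ^ 2 + 1) / (2 * b)) ^ 2 - 1) := by
  obtain ⟨X, hX⟩ : ∃ X, X = p ^ 2 + a ^ 2 := ⟨_, rfl⟩
  obtain ⟨Y, hY⟩ : ∃ Y, Y = q ^ 2 + b ^ 2 := ⟨_, rfl⟩
  rw [← hX, ← hY]
  have h1 : ((X + 1) / (2 * a)) ^ 2 - 1 = ((X - 1) ^ 2 + 4 * p ^ 2) / (2 * a) ^ 2 := by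
    field_simp
    rw [hX]; ring
  have h2 : ((Y + 1) / (2 * b)) ^ 2 - 1 = ((Y - 1) ^ 2 + 4 * q ^ 2) / (2 * b) ^ 2 := by
    field_simp
    rw [hY]; ring
  rw [h1, h2, Real.sqrt_div (by positivity), Real.sqrt_div (by positivity),
    Real.sqrt_sq (by positivity), Real.sqrt_sq (by positivity)]
  have h3 : -((X - 1) * (Y - 1)) - 4 * I ≤
      √((X - 1) ^ 2 + 4 * p ^ 2) * √((Y - 1) ^ 2 + 4 * q ^ 2) := by
    rw [← Real.sqrt_mul (by positivity)]
    apply Real.le_sqrt_of_sq_le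
    have hI2 : I ^ 2 ≤ (p * q) ^ 2 := by
      rw [← sq_abs I]; gcongr
    obtain ⟨h4, h5⟩ := abs_le.1 hcs
    -- The cross term of the squared inequality; the sign of `(X - 1)(Y - 1)` decides which of the
    -- two bounds on `I` is used.
    have h6 : 2 * ((X - 1) * (Y - 1)) * (4 * I) ≤
        4 * (q ^ 2 * (X - 1) ^ 2 + p ^ 2 * (Y - 1) ^ 2) := by
      rcases le_total 0 ((X - 1) * (Y - 1)) with h | h
      · nlinarith [sq_nonneg (q * (X - 1) - p * (Y - 1)), mul_le_mul_of_nonneg_left h5 h]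
      · nlinarith [sq_nonneg (q * (X - 1) + p * (Y - 1)), mul_le_mul_of_nonpos_left h4 h]
    linarith
  have h7 : (p ^ 2 - 2 * I + q ^ 2 + a ^ 2 + b ^ 2) * 2 ≤
      (X + 1) * (Y + 1) + √((X - 1) ^ 2 + 4 * p ^ 2) * √((Y - 1) ^ 2 + 4 * q ^ 2) := by
    have : (p ^ 2 - 2 * I + q ^ 2 + a ^ 2 + b ^ 2) = X + Y - 2 * I := by rw [hX, hY]; ring
    rw [this]
    linarith
  have h8 : (X + 1) / (2 * a) * ((Y + 1) / (2 * b)) +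
      √((X - 1) ^ 2 + 4 * p ^ 2) / (2 * a) * (√((Y - 1) ^ 2 + 4 * q ^ 2) / (2 * b)) =
      ((X + 1) * (Y + 1) + √((X - 1) ^ 2 + 4 * p ^ 2) * √((Y - 1) ^ 2 + 4 * q ^ 2)) / 2 /
        (2 * a * b) := by
    field_simp
  rw [h8]
  gcongr
  linarith

/-- The case of the triangle inequality to which transitivity of the isometries reduces the general
one. -/
lemma hdist_triangle_base (x y : HypSpace d) :
    hdist 1 x y ≤ hdist 1 (base d) x + hdist 1 (base d) y := by
  rw [hdist_le_iff _ _ (add_nonneg (hdist_nonneg _ _) (hdist_nonneg _ _)), Real.cosh_add,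
    hdist_one, hdist_one, Real.cosh_arcosh (one_le_chd _ _), Real.cosh_arcosh (one_le_chd _ _),
    Real.sinh_arcosh (one_le_chd _ _), Real.sinh_arcosh (one_le_chd _ _),
    chd_base, chd_base, chd_eq, norm_sub_sq_real]
  exact hyp_triangle_aux x.2 y.2 (abs_real_inner_le_norm _ _)

lemma hdist_triangle (x y z : HypSpace d) : hdist 1 x z ≤ hdist 1 x y + hdist 1 y z := by
  have := hdist_triangle_base (iact y x) (iact y z)
  rwa [hdist_iact, hdist_base_iact, hdist_base_iact, hdist_comm y x] at this

lemma continuous_chd : Continuous fun p : HypSpace d × HypSpace d => chd p.1 p.2 := by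
  have h : ∀ p : HypSpace d × HypSpace d, 2 * p.1.1.2 * p.2.1.2 ≠ 0 := fun p =>
    (mul_pos (mul_pos two_pos p.1.2) p.2.2).ne'
  unfold chd
  fun_prop (disch := exact h _)

lemma continuous_hdist : Continuous fun p : HypSpace d × HypSpace d => hdist 1 p.1 p.2 := by
  simp_rw [hdist_one]
  exact Real.continuousOn_arcosh.comp_continuous continuous_chd fun p => one_le_chd _ _

lemma continuous_hdist_comp {Y : Type*} [TopologicalSpace Y] {f g : Y → HypSpace d}
    (hf : Continuous f) (hg : Continuous g) : Continuous fun y => hdist (d := d) 1 (f y) (g y) :=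
  Continuous.comp₂ (continuous_hdist (d := d)) hf hg

lemma continuous_act (x : HypSpace d) : Continuous (act x) := by
  unfold act; fun_prop

lemma continuous_iact (x : HypSpace d) : Continuous (iact x) := by
  unfold iact; fun_prop

/-- `act x` as a homeomorphism. -/
noncomputable def actHomeo (x : HypSpace d) : HypSpace d ≃ₜ HypSpace d where
  toFun := act x
  invFun := iact x
  left_inv := iact_act x
  right_inv := act_iact x
  continuous_toFun := continuous_act x
  continuous_invFun := continuous_iact x

/-- Dropping the horizontal part from `chd (base d) x` leaves the hyperbolic cosine of the logarithm
of the height. -/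
lemma abs_log_le_hdist_base (x : HypSpace d) : |Real.log x.1.2| ≤ hdist 1 (base d) x := by
  have hx : 0 < x.1.2 := x.2
  have : Real.cosh (Real.log x.1.2) ≤ Real.cosh (hdist 1 (base d) x) := by
    rw [cosh_hdist, chd_base, Real.cosh_eq, Real.exp_neg, Real.exp_log hx]
    rw [div_le_div_iff₀ two_pos (by positivity)]
    have : 0 ≤ ‖x.1.1‖ ^ 2 := by positivity
    have h2 : (x.1.2 + x.1.2⁻¹) * (2 * x.1.2) = 2 * (x.1.2 ^ 2 + 1) := by field_simp
    rw [h2]; nlinarith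
  rwa [Real.cosh_le_cosh, abs_of_nonneg (hdist_nonneg _ _)] at this

/-- The point at distance `t` from `x` on the geodesic from `x` to `o`. -/
lemma exists_between (x o : HypSpace d) {t : ℝ} (h0 : 0 ≤ t) (ht : t ≤ hdist 1 x o) :
    ∃ m : HypSpace d, hdist 1 x m = t ∧ hdist 1 m o = hdist 1 x o - t := by
  set r := hdist 1 x o with hr
  rcases (h0.trans ht).eq_or_lt with h | hrpos
  · refine ⟨x, ?_, ?_⟩
    · rw [hdist_self]; linarith
    · rw [← hr]; linarith
  have hx : 0 < x.1.2 := x.2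
  have ho : 0 < o.1.2 := o.2
  have hs : 0 < Real.sinh r := Real.sinh_pos_iff.2 hrpos
  -- In the hyperboloid model the geodesic point at distance `t` is `p • x + q • o` with these
  -- weights; `hunit` below says that this vector has Minkowski norm one.
  set p := Real.sinh (r - t) / Real.sinh r with hp
  set q := Real.sinh t / Real.sinh r with hq
  have hp0 : 0 ≤ p := div_nonneg (Real.sinh_nonneg_iff.2 (by linarith)) hs.le
  have hq0 : 0 ≤ q := div_nonneg (Real.sinh_nonneg_iff.2 h0) hs.le
  have hpq : 0 < p + q := by
    rcases h0.eq_or_lt with h | h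
    · have : p = 1 := by rw [hp, ← h, sub_zero, div_self hs.ne']
      linarith
    · have : 0 < q := div_pos (Real.sinh_pos_iff.2 h) hs
      linarith
  have hpr : p + q * Real.cosh r = Real.cosh t := by
    rw [hp, hq, Real.sinh_sub]; field_simp; ring
  have hqr : p * Real.cosh r + q = Real.cosh (r - t) := by
    rw [hp, hq, Real.sinh_sub, Real.cosh_sub]
    field_simp
    linear_combination (-Real.sinh t) * Real.cosh_sq r
  have hc : Real.cosh r = chd x o := cosh_hdist x o
  have hunit : p ^ 2 + q ^ 2 + 2 * p * q * Real.cosh r = 1 := by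
    have h1 : p * (p + q * Real.cosh r) + q * (p * Real.cosh r + q) = 1 := by
      rw [hpr, hqr, hp, hq]
      field_simp
      have := Real.sinh_add (r - t) t
      rw [sub_add_cancel] at this
      linarith
    linarith
  -- The hyperboloid vector of a point `y` has the linear coordinates `1 / y_d` and `y' / y_d`. Thus
  -- `u` is the inverse height of the new point and `v` its horizontal part divided by its height.
  set u := p / x.1.2 + q / o.1.2 with hu
  have hu0 : 0 < u := by
    rcases hp0.eq_or_lt with h | h
    · have : 0 < q := by linarith
      have := div_pos this ho
      rw [hu, ← h]; simpa using this
    · have h1 := div_pos h hx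
      have h2 := div_nonneg hq0 ho.le
      linarith
  set v := (p / x.1.2) • x.1.1 + (q / o.1.2) • o.1.1 with hv
  -- Up to sign `chd y` is the Minkowski product with `y`, hence linear on the hyperboloid vectors.
  have key : ∀ y : HypSpace d, chd y ⟨(u⁻¹ • v, u⁻¹), inv_pos.2 hu0⟩ =
      p * chd y x + q * chd y o := by
    intro y
    have hy : 0 < y.1.2 := y.2
    rw [chd_eq, chd_eq, chd_eq]
    have hv2 : ‖v‖ ^ 2 + 1 = u * (p / x.1.2 * (‖x.1.1‖ ^ 2 + x.1.2 ^ 2) +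
        q / o.1.2 * (‖o.1.1‖ ^ 2 + o.1.2 ^ 2)) := by
      rw [hv, norm_add_sq_real, norm_smul, norm_smul, inner_smul_left, inner_smul_right, hu,
        Real.norm_of_nonneg (div_nonneg hp0 hx.le), Real.norm_of_nonneg (div_nonneg hq0 ho.le)]
      rw [hc, chd_eq, norm_sub_sq_real] at hunit
      simp only [conj_trivial]
      rw [← hunit]
      field_simp
      ring
    have hvi : inner ℝ y.1.1 v = p / x.1.2 * inner ℝ y.1.1 x.1.1 +
        q / o.1.2 * inner ℝ y.1.1 o.1.1 := by
      rw [hv, inner_add_right, inner_smul_right, inner_smul_right]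
    have h1 : ‖y.1.1 - u⁻¹ • v‖ ^ 2 + y.1.2 ^ 2 + u⁻¹ ^ 2 =
        ‖y.1.1‖ ^ 2 + y.1.2 ^ 2 - 2 * u⁻¹ * inner ℝ y.1.1 v + u⁻¹ ^ 2 * (‖v‖ ^ 2 + 1) := by
      rw [norm_sub_sq_real, norm_smul, inner_smul_right, Real.norm_of_nonneg (inv_pos.2 hu0).le]
      ring
    simp only
    rw [h1, hv2, hvi, norm_sub_sq_real, norm_sub_sq_real]
    have hu' : u = (p * o.1.2 + q * x.1.2) / (x.1.2 * o.1.2) := by rw [hu]; field_simp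
    have h2 : (‖y.1.1‖ ^ 2 + y.1.2 ^ 2 - 2 * u⁻¹ * (p / x.1.2 * inner ℝ y.1.1 x.1.1 +
        q / o.1.2 * inner ℝ y.1.1 o.1.1) + u⁻¹ ^ 2 * (u * (p / x.1.2 * (‖x.1.1‖ ^ 2 + x.1.2 ^ 2) +
        q / o.1.2 * (‖o.1.1‖ ^ 2 + o.1.2 ^ 2)))) / (2 * y.1.2 * u⁻¹) =
        (u * (‖y.1.1‖ ^ 2 + y.1.2 ^ 2) - 2 * (p / x.1.2 * inner ℝ y.1.1 x.1.1 +
        q / o.1.2 * inner ℝ y.1.1 o.1.1) + (p / x.1.2 * (‖x.1.1‖ ^ 2 + x.1.2 ^ 2) +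
        q / o.1.2 * (‖o.1.1‖ ^ 2 + o.1.2 ^ 2))) / (2 * y.1.2) := by
      field_simp
    rw [h2, hu]
    field_simp
    ring
  have hself : ∀ y : HypSpace d, chd y y = 1 := fun y => by simp [chd]
  refine ⟨⟨(u⁻¹ • v, u⁻¹), inv_pos.2 hu0⟩, ?_, ?_⟩
  · rw [hdist_one, key, hself, ← hc, mul_one, hpr, Real.arcosh_cosh h0]
  · rw [hdist_comm, hdist_one, key, hself, chd_comm o x, ← hc, mul_one, hqr,
      Real.arcosh_cosh (by linarith)]

end HypRST

/-! ### Hyperbolic volume: invariance, balls, horoballs and lenses. -/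

namespace HypRST

variable {d : ℕ}

lemma measurableSet_upper (d : ℕ) :
    MeasurableSet {x : EuclideanSpace ℝ (Fin (d - 1)) × ℝ | 0 < x.2} :=
  measurableSet_lt measurable_const measurable_snd

lemma measurableEmbedding_val (d : ℕ) :
    MeasurableEmbedding (Subtype.val : HypSpace d → EuclideanSpace ℝ (Fin (d - 1)) × ℝ) :=
  MeasurableEmbedding.subtype_coe (measurableSet_upper d)

lemma lintegral_hvol {f : EuclideanSpace ℝ (Fin (d - 1)) × ℝ → ℝ≥0∞} (hf : Measurable f) :
    ∫⁻ x : HypSpace d, f x.1 ∂(hvol d 1) =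
      ∫⁻ p in {p | 0 < p.2}, ENNReal.ofReal (1 / p.2 ^ d) * f p := by
  have hm : Measurable fun p : EuclideanSpace ℝ (Fin (d - 1)) × ℝ =>
      ENNReal.ofReal (1 / p.2 ^ d) := by fun_prop
  unfold hvol
  simp only [Real.one_rpow]
  have hm' : Measurable fun x : HypSpace d => ENNReal.ofReal (1 / x.1.2 ^ d) :=
    hm.comp measurable_subtype_coe
  have hf' : Measurable fun x : HypSpace d => f x.1 := hf.comp measurable_subtype_coe
  rw [lintegral_withDensity_eq_lintegral_mul _ hm' hf']
  have := (measurableEmbedding_val d).lintegral_map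
    (μ := Measure.comap Subtype.val volume) (fun p => ENNReal.ofReal (1 / p.2 ^ d) * f p)
  simp only [Pi.mul_apply]
  rw [← this, (measurableEmbedding_val d).map_comap]
  congr 2
  ext p
  simp

lemma hvol_preimage {A : Set (EuclideanSpace ℝ (Fin (d - 1)) × ℝ)} (hA : MeasurableSet A) :
    hvol d 1 (Subtype.val ⁻¹' A) =
      ∫⁻ p in {p | 0 < p.2}, ENNReal.ofReal (1 / p.2 ^ d) * A.indicator 1 p := by
  rw [← lintegral_hvol (measurable_one.indicator hA),
    ← lintegral_indicator_one (measurable_subtype_coe hA)]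
  rfl

/-- A dilation by `x_d` multiplies Lebesgue measure by `x_d ^ d` and the density by its inverse;
horizontal translations change neither. -/
lemma measurePreserving_act (hd : 1 ≤ d) (x : HypSpace d) :
    MeasurePreserving (act x) (hvol d 1) (hvol d 1) := by
  refine ⟨(continuous_act x).measurable, ?_⟩
  ext S hS
  have hx : 0 < x.1.2 := x.2
  rw [Measure.map_apply (continuous_act x).measurable hS]
  obtain ⟨A, hA, rfl⟩ : ∃ A : Set (EuclideanSpace ℝ (Fin (d - 1)) × ℝ),
      MeasurableSet A ∧ Subtype.val ⁻¹' A = S := hS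
  set T : EuclideanSpace ℝ (Fin (d - 1)) × ℝ → EuclideanSpace ℝ (Fin (d - 1)) × ℝ :=
    fun p => x.1.2 • p + (x.1.1, 0) with hT
  have hTm : Measurable T := by fun_prop
  have h1 : act x ⁻¹' (Subtype.val ⁻¹' A) = Subtype.val ⁻¹' (T ⁻¹' A) := by
    ext y
    have : (act x y).1 = T y.1 := by
      apply Prod.ext <;> simp [act, hT, add_comm]
    simp only [mem_preimage, this]
  rw [h1, hvol_preimage (hTm hA), hvol_preimage hA]
  have : (volume : Measure (EuclideanSpace ℝ (Fin (d - 1)) × ℝ)).IsAddHaarMeasure := by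
    rw [Measure.volume_eq_prod]; infer_instance
  have hmap : Measure.map T volume = ENNReal.ofReal ((x.1.2 ^ d)⁻¹) •
      (volume : Measure (EuclideanSpace ℝ (Fin (d - 1)) × ℝ)) := by
    have e : T = (fun p => p + (x.1.1, 0)) ∘ fun p => x.1.2 • p := rfl
    rw [e, ← Measure.map_map (by fun_prop) (by fun_prop), Measure.map_addHaar_smul _ hx.ne',
      Measure.map_smul, (measurePreserving_add_right volume _).map_eq]
    have : Module.finrank ℝ (EuclideanSpace ℝ (Fin (d - 1)) × ℝ) = d := by
      simp; omega
    rw [this, abs_of_pos (by positivity)]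
  have hU := measurableSet_upper d
  have hfm : Measurable fun p : EuclideanSpace ℝ (Fin (d - 1)) × ℝ =>
      ENNReal.ofReal (1 / p.2 ^ d) * A.indicator 1 p :=
    (by fun_prop : Measurable fun p : EuclideanSpace ℝ (Fin (d - 1)) × ℝ =>
      ENNReal.ofReal (1 / p.2 ^ d)).mul (measurable_one.indicator hA)
  have hpre : T ⁻¹' {p | 0 < p.2} = {p | 0 < p.2} := by
    ext p
    simp [hT, hx]
  have h2 := setLIntegral_map (μ := volume) hU hfm hTm
  rw [hmap, Measure.restrict_smul, lintegral_smul_measure, hpre] at h2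
  have h3 : ∀ p : EuclideanSpace ℝ (Fin (d - 1)) × ℝ,
      ENNReal.ofReal (1 / p.2 ^ d) * (T ⁻¹' A).indicator 1 p =
      ENNReal.ofReal (x.1.2 ^ d) * (ENNReal.ofReal (1 / (T p).2 ^ d) * A.indicator 1 (T p)) := by
    intro p
    have e1 : (T p).2 = x.1.2 * p.2 := by simp [hT]
    have e2 : (T ⁻¹' A).indicator (1 : EuclideanSpace ℝ (Fin (d - 1)) × ℝ → ℝ≥0∞) p =
        A.indicator 1 (T p) := rfl
    rw [e1, e2, ← mul_assoc, ← ENNReal.ofReal_mul (by positivity)]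
    congr 2
    rw [mul_pow]
    field_simp
  simp_rw [h3]
  rw [lintegral_const_mul' _ _ ENNReal.ofReal_ne_top, ← h2, smul_eq_mul, ← mul_assoc,
    ← ENNReal.ofReal_mul (by positivity), mul_inv_cancel₀ (by positivity)]
  simp

lemma hvol_act_preimage (hd : 1 ≤ d) (x : HypSpace d) (S : Set (HypSpace d)) :
    hvol d 1 (act x ⁻¹' S) = hvol d 1 S :=
  (measurePreserving_act hd x).measure_preimage_emb (actHomeo x).measurableEmbedding S

lemma unitBallVol_pos {k : ℕ} (hk : 1 ≤ k) : 0 < unitBallVol k := by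
  have : (0 : ℝ) < k := by exact_mod_cast hk
  unfold unitBallVol
  have h := Real.Gamma_pos_of_pos (half_pos this)
  have := Real.pi_pos
  positivity

lemma volume_ball_eq {k : ℕ} (hk : 1 ≤ k) (x : EuclideanSpace ℝ (Fin k)) (r : ℝ) :
    volume (Metric.ball x r) = ENNReal.ofReal (unitBallVol k) * ENNReal.ofReal r ^ k := by
  have : Nonempty (Fin k) := ⟨⟨0, hk⟩⟩
  have hk' : (0 : ℝ) < k := by exact_mod_cast hk
  rw [EuclideanSpace.volume_ball, mul_comm, Fintype.card_fin]
  congr 2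
  rw [Real.Gamma_add_one (by positivity), unitBallVol]
  have : √Real.pi ^ k = Real.pi ^ ((k : ℝ) / 2) := by
    rw [Real.sqrt_eq_rpow, ← Real.rpow_natCast, ← Real.rpow_mul Real.pi_pos.le]
    congr 1; ring
  rw [this]
  have h := (Real.Gamma_pos_of_pos (half_pos hk')).ne'
  field_simp

/-- Fubini by height: each horizontal slice is a Euclidean ball. -/
lemma hvol_region (hd : 2 ≤ d) (c : EuclideanSpace ℝ (Fin (d - 1))) {I : Set ℝ}
    (hI : MeasurableSet I) (hI0 : I ⊆ Ioi 0) {f : ℝ → ℝ} (hf : Measurable f) :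
    hvol d 1 {y | y.1.2 ∈ I ∧ ‖y.1.1 - c‖ < f y.1.2} =
      ∫⁻ t in I, ENNReal.ofReal (1 / t ^ d) *
        (ENNReal.ofReal (unitBallVol (d - 1)) * ENNReal.ofReal (f t) ^ (d - 1)) := by
  set A : Set (EuclideanSpace ℝ (Fin (d - 1)) × ℝ) := {p | p.2 ∈ I ∧ ‖p.1 - c‖ < f p.2} with hA
  have hAm : MeasurableSet A :=
    (measurable_snd hI).inter (measurableSet_lt (f := fun p : EuclideanSpace ℝ (Fin (d - 1)) × ℝ =>
      ‖p.1 - c‖) (by fun_prop) (hf.comp measurable_snd))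
  have : {y : HypSpace d | y.1.2 ∈ I ∧ ‖y.1.1 - c‖ < f y.1.2} = Subtype.val ⁻¹' A := rfl
  rw [this, hvol_preimage hAm, ← lintegral_indicator (measurableSet_upper d),
    Measure.volume_eq_prod, lintegral_prod_symm, ← lintegral_indicator hI]
  · congr 1
    ext t
    by_cases ht : t ∈ I
    · rw [indicator_of_mem ht, ← volume_ball_eq (by omega) c (f t),
        ← lintegral_indicator_one measurableSet_ball,
        ← lintegral_const_mul _ (measurable_one.indicator measurableSet_ball)]
      congr 1
      ext y
      rw [indicator_of_mem (show (y, t) ∈ {p : EuclideanSpace ℝ (Fin (d - 1)) × ℝ | 0 < p.2} from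
        hI0 ht)]
      congr 1
      by_cases hy : y ∈ Metric.ball c (f t)
      · rw [indicator_of_mem hy, indicator_of_mem]
        · rfl
        · exact ⟨ht, by rwa [mem_ball_iff_norm] at hy⟩
      · rw [indicator_of_notMem hy, indicator_of_notMem]
        exact fun h => hy (by rw [mem_ball_iff_norm]; exact h.2)
    · rw [indicator_of_notMem ht]
      rw [lintegral_eq_zero_of_ae_eq_zero]
      filter_upwards with y
      simp [indicator, hA, ht]
  · apply Measurable.aemeasurable
    apply Measurable.indicator _ (measurableSet_upper d)
    exact (by fun_prop : Measurable fun p : EuclideanSpace ℝ (Fin (d - 1)) × ℝ =>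
      ENNReal.ofReal (1 / p.2 ^ d)).mul (measurable_one.indicator hAm)

/-- The slice at height `t` contributes a multiple of `t ^ (d - 1)` against the density `t ^ (-d)`,
which leaves `dt / t`. Truncated cones serve to compare with balls and to measure the exceptional
directions in the averaging. -/
lemma hvol_cone (hd : 2 ≤ d) (c : EuclideanSpace ℝ (Fin (d - 1))) {a b m : ℝ} (ha : 0 < a)
    (hab : a ≤ b) (hm : 0 ≤ m) :
    hvol d 1 {y | y.1.2 ∈ Ioo a b ∧ ‖y.1.1 - c‖ < m * y.1.2} =
      ENNReal.ofReal (unitBallVol (d - 1) * m ^ (d - 1) * Real.log (b / a)) := by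
  have hb : 0 < b := ha.trans_le hab
  rw [hvol_region hd c measurableSet_Ioo (fun t ht => ha.trans ht.1) (f := fun t => m * t)
    (by fun_prop)]
  have hk := (unitBallVol_pos (k := d - 1) (by omega)).le
  have h1 : ∀ t ∈ Ioo a b, ENNReal.ofReal (1 / t ^ d) *
        (ENNReal.ofReal (unitBallVol (d - 1)) * ENNReal.ofReal (m * t) ^ (d - 1)) =
      ENNReal.ofReal (unitBallVol (d - 1) * m ^ (d - 1) * (1 / t)) := by
    intro t ht
    have h0 : 0 < t := ha.trans ht.1
    rw [← ENNReal.ofReal_pow (by positivity), ← ENNReal.ofReal_mul hk,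
      ← ENNReal.ofReal_mul (by positivity)]
    congr 1
    obtain ⟨k, rfl⟩ : ∃ k, d = k + 1 := ⟨d - 1, by omega⟩
    simp only [Nat.add_sub_cancel]
    rw [mul_pow]
    field_simp
    ring
  rw [setLIntegral_congr_fun measurableSet_Ioo h1, ← ofReal_integral_eq_lintegral_ofReal]
  · rw [integral_const_mul, ← integral_Ioc_eq_integral_Ioo, ← intervalIntegral.integral_of_le hab,
      integral_one_div_of_pos ha hb]
  · apply Integrable.const_mul
    have : IntegrableOn (fun t : ℝ => 1 / t) (Icc a b) := by
      apply ContinuousOn.integrableOn_compact isCompact_Icc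
      exact continuousOn_const.div continuousOn_id fun t ht => (ha.trans_le ht.1).ne'
    exact this.mono_set Ioo_subset_Icc_self
  · filter_upwards [ae_restrict_mem measurableSet_Ioo] with t ht
    have h0 : 0 < t := ha.trans ht.1
    simp only [Pi.zero_apply]; positivity

lemma isOpen_hball (x : HypSpace d) (r : ℝ) : IsOpen (hball 1 x r) :=
  isOpen_lt (continuous_hdist_comp continuous_const continuous_id) continuous_const

lemma measurableSet_hball (x : HypSpace d) (r : ℝ) : MeasurableSet (hball 1 x r) :=
  (isOpen_hball x r).measurableSet

lemma hvol_hball (hd : 1 ≤ d) (x : HypSpace d) (r : ℝ) :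
    hvol d 1 (hball 1 x r) = hvol d 1 (hball 1 (base d) r) := by
  rw [← hvol_act_preimage hd x (hball 1 x r)]
  congr 1
  ext y
  simp only [hball, mem_preimage, mem_ofPred_eq]
  nth_rw 1 [← act_base x]
  rw [act_base x]
  conv_lhs => rw [← act_base x]
  rw [act_base x]
  rw [show hdist 1 x (act x y) = hdist 1 (base d) y by
    conv_rhs => rw [← hdist_act x, act_base]]

lemma one_add_sq_div_two_le_cosh' {s : ℝ} (hs : 0 ≤ s) : 1 + s ^ 2 / 2 ≤ Real.cosh s := by
  have h1 : s / 2 ≤ Real.sinh (s / 2) := Real.self_le_sinh_iff.2 (by linarith)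
  have h2 : Real.cosh s = 1 + 2 * Real.sinh (s / 2) ^ 2 := by
    have := Real.cosh_two_mul (s / 2)
    rw [mul_div_cancel₀ s two_ne_zero, Real.cosh_sq] at this
    linarith
  rw [h2]
  nlinarith

lemma cosh_sub_one_le {s : ℝ} (hs : 0 ≤ s) : 2 * (Real.cosh s - 1) ≤ s ^ 2 * Real.exp s := by
  have h2 : Real.cosh s = 1 + 2 * Real.sinh (s / 2) ^ 2 := by
    have := Real.cosh_two_mul (s / 2)
    rw [mul_div_cancel₀ s two_ne_zero, Real.cosh_sq] at this
    linarith
  have h3 : Real.sinh (s / 2) ≤ s / 2 * Real.exp (s / 2) := by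
    rw [Real.sinh_eq]
    have h4 := Real.add_one_le_exp (-s)
    have h5 : Real.exp (-(s / 2)) = Real.exp (s / 2) * Real.exp (-s) := by
      rw [← Real.exp_add]; congr 1; ring
    rw [h5]
    nlinarith [Real.exp_pos (s / 2)]
  have h6 : 0 ≤ Real.sinh (s / 2) := Real.sinh_nonneg_iff.2 (by linarith)
  have h7 : Real.exp s = Real.exp (s / 2) ^ 2 := by
    rw [← Real.exp_nat_mul]; congr 1; push_cast; ring
  rw [h2, h7]
  have : Real.sinh (s / 2) ^ 2 ≤ (s / 2 * Real.exp (s / 2)) ^ 2 := by gcongr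
  nlinarith

/-- The ball around the base point contains the truncated cone of slope `s / 2` between the heights
`exp (-s / 2)` and `1`. -/
lemma le_hvol_hball (hd : 2 ≤ d) (x : HypSpace d) {s : ℝ} (hs : 0 ≤ s) :
    ENNReal.ofReal (unitBallVol (d - 1) * (s / 2) ^ d) ≤ hvol d 1 (hball 1 x s) := by
  rw [hvol_hball (by omega)]
  rcases hs.eq_or_lt with rfl | hs'
  · simp [show d ≠ 0 by omega]
  have h1 := hvol_cone hd (0 : EuclideanSpace ℝ (Fin (d - 1))) (a := Real.exp (-(s / 2))) (b := 1)
    (m := s / 2) (Real.exp_pos _) (Real.exp_le_one_iff.2 (by linarith)) (by positivity)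
  rw [one_div, ← Real.exp_neg, Real.log_exp, neg_neg, mul_assoc, ← pow_succ,
    show d - 1 + 1 = d by omega] at h1
  rw [← h1]
  apply measure_mono
  rintro y ⟨⟨hy1, hy2⟩, hy3⟩
  have hy : 0 < y.1.2 := y.2
  simp only [hball, mem_ofPred_eq]
  rw [hdist_lt_iff _ _ hs, chd_base, div_lt_iff₀ (by positivity)]
  rw [sub_zero] at hy3
  have hn := norm_nonneg y.1.1
  have h2 : ‖y.1.1‖ ^ 2 ≤ (s / 2 * y.1.2) ^ 2 := by gcongr
  have h3 : |Real.log y.1.2| ≤ |s / 2| := by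
    rw [abs_of_nonneg (half_pos hs').le, abs_le]
    constructor
    · rw [Real.le_log_iff_exp_le hy]; exact hy1.le
    · exact (Real.log_nonpos hy.le hy2.le).trans (half_pos hs').le
  rw [← Real.cosh_le_cosh, Real.cosh_log hy] at h3
  have h4 : (y.1.2 + y.1.2⁻¹) / 2 * (2 * y.1.2) = y.1.2 ^ 2 + 1 := by field_simp
  have h5 : y.1.2 ^ 2 + 1 ≤ Real.cosh (s / 2) * (2 * y.1.2) := by
    rw [← h4]; gcongr
  have h6 : Real.cosh s = 2 * Real.cosh (s / 2) ^ 2 - 1 := by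
    have := Real.cosh_two_mul (s / 2)
    rw [mul_div_cancel₀ s two_ne_zero] at this
    have h7 := Real.cosh_sq (s / 2)
    linarith
  have h8 := one_add_sq_div_two_le_cosh' (half_pos hs').le
  have h9 : Real.cosh (s / 2) + (s / 2) ^ 2 / 2 < Real.cosh s := by
    rw [h6]
    have : 0 < s ^ 2 := by positivity
    nlinarith
  have h10 : (s / 2 * y.1.2) ^ 2 ≤ (s / 2) ^ 2 * y.1.2 := by
    rw [mul_pow]
    have : y.1.2 ^ 2 ≤ y.1.2 := by nlinarith
    gcongr
  nlinarith [mul_lt_mul_of_pos_right h9 hy]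

/-- The ball lies in the truncated cone of slope `s * exp s` between the heights `exp (-s)` and `exp
s`. The bound is of Euclidean order for small `s`. -/
lemma hvol_hball_le (hd : 2 ≤ d) (x : HypSpace d) {s : ℝ} (hs : 0 ≤ s) :
    hvol d 1 (hball 1 x s) ≤
      ENNReal.ofReal (2 * unitBallVol (d - 1) * s ^ d * Real.exp ((d - 1 : ℕ) * s)) := by
  rw [hvol_hball (by omega)]
  have h1 := hvol_cone hd (0 : EuclideanSpace ℝ (Fin (d - 1))) (a := Real.exp (-s))
    (b := Real.exp s) (m := s * Real.exp s) (Real.exp_pos _) (Real.exp_le_exp.2 (by linarith))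
    (by positivity)
  rw [← Real.exp_sub, Real.log_exp, sub_neg_eq_add] at h1
  have h2 : unitBallVol (d - 1) * (s * Real.exp s) ^ (d - 1) * (s + s) =
      2 * unitBallVol (d - 1) * s ^ d * Real.exp ((d - 1 : ℕ) * s) := by
    obtain ⟨k, rfl⟩ : ∃ k, d = k + 1 := ⟨d - 1, by omega⟩
    simp only [Nat.add_sub_cancel]
    rw [mul_pow, Real.exp_nat_mul]
    ring
  rw [← h2, ← h1]
  apply measure_mono
  intro y hy
  have hy0 : 0 < y.1.2 := y.2
  simp only [hball, mem_ofPred_eq] at hy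
  have hs' : 0 < s := (hdist_nonneg _ _).trans_lt hy
  have h3 := abs_lt.1 ((abs_log_le_hdist_base y).trans_lt hy)
  have h4 : Real.exp (-s) < y.1.2 := (Real.lt_log_iff_exp_lt hy0).1 h3.1
  have h5 : y.1.2 < Real.exp s := (Real.log_lt_iff_lt_exp hy0).1 h3.2
  refine ⟨⟨h4, h5⟩, ?_⟩
  rw [sub_zero]
  rw [hdist_lt_iff _ _ hs, chd_base, div_lt_iff₀ (by positivity)] at hy
  apply lt_of_pow_lt_pow_left₀ 2 (by positivity)
  have h6 := cosh_sub_one_le hs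
  have h7 : ‖y.1.1‖ ^ 2 < 2 * (Real.cosh s - 1) * y.1.2 := by nlinarith [sq_nonneg (y.1.2 - 1)]
  have h8 : 1 < Real.exp s * y.1.2 := by
    have := mul_lt_mul_of_pos_left h4 (Real.exp_pos s)
    rwa [← Real.exp_add, add_neg_cancel, Real.exp_zero] at this
  have he := Real.exp_pos s
  calc ‖y.1.1‖ ^ 2 < 2 * (Real.cosh s - 1) * y.1.2 := h7
    _ ≤ s ^ 2 * Real.exp s * y.1.2 := by gcongr
    _ = s ^ 2 * Real.exp s * y.1.2 * 1 := by ring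
    _ ≤ s ^ 2 * Real.exp s * y.1.2 * (Real.exp s * y.1.2) := by gcongr
    _ = (s * Real.exp s * y.1.2) ^ 2 := by ring

lemma hvol_hball_lt_top (hd : 2 ≤ d) (x : HypSpace d) (s : ℝ) : hvol d 1 (hball 1 x s) < ∞ := by
  rcases le_total 0 s with h | h
  · exact (hvol_hball_le hd x h).trans_lt ENNReal.ofReal_lt_top
  · have : hball 1 x s = ∅ := by
      ext y
      simpa [hball] using h.trans (hdist_nonneg x y)
    simp [this]

/-- The slice of the ball at height `τ` is a Euclidean ball of squared radius `2τ cosh s - τ² - 1`;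
the substitution `τ = exp t` produces the integrand of `G`. -/
lemma hvol_horoball_inter_hball (hd : 2 ≤ d) {s : ℝ} (hs : 0 ≤ s) :
    hvol d 1 {y | 1 < y.1.2 ∧ hdist 1 (base d) y < s} = ENNReal.ofReal (G d s) := by
  set f : ℝ → ℝ := fun t => √(2 * t * Real.cosh s - t ^ 2 - 1) with hf
  have hset : {y : HypSpace d | 1 < y.1.2 ∧ hdist 1 (base d) y < s} =
      {y | y.1.2 ∈ Ioi 1 ∧ ‖y.1.1 - 0‖ < f y.1.2} := by
    ext y
    have hy : 0 < y.1.2 := y.2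
    simp only [mem_ofPred_eq, mem_Ioi, sub_zero, hf]
    rw [hdist_lt_iff _ _ hs, chd_base, div_lt_iff₀ (by positivity), Real.lt_sqrt (norm_nonneg _)]
    refine and_congr_right fun _ => ⟨fun h => by nlinarith, fun h => by nlinarith⟩
  rw [hset, hvol_region hd 0 measurableSet_Ioi (Ioi_subset_Ioi zero_le_one) (by fun_prop)]
  have himg : Ioi (1 : ℝ) = Real.exp '' Ioi 0 := by
    ext t
    simp only [mem_Ioi, mem_image]
    constructor
    · intro h
      exact ⟨Real.log t, Real.log_pos h, Real.exp_log (by linarith)⟩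
    · rintro ⟨r, hr, rfl⟩
      exact Real.one_lt_exp_iff.2 hr
  have hk := (unitBallVol_pos (k := d - 1) (by omega)).le
  rw [himg, lintegral_image_eq_lintegral_abs_deriv_mul measurableSet_Ioi
    (fun x _ => (Real.hasDerivAt_exp x).hasDerivWithinAt) Real.exp_injective.injOn]
  set g : ℝ → ℝ := fun t =>
    (2 * Real.exp (-t) * (Real.cosh s - Real.cosh t)) ^ (((d : ℝ) - 1) / 2) with hg
  have hexp : (0 : ℝ) < ((d : ℝ) - 1) / 2 := by
    have : (2 : ℝ) ≤ d := by exact_mod_cast hd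
    linarith
  have key : ∀ t ∈ Ioi (0 : ℝ), ENNReal.ofReal |Real.exp t| * (ENNReal.ofReal (1 / Real.exp t ^ d) *
      (ENNReal.ofReal (unitBallVol (d - 1)) * ENNReal.ofReal (f (Real.exp t)) ^ (d - 1))) =
      (Ioc 0 s).indicator (fun t => ENNReal.ofReal (unitBallVol (d - 1) * g t)) t := by
    intro t ht
    have ht0 : 0 < t := ht
    have he := Real.exp_pos t
    have hq : 2 * Real.exp t * Real.cosh s - Real.exp t ^ 2 - 1 =
        2 * Real.exp t * (Real.cosh s - Real.cosh t) := by
      rw [Real.cosh_eq t, Real.exp_neg]; field_simp; ring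
    by_cases hts : t ≤ s
    · rw [indicator_of_mem (show t ∈ Ioc 0 s from ⟨ht, hts⟩), abs_of_pos he,
        ← ENNReal.ofReal_pow (show 0 ≤ f (Real.exp t) from Real.sqrt_nonneg _),
        ← ENNReal.ofReal_mul hk,
        ← ENNReal.ofReal_mul (by positivity), ← ENNReal.ofReal_mul he.le]
      congr 1
      have hc : 0 ≤ Real.cosh s - Real.cosh t := by
        rw [sub_nonneg, Real.cosh_le_cosh, abs_of_pos ht0, abs_of_nonneg hs]; exact hts
      have hgt : g t = (f (Real.exp t) * Real.exp (-t)) ^ (d - 1) := by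
        have h1 : 2 * Real.exp (-t) * (Real.cosh s - Real.cosh t) =
            (f (Real.exp t) * Real.exp (-t)) ^ 2 := by
          rw [mul_pow, hf]
          simp only
          rw [hq, Real.sq_sqrt (by positivity), Real.exp_neg]
          field_simp
        have hf0 : 0 ≤ f (Real.exp t) * Real.exp (-t) := by positivity
        rw [hg]
        simp only
        rw [h1, ← Real.rpow_natCast, ← Real.rpow_mul hf0, ← Real.rpow_natCast]
        congr 1
        rw [Nat.cast_sub (by omega)]
        push_cast; ring
      rw [hgt, mul_pow, Real.exp_neg, inv_pow]
      generalize f (Real.exp t) = F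
      have hpow : Real.exp t ^ d = Real.exp t ^ (d - 1) * Real.exp t := by
        rw [← pow_succ]; congr 1; omega
      rw [hpow]
      field_simp
    · rw [indicator_of_notMem (fun h => hts h.2)]
      have : f (Real.exp t) = 0 := by
        rw [hf]
        simp only
        rw [hq]
        apply Real.sqrt_eq_zero_of_nonpos
        have hc : Real.cosh s - Real.cosh t ≤ 0 := by
          rw [sub_nonpos, Real.cosh_le_cosh, abs_of_pos ht0, abs_of_nonneg hs]; linarith
        nlinarith
      rw [this]
      simp [show d - 1 ≠ 0 by omega]
  rw [setLIntegral_congr_fun measurableSet_Ioi key, lintegral_indicator measurableSet_Ioc,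
    Measure.restrict_restrict measurableSet_Ioc, inter_eq_left.2 Ioc_subset_Ioi_self,
    ← ofReal_integral_eq_lintegral_ofReal, integral_const_mul, G,
    intervalIntegral.integral_of_le hs]
  · apply Integrable.const_mul
    apply Continuous.integrableOn_Ioc
    exact Continuous.rpow_const (by fun_prop) fun x => Or.inr hexp.le
  · filter_upwards [ae_restrict_mem measurableSet_Ioc] with t ht
    have hc : 0 ≤ Real.cosh s - Real.cosh t := by
      rw [sub_nonneg, Real.cosh_le_cosh, abs_of_pos ht.1, abs_of_nonneg hs]; exact ht.2
    have := Real.exp_pos (-t)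
    simp only [Pi.zero_apply]
    positivity

lemma hvol_height_eq (c : ℝ) : hvol d 1 {y | y.1.2 = c} = 0 := by
  have hA : MeasurableSet {p : EuclideanSpace ℝ (Fin (d - 1)) × ℝ | p.2 = c} :=
    measurableSet_eq_fun measurable_snd measurable_const
  have h0 : (volume : Measure (EuclideanSpace ℝ (Fin (d - 1)) × ℝ)) {p | p.2 = c} = 0 := by
    rw [Measure.volume_eq_prod, Measure.prod_apply hA]
    simp [Set.preimage]
  have h1 : {y : HypSpace d | y.1.2 = c} = Subtype.val ⁻¹' {p | p.2 = c} := rfl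
  rw [h1, hvol_preimage hA, lintegral_eq_zero_of_ae_eq_zero]
  apply ae_restrict_of_ae
  filter_upwards [measure_eq_zero_iff_ae_notMem.1 h0] with p hp
  rw [indicator_of_notMem (by exact hp)]; simp

/-- Horizontal slices lie in Euclidean spheres. This rules out ties in the distance to the root when
pairs of points are ordered. -/
lemma hvol_sphere (hd : 2 ≤ d) (o : HypSpace d) (r : ℝ) : hvol d 1 {y | hdist 1 o y = r} = 0 := by
  have ho : 0 < o.1.2 := o.2
  set A : Set (EuclideanSpace ℝ (Fin (d - 1)) × ℝ) :=
    {p | ‖p.1 - o.1.1‖ ^ 2 = 2 * o.1.2 * p.2 * Real.cosh r - o.1.2 ^ 2 - p.2 ^ 2}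
  have hA : MeasurableSet A := measurableSet_eq_fun (by fun_prop) (by fun_prop)
  have h0 : (volume : Measure (EuclideanSpace ℝ (Fin (d - 1)) × ℝ)) A = 0 := by
    have : Nonempty (Fin (d - 1)) := ⟨⟨0, by omega⟩⟩
    rw [Measure.volume_eq_prod, Measure.prod_apply_symm hA]
    apply lintegral_eq_zero_of_ae_eq_zero
    filter_upwards with t
    refine measure_mono_null ?_ (Measure.addHaar_sphere volume o.1.1
      (√(2 * o.1.2 * t * Real.cosh r - o.1.2 ^ 2 - t ^ 2)))
    intro y hy
    have hy' : ‖y - o.1.1‖ ^ 2 = 2 * o.1.2 * t * Real.cosh r - o.1.2 ^ 2 - t ^ 2 := hy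
    rw [mem_sphere_iff_norm, ← hy', Real.sqrt_sq (norm_nonneg _)]
  have h1 : {y : HypSpace d | hdist 1 o y = r} ⊆ Subtype.val ⁻¹' A := by
    intro y hy
    have hy0 : 0 < y.1.2 := y.2
    have h2 : Real.cosh r = chd o y := by rw [← cosh_hdist, hy]
    rw [chd_eq, norm_sub_rev] at h2
    simp only [A, mem_preimage, mem_ofPred_eq]
    rw [h2]
    field_simp
    ring
  refine measure_mono_null h1 ?_
  rw [hvol_preimage hA, lintegral_eq_zero_of_ae_eq_zero]
  apply ae_restrict_of_ae
  filter_upwards [measure_eq_zero_iff_ae_notMem.1 h0] with p hp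
  rw [indicator_of_notMem hp]; simp

/-- The part of the ball of radius `s` around `x` that is closer to `o` than `x` is. -/
def lens (o x : HypSpace d) (s : ℝ) : Set (HypSpace d) :=
  {y | hdist 1 x y < s ∧ hdist 1 o y < hdist 1 o x}

lemma isOpen_lens (o x : HypSpace d) (s : ℝ) : IsOpen (lens o x s) :=
  (isOpen_hball x s).inter (isOpen_hball o _)

lemma lens_subset_hball (o x : HypSpace d) (s : ℝ) : lens o x s ⊆ hball 1 x s := fun _ h => h.1

/-- The lens contains the ball of radius `s / 2` around the point at distance `s / 2` from `x` on
the way to `o`. The bound is uniform in the root and is the source of all tail estimates. -/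
lemma le_hvol_lens (hd : 2 ≤ d) (o x : HypSpace d) {s : ℝ} (hs : 0 ≤ s) (hs' : s ≤ hdist 1 o x) :
    ENNReal.ofReal (unitBallVol (d - 1) / 4 ^ d * s ^ d) ≤ hvol d 1 (lens o x s) := by
  obtain ⟨m, hm1, hm2⟩ := exists_between x o (t := s / 2) (by linarith)
    (by rw [hdist_comm]; linarith)
  have h := le_hvol_hball hd m (s := s / 2) (by linarith)
  have e : unitBallVol (d - 1) / 4 ^ d * s ^ d = unitBallVol (d - 1) * (s / 2 / 2) ^ d := by
    rw [div_div, div_pow]; norm_num; ring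
  rw [e]
  refine h.trans (measure_mono fun y hy => ?_)
  simp only [hball, mem_ofPred_eq] at hy
  constructor
  · have := hdist_triangle x m y; linarith
  · have := hdist_triangle o m y
    rw [hdist_comm o m, hm2, hdist_comm x o] at this
    linarith

lemma hvol_lens_lt_top (hd : 2 ≤ d) (o x : HypSpace d) (s : ℝ) : hvol d 1 (lens o x s) < ∞ :=
  (measure_mono (lens_subset_hball o x s)).trans_lt (hvol_hball_lt_top hd x s)

lemma iUnion_hball (x : HypSpace d) : ⋃ n : ℕ, hball 1 x n = univ := by
  ext y
  simp only [mem_iUnion, mem_univ, iff_true]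
  exact exists_nat_gt (hdist 1 x y)

lemma sigmaFinite_hvol (hd : 2 ≤ d) : SigmaFinite (hvol d 1) :=
  ⟨⟨⟨fun n => hball 1 (base d) n, fun _ => trivial, fun _ => hvol_hball_lt_top hd _ _,
    iUnion_hball _⟩⟩⟩

end HypRST

/-! ### Spaces of point configurations: measurability of counts and the counting kernel. -/

namespace HypRST

set_option linter.unusedSectionVars false

section Configurations

variable {X : Type*} [MeasurableSpace X]

/-- Point configurations: subsets of `X` with the `σ`-algebra generated by the void events. -/
@[ext]
structure Conf (X : Type*) where
  /-- The set of points. -/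
  pts : Set X

/-- The event that the configuration has no point in `B`. -/
def voidEvent (B : Set X) : Set (Conf X) := {ξ | ξ.pts ∩ B = ∅}

/-- Void events form a π-system on which the two sides of the Mecke formula are compared; counts
turn out measurable as well, by `measurable_encard`. -/
instance Conf.measurableSpace : MeasurableSpace (Conf X) :=
  MeasurableSpace.generateFrom {V | ∃ B : Set X, MeasurableSet B ∧ V = voidEvent B}

lemma measurableSet_voidEvent {B : Set X} (hB : MeasurableSet B) :
    MeasurableSet (voidEvent B) :=
  MeasurableSpace.measurableSet_generateFrom ⟨B, hB, rfl⟩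

lemma mem_voidEvent {B : Set X} {ξ : Conf X} : ξ ∈ voidEvent B ↔ ξ.pts ∩ B = ∅ := Iff.rfl

lemma mem_voidEvent' {B : Set X} {ξ : Conf X} :
    ξ ∈ voidEvent B ↔ ∀ x ∈ ξ.pts, x ∉ B := by
  rw [mem_voidEvent, ← disjoint_iff_inter_eq_empty, disjoint_left]

/-- Adding a point to a configuration. -/
def Conf.insert (x : X) (ξ : Conf X) : Conf X := ⟨Insert.insert x ξ.pts⟩

lemma insert_mem_voidEvent {B : Set X} {x : X} {ξ : Conf X} :
    Conf.insert x ξ ∈ voidEvent B ↔ x ∉ B ∧ ξ ∈ voidEvent B := by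
  simp only [mem_voidEvent', Conf.insert]
  constructor
  · intro h
    exact ⟨h x (mem_insert _ _), fun y hy => h y (mem_insert_of_mem _ hy)⟩
  · rintro ⟨h1, h2⟩ y (rfl | hy)
    exacts [h1, h2 y hy]

lemma insert_comm (x y : X) (ξ : Conf X) :
    Conf.insert x (Conf.insert y ξ) = Conf.insert y (Conf.insert x ξ) :=
  Conf.ext (Set.insert_comm x y ξ.pts)

lemma measurable_conf {Y : Type*} [MeasurableSpace Y] {f : Y → Conf X}
    (h : ∀ B : Set X, MeasurableSet B → MeasurableSet {y | f y ∈ voidEvent B}) :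
    Measurable f := by
  apply measurable_generateFrom
  rintro _ ⟨B, hB, rfl⟩
  exact h B hB

lemma measurable_insert : Measurable fun p : X × Conf X => Conf.insert p.1 p.2 := by
  apply measurable_conf
  intro B hB
  have : {p : X × Conf X | Conf.insert p.1 p.2 ∈ voidEvent B} = Bᶜ ×ˢ voidEvent B := by
    ext p
    exact insert_mem_voidEvent
  rw [this]
  exact hB.compl.prod (measurableSet_voidEvent hB)

lemma measurable_insert_left (x : X) : Measurable fun ξ : Conf X => Conf.insert x ξ :=
  measurable_insert.comp (measurable_const.prodMk measurable_id)

lemma isPiSystem_voidEvent :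
    IsPiSystem {V | ∃ B : Set X, MeasurableSet B ∧ V = voidEvent B} := by
  rintro _ ⟨B, hB, rfl⟩ _ ⟨C, hC, rfl⟩ _
  refine ⟨B ∪ C, hB.union hC, ?_⟩
  ext ξ
  simp only [mem_inter_iff, mem_voidEvent', mem_union, not_or]
  exact ⟨fun h x hx => ⟨h.1 x hx, h.2 x hx⟩, fun h => ⟨fun x hx => (h x hx).1, fun x hx => (h x hx).2⟩⟩

section Count

variable [MeasurableSpace.CountablyGenerated X] [MeasurableSpace.SeparatesPoints X]

/-- The first `n` bits of an encoding of the points of `X`. -/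
noncomputable def bits (n : ℕ) (x : X) : Fin n → Bool :=
  fun i => MeasurableSpace.mapNatBool X x i

lemma measurable_bits (n : ℕ) : Measurable (bits (X := X) n) :=
  measurable_pi_lambda _ fun i =>
    (measurable_pi_apply (i : ℕ)).comp (MeasurableSpace.measurable_mapNatBool X)

lemma exists_injOn_bits {t : Set X} (ht : t.Finite) : ∃ n, InjOn (bits (X := X) n) t := by
  classical
  have h : ∀ p : X × X, ∃ n, p.1 ≠ p.2 → bits n p.1 ≠ bits n p.2 := by
    rintro ⟨x, y⟩
    by_cases hxy : x = y
    · exact ⟨0, fun h => absurd hxy h⟩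
    · have := (MeasurableSpace.injective_mapNatBool X).ne hxy
      obtain ⟨k, hk⟩ := Function.ne_iff.1 this
      exact ⟨k + 1, fun _ he => hk (congrFun he ⟨k, Nat.lt_succ_self k⟩)⟩
  choose N hN using h
  set m := (ht.toFinset ×ˢ ht.toFinset).sup N with hm
  refine ⟨m, fun x hx y hy hxy => ?_⟩
  by_contra hne
  refine hN (x, y) hne ?_
  have hle : N (x, y) ≤ m := Finset.le_sup (f := N)
    (Finset.mem_product.2 ⟨ht.mem_toFinset.2 hx, ht.mem_toFinset.2 hy⟩)
  funext i
  exact congrFun hxy ⟨i, i.2.trans_le hle⟩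

/-- The number of occupied cells at resolution `n` never exceeds the number of points, and reaches
that of any finite subset once its points are separated. -/
lemma encard_eq_iSup_bits (S : Set X) : S.encard = ⨆ n, (bits n '' S).encard := by
  apply le_antisymm
  · rw [← ENat.forall_natCast_le_iff_le]
    intro a ha
    obtain ⟨t, htS, hta⟩ := Set.exists_subset_encard_eq ha
    have ht : t.Finite := Set.finite_of_encard_eq_coe hta
    obtain ⟨n, hn⟩ := exists_injOn_bits ht
    refine le_trans ?_ (le_iSup _ n)
    rw [← hta, ← hn.encard_image]
    exact encard_le_encard (image_mono htS)
  · exact iSup_le fun n => encard_image_le _ _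

/-- At each resolution the number of occupied cells is a finite sum of indicators of complements of
void events. -/
lemma measurable_encard {B : Set X} (hB : MeasurableSet B) :
    Measurable fun ξ : Conf X => (ξ.pts ∩ B).encard := by
  classical
  simp_rw [encard_eq_iSup_bits (X := X)]
  have : BorelSpace ℕ∞ := ⟨borel_eq_top_of_countable.symm⟩
  apply Measurable.iSup
  intro n
  have h : ∀ ξ : Conf X, (bits n '' (ξ.pts ∩ B)).encard =
      ∑ b : Fin n → Bool, if ξ ∈ voidEvent (B ∩ bits n ⁻¹' {b}) then (0 : ℕ∞) else 1 := by
    intro ξ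
    have h1 : bits n '' (ξ.pts ∩ B) =
        ((Finset.univ.filter fun b => ¬ ξ ∈ voidEvent (B ∩ bits n ⁻¹' {b}) :
          Finset (Fin n → Bool)) : Set (Fin n → Bool)) := by
      ext b
      simp only [mem_image, Finset.coe_filter, Finset.mem_univ, true_and, mem_ofPred_eq,
        mem_voidEvent', not_forall, not_not]
      constructor
      · rintro ⟨x, ⟨hx, hxB⟩, hb⟩
        exact ⟨x, hx, hxB, hb⟩
      · rintro ⟨x, hx, hxB, hb⟩
        exact ⟨x, ⟨hx, hxB⟩, hb⟩
    rw [h1, encard_coe_eq_coe_finsetCard, Finset.card_filter]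
    push_cast
    exact Finset.sum_congr rfl fun b _ => by split_ifs <;> simp_all
  simp_rw [h]
  refine Finset.measurable_sum _ fun b _ => ?_
  exact Measurable.ite (measurableSet_voidEvent
    (hB.inter (measurable_bits n (MeasurableSet.singleton b)))) measurable_const measurable_const

end Count

/-- A countable exhaustion by measurable sets, playing the role of the bounded sets. -/
structure Exhaustion (X : Type*) [MeasurableSpace X] where
  /-- The sets of the exhaustion. -/
  set : ℕ → Set X
  measurableSet : ∀ k, MeasurableSet (set k)
  mono : Monotone set
  iUnion_eq : ⋃ k, set k = univ

/-- Locally finite configurations. -/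
def LocFin (E : Exhaustion X) (ξ : Conf X) : Prop := ∀ k, (ξ.pts ∩ E.set k).Finite

lemma LocFin.countable {E : Exhaustion X} {ξ : Conf X} (h : LocFin E ξ) :
    ξ.pts.Countable := by
  have : ξ.pts = ⋃ k, ξ.pts ∩ E.set k := by
    rw [← inter_iUnion, E.iUnion_eq, inter_univ]
  rw [this]
  exact countable_iUnion fun k => (h k).countable

lemma LocFin.insert {E : Exhaustion X} {ξ : Conf X} (h : LocFin E ξ) (x : X) :
    LocFin E (Conf.insert x ξ) := fun k =>
  ((h k).insert x).subset fun y hy => by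
    rcases hy with ⟨hy | hy, hy2⟩
    · exact Or.inl hy
    · exact Or.inr ⟨hy, hy2⟩

variable [MeasurableSpace.CountablyGenerated X] [MeasurableSpace.SeparatesPoints X]

lemma measurableSet_locFin (E : Exhaustion X) : MeasurableSet {ξ | LocFin E ξ} := by
  have : {ξ | LocFin E ξ} = ⋂ k, {ξ : Conf X | (ξ.pts ∩ E.set k).encard ∈ ({⊤}ᶜ : Set ℕ∞)} := by
    ext ξ
    simp [LocFin]
  rw [this]
  exact MeasurableSet.iInter fun k =>
    measurable_encard (E.measurableSet k) (MeasurableSet.of_discrete)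

variable [MeasurableSingletonClass X]

open scoped Classical in
/-- The counting measure of a configuration, as a kernel. -/
noncomputable def pointKernel (E : Exhaustion X) : Kernel (Conf X) X where
  -- The value `0` off the locally finite configurations keeps every measure finite on the sets of
  -- the exhaustion, as s-finiteness of the kernel requires.
  toFun ξ := if LocFin E ξ then Measure.count.restrict ξ.pts else 0
  measurable' := by
    apply Measure.measurable_of_measurable_coe
    intro B hB
    have : (fun ξ : Conf X => (if LocFin E ξ then Measure.count.restrict ξ.pts else 0) B) =
        fun ξ => if LocFin E ξ then ((ξ.pts ∩ B).encard : ℝ≥0∞) else 0 := by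
      funext ξ
      split_ifs with h
      · rw [Measure.restrict_apply hB, inter_comm,
          Measure.count_apply (h.countable.mono inter_subset_left).measurableSet]
      · simp
    rw [this]
    exact Measurable.ite (measurableSet_locFin E)
      ((Measurable.of_discrete (f := fun n : ℕ∞ => (n : ℝ≥0∞))).comp (measurable_encard hB))
      measurable_const

lemma pointKernel_eq {E : Exhaustion X} {ξ : Conf X} (h : LocFin E ξ) :
    pointKernel E ξ = Measure.count.restrict ξ.pts := by
  classical
  exact if_pos h

lemma pointKernel_apply {E : Exhaustion X} {ξ : Conf X} (h : LocFin E ξ) {B : Set X}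
    (hB : MeasurableSet B) : pointKernel E ξ B = ((ξ.pts ∩ B).encard : ℝ≥0∞) := by
  rw [pointKernel_eq h, Measure.restrict_apply hB, inter_comm,
    Measure.count_apply (h.countable.mono inter_subset_left).measurableSet]

lemma pointKernel_eq_zero {E : Exhaustion X} {ξ : Conf X} (h : ¬ LocFin E ξ) :
    pointKernel E ξ = 0 := by
  classical
  exact if_neg h

lemma pointKernel_exhaustion_lt_top (E : Exhaustion X) (ξ : Conf X) (k : ℕ) :
    pointKernel E ξ (E.set k) < ∞ := by
  by_cases h : LocFin E ξ
  · rw [pointKernel_apply h (E.measurableSet k)]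
    have := (h k).encard_lt_top
    exact_mod_cast this
  · simp [pointKernel_eq_zero h]

/-- The space is cut along the exhaustion and, on each piece, the configurations are cut according
to their number of points there, so that every summand is a finite kernel. -/
instance isSFiniteKernel_pointKernel (E : Exhaustion X) : IsSFiniteKernel (pointKernel E) := by
  classical
  have hS : ∀ k, MeasurableSet (disjointed E.set k) := fun k =>
    MeasurableSet.disjointed E.measurableSet k
  have hfin : ∀ k ξ, pointKernel E ξ (disjointed E.set k) < ∞ := fun k ξ =>
    (measure_mono (disjointed_subset _ _)).trans_lt (pointKernel_exhaustion_lt_top E ξ k)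
  have hsum : pointKernel E = Kernel.sum fun k => (pointKernel E).restrict (hS k) := by
    ext1 ξ
    rw [Kernel.sum_apply]
    simp_rw [Kernel.restrict_apply]
    rw [← Measure.restrict_iUnion (disjoint_disjointed _) hS, iUnion_disjointed, E.iUnion_eq,
      Measure.restrict_univ]
  have hk : ∀ k, IsSFiniteKernel ((pointKernel E).restrict (hS k)) := by
    intro k
    set T : ℕ → Set (Conf X) := fun n =>
      {ξ | (n : ℝ≥0∞) ≤ pointKernel E ξ (disjointed E.set k) ∧
        pointKernel E ξ (disjointed E.set k) < n + 1} with hTdef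
    have hT : ∀ n, MeasurableSet (T n) := fun n =>
      (measurableSet_le measurable_const (Kernel.measurable_coe _ (hS k))).inter
        (measurableSet_lt (Kernel.measurable_coe _ (hS k)) measurable_const)
    have hex : ∀ ξ, ∃ n : ℕ, ∀ m, ξ ∈ T m ↔ m = n := by
      intro ξ
      obtain ⟨r, hr, -⟩ := ENNReal.lt_iff_exists_coe.1 (hfin k ξ)
      refine ⟨⌊r⌋₊, fun m => ?_⟩
      simp only [hTdef, mem_ofPred_eq, hr]
      rw [eq_comm, Nat.floor_eq_iff (by positivity)]
      norm_cast
    have hs : (pointKernel E).restrict (hS k) = Kernel.sum fun n =>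
        Kernel.piecewise (hT n) ((pointKernel E).restrict (hS k)) 0 := by
      ext1 ξ
      rw [Kernel.sum_apply]
      obtain ⟨n, hn⟩ := hex ξ
      ext B hB
      rw [Measure.sum_apply _ hB, tsum_eq_single n]
      · rw [Kernel.piecewise_apply, if_pos ((hn n).2 rfl)]
      · intro m hm
        rw [Kernel.piecewise_apply, if_neg (fun h => hm ((hn m).1 h))]
        simp
    rw [hs]
    have : ∀ n, IsFiniteKernel (Kernel.piecewise (hT n) ((pointKernel E).restrict (hS k)) 0) := by
      intro n
      refine ⟨⟨n + 1, by finiteness, fun ξ => ?_⟩⟩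
      rw [Kernel.piecewise_apply]
      split_ifs with h
      · rw [Kernel.restrict_apply, Measure.restrict_apply_univ]
        exact h.2.le
      · simp
    infer_instance
  rw [hsum]
  infer_instance

lemma lintegral_pointKernel_insert {E : Exhaustion X} {ξ : Conf X} (h : LocFin E ξ) {x : X}
    (hx : x ∉ ξ.pts) (f : X → ℝ≥0∞) :
    ∫⁻ y, f y ∂(pointKernel E (Conf.insert x ξ)) = f x + ∫⁻ y, f y ∂(pointKernel E ξ) := by
  have h1 : Measure.count.restrict (Insert.insert x ξ.pts) =
      Measure.count.restrict {x} + Measure.count.restrict ξ.pts := by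
    rw [← singleton_union, Measure.restrict_union (disjoint_singleton_left.2 hx)
      h.countable.measurableSet]
  rw [pointKernel_eq h, pointKernel_eq (h.insert x), Conf.insert, h1, lintegral_add_measure,
    Measure.restrict_singleton, Measure.count_singleton, one_smul, lintegral_dirac]

end Configurations

/-! ### Poisson laws and the Mecke formulas. -/

section PoissonLaw

variable {X : Type*} [MeasurableSpace X] [MeasurableSpace.CountablyGenerated X]
  [MeasurableSpace.SeparatesPoints X] [MeasurableSingletonClass X]

/-- `Q` is the law of a Poisson process with intensity measure `μ`. -/
structure IsPoissonLaw (E : Exhaustion X) (μ : Measure X) (Q : Measure (Conf X)) : Prop where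
  isProb : IsProbabilityMeasure Q
  finite : ∀ k, μ (E.set k) < ∞
  locFin : ∀ᵐ ξ ∂Q, LocFin E ξ
  mean : ∀ B, MeasurableSet B → ∫⁻ ξ : Conf X, ((ξ.pts ∩ B).encard : ℝ≥0∞) ∂Q = μ B
  void : ∀ B, MeasurableSet B → μ B ≠ ∞ →
    Q (voidEvent B) = ENNReal.ofReal (Real.exp (-(μ B).toReal))
  indep : ∀ (k : ℕ) (B : Fin k → Set X), (∀ i, MeasurableSet (B i)) →
    Pairwise (fun i j => Disjoint (B i) (B j)) →
    iIndepFun (fun i (ξ : Conf X) => (ξ.pts ∩ B i).encard) Q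

variable {E : Exhaustion X} {μ : Measure X} {Q : Measure (Conf X)}

lemma IsPoissonLaw.sigmaFinite (h : IsPoissonLaw E μ Q) : SigmaFinite μ :=
  ⟨⟨⟨E.set, fun _ => trivial, h.finite, E.iUnion_eq⟩⟩⟩

lemma IsPoissonLaw.indep₂ (h : IsPoissonLaw E μ Q) {A B : Set X} (hA : MeasurableSet A)
    (hB : MeasurableSet B) (hAB : Disjoint A B) :
    IndepFun (fun ξ : Conf X => (ξ.pts ∩ A).encard)
      (fun ξ : Conf X => (ξ.pts ∩ B).encard) Q := by
  have := h.indep 2 ![A, B] (by intro i; fin_cases i <;> simpa)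
    (by
      intro i j hij
      fin_cases i <;> fin_cases j <;> simp_all [disjoint_comm])
  exact this.indepFun (i := 0) (j := 1) (by simp)

lemma IsPoissonLaw.mean_pointKernel (h : IsPoissonLaw E μ Q) {B : Set X} (hB : MeasurableSet B) :
    ∫⁻ ξ, pointKernel E ξ B ∂Q = μ B := by
  rw [← h.mean B hB]
  apply lintegral_congr_ae
  filter_upwards [h.locFin] with ξ hξ
  exact pointKernel_apply hξ hB

lemma voidEvent_eq (B : Set X) :
    voidEvent B = {ξ : Conf X | (ξ.pts ∩ B).encard = 0} := by
  ext ξ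
  simp [voidEvent]

/-- On the void event of `B` the points in `C` are those in `C \ B`, whose number is independent of
that event. This is the Mecke formula on generators. -/
lemma IsPoissonLaw.setLIntegral_voidEvent (h : IsPoissonLaw E μ Q) {B C : Set X}
    (hB : MeasurableSet B) (hC : MeasurableSet C) :
    ∫⁻ ξ in voidEvent B, pointKernel E ξ C ∂Q = Q (voidEvent B) * μ (C \ B) := by
  have hCB : MeasurableSet (C \ B) := hC.diff hB
  have hind := h.indep₂ hB hCB disjoint_sdiff_right
  have h1 : ∫⁻ ξ in voidEvent B, pointKernel E ξ C ∂Q =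
      ∫⁻ ξ : Conf X, (if (ξ.pts ∩ B).encard = 0 then 1 else 0) *
        ((ξ.pts ∩ (C \ B)).encard : ℝ≥0∞) ∂Q := by
    rw [← lintegral_indicator (measurableSet_voidEvent hB)]
    apply lintegral_congr_ae
    filter_upwards [h.locFin] with ξ hξ
    by_cases hv : ξ ∈ voidEvent B
    · rw [indicator_of_mem hv, pointKernel_apply hξ hC]
      have hv' : (ξ.pts ∩ B).encard = 0 := by rwa [voidEvent_eq] at hv
      rw [if_pos hv', one_mul]
      congr 2
      ext x
      have := mem_voidEvent'.1 hv x
      simp only [mem_inter_iff, Set.mem_sdiff]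
      tauto
    · rw [indicator_of_notMem hv]
      have hv' : ¬ (ξ.pts ∩ B).encard = 0 := by rwa [voidEvent_eq] at hv
      rw [if_neg hv', zero_mul]
  have hm1 : Measurable fun n : ℕ∞ => if n = 0 then (1 : ℝ≥0∞) else 0 := Measurable.of_discrete
  have hm2 : Measurable fun n : ℕ∞ => (n : ℝ≥0∞) := Measurable.of_discrete
  have h2 := lintegral_mul_eq_lintegral_mul_lintegral_of_indepFun
    (hm1.comp (measurable_encard hB)) (hm2.comp (measurable_encard hCB)) (hind.comp hm1 hm2)
  simp only [Pi.mul_apply, Function.comp_apply] at h2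
  rw [h1, h2, h.mean _ hCB]
  congr 1
  rw [← lintegral_indicator_one (measurableSet_voidEvent hB)]
  congr 1
  ext ξ
  rw [voidEvent_eq]
  simp [indicator]

/-- The Campbell measure of a Poisson process. -/
lemma IsPoissonLaw.map_compProd (h : IsPoissonLaw E μ Q) :
    (Q ⊗ₘ pointKernel E).map Prod.swap =
      (μ.prod Q).map fun p : X × Conf X => (p.1, Conf.insert p.1 p.2) := by
  have := h.isProb
  have := h.sigmaFinite
  have hm : Measurable fun p : X × Conf X => (p.1, Conf.insert p.1 p.2) :=
    measurable_fst.prodMk measurable_insert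
  have huniv : voidEvent (∅ : Set X) = univ := by ext ξ; simp [voidEvent]
  have hs1 : IsCountablySpanning {s : Set X | MeasurableSet s} :=
    ⟨fun _ => univ, fun _ => MeasurableSet.univ, iUnion_const _⟩
  have hs2 : IsCountablySpanning {V | ∃ B : Set X, MeasurableSet B ∧ V = voidEvent B} :=
    ⟨fun _ => univ, fun _ => ⟨∅, MeasurableSet.empty, huniv.symm⟩, iUnion_const _⟩
  -- It suffices to compare on products `C ×ˢ voidEvent B`; on the other side, inserting `x` keeps
  -- `B` void exactly when `x ∉ B`, which again restricts `C` to `C \ B`.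
  have key : ∀ C B : Set X, MeasurableSet C → MeasurableSet B →
      (Q ⊗ₘ pointKernel E).map Prod.swap (C ×ˢ voidEvent B) = Q (voidEvent B) * μ (C \ B) := by
    intro C B hC hB
    rw [Measure.map_apply measurable_swap (hC.prod (measurableSet_voidEvent hB)),
      preimage_swap_prod, Measure.compProd_apply_prod (measurableSet_voidEvent hB) hC,
      h.setLIntegral_voidEvent hB hC]
  refine Measure.ext_of_generateFrom_of_iUnion
    (image2 (· ×ˢ ·) {s : Set X | MeasurableSet s}
      {V | ∃ B : Set X, MeasurableSet B ∧ V = voidEvent B})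
    (fun k => E.set k ×ˢ univ) (generateFrom_eq_prod MeasurableSpace.generateFrom_measurableSet rfl
      hs1 hs2).symm (MeasurableSpace.isPiSystem_measurableSet.prod isPiSystem_voidEvent) ?_ ?_ ?_ ?_
  · rw [← iUnion_prod_const, E.iUnion_eq, univ_prod_univ]
  · exact fun k => mem_image2_of_mem (E.measurableSet k) ⟨∅, MeasurableSet.empty, huniv.symm⟩
  · intro k
    rw [← huniv, key _ _ (E.measurableSet k) MeasurableSet.empty, sdiff_empty]
    exact ENNReal.mul_ne_top (measure_ne_top _ _) (h.finite k).ne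
  · rintro _ ⟨C, hC, _, ⟨B, hB, rfl⟩, rfl⟩
    have hC' : MeasurableSet C := hC
    simp only
    rw [key C B hC' hB, Measure.map_apply hm (hC'.prod (measurableSet_voidEvent hB))]
    have : (fun p : X × Conf X => (p.1, Conf.insert p.1 p.2)) ⁻¹' (C ×ˢ voidEvent B) =
        (C \ B) ×ˢ voidEvent B := by
      ext p
      simp only [mem_preimage, mem_prod, insert_mem_voidEvent, Set.mem_sdiff]
      tauto
    rw [this, Measure.prod_prod, mul_comm]

/-- The Mecke formula. -/
theorem IsPoissonLaw.mecke (h : IsPoissonLaw E μ Q) {f : X × Conf X → ℝ≥0∞} (hf : Measurable f) :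
    ∫⁻ ξ, ∫⁻ x, f (x, ξ) ∂(pointKernel E ξ) ∂Q =
      ∫⁻ x, ∫⁻ ξ, f (x, Conf.insert x ξ) ∂Q ∂μ := by
  have := h.isProb
  have := h.sigmaFinite
  have hm : Measurable fun p : X × Conf X => (p.1, Conf.insert p.1 p.2) :=
    measurable_fst.prodMk measurable_insert
  have hs : Measurable fun p : Conf X × X => f p.swap := hf.comp measurable_swap
  have hi : Measurable fun p : X × Conf X => f (p.1, Conf.insert p.1 p.2) := hf.comp hm
  have h1 : ∫⁻ p, f p ∂((Q ⊗ₘ pointKernel E).map Prod.swap) =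
      ∫⁻ ξ, ∫⁻ x, f (x, ξ) ∂(pointKernel E ξ) ∂Q := by
    rw [lintegral_map hf measurable_swap, Measure.lintegral_compProd hs]
    rfl
  rw [← h1, h.map_compProd, lintegral_map hf hm, lintegral_prod _ hi.aemeasurable]

/-- The Mecke formula for signed functions. -/
theorem IsPoissonLaw.integral_mecke (h : IsPoissonLaw E μ Q) {f : X × Conf X → ℝ}
    (hf : Measurable f) (hfi : ∫⁻ ξ, ∫⁻ x, ‖f (x, ξ)‖ₑ ∂(pointKernel E ξ) ∂Q < ∞) :
    Integrable (fun p : X × Conf X => f (p.1, Conf.insert p.1 p.2)) (μ.prod Q) ∧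
    ∫ ξ, ∫ x, f (x, ξ) ∂(pointKernel E ξ) ∂Q =
      ∫ x, ∫ ξ, f (x, Conf.insert x ξ) ∂Q ∂μ := by
  have := h.isProb
  have := h.sigmaFinite
  have hm : Measurable fun p : X × Conf X => (p.1, Conf.insert p.1 p.2) :=
    measurable_fst.prodMk measurable_insert
  have hs : Measurable fun p : Conf X × X => ‖f p.swap‖ₑ := (hf.comp measurable_swap).enorm
  have hi1 : Integrable (fun p : Conf X × X => f p.swap) (Q ⊗ₘ pointKernel E) := by
    refine ⟨(hf.comp measurable_swap).aestronglyMeasurable, ?_⟩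
    rw [HasFiniteIntegral, Measure.lintegral_compProd hs]
    exact hfi
  have hi2 : Integrable f ((Q ⊗ₘ pointKernel E).map Prod.swap) :=
    (integrable_map_measure hf.aestronglyMeasurable measurable_swap.aemeasurable).2 hi1
  have hi3 := hi2
  rw [h.map_compProd, integrable_map_measure hf.aestronglyMeasurable hm.aemeasurable] at hi3
  have hi4 : Integrable (fun p : X × Conf X => f (p.1, Conf.insert p.1 p.2)) (μ.prod Q) := hi3
  refine ⟨hi4, ?_⟩
  have h1 : ∫ p, f p ∂((Q ⊗ₘ pointKernel E).map Prod.swap) =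
      ∫ ξ, ∫ x, f (x, ξ) ∂(pointKernel E ξ) ∂Q := by
    rw [integral_map measurable_swap.aemeasurable hf.aestronglyMeasurable,
      Measure.integral_compProd hi1]
    rfl
  rw [← h1, h.map_compProd, integral_map hm.aemeasurable hf.aestronglyMeasurable,
    integral_prod _ hi4]

lemma IsPoissonLaw.notMem (h : IsPoissonLaw E μ Q) [NullSingletonClass μ] (x : X) :
    ∀ᵐ ξ ∂Q, x ∉ ξ.pts := by
  have h1 := h.mean {x} (measurableSet_singleton x)
  have hm : Measurable fun ξ : Conf X => ((ξ.pts ∩ {x}).encard : ℝ≥0∞) :=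
    (Measurable.of_discrete (f := fun n : ℕ∞ => (n : ℝ≥0∞))).comp
      (measurable_encard (measurableSet_singleton x))
  rw [measure_singleton, lintegral_eq_zero_iff hm] at h1
  filter_upwards [h1] with ξ hξ hx
  have : ξ.pts ∩ {x} = ∅ := by simpa using hξ
  exact (this ▸ (⟨hx, rfl⟩ : x ∈ ξ.pts ∩ {x}) : x ∈ (∅ : Set X))

lemma measurable_lintegral_pointKernel {Y : Type*} [MeasurableSpace Y] {f : Y × X → ℝ≥0∞}
    (hf : Measurable f) {g : Y → Conf X} (hg : Measurable g) :
    Measurable fun y => ∫⁻ x, f (y, x) ∂(pointKernel E (g y)) :=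
  hf.lintegral_kernel_prod_right' (κ := (pointKernel E).comap g hg)

/-- The Mecke formula for pairs of points. -/
theorem IsPoissonLaw.mecke₂ (h : IsPoissonLaw E μ Q) [NullSingletonClass μ] {f : X × X × Conf X → ℝ≥0∞}
    (hf : Measurable f) :
    ∫⁻ ξ, ∫⁻ x, ∫⁻ y, f (x, y, ξ) ∂(pointKernel E ξ) ∂(pointKernel E ξ) ∂Q =
      ∫⁻ x, ∫⁻ ξ, f (x, x, Conf.insert x ξ) ∂Q ∂μ +
      ∫⁻ x, ∫⁻ y, ∫⁻ ξ, f (x, y, Conf.insert x (Conf.insert y ξ)) ∂Q ∂μ ∂μ := by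
  have := h.isProb
  have := h.sigmaFinite
  have hF : Measurable fun p : X × Conf X => ∫⁻ y, f (p.1, y, p.2) ∂(pointKernel E p.2) :=
    measurable_lintegral_pointKernel (Y := X × Conf X) (f := fun q => f (q.1.1, q.2, q.1.2))
      (hf.comp (by fun_prop)) measurable_snd
  rw [h.mecke hF, ← lintegral_add_left]
  · congr 1
    ext x
    -- Second application with `x` frozen: the points of `insert x ξ` are `x` itself, which yields
    -- the diagonal term, and those of `ξ`.
    have h2 := h.mecke (f := fun p => f (x, p.1, Conf.insert x p.2))
      (hf.comp (measurable_const.prodMk (measurable_fst.prodMk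
        ((measurable_insert_left x).comp measurable_snd))))
    simp only at h2
    rw [← h2, ← lintegral_add_left]
    · apply lintegral_congr_ae
      filter_upwards [h.locFin, h.notMem x] with ξ h3 h4
      exact lintegral_pointKernel_insert h3 h4 _
    · exact hf.comp (measurable_const.prodMk (measurable_const.prodMk (measurable_insert_left x)))
  · have : Measurable fun p : X × Conf X => f (p.1, p.1, Conf.insert p.1 p.2) :=
      hf.comp (measurable_fst.prodMk (measurable_fst.prodMk measurable_insert))
    exact this.lintegral_prod_right'

end PoissonLaw

end HypRST

/-! ### Integration by parts and a lower bound for variances. -/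

namespace HypRST

set_option linter.unusedSectionVars false

section IntegrationByParts

variable {X : Type*} [MeasurableSpace X] [MeasurableSpace.CountablyGenerated X]
  [MeasurableSpace.SeparatesPoints X] [MeasurableSingletonClass X]
  {E : Exhaustion X} {μ : Measure X} {Q : Measure (Conf X)}

lemma IsPoissonLaw.lintegral_sq (h : IsPoissonLaw E μ Q) [NullSingletonClass μ] {W : Set X}
    (hW : MeasurableSet W) :
    ∫⁻ ξ, pointKernel E ξ W ^ 2 ∂Q = μ W + μ W ^ 2 := by
  have := h.isProb
  have hm : Measurable (W.indicator (1 : X → ℝ≥0∞)) := measurable_one.indicator hW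
  have h1 := h.mecke₂ (f := fun p => W.indicator 1 p.1 * W.indicator 1 p.2.1)
    ((hm.comp measurable_fst).mul (hm.comp measurable_snd.fst))
  simp only [lintegral_const, measure_univ, mul_one] at h1
  have h2 : ∀ ν : Measure X, ∫⁻ x, ∫⁻ y, W.indicator 1 x * W.indicator 1 y ∂ν ∂ν = ν W ^ 2 := by
    intro ν
    simp_rw [lintegral_const_mul _ hm, lintegral_mul_const _ hm, lintegral_indicator_one hW]
    ring
  simp_rw [h2] at h1
  rw [h1]
  congr 1
  rw [← lintegral_indicator_one hW]
  congr 1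
  ext x
  by_cases hx : x ∈ W <;> simp [hx]

lemma IsPoissonLaw.ae_lt_top (h : IsPoissonLaw E μ Q) {W : Set X}
    (hW : MeasurableSet W) (hμ : μ W < ∞) : ∀ᵐ ξ ∂Q, pointKernel E ξ W < ∞ := by
  apply _root_.MeasureTheory.ae_lt_top (Kernel.measurable_coe _ hW)
  rw [h.mean_pointKernel hW]
  exact hμ.ne

lemma IsPoissonLaw.memLp_count (h : IsPoissonLaw E μ Q) [NullSingletonClass μ] {W : Set X}
    (hW : MeasurableSet W) (hμ : μ W < ∞) :
    MemLp (fun ξ => (pointKernel E ξ).real W) 2 Q := by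
  have hm : Measurable fun ξ => (pointKernel E ξ).real W :=
    (Kernel.measurable_coe _ hW).ennreal_toReal
  rw [memLp_two_iff_integrable_sq hm.aestronglyMeasurable]
  refine ⟨(hm.pow_const 2).aestronglyMeasurable, ?_⟩
  rw [HasFiniteIntegral]
  have : ∫⁻ ξ, ‖(pointKernel E ξ).real W ^ 2‖ₑ ∂Q ≤ ∫⁻ ξ, pointKernel E ξ W ^ 2 ∂Q := by
    apply lintegral_mono
    intro ξ
    simp only [enorm_pow]
    gcongr
    rw [Real.enorm_of_nonneg measureReal_nonneg]
    exact ENNReal.ofReal_toReal_le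
  refine this.trans_lt ?_
  rw [h.lintegral_sq hW]
  finiteness

/-- The section of a set of marked configurations. -/
def confSection (D : Set (X × Conf X)) (ξ : Conf X) : Set X := {x | (x, ξ) ∈ D}

lemma measurableSet_confSection {D : Set (X × Conf X)} (hD : MeasurableSet D) (ξ : Conf X) :
    MeasurableSet (confSection D ξ) :=
  (measurable_id.prodMk measurable_const : Measurable fun x : X => (x, ξ)) hD

lemma measurable_pointKernel_confSection {D : Set (X × Conf X)} (hD : MeasurableSet D) :
    Measurable fun ξ => (pointKernel E ξ).real (confSection D ξ) :=
  (Kernel.measurable_kernel_prodMk_left (κ := pointKernel E)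
    (measurable_swap hD)).ennreal_toReal

lemma measurable_measure_confSection [SFinite μ] {D : Set (X × Conf X)} (hD : MeasurableSet D) :
    Measurable fun ξ => μ.real (confSection D ξ) :=
  (measurable_measure_prodMk_left (ν := μ) (measurable_swap hD)).ennreal_toReal

variable (E μ) in
/-- The compensated number of points `x` of the configuration with `(x, ξ) ∈ D`. -/
noncomputable def compensated (D : Set (X × Conf X)) (ξ : Conf X) : ℝ :=
  (pointKernel E ξ).real (confSection D ξ) - μ.real (confSection D ξ)

lemma confSection_subset {D : Set (X × Conf X)} {W : Set X} (hDW : D ⊆ W ×ˢ univ) (ξ : Conf X) :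
    confSection D ξ ⊆ W := fun _ hx => (hDW hx).1

lemma IsPoissonLaw.memLp_compensated (h : IsPoissonLaw E μ Q) [NullSingletonClass μ] {W : Set X}
    (hW : MeasurableSet W) (hμ : μ W < ∞) {D : Set (X × Conf X)} (hD : MeasurableSet D)
    (hDW : D ⊆ W ×ˢ univ) : MemLp (compensated E μ D) 2 Q := by
  have := h.isProb
  have := h.sigmaFinite
  refine MemLp.of_le ((h.memLp_count hW hμ).add (memLp_const (μ.real W)))
    ((measurable_pointKernel_confSection hD).sub
      (measurable_measure_confSection hD)).aestronglyMeasurable ?_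
  filter_upwards [h.ae_lt_top hW hμ] with ξ hξ
  have h1 : (pointKernel E ξ).real (confSection D ξ) ≤ (pointKernel E ξ).real W :=
    measureReal_mono (confSection_subset hDW ξ) hξ.ne
  have h2 : μ.real (confSection D ξ) ≤ μ.real W :=
    measureReal_mono (confSection_subset hDW ξ) hμ.ne
  have h3 : 0 ≤ (pointKernel E ξ).real (confSection D ξ) := measureReal_nonneg
  have h4 : 0 ≤ μ.real (confSection D ξ) := measureReal_nonneg
  simp only [Pi.add_apply, Real.norm_eq_abs]
  rw [abs_of_nonneg (by positivity : 0 ≤ (pointKernel E ξ).real W + μ.real W)]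
  unfold compensated
  rw [abs_le]
  constructor <;> linarith

/-- Integration by parts for functionals of a Poisson process. -/
theorem IsPoissonLaw.integral_mul_compensated (h : IsPoissonLaw E μ Q) [NullSingletonClass μ]
    {W : Set X} (hW : MeasurableSet W) (hμ : μ W < ∞) {D : Set (X × Conf X)}
    (hD : MeasurableSet D) (hDW : D ⊆ W ×ˢ univ)
    (hDi : ∀ x ξ, (x, Conf.insert x ξ) ∈ D ↔ (x, ξ) ∈ D)
    {F : Conf X → ℝ} (hFm : Measurable F) (hF : MemLp F 2 Q) :
    Integrable (fun p : X × Conf X =>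
      D.indicator (fun p => F (Conf.insert p.1 p.2) - F p.2) p) (μ.prod Q) ∧
    ∫ ξ, F ξ * compensated E μ D ξ ∂Q =
      ∫ x, ∫ ξ, D.indicator (fun p => F (Conf.insert p.1 p.2) - F p.2) (x, ξ) ∂Q ∂μ := by
  have := h.isProb
  have := h.sigmaFinite
  set f : X × Conf X → ℝ := D.indicator fun p => F p.2 with hf
  have hfm : Measurable f := (hFm.comp measurable_snd).indicator hD
  have hFN : Integrable (fun ξ => F ξ * (pointKernel E ξ).real (confSection D ξ)) Q := by
    refine (hF.integrable_mul (h.memLp_count hW hμ)).mono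
      (hFm.mul (measurable_pointKernel_confSection hD)).aestronglyMeasurable ?_
    filter_upwards [h.ae_lt_top hW hμ] with ξ hξ
    simp only [norm_mul, Pi.mul_apply]
    gcongr
    rw [Real.norm_of_nonneg measureReal_nonneg, Real.norm_of_nonneg measureReal_nonneg]
    exact measureReal_mono (confSection_subset hDW ξ) hξ.ne
  have hsec : ∀ ξ x, f (x, ξ) = (confSection D ξ).indicator (fun _ => F ξ) x := fun ξ x => rfl
  have hfin : ∫⁻ ξ, ∫⁻ x, ‖f (x, ξ)‖ₑ ∂(pointKernel E ξ) ∂Q < ∞ := by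
    refine lt_of_eq_of_lt ?_ hFN.2
    apply lintegral_congr_ae
    filter_upwards [h.ae_lt_top hW hμ] with ξ hξ
    have hξ' : pointKernel E ξ (confSection D ξ) ≠ ∞ :=
      ((measure_mono (confSection_subset hDW ξ)).trans_lt hξ).ne
    simp_rw [hsec, enorm_indicator_eq_indicator_enorm]
    rw [lintegral_indicator_const (measurableSet_confSection hD ξ), enorm_mul,
      Real.enorm_of_nonneg measureReal_nonneg, ofReal_measureReal hξ']
  obtain ⟨hi1, he1⟩ := h.integral_mecke hfm hfin
  have hL : ∀ ξ, ∫ x, f (x, ξ) ∂(pointKernel E ξ) =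
      F ξ * (pointKernel E ξ).real (confSection D ξ) := by
    intro ξ
    simp_rw [hsec]
    rw [integral_indicator (measurableSet_confSection hD ξ), setIntegral_const, smul_eq_mul,
      mul_comm]
  have hi2 : Integrable f (μ.prod Q) := by
    have hWF : Integrable ((W ×ˢ univ).indicator fun p : X × Conf X => F p.2) (μ.prod Q) := by
      rw [integrable_indicator_iff (hW.prod MeasurableSet.univ), IntegrableOn,
        ← Measure.prod_restrict, Measure.restrict_univ]
      have : IsFiniteMeasure (μ.restrict W) := ⟨by simpa using hμ⟩
      exact (hF.integrable (by norm_num)).comp_snd _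
    refine hWF.mono hfm.aestronglyMeasurable (ae_of_all _ fun p => ?_)
    rw [hf]
    by_cases hp : p ∈ D
    · rw [indicator_of_mem hp, indicator_of_mem (hDW hp)]
    · rw [indicator_of_notMem hp]; simp
  have hM : ∀ ξ, ∫ x, f (x, ξ) ∂μ = F ξ * μ.real (confSection D ξ) := by
    intro ξ
    simp_rw [hsec]
    rw [integral_indicator (measurableSet_confSection hD ξ), setIntegral_const, smul_eq_mul,
      mul_comm]
  have he2 : ∫ ξ, F ξ * μ.real (confSection D ξ) ∂Q = ∫ x, ∫ ξ, f (x, ξ) ∂Q ∂μ := by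
    simp_rw [← hM]
    exact (integral_integral_swap (f := fun x ξ => f (x, ξ)) hi2).symm
  have hFM : Integrable (fun ξ => F ξ * μ.real (confSection D ξ)) Q := by
    simp_rw [← hM]
    exact hi2.integral_prod_right
  -- Since membership in `D` does not see the point `x` itself, the shift in the Mecke formula
  -- changes only the argument of `F`.
  have hdiff : ∀ p : X × Conf X, D.indicator (fun p => F (Conf.insert p.1 p.2) - F p.2) p =
      f (p.1, Conf.insert p.1 p.2) - f p := by
    intro p
    rw [hf]
    by_cases hp : p ∈ D
    · rw [indicator_of_mem hp, indicator_of_mem hp, indicator_of_mem ((hDi _ _).2 hp)]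
    · rw [indicator_of_notMem hp, indicator_of_notMem hp,
        indicator_of_notMem (fun h => hp ((hDi _ _).1 h)), sub_zero]
  simp_rw [hdiff]
  refine ⟨hi1.sub hi2, ?_⟩
  unfold compensated
  simp_rw [mul_sub]
  rw [integral_sub hFN hFM, he2]
  simp_rw [← hL]
  rw [he1, ← integral_sub hi1.integral_prod_left hi2.integral_prod_left]
  apply integral_congr_ae
  filter_upwards [hi1.prod_right_ae, hi2.prod_right_ae] with x hx1 hx2
  exact (integral_sub hx1 hx2).symm

lemma abs_measureReal_sub_le {ν : Measure X} {A B U W : Set X} (hW : ν W < ∞) (hA : A ⊆ W)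
    (hB : B ⊆ W) (hU : MeasurableSet U) (h : A \ U = B \ U) :
    |ν.real A - ν.real B| ≤ ν.real (W ∩ U) := by
  have hWU : ν (W ∩ U) ≠ ∞ := ((measure_mono inter_subset_left).trans_lt hW).ne
  rw [← measureReal_inter_add_sdiff hU (s := A) ((measure_mono hA).trans_lt hW).ne,
    ← measureReal_inter_add_sdiff hU (s := B) ((measure_mono hB).trans_lt hW).ne, h]
  have h1 : ν.real (A ∩ U) ≤ ν.real (W ∩ U) := measureReal_mono (inter_subset_inter_left _ hA) hWU
  have h2 : ν.real (B ∩ U) ≤ ν.real (W ∩ U) := measureReal_mono (inter_subset_inter_left _ hB) hWU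
  have h3 : 0 ≤ ν.real (A ∩ U) := measureReal_nonneg
  have h4 : 0 ≤ ν.real (B ∩ U) := measureReal_nonneg
  rw [abs_le]
  constructor <;> linarith

lemma pointKernel_insert_real {ξ : Conf X} (h : LocFin E ξ) {x : X} (hx : x ∉ ξ.pts) {S : Set X}
    (hS : MeasurableSet S) (hxS : x ∈ S) (hfin : pointKernel E ξ S < ∞) :
    (pointKernel E (Conf.insert x ξ)).real S = 1 + (pointKernel E ξ).real S := by
  have h1 := lintegral_pointKernel_insert h hx (S.indicator 1)
  rw [lintegral_indicator_one hS, lintegral_indicator_one hS, indicator_of_mem hxS,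
    Pi.one_apply] at h1
  rw [measureReal_def, measureReal_def, h1, ENNReal.toReal_add ENNReal.one_ne_top hfin.ne,
    ENNReal.toReal_one]

/-- The variance of a compensated sum of local indicators. -/
theorem IsPoissonLaw.integral_compensated_sq_le (h : IsPoissonLaw E μ Q) [NullSingletonClass μ]
    {W : Set X} (hW : MeasurableSet W) (hμ : μ W < ∞) {D : Set (X × Conf X)}
    (hD : MeasurableSet D) (hDW : D ⊆ W ×ˢ univ)
    (hDi : ∀ x ξ, (x, Conf.insert x ξ) ∈ D ↔ (x, ξ) ∈ D)
    {U : X → Set X} (hU : ∀ x, MeasurableSet (U x)) {u₀ : ℝ} (hu₀ : 0 ≤ u₀)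
    (hUμ : ∀ x, μ (U x) ≤ ENNReal.ofReal u₀)
    (hUD : ∀ x y ξ, y ∉ U x → ((y, Conf.insert x ξ) ∈ D ↔ (y, ξ) ∈ D)) :
    ∫ ξ, compensated E μ D ξ ^ 2 ∂Q ≤ μ.real W * (1 + 2 * u₀) := by
  have := h.isProb
  have := h.sigmaFinite
  set H := compensated E μ D with hH
  have hHm : Measurable H :=
    (measurable_pointKernel_confSection hD).sub (measurable_measure_confSection hD)
  -- With `F = H` the second moment of `H` becomes the mean add-one cost of `H` on `D`.
  obtain ⟨hi, he⟩ := h.integral_mul_compensated hW hμ hD hDW hDi hHm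
    (h.memLp_compensated hW hμ hD hDW)
  simp_rw [pow_two]
  rw [← hH] at he
  rw [he]
  have hWint : Integrable (W.indicator fun _ => 1 + 2 * u₀) μ := by
    rw [integrable_indicator_iff hW]
    exact integrableOn_const hμ.ne
  have hval : ∫ x, W.indicator (fun _ => 1 + 2 * u₀) x ∂μ = μ.real W * (1 + 2 * u₀) := by
    rw [integral_indicator hW, setIntegral_const, smul_eq_mul]
  rw [← hval]
  refine integral_mono_ae hi.integral_prod_left hWint ?_
  filter_upwards [hi.prod_right_ae] with x hxi
  by_cases hx : x ∈ W
  swap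
  · have : ∀ ξ, D.indicator (fun p => H (Conf.insert p.1 p.2) - H p.2) (x, ξ) = 0 := fun ξ =>
        indicator_of_notMem (fun hp => hx (hDW hp).1) _
    simp [this, hx]
  rw [indicator_of_mem hx]
  have hWU : MeasurableSet (W ∩ U x) := hW.inter (hU x)
  have hWUμ : μ (W ∩ U x) < ∞ := (measure_mono inter_subset_left).trans_lt hμ
  have hle : μ.real (W ∩ U x) ≤ u₀ := by
    have h1 : μ (W ∩ U x) ≤ μ (U x) := measure_mono inter_subset_right
    exact ENNReal.toReal_le_of_le_ofReal hu₀ (h1.trans (hUμ x))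
  have hNint : Integrable (fun ξ => (pointKernel E ξ).real (W ∩ U x)) Q :=
    (h.memLp_count hWU hWUμ).integrable (by norm_num)
  have hNval : ∫ ξ, (pointKernel E ξ).real (W ∩ U x) ∂Q = μ.real (W ∩ U x) := by
    rw [measureReal_def, ← h.mean_pointKernel hWU]
    unfold Measure.real
    exact integral_toReal (Kernel.measurable_coe _ hWU).aemeasurable (h.ae_lt_top hWU hWUμ)
  have hconst : ∀ c : ℝ, Integrable (fun _ : Conf X => c) Q := fun c => integrable_const c
  have h1N : Integrable (fun ξ => 1 + (pointKernel E ξ).real (W ∩ U x)) Q := (hconst 1).add hNint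
  have hsum : Integrable (fun ξ => 1 + (pointKernel E ξ).real (W ∩ U x) + u₀) Q :=
    h1N.add (hconst u₀)
  -- The new point adds one to the count. By locality the other points and the compensator change
  -- only inside `U x`, by at most the number of points there and by `u₀`.
  have hbound : ∫ ξ, D.indicator (fun p => H (Conf.insert p.1 p.2) - H p.2) (x, ξ) ∂Q ≤
      ∫ ξ, (1 + (pointKernel E ξ).real (W ∩ U x) + u₀) ∂Q := by
    refine integral_mono_ae hxi hsum ?_
    filter_upwards [h.locFin, h.notMem x, h.ae_lt_top hW hμ] with ξ h1 h2 h3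
    have hK0 : 0 ≤ (pointKernel E ξ).real (W ∩ U x) := measureReal_nonneg
    by_cases hp : (x, ξ) ∈ D
    swap
    · rw [indicator_of_notMem hp]; positivity
    rw [indicator_of_mem hp]
    have hs1 := confSection_subset hDW (Conf.insert x ξ)
    have hs2 := confSection_subset hDW ξ
    have hd : confSection D (Conf.insert x ξ) \ U x = confSection D ξ \ U x := by
      ext y
      by_cases hy : y ∈ U x
      · simp [hy]
      · simp only [Set.mem_sdiff, hy, not_false_eq_true, and_true]
        exact hUD x y ξ hy
    have e1 := pointKernel_insert_real h1 h2 (measurableSet_confSection hD (Conf.insert x ξ))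
      ((hDi x ξ).2 hp) ((measure_mono hs1).trans_lt h3)
    have e2 := abs_le.1 (abs_measureReal_sub_le h3 hs1 hs2 (hU x) hd)
    have e3 := abs_le.1 (abs_measureReal_sub_le hμ hs1 hs2 (hU x) hd)
    simp only [hH, compensated]
    rw [e1]
    linarith [e2.1, e2.2, e3.1, e3.2]
  refine hbound.trans ?_
  rw [integral_add h1N (hconst u₀), integral_add (hconst 1) hNint, hNval]
  simp
  linarith

/-- A lower bound for the variance of a functional of a Poisson process, by comparison with a
compensated sum of local indicators. -/
theorem IsPoissonLaw.le_variance (h : IsPoissonLaw E μ Q) [NullSingletonClass μ]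
    {W : Set X} (hW : MeasurableSet W) (hμ : μ W < ∞) {D : Set (X × Conf X)}
    (hD : MeasurableSet D) (hDW : D ⊆ W ×ˢ univ)
    (hDi : ∀ x ξ, (x, Conf.insert x ξ) ∈ D ↔ (x, ξ) ∈ D)
    {U : X → Set X} (hU : ∀ x, MeasurableSet (U x)) {u₀ : ℝ} (hu₀ : 0 ≤ u₀)
    (hUμ : ∀ x, μ (U x) ≤ ENNReal.ofReal u₀)
    (hUD : ∀ x y ξ, y ∉ U x → ((y, Conf.insert x ξ) ∈ D ↔ (y, ξ) ∈ D))
    {F : Conf X → ℝ} (hFm : Measurable F) (hF : MemLp F 2 Q) {δ : ℝ} (hδ : 0 ≤ δ)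
    (hFδ : ∀ x ∈ W, Integrable (fun ξ => D.indicator
        (fun p => F (Conf.insert p.1 p.2) - F p.2) (x, ξ)) Q →
      δ ≤ ∫ ξ, D.indicator (fun p => F (Conf.insert p.1 p.2) - F p.2) (x, ξ) ∂Q) :
    δ ^ 2 * μ.real W ≤ variance F Q * (1 + 2 * u₀) := by
  have := h.isProb
  have := h.sigmaFinite
  rcases (measureReal_nonneg (μ := μ) (s := W)).eq_or_lt with h0 | hpos
  · rw [← h0, mul_zero]
    exact mul_nonneg (variance_nonneg _ _) (by positivity)
  set H := compensated E μ D with hH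
  have hHL := h.memLp_compensated hW hμ hD hDW
  rw [← hH] at hHL
  have hH2 : ∫ ξ, H ξ ^ 2 ∂Q ≤ μ.real W * (1 + 2 * u₀) :=
    h.integral_compensated_sq_le hW hμ hD hDW hDi hU hu₀ hUμ hUD
  obtain ⟨hi, he⟩ := h.integral_mul_compensated hW hμ hD hDW hDi hFm hF
  have hmean : ∫ ξ, H ξ ∂Q = 0 := by
    have := (h.integral_mul_compensated hW hμ hD hDW hDi (F := fun _ => 1) measurable_const
      (memLp_const 1)).2
    simpa using this
  have hlow : δ * μ.real W ≤ ∫ ξ, F ξ * H ξ ∂Q := by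
    rw [hH, he]
    have hval : ∫ x, W.indicator (fun _ => δ) x ∂μ = δ * μ.real W := by
      rw [integral_indicator hW, setIntegral_const, smul_eq_mul, mul_comm]
    rw [← hval]
    refine integral_mono_ae ?_ hi.integral_prod_left ?_
    · rw [integrable_indicator_iff hW]
      exact integrableOn_const hμ.ne
    · filter_upwards [hi.prod_right_ae] with x hxi
      by_cases hx : x ∈ W
      · rw [indicator_of_mem hx]
        exact hFδ x hx hxi
      · have : ∀ ξ, D.indicator (fun p => F (Conf.insert p.1 p.2) - F p.2) (x, ξ) = 0 := fun ξ =>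
          indicator_of_notMem (fun hp => hx (hDW hp).1) _
        simp [this, hx]
  set m := ∫ ξ, F ξ ∂Q with hm
  have hFi : Integrable F Q := hF.integrable (by norm_num)
  have hHi : Integrable H Q := hHL.integrable (by norm_num)
  have hFH : Integrable (fun ξ => F ξ * H ξ) Q := hF.integrable_mul hHL
  have hHH : Integrable (fun ξ => H ξ ^ 2) Q := hHL.integrable_sq
  set B := μ.real W * (1 + 2 * u₀) with hB
  have hB0 : 0 < B := by positivity
  set c := ∫ ξ, F ξ * H ξ ∂Q with hc
  -- The minimiser of `variance F - 2tc + t²B`; nonnegativity of the mean of `(F - m - tH)²` at this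
  -- `t` gives `c² ≤ variance F * B`.
  set t := c / B with ht
  have hFm2 : Integrable (fun ξ => (F ξ - m) ^ 2) Q := (hF.sub (memLp_const m)).integrable_sq
  have hvar : variance F Q = ∫ ξ, (F ξ - m) ^ 2 ∂Q :=
    variance_eq_integral hF.aestronglyMeasurable.aemeasurable
  have hexp : ∫ ξ, (F ξ - m - t * H ξ) ^ 2 ∂Q =
      variance F Q - 2 * t * c + t ^ 2 * ∫ ξ, H ξ ^ 2 ∂Q := by
    have e : ∀ ξ, (F ξ - m - t * H ξ) ^ 2 =
        ((F ξ - m) ^ 2 - 2 * t * (F ξ * H ξ)) + (2 * t * m * H ξ + t ^ 2 * H ξ ^ 2) := fun ξ => by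
      ring
    have i1 : Integrable (fun ξ => (F ξ - m) ^ 2 - 2 * t * (F ξ * H ξ)) Q :=
      hFm2.sub (hFH.const_mul _)
    have i2 : Integrable (fun ξ => 2 * t * m * H ξ + t ^ 2 * H ξ ^ 2) Q :=
      (hHi.const_mul _).add (hHH.const_mul _)
    simp_rw [e]
    rw [integral_add i1 i2,
      integral_sub hFm2 (hFH.const_mul _), integral_add (hHi.const_mul _) (hHH.const_mul _),
      integral_const_mul, integral_const_mul, integral_const_mul, hmean, hvar]
    ring
  have hnn : 0 ≤ ∫ ξ, (F ξ - m - t * H ξ) ^ 2 ∂Q := integral_nonneg fun ξ => sq_nonneg _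
  have h1 : t ^ 2 * ∫ ξ, H ξ ^ 2 ∂Q ≤ t ^ 2 * B := by gcongr
  have h2 : t * B = c := by rw [ht]; field_simp
  have h3 : t * c ≤ variance F Q := by
    have : t ^ 2 * B = t * c := by rw [← h2]; ring
    linarith
  have h4 : c ^ 2 ≤ variance F Q * B := by
    have := mul_le_mul_of_nonneg_right h3 hB0.le
    calc c ^ 2 = t * c * B := by rw [← h2]; ring
      _ ≤ _ := this
  have h5 : (δ * μ.real W) ^ 2 ≤ c ^ 2 := by gcongr
  have h6 : μ.real W * (δ ^ 2 * μ.real W) ≤ μ.real W * (variance F Q * (1 + 2 * u₀)) := by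
    calc μ.real W * (δ ^ 2 * μ.real W) = (δ * μ.real W) ^ 2 := by ring
      _ ≤ _ := h5.trans h4
      _ = _ := by rw [hB]; ring
  exact le_of_mul_le_mul_left h6 hpos

end IntegrationByParts

end HypRST

/-! ### The given Poisson process induces a Poisson law on configurations. -/

namespace HypRST

variable {d : ℕ}

/-- The exhaustion of the hyperbolic space by balls. -/
def hypExhaustion (d : ℕ) : Exhaustion (HypSpace d) where
  set k := hball 1 (base d) k
  measurableSet k := measurableSet_hball _ _
  mono := by
    intro i j h y hy
    exact lt_of_lt_of_le (show hdist 1 (base d) y < i from hy) (Nat.cast_le.2 h)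
  iUnion_eq := iUnion_hball _

lemma locFin_inter_hball {ξ : Conf (HypSpace d)} (h : LocFin (hypExhaustion d) ξ)
    (x : HypSpace d) (r : ℝ) : (ξ.pts ∩ hball 1 x r).Finite := by
  obtain ⟨k, hk⟩ := exists_nat_gt (hdist 1 (base d) x + r)
  refine (h k).subset (inter_subset_inter_right _ fun y hy => ?_)
  simp only [hball, mem_ofPred_eq, hypExhaustion] at *
  linarith [hdist_triangle (base d) x y]

instance nullSingletonClass_hvol (c : ℝ≥0∞) : NullSingletonClass (c • hvol d 1) :=
  ⟨fun x => by
    rw [Measure.smul_apply, measure_mono_null (t := {y | y.1.2 = x.1.2}) _ (hvol_height_eq _),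
      smul_zero]
    rintro _ rfl
    rfl⟩

/-- The Poisson distribution of the counts is used only through their means and void probabilities.
-/
lemma IsPoissonProcess.isPoissonLaw (hd : 2 ≤ d) {γ : ℝ} {Ω : Type u} [MeasurableSpace Ω]
    {P : Measure Ω} [IsProbabilityMeasure P] {η : Ω → Set (HypSpace d)}
    (h : IsPoissonProcess 1 (ENNReal.ofReal γ • hvol d 1) P η) :
    Measurable (fun ω => (⟨η ω⟩ : Conf (HypSpace d))) ∧
    IsPoissonLaw (hypExhaustion d) (ENNReal.ofReal γ • hvol d 1)
      (P.map fun ω => (⟨η ω⟩ : Conf (HypSpace d))) := by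
  have hm : Measurable (fun ω => (⟨η ω⟩ : Conf (HypSpace d))) := by
    apply measurable_conf
    intro B hB
    have : {ω | (⟨η ω⟩ : Conf (HypSpace d)) ∈ voidEvent B} =
        (fun ω => (η ω ∩ B).encard) ⁻¹' {0} := by
      ext ω
      simp [mem_voidEvent]
    rw [this]
    exact h.measurable_count B hB (MeasurableSet.singleton _)
  have hmc : ∀ B : Set (HypSpace d), MeasurableSet B →
      Measurable fun ξ : Conf (HypSpace d) => ((ξ.pts ∩ B).encard : ℝ≥0∞) := fun B hB =>
    (Measurable.of_discrete (f := fun n : ℕ∞ => (n : ℝ≥0∞))).comp (measurable_encard hB)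
  refine ⟨hm, Measure.isProbabilityMeasure_map hm.aemeasurable, ?_, ?_, ?_, ?_, ?_⟩
  · intro k
    exact ENNReal.mul_lt_top ENNReal.ofReal_lt_top (hvol_hball_lt_top hd _ _)
  · rw [ae_map_iff hm.aemeasurable (measurableSet_locFin _)]
    exact ae_of_all _ fun ω k => h.locallyFinite ω _ _
  · intro B hB
    rw [lintegral_map (hmc B hB) hm]
    set μ := ENNReal.ofReal γ • hvol d 1 with hμ
    by_cases hfin : μ B = ∞
    · rw [hfin]
      have : ∀ᵐ ω ∂P, ((η ω ∩ B).encard : ℝ≥0∞) = ∞ := by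
        filter_upwards [h.infinite_count B hB hfin] with ω hω
        rw [hω]; rfl
      rw [lintegral_congr_ae this]
      simp
    · set N : Ω → ℕ∞ := fun ω => (η ω ∩ B).encard with hN
      have hNm : Measurable N := h.measurable_count B hB
      set r := (μ B).toNNReal with hr
      have hp : ∀ k : ℕ, P.map N {(k : ℕ∞)} = poissonMeasure r {k} := by
        intro k
        rw [Measure.map_apply hNm (MeasurableSet.singleton _)]
        exact h.poisson_count B hB hfin k
      have hlaw : P.map N = (poissonMeasure r).map (fun k : ℕ => (k : ℕ∞)) := by
        have hc : Measurable (fun k : ℕ => (k : ℕ∞)) := Measurable.of_discrete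
        have hpr : IsProbabilityMeasure (P.map N) :=
          Measure.isProbabilityMeasure_map hNm.aemeasurable
        have hrange : MeasurableSet (range (fun k : ℕ => (k : ℕ∞))) := MeasurableSet.of_discrete
        have hk : ∀ k : ℕ, ((poissonMeasure r).map (fun k : ℕ => (k : ℕ∞))) {(k : ℕ∞)} =
            poissonMeasure r {k} := by
          intro k
          rw [Measure.map_apply hc (MeasurableSet.singleton _)]
          congr 1
          ext j
          simp
        -- The finite values already carry the full mass of the Poisson distribution.
        have htop : P.map N {⊤} = 0 := by
          have h1 : P.map N (range (fun k : ℕ => (k : ℕ∞))) = 1 := by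
            rw [← iUnion_singleton_eq_range, measure_iUnion]
            · simp_rw [hp]
              have := measure_iUnion (μ := poissonMeasure r) (f := fun k : ℕ => ({k} : Set ℕ))
                (fun i j hij => by simpa using hij) (fun k => MeasurableSet.singleton k)
              rw [← this, iUnion_singleton_eq_range]
              simp
            · intro i j hij
              simpa using hij
            · exact fun k => MeasurableSet.singleton _
          have h2 : ({⊤} : Set ℕ∞) ⊆ (range (fun k : ℕ => (k : ℕ∞)))ᶜ := by
            rintro _ rfl ⟨k, hk⟩
            exact ENat.natCast_ne_top k hk
          refine measure_mono_null h2 ?_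
          rw [measure_compl hrange (measure_ne_top _ _), h1, measure_univ, tsub_self]
        refine Measure.ext_of_singleton fun a => ?_
        induction a using ENat.recTopCoe with
        | top =>
          rw [htop, Measure.map_apply hc (MeasurableSet.singleton _)]
          have : (fun k : ℕ => (k : ℕ∞)) ⁻¹' {⊤} = ∅ := by ext; simp
          rw [this, measure_empty]
        | coe k => rw [hp, hk]
      have hval : ∫⁻ ω, (N ω : ℝ≥0∞) ∂P = ∫⁻ k : ℕ, (k : ℝ≥0∞) ∂(poissonMeasure r) := by
        rw [← lintegral_map (f := fun n : ℕ∞ => (n : ℝ≥0∞)) Measurable.of_discrete hNm, hlaw,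
          lintegral_map Measurable.of_discrete Measurable.of_discrete]
        simp
      rw [hval, lintegral_countable']
      simp_rw [poissonMeasure_singleton]
      -- The term `k = 0` vanishes, and `k` times the weight of `k` is `r` times the weight of `k -
      -- 1`.
      have hsum : HasSum (fun k : ℕ => (k : ℝ) * (Real.exp (-r) * r ^ k / k.factorial)) r := by
        rw [← hasSum_nat_add_iff' 1]
        simp only [Finset.range_one, Finset.sum_singleton, Nat.cast_zero, zero_mul, sub_zero]
        have h0 := (hasSum_one_poissonMeasure r).mul_left (r : ℝ)
        rw [mul_one] at h0
        have e : (fun k : ℕ => ((k + 1 : ℕ) : ℝ) *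
            (Real.exp (-r) * r ^ (k + 1) / (k + 1).factorial)) =
            fun k : ℕ => (r : ℝ) * (Real.exp (-r) * r ^ k / k.factorial) := by
          funext k
          rw [Nat.factorial_succ]
          push_cast
          field_simp
          ring
        rw [e]
        exact h0
      have hterm : ∀ k : ℕ, (k : ℝ≥0∞) * ENNReal.ofReal (Real.exp (-r) * r ^ k / k.factorial) =
          ENNReal.ofReal ((k : ℝ) * (Real.exp (-r) * r ^ k / k.factorial)) := fun k => by
        rw [ENNReal.ofReal_mul (Nat.cast_nonneg k), ENNReal.ofReal_natCast]
      simp_rw [hterm]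
      rw [← ENNReal.ofReal_tsum_of_nonneg (fun k => by positivity) hsum.summable, hsum.tsum_eq,
        ENNReal.ofReal_coe_nnreal, hr, ENNReal.coe_toNNReal hfin]
  · intro B hB hfin
    rw [Measure.map_apply hm (measurableSet_voidEvent hB)]
    have h0 := h.poisson_count B hB hfin 0
    have : (fun ω => (⟨η ω⟩ : Conf (HypSpace d))) ⁻¹' voidEvent B =
        {ω | (η ω ∩ B).encard = (0 : ℕ)} := by
      ext ω
      simp [mem_voidEvent]
    rw [this, h0, poissonMeasure_singleton]
    congr 1
    simp
    rfl
  · intro k B hB hdis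
    rw [iIndepFun_iff_measure_inter_preimage_eq_mul]
    have := h.indep_count k B hB hdis
    rw [iIndepFun_iff_measure_inter_preimage_eq_mul] at this
    intro S sets hsets
    rw [Measure.map_apply hm]
    · have e := this S hsets
      simp only [preimage_iInter]
      rw [show (∏ i ∈ S, (P.map fun ω => (⟨η ω⟩ : Conf (HypSpace d)))
          ((fun ξ : Conf (HypSpace d) => (ξ.pts ∩ B i).encard) ⁻¹' sets i)) =
          ∏ i ∈ S, P ((fun ω => (η ω ∩ B i).encard) ⁻¹' sets i) from
        Finset.prod_congr rfl fun i hi => Measure.map_apply hm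
          (measurable_encard (hB i) (hsets i hi))]
      exact e
    · exact Finset.measurableSet_biInter _ fun i hi => measurable_encard (hB i) (hsets i hi)

end HypRST

/-! ### Edge lengths as void events, and their survival functions. -/

namespace HypRST

variable {d : ℕ}

section EdgeLength

lemma edgeLength_nonneg (o x : HypSpace d) (ξ : Set (HypSpace d)) : 0 ≤ edgeLength 1 o ξ x := by
  refine Real.sInf_nonneg ?_
  rintro _ ⟨y, -, rfl⟩
  exact hdist_nonneg _ _

/-- The root is always a candidate neighbour and accounts for the cap at `hdist 1 o x`; every other
candidate within distance `s` lies in the lens. All probabilities of edge lengths are reduced to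
void probabilities in this way. -/
lemma le_edgeLength_iff {o x : HypSpace d} (hx : x ≠ o) (ξ : Set (HypSpace d)) (s : ℝ) :
    s ≤ edgeLength 1 o ξ x ↔ s ≤ hdist 1 o x ∧ ξ ∩ lens o x s = ∅ := by
  have ho : o ∈ closerVertices 1 o ξ x :=
    ⟨mem_insert _ _, by rw [hdist_self]; exact hdist_pos (Ne.symm hx)⟩
  have hb : BddBelow (hdist 1 x '' closerVertices 1 o ξ x) :=
    ⟨0, by rintro _ ⟨y, -, rfl⟩; exact hdist_nonneg _ _⟩
  rw [edgeLength, le_csInf_iff hb ⟨_, mem_image_of_mem _ ho⟩]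
  constructor
  · intro h
    refine ⟨by rw [hdist_comm]; exact h _ (mem_image_of_mem _ ho), ?_⟩
    refine eq_empty_of_forall_notMem fun y hy => ?_
    exact absurd (h _ (mem_image_of_mem _ ⟨mem_insert_of_mem _ hy.1, hy.2.2⟩)) (not_le.2 hy.2.1)
  · rintro ⟨h1, h2⟩ _ ⟨y, ⟨rfl | hy, hlt⟩, rfl⟩
    · rwa [hdist_comm]
    · by_contra hc
      exact (h2 ▸ (⟨hy, not_le.1 hc, hlt⟩ : y ∈ ξ ∩ lens o x s) : y ∈ (∅ : Set (HypSpace d)))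

lemma closerVertices_self (o : HypSpace d) (ξ : Set (HypSpace d)) :
    closerVertices 1 o ξ o = ∅ := by
  refine eq_empty_of_forall_notMem fun y hy => ?_
  have := hy.2
  rw [hdist_self] at this
  exact absurd this (not_lt.2 (hdist_nonneg _ _))

lemma edgeLength_self (o : HypSpace d) (ξ : Set (HypSpace d)) : edgeLength 1 o ξ o = 0 := by
  rw [edgeLength, closerVertices_self, image_empty, Real.sInf_empty]

/-- A point no closer to the root is never a candidate neighbour of `x`. The case `y = x` removes
the point inserted by the Mecke formula. -/
lemma edgeLength_insert_of_le {o x y : HypSpace d} (h : hdist 1 o x ≤ hdist 1 o y)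
    (ξ : Set (HypSpace d)) : edgeLength 1 o (insert y ξ) x = edgeLength 1 o ξ x := by
  have : closerVertices 1 o (insert y ξ) x = closerVertices 1 o ξ x := by
    ext z
    simp only [closerVertices, mem_ofPred_eq, mem_insert_iff]
    constructor
    · rintro ⟨rfl | rfl | hz, hlt⟩
      · exact ⟨.inl rfl, hlt⟩
      · exact absurd hlt (not_lt.2 h)
      · exact ⟨.inr hz, hlt⟩
    · rintro ⟨rfl | hz, hlt⟩
      · exact ⟨.inl rfl, hlt⟩
      · exact ⟨.inr (.inr hz), hlt⟩
  rw [edgeLength, edgeLength, this]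

lemma isOpen_lens_prod (o : HypSpace d) (s : ℝ) :
    IsOpen {p : HypSpace d × HypSpace d | p.2 ∈ lens o p.1 s} := by
  have h1 : Continuous fun p : HypSpace d × HypSpace d => hdist (d := d) 1 p.1 p.2 :=
    continuous_hdist_comp continuous_fst continuous_snd
  have h2 : Continuous fun p : HypSpace d × HypSpace d => hdist (d := d) 1 o p.2 :=
    continuous_hdist_comp continuous_const continuous_snd
  have h3 : Continuous fun p : HypSpace d × HypSpace d => hdist (d := d) 1 o p.1 :=
    continuous_hdist_comp continuous_const continuous_fst
  exact (isOpen_lt h1 continuous_const).inter (isOpen_lt h2 h3)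

/-- An open `A` is a countable union of basic rectangles `u ×ˢ v`; its section at `x` is void
exactly when, for every such rectangle, `x ∉ u` or `v` is void. -/
lemma measurableSet_inter_eq_empty {A : Set (HypSpace d × HypSpace d)} (hA : IsOpen A) :
    MeasurableSet {p : HypSpace d × Conf (HypSpace d) | p.2.pts ∩ {y | (p.1, y) ∈ A} = ∅} := by
  have hb := TopologicalSpace.isBasis_countableBasis (HypSpace d)
  have hc := TopologicalSpace.countable_countableBasis (HypSpace d)
  set S : Set (Set (HypSpace d) × Set (HypSpace d)) :=
    {q | q.1 ∈ TopologicalSpace.countableBasis (HypSpace d) ∧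
      q.2 ∈ TopologicalSpace.countableBasis (HypSpace d) ∧ q.1 ×ˢ q.2 ⊆ A} with hS
  have hSc : S.Countable := (hc.prod hc).mono fun q hq => Set.mem_prod.2 ⟨hq.1, hq.2.1⟩
  have e : {p : HypSpace d × Conf (HypSpace d) | p.2.pts ∩ {y | (p.1, y) ∈ A} = ∅} =
      ⋂ q ∈ S, (q.1 ×ˢ (univ : Set (Conf (HypSpace d))))ᶜ ∪ univ ×ˢ voidEvent q.2 := by
    ext p
    simp only [mem_ofPred_eq, mem_iInter]
    constructor
    · intro h q hq
      by_cases hp : p.1 ∈ q.1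
      · refine .inr ⟨mem_univ _, mem_voidEvent.2 (eq_empty_of_forall_notMem fun y hy => ?_)⟩
        have : y ∈ p.2.pts ∩ {y | (p.1, y) ∈ A} := ⟨hy.1, hq.2.2 ⟨hp, hy.2⟩⟩
        rw [h] at this
        exact this
      · exact .inl fun h' => hp h'.1
    · intro h
      refine eq_empty_of_forall_notMem fun y hy => ?_
      have hy2 : (p.1, y) ∈ A := hy.2
      obtain ⟨U, hU, hmem, hsub⟩ := (hb.prod hb).exists_subset_of_mem_open hy2 hA
      obtain ⟨u, hu, v, hv, rfl⟩ := hU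
      rcases h (u, v) ⟨hu, hv, hsub⟩ with h' | h'
      · exact h' ⟨hmem.1, mem_univ _⟩
      · have h'' : y ∈ p.2.pts ∩ v := ⟨hy.1, hmem.2⟩
        rw [mem_voidEvent.1 h'.2] at h''
        exact h''
  rw [e]
  refine MeasurableSet.biInter hSc fun q hq => ?_
  refine ((hb.isOpen hq.1).measurableSet.prod MeasurableSet.univ).compl.union
    (MeasurableSet.univ.prod (measurableSet_voidEvent (hb.isOpen hq.2.1).measurableSet))

lemma measurable_edgeLength (o : HypSpace d) :
    Measurable fun p : HypSpace d × Conf (HypSpace d) => edgeLength 1 o p.2.pts p.1 := by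
  refine measurable_of_Ici fun s => ?_
  have e : (fun p : HypSpace d × Conf (HypSpace d) => edgeLength 1 o p.2.pts p.1) ⁻¹' Ici s =
      ({p | p.1 = o} ∩ {_p | s ≤ 0}) ∪ ({p | p.1 ≠ o} ∩ ({p | s ≤ hdist 1 o p.1} ∩
        {p | p.2.pts ∩ {y | (p.1, y) ∈ {p : HypSpace d × HypSpace d | p.2 ∈ lens o p.1 s}} = ∅})) := by
    ext p
    simp only [mem_preimage, mem_Ici, mem_union, mem_inter_iff, mem_ofPred_eq, ofPred_mem_eq]
    by_cases hp : p.1 = o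
    · simp [hp, edgeLength_self]
    · simp [hp, le_edgeLength_iff hp]
  rw [e]
  have h1 : MeasurableSet {p : HypSpace d × Conf (HypSpace d) | p.1 = o} :=
    measurable_fst (measurableSet_singleton o)
  have h2 : MeasurableSet {p : HypSpace d × Conf (HypSpace d) | s ≤ hdist 1 o p.1} :=
    measurableSet_le measurable_const ((continuous_hdist_comp continuous_const continuous_id).measurable.comp measurable_fst)
  exact (h1.inter (MeasurableSet.const _)).union
    (h1.compl.inter (h2.inter (measurableSet_inter_eq_empty (isOpen_lens_prod o s))))

end EdgeLength

section EdgeSum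

/-- The edge-length functional as an integral with values in `[0, ∞]`. -/
noncomputable def edgeSum (o : HypSpace d) (β R : ℝ) (ξ : Conf (HypSpace d)) : ℝ≥0∞ :=
  ∫⁻ x, (hball 1 o R).indicator (fun x => ENNReal.ofReal (edgeLength 1 o ξ.pts x ^ β)) x
    ∂(pointKernel (hypExhaustion d) ξ)

lemma measurable_ofReal_edgeLength_rpow (o : HypSpace d) (β R : ℝ) :
    Measurable fun p : HypSpace d × Conf (HypSpace d) => (hball 1 o R).indicator
      (fun x => ENNReal.ofReal (edgeLength 1 o p.2.pts x ^ β)) p.1 := by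
  have h : Measurable fun p : HypSpace d × Conf (HypSpace d) =>
      ENNReal.ofReal (edgeLength 1 o p.2.pts p.1 ^ β) :=
    ((measurable_edgeLength o).pow_const β).ennreal_ofReal
  have e : (fun p : HypSpace d × Conf (HypSpace d) => (hball 1 o R).indicator
      (fun x => ENNReal.ofReal (edgeLength 1 o p.2.pts x ^ β)) p.1) =
      ((hball 1 o R) ×ˢ univ).indicator fun p : HypSpace d × Conf (HypSpace d) =>
        ENNReal.ofReal (edgeLength 1 o p.2.pts p.1 ^ β) := by
    ext p
    by_cases hp : p.1 ∈ hball 1 o R <;> simp [indicator, hp]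
  rw [e]
  exact h.indicator ((measurableSet_hball _ _).prod MeasurableSet.univ)

lemma measurable_edgeSum (o : HypSpace d) (β R : ℝ) : Measurable (edgeSum o β R) := by
  have h2 := measurable_lintegral_pointKernel (E := hypExhaustion d)
    ((measurable_ofReal_edgeLength_rpow o β R).comp measurable_swap) measurable_id
  exact h2

lemma lintegral_pointKernel_indicator {ξ : Conf (HypSpace d)} (h : LocFin (hypExhaustion d) ξ)
    (o : HypSpace d) (R : ℝ) (f : HypSpace d → ℝ≥0∞) :
    ∫⁻ x, (hball 1 o R).indicator f x ∂(pointKernel (hypExhaustion d) ξ) =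
      ∑ x ∈ (locFin_inter_hball h o R).toFinset, f x := by
  generalize hS : (locFin_inter_hball h o R).toFinset = S
  have hS' : ξ.pts ∩ hball 1 o R = S := by rw [← hS, Set.Finite.coe_toFinset]
  rw [pointKernel_eq h, lintegral_indicator (measurableSet_hball _ _),
    Measure.restrict_restrict (measurableSet_hball _ _), inter_comm, hS', lintegral_finset]
  simp

lemma edgeSum_eq {ξ : Conf (HypSpace d)} (h : LocFin (hypExhaustion d) ξ) (o : HypSpace d)
    (β R : ℝ) : edgeSum o β R ξ = ENNReal.ofReal (edgeFunctional 1 o β R ξ.pts) := by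
  rw [edgeSum, lintegral_pointKernel_indicator h, edgeFunctional,
    finsum_mem_eq_finite_toFinset_sum _ (locFin_inter_hball h o R), ENNReal.ofReal_sum_of_nonneg]
  exact fun x _ => Real.rpow_nonneg (edgeLength_nonneg _ _ _) _

end EdgeSum

section Survival

/-- The probability that a point `x` has no closer point within distance `s`. -/
noncomputable def surv (γ : ℝ) (o x : HypSpace d) (s : ℝ) : ℝ :=
  {s | s ≤ hdist 1 o x}.indicator (fun s => Real.exp (-(γ * (hvol d 1).real (lens o x s)))) s

/-- The joint probability that `x` and `y` have no closer point within distance `s` and `t`,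
for `y` closer to `o` than `x`. -/
noncomputable def surv₂ (γ : ℝ) (o x y : HypSpace d) (s t : ℝ) : ℝ :=
  {p : ℝ × ℝ | p.1 ≤ hdist 1 o x ∧ p.2 ≤ hdist 1 o y ∧ p.1 ≤ hdist 1 x y}.indicator
    (fun p => Real.exp (-(γ * (hvol d 1).real (lens o x p.1 ∪ lens o y p.2)))) (s, t)

variable {γ : ℝ} {Q : Measure (Conf (HypSpace d))}

lemma IsPoissonLaw.measure_voidEvent (hγ : 0 < γ)
    (hQ : IsPoissonLaw (hypExhaustion d) (ENNReal.ofReal γ • hvol d 1) Q) {B : Set (HypSpace d)}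
    (hB : MeasurableSet B) (hfin : hvol d 1 B ≠ ∞) :
    Q (voidEvent B) = ENNReal.ofReal (Real.exp (-(γ * (hvol d 1).real B))) := by
  rw [hQ.void B hB (ENNReal.mul_ne_top ENNReal.ofReal_ne_top hfin), Measure.smul_apply,
    smul_eq_mul, ENNReal.toReal_mul, ENNReal.toReal_ofReal hγ.le, measureReal_def]

lemma IsPoissonLaw.measure_le_edgeLength (hd : 2 ≤ d) (hγ : 0 < γ)
    (hQ : IsPoissonLaw (hypExhaustion d) (ENNReal.ofReal γ • hvol d 1) Q) {o x : HypSpace d}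
    (hx : x ≠ o) (s : ℝ) :
    Q {ξ | s ≤ edgeLength 1 o (Conf.insert x ξ).pts x} = ENNReal.ofReal (surv γ o x s) := by
  have e : {ξ : Conf (HypSpace d) | s ≤ edgeLength 1 o (Conf.insert x ξ).pts x} =
      {_ξ | s ≤ hdist 1 o x} ∩ voidEvent (lens o x s) := by
    ext ξ
    simp only [mem_ofPred_eq, mem_inter_iff, mem_voidEvent, Conf.insert]
    rw [edgeLength_insert_of_le le_rfl, le_edgeLength_iff hx]
  rw [e, surv]
  by_cases hs : s ≤ hdist 1 o x
  · rw [indicator_of_mem (by exact hs), ← hQ.measure_voidEvent hγ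
      (isOpen_lens o x s).measurableSet (hvol_lens_lt_top hd _ _ _).ne]
    simp [hs]
  · rw [indicator_of_notMem (by exact hs)]
    simp [hs]

/-- The closer point `y` is a candidate neighbour of `x`, whence the condition `s ≤ hdist 1 x y`,
whereas `x` has no influence on the edge at `y`. -/
lemma IsPoissonLaw.measure_le_edgeLength₂ (hd : 2 ≤ d) (hγ : 0 < γ)
    (hQ : IsPoissonLaw (hypExhaustion d) (ENNReal.ofReal γ • hvol d 1) Q) {o x y : HypSpace d}
    (hy : y ≠ o) (hlt : hdist 1 o y < hdist 1 o x) (s t : ℝ) :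
    Q {ξ | s ≤ edgeLength 1 o (Conf.insert x (Conf.insert y ξ)).pts x ∧
        t ≤ edgeLength 1 o (Conf.insert x (Conf.insert y ξ)).pts y} =
      ENNReal.ofReal (surv₂ γ o x y s t) := by
  have hx : x ≠ o := by
    rintro rfl
    rw [hdist_self] at hlt
    exact absurd hlt (not_lt.2 (hdist_nonneg _ _))
  have e : {ξ : Conf (HypSpace d) | s ≤ edgeLength 1 o (Conf.insert x (Conf.insert y ξ)).pts x ∧
        t ≤ edgeLength 1 o (Conf.insert x (Conf.insert y ξ)).pts y} =
      {_ξ | s ≤ hdist 1 o x ∧ t ≤ hdist 1 o y ∧ s ≤ hdist 1 x y} ∩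
        voidEvent (lens o x s ∪ lens o y t) := by
    ext ξ
    simp only [mem_ofPred_eq, mem_inter_iff, mem_voidEvent, Conf.insert]
    rw [edgeLength_insert_of_le le_rfl, edgeLength_insert_of_le hlt.le,
      edgeLength_insert_of_le le_rfl, le_edgeLength_iff hx, le_edgeLength_iff hy,
      inter_union_distrib_left, union_empty_iff]
    by_cases hxy : s ≤ hdist 1 x y
    · have : y ∉ lens o x s := fun h => absurd h.1 (not_lt.2 hxy)
      rw [insert_inter_of_notMem this]
      tauto
    · have : y ∈ lens o x s := ⟨not_le.1 hxy, hlt⟩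
      simp only [hxy, and_false, false_and, iff_false, not_and]
      rw [insert_inter_of_mem this]
      exact fun h => absurd h.2 (insert_nonempty _ _).ne_empty
  rw [e, surv₂]
  by_cases hs : s ≤ hdist 1 o x ∧ t ≤ hdist 1 o y ∧ s ≤ hdist 1 x y
  · rw [indicator_of_mem (by exact hs), ← hQ.measure_voidEvent hγ
      ((isOpen_lens o x s).union (isOpen_lens o y t)).measurableSet
      (measure_union_lt_top (hvol_lens_lt_top hd _ _ _) (hvol_lens_lt_top hd _ _ _)).ne]
    simp [hs]
  · rw [indicator_of_notMem (by exact hs)]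
    have : {_ξ : Conf (HypSpace d) | s ≤ hdist 1 o x ∧ t ≤ hdist 1 o y ∧ s ≤ hdist 1 x y} = ∅ :=
      eq_empty_of_forall_notMem fun _ h => hs h
    rw [this]
    simp

lemma measurable_indicator_rpow_le {Y : Type*} [MeasurableSpace Y] {f g : Y → ℝ}
    (hf : Measurable f) (hg : Measurable g) (b : ℝ) :
    Measurable fun y => {u : ℝ | u ^ b ≤ g y}.indicator (1 : ℝ → ℝ≥0∞) (f y) := by
  have h : MeasurableSet {y | f y ^ b ≤ g y} := measurableSet_le (hf.pow_const b) hg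
  exact (measurable_const (a := (1 : ℝ≥0∞))).indicator h

lemma measurable_edgeLength_comp (o x : HypSpace d) {f : Conf (HypSpace d) → Conf (HypSpace d)}
    (hf : Measurable f) : Measurable fun ξ => edgeLength 1 o (f ξ).pts x := by
  have h1 : Measurable fun ξ : Conf (HypSpace d) => (x, f ξ) := measurable_const.prodMk hf
  have h2 := (measurable_edgeLength o).comp h1
  exact h2

/-- The layer cake formula for a power of a single number. -/
lemma lintegral_rpow_le {β : ℝ} (hβ : 0 < β) {l : ℝ} (hl : 0 ≤ l) :
    ∫⁻ u in Ioi (0 : ℝ), {u : ℝ | u ^ β⁻¹ ≤ l}.indicator 1 u = ENNReal.ofReal (l ^ β) := by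
  have h : EqOn ({u : ℝ | u ^ β⁻¹ ≤ l}.indicator (1 : ℝ → ℝ≥0∞)) ((Iic (l ^ β)).indicator 1)
      (Ioi 0) := by
    intro u hu
    have : u ∈ {u : ℝ | u ^ β⁻¹ ≤ l} ↔ u ∈ Iic (l ^ β) :=
      Real.rpow_inv_le_iff_of_pos (le_of_lt hu) hl hβ
    by_cases h1 : u ∈ Iic (l ^ β)
    · rw [indicator_of_mem h1, indicator_of_mem (this.2 h1)]
    · rw [indicator_of_notMem h1, indicator_of_notMem (mt this.1 h1)]
  rw [setLIntegral_congr_fun measurableSet_Ioi h, lintegral_indicator_one measurableSet_Iic,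
    Measure.restrict_apply measurableSet_Iic, inter_comm, Ioi_inter_Iic, Real.volume_Ioc, sub_zero]

lemma IsPoissonLaw.lintegral_edgeLength (hd : 2 ≤ d) (hγ : 0 < γ)
    (hQ : IsPoissonLaw (hypExhaustion d) (ENNReal.ofReal γ • hvol d 1) Q) {o x : HypSpace d}
    (hx : x ≠ o) {β : ℝ} (hβ : 0 < β) :
    ∫⁻ ξ, ENNReal.ofReal (edgeLength 1 o (Conf.insert x ξ).pts x ^ β) ∂Q =
      ∫⁻ u in Ioi (0 : ℝ), ENNReal.ofReal (surv γ o x (u ^ β⁻¹)) := by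
  have := hQ.isProb
  simp_rw [← lintegral_rpow_le hβ (edgeLength_nonneg _ _ _)]
  have hl : Measurable fun ξ : Conf (HypSpace d) => edgeLength 1 o (Conf.insert x ξ).pts x :=
    measurable_edgeLength_comp o x (measurable_insert_left x)
  rw [lintegral_lintegral_swap]
  · refine lintegral_congr fun u => ?_
    have hms : MeasurableSet {ξ : Conf (HypSpace d) |
        u ^ β⁻¹ ≤ edgeLength 1 o (Conf.insert x ξ).pts x} := measurableSet_le measurable_const hl
    rw [← hQ.measure_le_edgeLength hd hγ hx, ← lintegral_indicator_one hms]
    refine lintegral_congr fun ξ => ?_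
    simp only [indicator, mem_ofPred_eq, Pi.one_apply]
  · have h1 : Measurable fun p : Conf (HypSpace d) × ℝ =>
        edgeLength 1 o (Conf.insert x p.1).pts x := hl.comp measurable_fst
    have h2 := measurable_indicator_rpow_le measurable_snd h1 β⁻¹
    exact h2.aemeasurable

lemma IsPoissonLaw.lintegral_edgeLength_mul (hd : 2 ≤ d) (hγ : 0 < γ)
    (hQ : IsPoissonLaw (hypExhaustion d) (ENNReal.ofReal γ • hvol d 1) Q) {o x y : HypSpace d}
    (hy : y ≠ o) (hlt : hdist 1 o y < hdist 1 o x) {β : ℝ} (hβ : 0 < β) :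
    ∫⁻ ξ, ENNReal.ofReal (edgeLength 1 o (Conf.insert x (Conf.insert y ξ)).pts x ^ β) *
        ENNReal.ofReal (edgeLength 1 o (Conf.insert x (Conf.insert y ξ)).pts y ^ β) ∂Q =
      ∫⁻ p : ℝ × ℝ, ENNReal.ofReal (surv₂ γ o x y (p.1 ^ β⁻¹) (p.2 ^ β⁻¹))
        ∂((volume.restrict (Ioi 0)).prod (volume.restrict (Ioi 0))) := by
  have := hQ.isProb
  have hl : ∀ z, Measurable fun ξ : Conf (HypSpace d) =>
      edgeLength 1 o (Conf.insert x (Conf.insert y ξ)).pts z := fun z =>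
    measurable_edgeLength_comp o z ((measurable_insert_left x).comp (measurable_insert_left y))
  set ρ := (volume.restrict (Ioi 0) : Measure ℝ)
  have hS : ∀ l : ℝ, MeasurableSet {u : ℝ | u ^ β⁻¹ ≤ l} := fun l =>
    measurableSet_le (measurable_id.pow_const _) measurable_const
  have e : ∀ l l' : ℝ, 0 ≤ l → 0 ≤ l' → ENNReal.ofReal (l ^ β) * ENNReal.ofReal (l' ^ β) =
      ∫⁻ p : ℝ × ℝ, {u : ℝ | u ^ β⁻¹ ≤ l}.indicator 1 p.1 *
        {u : ℝ | u ^ β⁻¹ ≤ l'}.indicator 1 p.2 ∂(ρ.prod ρ) := by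
    intro l l' h h'
    rw [lintegral_prod_mul (measurable_one.indicator (hS l)).aemeasurable
      (measurable_one.indicator (hS l')).aemeasurable, lintegral_rpow_le hβ h,
      lintegral_rpow_le hβ h']
  simp_rw [e _ _ (edgeLength_nonneg _ _ _) (edgeLength_nonneg _ _ _)]
  rw [lintegral_lintegral_swap]
  · refine lintegral_congr fun p => ?_
    have hms : MeasurableSet {ξ : Conf (HypSpace d) |
        p.1 ^ β⁻¹ ≤ edgeLength 1 o (Conf.insert x (Conf.insert y ξ)).pts x ∧
        p.2 ^ β⁻¹ ≤ edgeLength 1 o (Conf.insert x (Conf.insert y ξ)).pts y} :=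
      (measurableSet_le measurable_const (hl x)).inter (measurableSet_le measurable_const (hl y))
    rw [← hQ.measure_le_edgeLength₂ hd hγ hy hlt, ← lintegral_indicator_one hms]
    refine lintegral_congr fun ξ => ?_
    simp only [indicator, mem_ofPred_eq, Pi.one_apply]
    split_ifs <;> simp_all
  · have h1 : ∀ z, Measurable fun p : Conf (HypSpace d) × ℝ × ℝ =>
        edgeLength 1 o (Conf.insert x (Conf.insert y p.1)).pts z :=
      fun z => (hl z).comp measurable_fst
    have h2 := (measurable_indicator_rpow_le measurable_snd.fst (h1 x) β⁻¹).mul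
      (measurable_indicator_rpow_le measurable_snd.snd (h1 y) β⁻¹)
    exact h2.aemeasurable

end Survival

end HypRST

/-! ### First and second moments of the edge-length functional. -/

namespace HypRST
set_option linter.unusedSectionVars false

section Symmetrisation

variable {X : Type*} [MeasurableSpace X] {ν : Measure X} [SFinite ν]

/-- Ties are null, so each unordered pair is counted twice. Ordering is needed because `surv₂` gives
the joint law only when the second point is closer to the root. -/
lemma lintegral_lintegral_symm {r : X → ℝ} (hr : Measurable r)
    (hν : ∀ c, ν {y | r y = c} = 0) {h : X × X → ℝ≥0∞} (hh : Measurable h)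
    (hsymm : ∀ x y, h (x, y) = h (y, x)) :
    ∫⁻ x, ∫⁻ y, h (x, y) ∂ν ∂ν =
      2 * ∫⁻ x, ∫⁻ y, {y | r y < r x}.indicator (fun y => h (x, y)) y ∂ν ∂ν := by
  have hS : MeasurableSet {p : X × X | r p.2 < r p.1} :=
    measurableSet_lt (hr.comp measurable_snd) (hr.comp measurable_fst)
  set f : X × X → ℝ≥0∞ := {p : X × X | r p.2 < r p.1}.indicator h with hf
  have hfm : Measurable f := hh.indicator hS
  have hfe : ∀ x y, {y | r y < r x}.indicator (fun y => h (x, y)) y = f (x, y) := by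
    intro x y
    simp only [hf, indicator, mem_ofPred_eq]
  have hfsm : Measurable fun p : X × X => f (p.2, p.1) := hfm.comp measurable_swap
  have h1 : ∀ x, ∫⁻ y, h (x, y) ∂ν = ∫⁻ y, f (x, y) ∂ν + ∫⁻ y, f (y, x) ∂ν := by
    intro x
    have hx : Measurable fun y => f (x, y) := hfm.comp measurable_prodMk_left
    rw [← lintegral_add_left hx]
    refine lintegral_congr_ae ?_
    have : ∀ᵐ y ∂ν, r y ≠ r x := by
      rw [ae_iff]
      simpa using hν (r x)
    filter_upwards [this] with y hy
    simp only [hf, indicator, mem_ofPred_eq]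
    rcases lt_or_gt_of_ne hy with h' | h'
    · simp [h', h'.not_gt]
    · simp [h', h'.not_gt, hsymm x y]
  simp_rw [hfe, h1]
  have h2 : Measurable fun x => ∫⁻ y, f (x, y) ∂ν := hfm.lintegral_prod_right'
  rw [lintegral_add_left h2, two_mul]
  congr 1
  exact lintegral_lintegral_swap (f := fun x y => f (y, x)) hfsm.aemeasurable

end Symmetrisation

variable {d : ℕ} {γ : ℝ} {Q : Measure (Conf (HypSpace d))}

variable [SigmaFinite (hvol d 1)]

section Measurability

lemma measurable_hvol_lens (o : HypSpace d) :
    Measurable fun p : HypSpace d × ℝ => (hvol d 1).real (lens o p.1 p.2) := by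
  have h1 : Continuous fun p : (HypSpace d × ℝ) × HypSpace d => hdist (d := d) 1 p.1.1 p.2 :=
    continuous_hdist_comp (by fun_prop) continuous_snd
  have h2 : Continuous fun p : (HypSpace d × ℝ) × HypSpace d => hdist (d := d) 1 o p.2 :=
    continuous_hdist_comp continuous_const continuous_snd
  have h3 : Continuous fun p : (HypSpace d × ℝ) × HypSpace d => hdist (d := d) 1 o p.1.1 :=
    continuous_hdist_comp continuous_const (by fun_prop)
  have hS : MeasurableSet {p : (HypSpace d × ℝ) × HypSpace d | p.2 ∈ lens o p.1.1 p.1.2} :=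
    ((isOpen_lt h1 (by fun_prop)).inter (isOpen_lt h2 h3)).measurableSet
  have h4 := (measurable_measure_prodMk_left (ν := hvol d 1) hS).ennreal_toReal
  exact h4

lemma measurable_hvol_lens_union (o : HypSpace d) :
    Measurable fun p : (HypSpace d × ℝ) × (HypSpace d × ℝ) =>
      (hvol d 1).real (lens o p.1.1 p.1.2 ∪ lens o p.2.1 p.2.2) := by
  have h1 : Continuous fun p : ((HypSpace d × ℝ) × (HypSpace d × ℝ)) × HypSpace d =>
      hdist (d := d) 1 p.1.1.1 p.2 := continuous_hdist_comp (by fun_prop) continuous_snd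
  have h1' : Continuous fun p : ((HypSpace d × ℝ) × (HypSpace d × ℝ)) × HypSpace d =>
      hdist (d := d) 1 p.1.2.1 p.2 := continuous_hdist_comp (by fun_prop) continuous_snd
  have h2 : Continuous fun p : ((HypSpace d × ℝ) × (HypSpace d × ℝ)) × HypSpace d =>
      hdist (d := d) 1 o p.2 := continuous_hdist_comp continuous_const continuous_snd
  have h3 : Continuous fun p : ((HypSpace d × ℝ) × (HypSpace d × ℝ)) × HypSpace d =>
      hdist (d := d) 1 o p.1.1.1 := continuous_hdist_comp continuous_const (by fun_prop)
  have h3' : Continuous fun p : ((HypSpace d × ℝ) × (HypSpace d × ℝ)) × HypSpace d =>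
      hdist (d := d) 1 o p.1.2.1 := continuous_hdist_comp continuous_const (by fun_prop)
  have hS : MeasurableSet {p : ((HypSpace d × ℝ) × (HypSpace d × ℝ)) × HypSpace d |
      p.2 ∈ lens o p.1.1.1 p.1.1.2 ∪ lens o p.1.2.1 p.1.2.2} :=
    (((isOpen_lt h1 (by fun_prop)).inter (isOpen_lt h2 h3)).union
      ((isOpen_lt h1' (by fun_prop)).inter (isOpen_lt h2 h3'))).measurableSet
  have h4 := (measurable_measure_prodMk_left (ν := hvol d 1) hS).ennreal_toReal
  exact h4

lemma measurable_surv (γ : ℝ) (o : HypSpace d) :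
    Measurable fun p : HypSpace d × ℝ => surv γ o p.1 p.2 := by
  have hS : MeasurableSet {p : HypSpace d × ℝ | p.2 ≤ hdist 1 o p.1} :=
    measurableSet_le measurable_snd
      (continuous_hdist_comp continuous_const continuous_fst).measurable
  have h1 : Measurable fun p : HypSpace d × ℝ =>
      Real.exp (-(γ * (hvol d 1).real (lens o p.1 p.2))) :=
    ((measurable_hvol_lens o).const_mul γ).neg.exp
  have h2 := h1.indicator hS
  convert h2 using 2 with p
  simp only [surv, indicator, mem_ofPred_eq]

lemma measurable_surv₂ (γ : ℝ) (o : HypSpace d) :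
    Measurable fun p : (HypSpace d × ℝ) × (HypSpace d × ℝ) =>
      surv₂ γ o p.1.1 p.2.1 p.1.2 p.2.2 := by
  have c1 : Measurable fun p : (HypSpace d × ℝ) × (HypSpace d × ℝ) =>
      hdist (d := d) 1 o p.1.1 :=
    (continuous_hdist_comp continuous_const (by fun_prop)).measurable
  have c2 : Measurable fun p : (HypSpace d × ℝ) × (HypSpace d × ℝ) =>
      hdist (d := d) 1 o p.2.1 :=
    (continuous_hdist_comp continuous_const (by fun_prop)).measurable
  have c3 : Measurable fun p : (HypSpace d × ℝ) × (HypSpace d × ℝ) =>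
      hdist (d := d) 1 p.1.1 p.2.1 :=
    (continuous_hdist_comp (by fun_prop) (by fun_prop)).measurable
  have hS : MeasurableSet {p : (HypSpace d × ℝ) × (HypSpace d × ℝ) |
      p.1.2 ≤ hdist 1 o p.1.1 ∧ p.2.2 ≤ hdist 1 o p.2.1 ∧ p.1.2 ≤ hdist 1 p.1.1 p.2.1} :=
    (measurableSet_le measurable_fst.snd c1).inter
      ((measurableSet_le measurable_snd.snd c2).inter (measurableSet_le measurable_fst.snd c3))
  have h1 : Measurable fun p : (HypSpace d × ℝ) × (HypSpace d × ℝ) =>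
      Real.exp (-(γ * (hvol d 1).real (lens o p.1.1 p.1.2 ∪ lens o p.2.1 p.2.2))) :=
    ((measurable_hvol_lens_union o).const_mul γ).neg.exp
  have h2 := h1.indicator hS
  convert h2 using 2 with p
  simp only [surv₂, indicator, mem_ofPred_eq]

lemma surv_nonneg (γ : ℝ) (o x : HypSpace d) (s : ℝ) : 0 ≤ surv γ o x s :=
  indicator_nonneg (fun _ _ => (Real.exp_pos _).le) _

lemma surv₂_nonneg (γ : ℝ) (o x y : HypSpace d) (s t : ℝ) : 0 ≤ surv₂ γ o x y s t :=
  indicator_nonneg (fun _ _ => (Real.exp_pos _).le) _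

lemma surv_le (hγ : 0 < γ) (o x : HypSpace d) (s : ℝ) :
    surv γ o x s ≤ {s | s ≤ hdist 1 o x}.indicator 1 s := by
  refine indicator_le_indicator ?_
  rw [Pi.one_apply, Real.exp_le_one_iff, neg_nonpos]
  exact mul_nonneg hγ.le measureReal_nonneg

lemma surv₂_le (hγ : 0 < γ) (o x y : HypSpace d) (s t : ℝ) :
    surv₂ γ o x y s t ≤
      {s | s ≤ hdist 1 o x}.indicator 1 s * {s | s ≤ hdist 1 o y}.indicator 1 t := by
  have h : Real.exp (-(γ * (hvol d 1).real (lens o x s ∪ lens o y t))) ≤ 1 := by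
    rw [Real.exp_le_one_iff, neg_nonpos]
    exact mul_nonneg hγ.le measureReal_nonneg
  simp only [surv₂, indicator, mem_ofPred_eq, Pi.one_apply]
  split_ifs <;> simp_all

/-- The expected power `β` of the edge length at `x`, when `x` is added to the process. -/
noncomputable def meanEdge (γ β : ℝ) (o x : HypSpace d) : ℝ≥0∞ :=
  ∫⁻ u in Ioi (0 : ℝ), ENNReal.ofReal (surv γ o x (u ^ β⁻¹))

/-- The expected product of powers of edge lengths at `x` and `y`, when both are added. -/
noncomputable def meanEdge₂ (γ β : ℝ) (o x y : HypSpace d) : ℝ≥0∞ :=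
  ∫⁻ p : ℝ × ℝ, ENNReal.ofReal (surv₂ γ o x y (p.1 ^ β⁻¹) (p.2 ^ β⁻¹))
    ∂((volume.restrict (Ioi 0)).prod (volume.restrict (Ioi 0)))

lemma measurable_surv_rpow (γ β : ℝ) (o : HypSpace d) :
    Measurable fun p : HypSpace d × ℝ => surv γ o p.1 (p.2 ^ β⁻¹) := by
  have h := (measurable_surv γ o).comp
    (measurable_fst.prodMk (measurable_snd.pow_const β⁻¹) :
      Measurable fun p : HypSpace d × ℝ => (p.1, p.2 ^ β⁻¹))
  exact h

lemma measurable_surv₂_rpow (γ β : ℝ) (o : HypSpace d) :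
    Measurable fun p : (HypSpace d × HypSpace d) × (ℝ × ℝ) =>
      surv₂ γ o p.1.1 p.1.2 (p.2.1 ^ β⁻¹) (p.2.2 ^ β⁻¹) := by
  have h := (measurable_surv₂ γ o).comp
    ((measurable_fst.fst.prodMk (measurable_snd.fst.pow_const β⁻¹)).prodMk
      (measurable_fst.snd.prodMk (measurable_snd.snd.pow_const β⁻¹)) :
      Measurable fun p : (HypSpace d × HypSpace d) × (ℝ × ℝ) =>
        ((p.1.1, p.2.1 ^ β⁻¹), (p.1.2, p.2.2 ^ β⁻¹)))
  exact h

lemma measurable_meanEdge (γ β : ℝ) (o : HypSpace d) : Measurable (meanEdge γ β o) := by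
  have h := (measurable_surv_rpow γ β o).ennreal_ofReal.lintegral_prod_right'
    (ν := volume.restrict (Ioi (0 : ℝ)))
  exact h

lemma measurable_meanEdge₂ (γ β : ℝ) (o : HypSpace d) :
    Measurable fun p : HypSpace d × HypSpace d => meanEdge₂ γ β o p.1 p.2 := by
  have h := (measurable_surv₂_rpow γ β o).ennreal_ofReal.lintegral_prod_right'
    (ν := (volume.restrict (Ioi (0 : ℝ))).prod (volume.restrict (Ioi (0 : ℝ))))
  exact h

/-- No edge is longer than the distance to the root. This crude bound only secures finiteness of the
moments for fixed `R`. -/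
lemma meanEdge_le (hγ : 0 < γ) {β : ℝ} (hβ : 0 < β) (o x : HypSpace d) :
    meanEdge γ β o x ≤ ENNReal.ofReal (hdist 1 o x ^ β) := by
  rw [← lintegral_rpow_le hβ (hdist_nonneg o x), meanEdge]
  refine lintegral_mono fun u => ?_
  refine (ENNReal.ofReal_le_ofReal (surv_le hγ o x _)).trans ?_
  simp only [indicator, mem_ofPred_eq, Pi.one_apply]
  split_ifs <;> simp

lemma meanEdge₂_le (hγ : 0 < γ) {β : ℝ} (hβ : 0 < β) (o x y : HypSpace d) :
    meanEdge₂ γ β o x y ≤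
      ENNReal.ofReal (hdist 1 o x ^ β) * ENNReal.ofReal (hdist 1 o y ^ β) := by
  have hS : ∀ l : ℝ, MeasurableSet {u : ℝ | u ^ β⁻¹ ≤ l} := fun l =>
    measurableSet_le (measurable_id.pow_const _) measurable_const
  rw [← lintegral_rpow_le hβ (hdist_nonneg o x), ← lintegral_rpow_le hβ (hdist_nonneg o y),
    ← lintegral_prod_mul (measurable_one.indicator (hS _)).aemeasurable
      (measurable_one.indicator (hS _)).aemeasurable, meanEdge₂]
  refine lintegral_mono fun p => ?_
  refine (ENNReal.ofReal_le_ofReal (surv₂_le hγ o x y _ _)).trans ?_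
  simp only [indicator, mem_ofPred_eq, Pi.one_apply]
  split_ifs <;> simp

end Measurability

section Moments

lemma ae_hvol_ne (o : HypSpace d) (c : ℝ≥0∞) : ∀ᵐ x ∂(c • hvol d 1), x ≠ o := by
  rw [ae_iff]
  simp

lemma IsPoissonLaw.lintegral_edgeSum (hd : 2 ≤ d) (hγ : 0 < γ)
    (hQ : IsPoissonLaw (hypExhaustion d) (ENNReal.ofReal γ • hvol d 1) Q) (o : HypSpace d)
    {β : ℝ} (hβ : 0 < β) (R : ℝ) :
    ∫⁻ ξ, edgeSum o β R ξ ∂Q =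
      ENNReal.ofReal γ * ∫⁻ x in hball 1 o R, meanEdge γ β o x ∂(hvol d 1) := by
  unfold edgeSum
  have h := hQ.mecke (measurable_ofReal_edgeLength_rpow o β R)
  simp only at h
  rw [h, ← smul_eq_mul, ← lintegral_smul_measure, ← Measure.restrict_smul,
    ← lintegral_indicator (measurableSet_hball o R)]
  refine lintegral_congr_ae ?_
  filter_upwards [ae_hvol_ne o (ENNReal.ofReal γ)] with x hx
  by_cases hxR : x ∈ hball 1 o R
  · simp_rw [indicator_of_mem hxR]
    exact hQ.lintegral_edgeLength hd hγ hx hβ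
  · simp [indicator_of_notMem hxR]

/-- The integral over pairs of points in the ball, ordered by their distance to `o`. -/
lemma IsPoissonLaw.lintegral_edgeSum_sq (hd : 2 ≤ d) (hγ : 0 < γ)
    (hQ : IsPoissonLaw (hypExhaustion d) (ENNReal.ofReal γ • hvol d 1) Q) (o : HypSpace d)
    {β : ℝ} (hβ : 0 < β) (R : ℝ) :
    ∫⁻ ξ, edgeSum o β R ξ ^ 2 ∂Q =
      ENNReal.ofReal γ * ∫⁻ x in hball 1 o R, meanEdge γ (2 * β) o x ∂(hvol d 1) +
      2 * ENNReal.ofReal γ ^ 2 * ∫⁻ x in hball 1 o R, ∫⁻ y, {y | hdist 1 o y < hdist 1 o x}.indicator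
        (fun y => meanEdge₂ γ β o x y) y ∂(hvol d 1) ∂(hvol d 1) := by
  have := hQ.isProb
  have hγ' : ENNReal.ofReal γ ≠ ∞ := ENNReal.ofReal_ne_top
  set f : HypSpace d × Conf (HypSpace d) → ℝ≥0∞ := fun p => (hball 1 o R).indicator
      (fun x => ENNReal.ofReal (edgeLength 1 o p.2.pts x ^ β)) p.1 with hf
  have hfm : Measurable f := measurable_ofReal_edgeLength_rpow o β R
  have h1 : Measurable fun p : HypSpace d × HypSpace d × Conf (HypSpace d) =>
      f (p.1, p.2.2) * f (p.2.1, p.2.2) :=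
    (hfm.comp (by fun_prop : Measurable fun p : HypSpace d × HypSpace d × Conf (HypSpace d) =>
      (p.1, p.2.2))).mul (hfm.comp measurable_snd)
  have h2 := hQ.mecke₂ h1
  simp only at h2
  have h3 : ∀ ξ, edgeSum o β R ξ ^ 2 = ∫⁻ x, ∫⁻ y, f (x, ξ) * f (y, ξ)
      ∂(pointKernel (hypExhaustion d) ξ) ∂(pointKernel (hypExhaustion d) ξ) := by
    intro ξ
    have hx : Measurable fun x => f (x, ξ) := hfm.comp measurable_prodMk_right
    simp_rw [lintegral_const_mul _ hx]
    rw [lintegral_mul_const _ hx, sq]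
    rfl
  simp_rw [h3]
  rw [h2]
  congr 1
  -- Diagonal pairs: the two equal factors combine to the exponent `2 * β`.
  · rw [← smul_eq_mul, ← lintegral_smul_measure, ← Measure.restrict_smul,
      ← lintegral_indicator (measurableSet_hball o R)]
    refine lintegral_congr_ae ?_
    filter_upwards [ae_hvol_ne o (ENNReal.ofReal γ)] with x hx
    by_cases hxR : x ∈ hball 1 o R
    · simp only [hf, indicator_of_mem hxR]
      have e := hQ.lintegral_edgeLength hd hγ hx (β := 2 * β) (by positivity)
      rw [meanEdge, ← e]
      refine lintegral_congr fun ξ => ?_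
      rw [← ENNReal.ofReal_mul (Real.rpow_nonneg (edgeLength_nonneg _ _ _) _),
        ← Real.rpow_add' (edgeLength_nonneg _ _ _) (by positivity), two_mul]
    · simp [hf, indicator_of_notMem hxR]
  · set h : HypSpace d × HypSpace d → ℝ≥0∞ := fun p => ∫⁻ ξ,
      f (p.1, Conf.insert p.1 (Conf.insert p.2 ξ)) * f (p.2, Conf.insert p.1 (Conf.insert p.2 ξ)) ∂Q
      with hh
    have hins : Measurable fun q : (HypSpace d × HypSpace d) × Conf (HypSpace d) =>
        Conf.insert q.1.1 (Conf.insert q.1.2 q.2) :=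
      measurable_insert.comp (measurable_fst.fst.prodMk
        (measurable_insert.comp (measurable_fst.snd.prodMk measurable_snd)))
    have hhm : Measurable h := by
      have := ((hfm.comp (measurable_fst.fst.prodMk hins)).mul
        (hfm.comp (measurable_fst.snd.prodMk hins))).lintegral_prod_right' (ν := Q)
      exact this
    have hsymm : ∀ x y, h (x, y) = h (y, x) := by
      intro x y
      simp only [hh]
      refine lintegral_congr fun ξ => ?_
      rw [insert_comm x y, mul_comm]
    have hs := lintegral_lintegral_symm (ν := hvol d 1)
      (continuous_hdist_comp (continuous_const (y := o)) continuous_id).measurable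
      (hvol_sphere hd o) hhm hsymm
    have e1 : ∫⁻ x, ∫⁻ y, h (x, y) ∂(ENNReal.ofReal γ • hvol d 1) ∂(ENNReal.ofReal γ • hvol d 1) =
        ENNReal.ofReal γ ^ 2 * ∫⁻ x, ∫⁻ y, h (x, y) ∂(hvol d 1) ∂(hvol d 1) := by
      simp_rw [lintegral_smul_measure, smul_eq_mul]
      rw [lintegral_const_mul' _ _ hγ', ← mul_assoc, sq]
    change ∫⁻ x, ∫⁻ y, h (x, y) ∂(ENNReal.ofReal γ • hvol d 1) ∂(ENNReal.ofReal γ • hvol d 1) = _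
    rw [e1, hs, ← mul_assoc, mul_comm _ (2 : ℝ≥0∞)]
    congr 1
    rw [← lintegral_indicator (measurableSet_hball o R)]
    refine lintegral_congr fun x => ?_
    by_cases hxR : x ∈ hball 1 o R
    · rw [indicator_of_mem hxR]
      have hae := ae_hvol_ne o 1
      rw [one_smul] at hae
      refine lintegral_congr_ae ?_
      filter_upwards [hae] with y hy
      by_cases hlt : hdist 1 o y < hdist 1 o x
      · have hyR : y ∈ hball 1 o R := hlt.trans hxR
        rw [indicator_of_mem (by exact hlt), indicator_of_mem (by exact hlt)]
        simp only [hh, hf, indicator_of_mem hxR, indicator_of_mem hyR]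
        exact hQ.lintegral_edgeLength_mul hd hγ hy hlt hβ
      · rw [indicator_of_notMem (by exact hlt), indicator_of_notMem (by exact hlt)]
    · rw [indicator_of_notMem hxR]
      simp [hh, hf, indicator_of_notMem hxR]

/-- Writing the squared mean over ordered pairs, in the same shape as the second moment, allows the
variance to be read as an integral of a density in the farther point `x`. -/
lemma IsPoissonLaw.sq_lintegral_edgeSum (hd : 2 ≤ d) (hγ : 0 < γ)
    (hQ : IsPoissonLaw (hypExhaustion d) (ENNReal.ofReal γ • hvol d 1) Q) (o : HypSpace d)
    {β : ℝ} (hβ : 0 < β) (R : ℝ) :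
    (∫⁻ ξ, edgeSum o β R ξ ∂Q) ^ 2 =
      2 * ENNReal.ofReal γ ^ 2 * ∫⁻ x in hball 1 o R, ∫⁻ y, {y | hdist 1 o y < hdist 1 o x}.indicator
        (fun y => meanEdge γ β o x * meanEdge γ β o y) y ∂(hvol d 1) ∂(hvol d 1) := by
  rw [hQ.lintegral_edgeSum hd hγ o hβ R, mul_pow, mul_comm 2, mul_assoc]
  congr 1
  set b : HypSpace d → ℝ≥0∞ := (hball 1 o R).indicator (meanEdge γ β o) with hb
  have hbm : Measurable b := (measurable_meanEdge γ β o).indicator (measurableSet_hball o R)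
  have hm : Measurable fun p : HypSpace d × HypSpace d => b p.1 * b p.2 :=
    (hbm.comp measurable_fst).mul (hbm.comp measurable_snd)
  have hs := lintegral_lintegral_symm (ν := hvol d 1)
    (continuous_hdist_comp (continuous_const (y := o)) continuous_id).measurable
    (hvol_sphere hd o) hm (fun x y => mul_comm _ _)
  simp only at hs
  have e : (∫⁻ x, b x ∂(hvol d 1)) ^ 2 = ∫⁻ x, ∫⁻ y, b x * b y ∂(hvol d 1) ∂(hvol d 1) := by
    simp_rw [lintegral_const_mul _ hbm]
    rw [lintegral_mul_const _ hbm, sq]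
  rw [← lintegral_indicator (measurableSet_hball o R), ← hb, e, hs,
    ← lintegral_indicator (measurableSet_hball o R)]
  congr 1
  refine lintegral_congr fun x => ?_
  by_cases hxR : x ∈ hball 1 o R
  · rw [indicator_of_mem hxR]
    refine lintegral_congr fun y => ?_
    by_cases hlt : hdist 1 o y < hdist 1 o x
    · have hyR : y ∈ hball 1 o R := hlt.trans hxR
      rw [indicator_of_mem (by exact hlt), indicator_of_mem (by exact hlt)]
      simp only [hb, indicator_of_mem hxR, indicator_of_mem hyR]
    · rw [indicator_of_notMem (by exact hlt), indicator_of_notMem (by exact hlt)]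
  · rw [indicator_of_notMem hxR]
    simp [hb, indicator_of_notMem hxR]

end Moments

end HypRST

/-! ### The variance as the integral of a density. -/

namespace HypRST
set_option linter.unusedSectionVars false

variable {d : ℕ} {γ : ℝ} {Q : Measure (Conf (HypSpace d))}

/-- The covariance of the indicators of long edges at `x` and at a closer point `y`. -/
noncomputable def covKernel (γ β : ℝ) (o x : HypSpace d) (p : HypSpace d × ℝ × ℝ) : ℝ :=
  {y | hdist 1 o y < hdist 1 o x}.indicator (fun y =>
    surv₂ γ o x y (p.2.1 ^ β⁻¹) (p.2.2 ^ β⁻¹) -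
      surv γ o x (p.2.1 ^ β⁻¹) * surv γ o y (p.2.2 ^ β⁻¹)) p.1

/-- The Lebesgue measure on the positive quadrant. -/
noncomputable def quadrant : Measure (ℝ × ℝ) :=
  (volume.restrict (Ioi 0)).prod (volume.restrict (Ioi 0))

instance : SFinite quadrant := by unfold quadrant; infer_instance

/-- The density of the expectation of the edge-length functional. -/
noncomputable def meanDensity (γ β : ℝ) (o x : HypSpace d) : ℝ :=
  γ * ∫ u in Ioi (0 : ℝ), surv γ o x (u ^ β⁻¹)

/-- The density of the variance of the edge-length functional. -/
noncomputable def varDensity (γ β : ℝ) (o x : HypSpace d) : ℝ :=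
  meanDensity γ (2 * β) o x +
    2 * γ ^ 2 * ∫ p, covKernel γ β o x p ∂((hvol d 1).prod quadrant)

variable [SigmaFinite (hvol d 1)]

lemma meanEdge_lt_top (hγ : 0 < γ) {β : ℝ} (hβ : 0 < β) (o x : HypSpace d) :
    meanEdge γ β o x < ∞ := (meanEdge_le hγ hβ o x).trans_lt ENNReal.ofReal_lt_top

lemma measurable_surv_left (γ β : ℝ) (o x : HypSpace d) :
    Measurable fun u : ℝ => surv γ o x (u ^ β⁻¹) := by
  have h := (measurable_surv_rpow γ β o).comp (measurable_prodMk_left (x := x))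
  exact h

lemma toReal_meanEdge (γ β : ℝ) (o x : HypSpace d) :
    (meanEdge γ β o x).toReal = ∫ u in Ioi (0 : ℝ), surv γ o x (u ^ β⁻¹) := by
  rw [meanEdge, integral_eq_lintegral_of_nonneg_ae (ae_of_all _ fun u => surv_nonneg _ _ _ _)
    (measurable_surv_left γ β o x).aestronglyMeasurable]

lemma integrable_surv (hγ : 0 < γ) {β : ℝ} (hβ : 0 < β) (o x : HypSpace d) :
    IntegrableOn (fun u : ℝ => surv γ o x (u ^ β⁻¹)) (Ioi 0) := by
  refine ⟨(measurable_surv_left γ β o x).aestronglyMeasurable, ?_⟩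
  rw [hasFiniteIntegral_iff_ofReal (ae_of_all _ fun u => surv_nonneg _ _ _ _)]
  exact meanEdge_lt_top hγ hβ o x

lemma meanDensity_eq (γ β : ℝ) (o x : HypSpace d) :
    meanDensity γ β o x = γ * (meanEdge γ β o x).toReal := by
  rw [toReal_meanEdge, meanDensity]

/-- The integral of `meanEdge₂` over the points closer to the root than `x`. -/
noncomputable def pairMean (γ β : ℝ) (o x : HypSpace d) : ℝ≥0∞ :=
  ∫⁻ y, {y | hdist 1 o y < hdist 1 o x}.indicator (fun y => meanEdge₂ γ β o x y) y ∂(hvol d 1)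

/-- The integral of the product of means over the points closer to the root than `x`. -/
noncomputable def pairProd (γ β : ℝ) (o x : HypSpace d) : ℝ≥0∞ :=
  ∫⁻ y, {y | hdist 1 o y < hdist 1 o x}.indicator
    (fun y => meanEdge γ β o x * meanEdge γ β o y) y ∂(hvol d 1)

lemma measurableSet_closer (o : HypSpace d) :
    MeasurableSet {p : HypSpace d × HypSpace d | hdist 1 o p.2 < hdist 1 o p.1} :=
  measurableSet_lt (continuous_hdist_comp continuous_const continuous_snd).measurable
    (continuous_hdist_comp continuous_const continuous_fst).measurable

lemma measurable_pairMean (γ β : ℝ) (o : HypSpace d) : Measurable (pairMean γ β o) := by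
  have h := ((measurable_meanEdge₂ γ β o).indicator (measurableSet_closer o)).lintegral_prod_right'
    (ν := hvol d 1)
  exact h

lemma measurable_pairProd (γ β : ℝ) (o : HypSpace d) : Measurable (pairProd γ β o) := by
  have hm : Measurable fun p : HypSpace d × HypSpace d => meanEdge γ β o p.1 * meanEdge γ β o p.2 :=
    ((measurable_meanEdge γ β o).comp measurable_fst).mul
      ((measurable_meanEdge γ β o).comp measurable_snd)
  have h := (hm.indicator (measurableSet_closer o)).lintegral_prod_right' (ν := hvol d 1)
  exact h

lemma lintegral_closer_le {o x : HypSpace d} {R β : ℝ} (hβ : 0 < β) (hx : hdist 1 o x ≤ R)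
    {f : HypSpace d → ℝ≥0∞}
    (hf : ∀ y, f y ≤ ENNReal.ofReal (hdist 1 o x ^ β) * ENNReal.ofReal (hdist 1 o y ^ β)) :
    ∫⁻ y, {y | hdist 1 o y < hdist 1 o x}.indicator f y ∂(hvol d 1) ≤
      ENNReal.ofReal (R ^ β) * ENNReal.ofReal (R ^ β) * hvol d 1 (hball 1 o R) := by
  rw [← lintegral_indicator_const (measurableSet_hball o R)]
  refine lintegral_mono fun y => ?_
  by_cases hlt : hdist 1 o y < hdist 1 o x
  · have hyR : y ∈ hball 1 o R := hlt.trans_le hx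
    rw [indicator_of_mem (by exact hlt), indicator_of_mem hyR]
    refine (hf y).trans ?_
    gcongr
    · exact hdist_nonneg _ _
    · exact hdist_nonneg _ _
    · exact (hlt.trans_le hx).le
  · rw [indicator_of_notMem (by exact hlt)]
    exact zero_le

lemma pairMean_le (hγ : 0 < γ) {β : ℝ} (hβ : 0 < β) {o x : HypSpace d} {R : ℝ}
    (hx : hdist 1 o x ≤ R) : pairMean γ β o x ≤
      ENNReal.ofReal (R ^ β) * ENNReal.ofReal (R ^ β) * hvol d 1 (hball 1 o R) :=
  lintegral_closer_le hβ hx fun y => meanEdge₂_le hγ hβ o x y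

lemma pairProd_le (hγ : 0 < γ) {β : ℝ} (hβ : 0 < β) {o x : HypSpace d} {R : ℝ}
    (hx : hdist 1 o x ≤ R) : pairProd γ β o x ≤
      ENNReal.ofReal (R ^ β) * ENNReal.ofReal (R ^ β) * hvol d 1 (hball 1 o R) :=
  lintegral_closer_le hβ hx fun y => mul_le_mul' (meanEdge_le hγ hβ o x) (meanEdge_le hγ hβ o y)

lemma setLIntegral_hball_lt_top (hd : 2 ≤ d) {o : HypSpace d} {R : ℝ} {f : HypSpace d → ℝ≥0∞}
    {c : ℝ≥0∞} (hc : c ≠ ∞) (hf : ∀ x, hdist 1 o x ≤ R → f x ≤ c) :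
    ∫⁻ x in hball 1 o R, f x ∂(hvol d 1) < ∞ := by
  refine (setLIntegral_mono' (g := fun _ => c) (measurableSet_hball o R)
    fun x hx => hf x (le_of_lt hx)).trans_lt ?_
  rw [setLIntegral_const]
  exact ENNReal.mul_lt_top (lt_top_iff_ne_top.2 hc) (hvol_hball_lt_top hd _ _)

lemma setLIntegral_meanEdge_lt_top (hd : 2 ≤ d) (hγ : 0 < γ) {β : ℝ} (hβ : 0 < β) (o : HypSpace d)
    (R : ℝ) : ∫⁻ x in hball 1 o R, meanEdge γ β o x ∂(hvol d 1) < ∞ := by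
  refine setLIntegral_hball_lt_top hd (c := ENNReal.ofReal (R ^ β)) ENNReal.ofReal_ne_top
    fun x hx => (meanEdge_le hγ hβ o x).trans ?_
  gcongr
  exact hdist_nonneg _ _

lemma ne_top_pair (hd : 2 ≤ d) (β : ℝ) (o : HypSpace d) (R : ℝ) :
    ENNReal.ofReal (R ^ β) * ENNReal.ofReal (R ^ β) * hvol d 1 (hball 1 o R) ≠ ∞ :=
  ENNReal.mul_ne_top (ENNReal.mul_ne_top ENNReal.ofReal_ne_top ENNReal.ofReal_ne_top)
    (hvol_hball_lt_top hd _ _).ne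

lemma setLIntegral_pairMean_lt_top (hd : 2 ≤ d) (hγ : 0 < γ) {β : ℝ} (hβ : 0 < β) (o : HypSpace d)
    (R : ℝ) : ∫⁻ x in hball 1 o R, pairMean γ β o x ∂(hvol d 1) < ∞ :=
  setLIntegral_hball_lt_top hd (ne_top_pair hd β o R) fun _ hx => pairMean_le hγ hβ hx

lemma setLIntegral_pairProd_lt_top (hd : 2 ≤ d) (hγ : 0 < γ) {β : ℝ} (hβ : 0 < β) (o : HypSpace d)
    (R : ℝ) : ∫⁻ x in hball 1 o R, pairProd γ β o x ∂(hvol d 1) < ∞ :=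
  setLIntegral_hball_lt_top hd (ne_top_pair hd β o R) fun _ hx => pairProd_le hγ hβ hx

/-- For a fixed root the points `y` range over a bounded ball, so both parts are finite and may be
integrated separately. Uniformity in the root is available only for their difference. -/
lemma integral_covKernel (hd : 2 ≤ d) (hγ : 0 < γ) {β : ℝ} (hβ : 0 < β) (o x : HypSpace d) :
    ∫ p, covKernel γ β o x p ∂((hvol d 1).prod quadrant) =
      (pairMean γ β o x).toReal - (pairProd γ β o x).toReal := by
  set S : Set (HypSpace d) := {y | hdist 1 o y < hdist 1 o x} with hS
  have hSm : MeasurableSet S := measurableSet_hball o _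
  have hSm' : MeasurableSet (S ×ˢ (univ : Set (ℝ × ℝ))) := hSm.prod MeasurableSet.univ
  set f₂ : HypSpace d × ℝ × ℝ → ℝ := fun p => surv₂ γ o x p.1 (p.2.1 ^ β⁻¹) (p.2.2 ^ β⁻¹) with hf₂
  set f₁ : HypSpace d × ℝ × ℝ → ℝ := fun p =>
    surv γ o x (p.2.1 ^ β⁻¹) * surv γ o p.1 (p.2.2 ^ β⁻¹) with hf₁
  have hm₂ : Measurable f₂ := by
    have := (measurable_surv₂_rpow γ β o).comp
      ((measurable_const (a := x)).prodMk measurable_fst |>.prodMk measurable_snd :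
        Measurable fun p : HypSpace d × ℝ × ℝ => ((x, p.1), p.2))
    exact this
  have hma : Measurable fun q : ℝ × ℝ => surv γ o x (q.1 ^ β⁻¹) :=
    (measurable_surv_left γ β o x).comp measurable_fst
  have hm₁ : Measurable f₁ := by
    have h1 := (measurable_surv_left γ β o x).comp
      (measurable_snd.fst : Measurable fun p : HypSpace d × ℝ × ℝ => p.2.1)
    have h2 := (measurable_surv_rpow γ β o).comp
      (measurable_fst.prodMk measurable_snd.snd :
        Measurable fun p : HypSpace d × ℝ × ℝ => (p.1, p.2.2))
    exact h1.mul h2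
  have hn₂ : ∀ p, 0 ≤ f₂ p := fun p => surv₂_nonneg _ _ _ _ _ _
  have hn₁ : ∀ p, 0 ≤ f₁ p := fun p => mul_nonneg (surv_nonneg _ _ _ _) (surv_nonneg _ _ _ _)
  have e₂ : ∫⁻ p, ENNReal.ofReal ((S ×ˢ univ).indicator f₂ p) ∂((hvol d 1).prod quadrant) =
      pairMean γ β o x := by
    rw [lintegral_prod _ (hm₂.indicator hSm').ennreal_ofReal.aemeasurable, pairMean]
    refine lintegral_congr fun y => ?_
    by_cases hy : y ∈ S
    · rw [indicator_of_mem (by exact hy)]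
      simp only [indicator, Set.mem_prod, hy, mem_univ, and_self, if_true, hf₂]
      rfl
    · rw [indicator_of_notMem (by exact hy)]
      simp [indicator, hy]
  have e₁ : ∫⁻ p, ENNReal.ofReal ((S ×ˢ univ).indicator f₁ p) ∂((hvol d 1).prod quadrant) =
      pairProd γ β o x := by
    rw [lintegral_prod _ (hm₁.indicator hSm').ennreal_ofReal.aemeasurable, pairProd]
    refine lintegral_congr fun y => ?_
    by_cases hy : y ∈ S
    · rw [indicator_of_mem (by exact hy)]
      simp only [indicator, Set.mem_prod, hy, mem_univ, and_self, if_true, hf₁]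
      simp_rw [ENNReal.ofReal_mul (surv_nonneg _ _ _ _)]
      rw [quadrant, lintegral_prod_mul (measurable_surv_left γ β o x).ennreal_ofReal.aemeasurable
        (measurable_surv_left γ β o y).ennreal_ofReal.aemeasurable]
      rfl
    · rw [indicator_of_notMem (by exact hy)]
      simp [indicator, hy]
  have hi : ∀ {f : HypSpace d × ℝ × ℝ → ℝ}, Measurable f → (∀ p, 0 ≤ f p) →
      ∫⁻ p, ENNReal.ofReal ((S ×ˢ univ).indicator f p) ∂((hvol d 1).prod quadrant) < ∞ →
      Integrable ((S ×ˢ univ).indicator f) ((hvol d 1).prod quadrant) := by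
    intro f hf hn hlt
    refine ⟨(hf.indicator hSm').aestronglyMeasurable, ?_⟩
    rwa [hasFiniteIntegral_iff_ofReal (ae_of_all _ fun p => indicator_nonneg (fun p _ => hn p) p)]
  have hi₂ := hi hm₂ hn₂ (by
    rw [e₂]; exact (pairMean_le hγ hβ le_rfl).trans_lt (lt_top_iff_ne_top.2 (ne_top_pair hd _ _ _)))
  have hi₁ := hi hm₁ hn₁ (by
    rw [e₁]; exact (pairProd_le hγ hβ le_rfl).trans_lt (lt_top_iff_ne_top.2 (ne_top_pair hd _ _ _)))
  have e : ∀ p, covKernel γ β o x p =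
      (S ×ˢ univ).indicator f₂ p - (S ×ˢ univ).indicator f₁ p := by
    intro p
    simp only [covKernel, indicator, Set.mem_prod, mem_univ, and_true, hS, mem_ofPred_eq, hf₁, hf₂]
    split_ifs <;> simp
  simp_rw [e]
  rw [integral_sub hi₂ hi₁, ← e₁, ← e₂,
    integral_eq_lintegral_of_nonneg_ae (ae_of_all _ fun p => indicator_nonneg (fun p _ => hn₁ p) p)
      hi₁.1,
    integral_eq_lintegral_of_nonneg_ae (ae_of_all _ fun p => indicator_nonneg (fun p _ => hn₂ p) p)
      hi₂.1]

section Law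

variable (hQ : IsPoissonLaw (hypExhaustion d) (ENNReal.ofReal γ • hvol d 1) Q)

lemma IsPoissonLaw.lintegral_edgeSum_sq_lt_top (hd : 2 ≤ d) (hγ : 0 < γ)
    (hQ : IsPoissonLaw (hypExhaustion d) (ENNReal.ofReal γ • hvol d 1) Q) (o : HypSpace d)
    {β : ℝ} (hβ : 0 < β) (R : ℝ) : ∫⁻ ξ, edgeSum o β R ξ ^ 2 ∂Q < ∞ := by
  rw [hQ.lintegral_edgeSum_sq hd hγ o hβ R]
  refine ENNReal.add_lt_top.2 ⟨ENNReal.mul_lt_top ENNReal.ofReal_lt_top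
    (setLIntegral_meanEdge_lt_top hd hγ (by positivity) o R), ENNReal.mul_lt_top ?_
    (setLIntegral_pairMean_lt_top hd hγ hβ o R)⟩
  exact ENNReal.mul_lt_top (by simp) (ENNReal.pow_lt_top ENNReal.ofReal_lt_top)

lemma IsPoissonLaw.ae_edgeSum_lt_top (hd : 2 ≤ d) (hγ : 0 < γ)
    (hQ : IsPoissonLaw (hypExhaustion d) (ENNReal.ofReal γ • hvol d 1) Q) (o : HypSpace d)
    {β : ℝ} (hβ : 0 < β) (R : ℝ) : ∀ᵐ ξ ∂Q, edgeSum o β R ξ < ∞ := by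
  have h := MeasureTheory.ae_lt_top ((measurable_edgeSum o β R).pow_const 2)
    (hQ.lintegral_edgeSum_sq_lt_top hd hγ o hβ R).ne
  filter_upwards [h] with ξ hξ
  exact (ENNReal.pow_lt_top_iff.1 hξ).resolve_right two_ne_zero

/-- The edge-length functional is square integrable. -/
theorem IsPoissonLaw.memLp_edgeSum (hd : 2 ≤ d) (hγ : 0 < γ)
    (hQ : IsPoissonLaw (hypExhaustion d) (ENNReal.ofReal γ • hvol d 1) Q) (o : HypSpace d)
    {β : ℝ} (hβ : 0 < β) (R : ℝ) : MemLp (fun ξ => (edgeSum o β R ξ).toReal) 2 Q := by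
  have hm : Measurable fun ξ : Conf (HypSpace d) => (edgeSum o β R ξ).toReal :=
    (measurable_edgeSum o β R).ennreal_toReal
  rw [memLp_two_iff_integrable_sq hm.aestronglyMeasurable]
  refine ⟨(hm.pow_const 2).aestronglyMeasurable, ?_⟩
  rw [hasFiniteIntegral_iff_ofReal (ae_of_all _ fun ξ => sq_nonneg _)]
  refine (lintegral_mono fun ξ => ?_).trans_lt (hQ.lintegral_edgeSum_sq_lt_top hd hγ o hβ R)
  rw [← ENNReal.toReal_pow]
  exact ENNReal.ofReal_toReal_le

/-- The expectation of the edge-length functional. -/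
theorem IsPoissonLaw.integral_edgeSum (hd : 2 ≤ d) (hγ : 0 < γ)
    (hQ : IsPoissonLaw (hypExhaustion d) (ENNReal.ofReal γ • hvol d 1) Q) (o : HypSpace d)
    {β : ℝ} (hβ : 0 < β) (R : ℝ) :
    ∫ ξ, (edgeSum o β R ξ).toReal ∂Q = ∫ x in hball 1 o R, meanDensity γ β o x ∂(hvol d 1) := by
  rw [integral_toReal (measurable_edgeSum o β R).aemeasurable
    (hQ.ae_edgeSum_lt_top hd hγ o hβ R), hQ.lintegral_edgeSum hd hγ o hβ R, ENNReal.toReal_mul,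
    ENNReal.toReal_ofReal hγ.le]
  simp_rw [meanDensity_eq]
  rw [integral_const_mul, integral_toReal (measurable_meanEdge γ β o).aemeasurable
    (ae_of_all _ fun x => meanEdge_lt_top hγ hβ o x)]

lemma varDensity_eq (hd : 2 ≤ d) (hγ : 0 < γ) {β : ℝ} (hβ : 0 < β) (o x : HypSpace d) :
    varDensity γ β o x = γ * (meanEdge γ (2 * β) o x).toReal +
      2 * γ ^ 2 * ((pairMean γ β o x).toReal - (pairProd γ β o x).toReal) := by
  rw [varDensity, meanDensity_eq, integral_covKernel hd hγ hβ]

/-- The variance of the edge-length functional. -/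
theorem IsPoissonLaw.variance_edgeSum (hd : 2 ≤ d) (hγ : 0 < γ)
    (hQ : IsPoissonLaw (hypExhaustion d) (ENNReal.ofReal γ • hvol d 1) Q) (o : HypSpace d)
    {β : ℝ} (hβ : 0 < β) (R : ℝ) :
    variance (fun ξ => (edgeSum o β R ξ).toReal) Q =
      ∫ x in hball 1 o R, varDensity γ β o x ∂(hvol d 1) := by
  have := hQ.isProb
  have h2β : 0 < 2 * β := by positivity
  set ν := (hvol d 1).restrict (hball 1 o R) with hν
  have htop : ∀ {f : HypSpace d → ℝ≥0∞}, Measurable f → ∫⁻ x, f x ∂ν < ∞ →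
      Integrable (fun x => (f x).toReal) ν ∧ ∫ x, (f x).toReal ∂ν = (∫⁻ x, f x ∂ν).toReal :=
    fun hf hlt => ⟨integrable_toReal_of_lintegral_ne_top hf.aemeasurable hlt.ne,
      integral_toReal hf.aemeasurable (MeasureTheory.ae_lt_top hf hlt.ne)⟩
  obtain ⟨iA, eA⟩ := htop (measurable_meanEdge γ (2 * β) o)
    (setLIntegral_meanEdge_lt_top hd hγ h2β o R)
  obtain ⟨iJ, eJ⟩ := htop (measurable_pairMean γ β o) (setLIntegral_pairMean_lt_top hd hγ hβ o R)
  obtain ⟨iP, eP⟩ := htop (measurable_pairProd γ β o) (setLIntegral_pairProd_lt_top hd hγ hβ o R)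
  simp_rw [varDensity_eq hd hγ hβ]
  have iJP : Integrable (fun x => (pairMean γ β o x).toReal - (pairProd γ β o x).toReal) ν :=
    iJ.sub iP
  rw [integral_add (iA.const_mul γ) (iJP.const_mul _), integral_const_mul, integral_const_mul,
    integral_sub iJ iP, eA, eJ, eP, variance_eq_sub (hQ.memLp_edgeSum hd hγ o hβ R)]
  have h1 : ∫ ξ, ((fun ξ => (edgeSum o β R ξ).toReal) ^ 2) ξ ∂Q =
      (∫⁻ ξ, edgeSum o β R ξ ^ 2 ∂Q).toReal := by
    simp_rw [Pi.pow_apply, ← ENNReal.toReal_pow]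
    refine integral_toReal ((measurable_edgeSum o β R).pow_const 2).aemeasurable ?_
    filter_upwards [hQ.ae_edgeSum_lt_top hd hγ o hβ R] with ξ hξ
    exact ENNReal.pow_lt_top hξ
  have h2 : (∫ ξ, (edgeSum o β R ξ).toReal ∂Q) ^ 2 = ((∫⁻ ξ, edgeSum o β R ξ ∂Q) ^ 2).toReal := by
    rw [integral_toReal (measurable_edgeSum o β R).aemeasurable
      (hQ.ae_edgeSum_lt_top hd hγ o hβ R), ENNReal.toReal_pow]
  have h3 := hQ.lintegral_edgeSum_sq hd hγ o hβ R
  have h4 := hQ.sq_lintegral_edgeSum hd hγ o hβ R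
  change _ = _ + 2 * ENNReal.ofReal γ ^ 2 * ∫⁻ x, pairMean γ β o x ∂ν at h3
  change _ = 2 * ENNReal.ofReal γ ^ 2 * ∫⁻ x, pairProd γ β o x ∂ν at h4
  have hc : 2 * ENNReal.ofReal γ ^ 2 ≠ ∞ :=
    ENNReal.mul_ne_top (by simp) (ENNReal.pow_ne_top ENNReal.ofReal_ne_top)
  rw [h1, h2, h3, h4, ENNReal.toReal_add
    (ENNReal.mul_ne_top ENNReal.ofReal_ne_top (setLIntegral_meanEdge_lt_top hd hγ h2β o R).ne)
    (ENNReal.mul_ne_top hc (setLIntegral_pairMean_lt_top hd hγ hβ o R).ne)]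
  simp only [ENNReal.toReal_mul, ENNReal.toReal_pow, ENNReal.toReal_ofReal hγ.le,
    ENNReal.toReal_ofNat]
  ring

end Law

end HypRST

/-! ### Invariance of the densities, and bounds uniform in the root. -/

namespace HypRST
set_option linter.unusedSectionVars false

variable {d : ℕ} {γ : ℝ}

section Invariance

lemma lens_act_preimage (z o x : HypSpace d) (s : ℝ) :
    act z ⁻¹' lens (act z o) (act z x) s = lens o x s := by
  ext y
  simp only [lens, mem_preimage, mem_ofPred_eq, hdist_act]

lemma measurableSet_lens (o x : HypSpace d) (s : ℝ) : MeasurableSet (lens o x s) :=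
  (isOpen_lens o x s).measurableSet

lemma surv_act (hd : 1 ≤ d) (γ : ℝ) (z o x : HypSpace d) (s : ℝ) :
    surv γ (act z o) (act z x) s = surv γ o x s := by
  simp only [surv, hdist_act, measureReal_def]
  simp_rw [← hvol_act_preimage hd z (lens (act z o) (act z x) _), lens_act_preimage]

lemma surv₂_act (hd : 1 ≤ d) (γ : ℝ) (z o x y : HypSpace d) (s t : ℝ) :
    surv₂ γ (act z o) (act z x) (act z y) s t = surv₂ γ o x y s t := by
  simp only [surv₂, hdist_act, measureReal_def]
  simp_rw [← hvol_act_preimage hd z (lens (act z o) (act z x) _ ∪ _), preimage_union,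
    lens_act_preimage]

lemma covKernel_act (hd : 1 ≤ d) (γ β : ℝ) (z o x y : HypSpace d) (q : ℝ × ℝ) :
    covKernel γ β (act z o) (act z x) (act z y, q) = covKernel γ β o x (y, q) := by
  simp only [covKernel, surv₂_act hd, surv_act hd, indicator, mem_ofPred_eq, hdist_act]

/-- The isometry `iact x` moves `x` to the base point, so the density depends only on the position
of the root as seen from `x`. -/
lemma meanDensity_eq_base (hd : 1 ≤ d) (γ β : ℝ) (o x : HypSpace d) :
    meanDensity γ β o x = meanDensity γ β (iact x o) (base d) := by
  have h := surv_act hd γ x (iact x o) (base d)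
  rw [act_iact, act_base] at h
  simp_rw [meanDensity, h]

lemma varDensity_eq_base (hd : 2 ≤ d) (γ β : ℝ) (o x : HypSpace d) :
    varDensity γ β o x = varDensity γ β (iact x o) (base d) := by
  have := sigmaFinite_hvol hd
  have hd1 : 1 ≤ d := by omega
  rw [varDensity, varDensity, ← meanDensity_eq_base hd1]
  congr 2
  have hmp : MeasurePreserving (Prod.map (act x) (id : ℝ × ℝ → ℝ × ℝ))
      ((hvol d 1).prod quadrant) ((hvol d 1).prod quadrant) :=
    (measurePreserving_act hd1 x).prod (MeasurePreserving.id quadrant)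
  have hme : MeasurableEmbedding (Prod.map (act x) (id : ℝ × ℝ → ℝ × ℝ)) :=
    ((actHomeo x).toMeasurableEquiv.prodCongr (MeasurableEquiv.refl _)).measurableEmbedding
  rw [← hmp.integral_comp hme]
  congr 1
  funext p
  have h := covKernel_act hd1 γ β x (iact x o) (base d) p.1 p.2
  rw [act_iact, act_base] at h
  exact h

end Invariance

section Domination

/-- The constant in the lower bound for the volume of a lens. -/
noncomputable def lensConst (d : ℕ) : ℝ := unitBallVol (d - 1) / 4 ^ d

lemma lensConst_pos (hd : 2 ≤ d) : 0 < lensConst d :=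
  div_pos (unitBallVol_pos (by omega)) (by positivity)

lemma le_measureReal_lens (hd : 2 ≤ d) {o x : HypSpace d} {s : ℝ} (hs : 0 ≤ s)
    (hs' : s ≤ hdist 1 o x) : lensConst d * s ^ d ≤ (hvol d 1).real (lens o x s) := by
  rw [measureReal_def, ← ENNReal.ofReal_le_iff_le_toReal (hvol_lens_lt_top hd _ _ _).ne]
  exact le_hvol_lens hd o x hs hs'

lemma surv_le_exp (hd : 2 ≤ d) (hγ : 0 < γ) (o x : HypSpace d) {s : ℝ} (hs : 0 ≤ s) :
    surv γ o x s ≤ Real.exp (-(γ * (lensConst d * s ^ d))) := by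
  rw [surv]
  by_cases h : s ≤ hdist 1 o x
  · rw [indicator_of_mem (by exact h)]
    have := le_measureReal_lens hd hs h
    gcongr
  · rw [indicator_of_notMem (by exact h)]
    positivity

lemma surv_le_one (hd : 2 ≤ d) (hγ : 0 < γ) (o x : HypSpace d) (s : ℝ) : surv γ o x s ≤ 1 := by
  have hσ := sigmaFinite_hvol hd
  refine (surv_le hγ o x s).trans ?_
  simp only [indicator, mem_ofPred_eq, Pi.one_apply]
  split_ifs <;> norm_num

lemma surv₂_le_exp (hd : 2 ≤ d) (hγ : 0 < γ) (o x y : HypSpace d) {s t : ℝ} (hs : 0 ≤ s)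
    (ht : 0 ≤ t) : surv₂ γ o x y s t ≤ Real.exp (-(γ * (lensConst d * max s t ^ d))) := by
  rw [surv₂]
  by_cases h : s ≤ hdist 1 o x ∧ t ≤ hdist 1 o y ∧ s ≤ hdist 1 x y
  · rw [indicator_of_mem (by exact h)]
    have h1 := le_measureReal_lens hd hs h.1
    have h2 := le_measureReal_lens hd ht h.2.1
    have hfin : hvol d 1 (lens o x s ∪ lens o y t) ≠ ∞ :=
      (measure_union_lt_top (hvol_lens_lt_top hd _ _ _) (hvol_lens_lt_top hd _ _ _)).ne
    have h3 : lensConst d * max s t ^ d ≤ (hvol d 1).real (lens o x s ∪ lens o y t) := by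
      rcases le_total s t with hst | hst
      · rw [max_eq_right hst]
        exact h2.trans (measureReal_mono subset_union_right hfin)
      · rw [max_eq_left hst]
        exact h1.trans (measureReal_mono subset_union_left hfin)
    gcongr
  · rw [indicator_of_notMem (by exact h)]
    positivity

/-- If the balls around `x` and `y` are disjoint, the edges at `x` and `y` are independent. -/
lemma surv₂_eq_mul (hd : 2 ≤ d) (γ : ℝ) (o x y : HypSpace d) {s t : ℝ} (ht : 0 ≤ t)
    (hst : s + t < hdist 1 x y) : surv₂ γ o x y s t = surv γ o x s * surv γ o y t := by
  have hdis : Disjoint (lens o x s) (lens o y t) := by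
    rw [Set.disjoint_left]
    intro z hz hz'
    have h1 := hz.1
    have h2 := hz'.1
    have h3 := hdist_triangle x z y
    rw [hdist_comm z y] at h3
    linarith
  have hs' : s ≤ hdist 1 x y := by linarith
  rw [surv₂, surv, surv]
  simp only [indicator, mem_ofPred_eq, hs', and_true]
  by_cases h1 : s ≤ hdist 1 o x
  · by_cases h2 : t ≤ hdist 1 o y
    · simp only [h1, h2, and_self, if_true]
      rw [← Real.exp_add, measureReal_union hdis (measurableSet_lens _ _ _)
        (hvol_lens_lt_top hd _ _ _).ne (hvol_lens_lt_top hd _ _ _).ne]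
      ring_nf
    · simp [h2]
  · simp [h1]

/-- The integrable function dominating the covariance kernel. -/
noncomputable def covBound (d : ℕ) (γ β : ℝ) (x : HypSpace d) (p : HypSpace d × ℝ × ℝ) : ℝ :=
  Real.exp (-(γ * lensConst d / 2 ^ (d + 1) * hdist 1 x p.1 ^ d)) *
    (Real.exp (-(γ * lensConst d / 4) * p.2.1 ^ (d / β)) *
      Real.exp (-(γ * lensConst d / 4) * p.2.2 ^ (d / β)))

lemma rpow_inv_pow {u : ℝ} (hu : 0 ≤ u) (β : ℝ) (d : ℕ) : (u ^ β⁻¹) ^ d = u ^ (d / β) := by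
  rw [← Real.rpow_natCast, ← Real.rpow_mul hu]
  congr 1
  ring

/-- If `s + t < hdist 1 x y` the covariance vanishes. Otherwise `max s t` is at least half the
distance, and the exponent `γ * lensConst d * (max s t) ^ d` is shared out: one half to the
distance, one quarter to each of `s` and `t`. -/
lemma abs_covKernel_le (hd : 2 ≤ d) (hγ : 0 < γ) (β : ℝ) (o x : HypSpace d)
    {p : HypSpace d × ℝ × ℝ} (h1 : 0 < p.2.1) (h2 : 0 < p.2.2) :
    |covKernel γ β o x p| ≤ covBound d γ β x p := by
  have hσ := sigmaFinite_hvol hd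
  obtain ⟨y, u, v⟩ := p
  simp only at h1 h2
  have hb : 0 ≤ covBound d γ β x (y, u, v) := by unfold covBound; positivity
  rw [covKernel]
  by_cases hlt : hdist 1 o y < hdist 1 o x
  swap
  · rw [indicator_of_notMem (by exact hlt), abs_zero]
    exact hb
  rw [indicator_of_mem (by exact hlt)]
  simp only
  have hs : 0 ≤ u ^ β⁻¹ := by positivity
  have ht : 0 ≤ v ^ β⁻¹ := by positivity
  rw [covBound]
  simp only
  rw [← rpow_inv_pow h1.le, ← rpow_inv_pow h2.le]
  generalize u ^ β⁻¹ = s at *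
  generalize v ^ β⁻¹ = t at *
  rcases lt_or_ge (s + t) (hdist 1 x y) with hst | hst
  · rw [surv₂_eq_mul hd γ o x y ht hst, sub_self, abs_zero]
    positivity
  have hc := lensConst_pos hd
  have hb2 : surv₂ γ o x y s t ≤ Real.exp (-(γ * (lensConst d * max s t ^ d))) :=
    surv₂_le_exp hd hγ o x y hs ht
  have hb1 : surv γ o x s * surv γ o y t ≤ Real.exp (-(γ * (lensConst d * max s t ^ d))) := by
    rcases le_total s t with h | h
    · rw [max_eq_right h]
      calc surv γ o x s * surv γ o y t ≤ 1 * surv γ o y t :=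
            mul_le_mul_of_nonneg_right (surv_le_one hd hγ _ _ _) (surv_nonneg _ _ _ _)
        _ ≤ _ := by rw [one_mul]; exact surv_le_exp hd hγ o y ht
    · rw [max_eq_left h]
      calc surv γ o x s * surv γ o y t ≤ surv γ o x s * 1 :=
            mul_le_mul_of_nonneg_left (surv_le_one hd hγ _ _ _) (surv_nonneg _ _ _ _)
        _ ≤ _ := by rw [mul_one]; exact surv_le_exp hd hγ o x hs
  have hn2 := surv₂_nonneg γ o x y s t
  have hn1 := mul_nonneg (surv_nonneg γ o x s) (surv_nonneg γ o y t)
  have h3 : |surv₂ γ o x y s t - surv γ o x s * surv γ o y t| ≤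
      Real.exp (-(γ * (lensConst d * max s t ^ d))) := by
    rw [abs_le]
    constructor <;> linarith
  refine h3.trans ?_
  rw [← Real.exp_add, ← Real.exp_add]
  refine Real.exp_le_exp.2 ?_
  have hD : hdist 1 x y ≤ 2 * max s t := by
    linarith [le_max_left s t, le_max_right s t]
  have h4 : hdist 1 x y ^ d ≤ 2 ^ d * max s t ^ d := by
    rw [← mul_pow]
    exact pow_le_pow_left₀ (hdist_nonneg _ _) hD d
  have h5 : s ^ d ≤ max s t ^ d := pow_le_pow_left₀ hs (le_max_left _ _) d
  have h6 : t ^ d ≤ max s t ^ d := pow_le_pow_left₀ ht (le_max_right _ _) d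
  have h7 : γ * lensConst d / 2 ^ (d + 1) * hdist 1 x y ^ d ≤
      γ * lensConst d / 2 * max s t ^ d := by
    calc γ * lensConst d / 2 ^ (d + 1) * hdist 1 x y ^ d
        ≤ γ * lensConst d / 2 ^ (d + 1) * (2 ^ d * max s t ^ d) := by gcongr
      _ = _ := by rw [pow_succ]; field_simp
  have hk : 0 < γ * lensConst d := mul_pos hγ hc
  nlinarith

lemma integral_exp_rpow_div {b β : ℝ} (hd : 2 ≤ d) (hb : 0 < b) (hβ : 0 < β) :
    ∫ u in Ioi (0 : ℝ), Real.exp (-b * u ^ (d / β)) =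
      b ^ (-(β / d)) * Real.Gamma (β / d + 1) := by
  have hd0 : (0 : ℝ) < d := by exact_mod_cast (by omega : 0 < d)
  rw [integral_exp_neg_mul_rpow (by positivity) hb, one_div_div, neg_div, one_div_div]

lemma integrableOn_exp_rpow_div {b β : ℝ} (hd : 2 ≤ d) (hb : 0 < b) (hβ : 0 < β) :
    IntegrableOn (fun u : ℝ => Real.exp (-b * u ^ (d / β))) (Ioi 0) := by
  have hd0 : (0 : ℝ) < d := by exact_mod_cast (by omega : 0 < d)
  have h := integrableOn_rpow_mul_exp_neg_mul_rpow (s := 0) (p := d / β) (by norm_num)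
    (by positivity) hb
  simpa using h

/-- A volume bound for balls whose exponential factor is absorbed by `exp (g * s ^ d / 2)`. -/
lemma exists_hvol_hball_le_exp (hd : 2 ≤ d) {g₀ : ℝ} (hg₀ : 0 < g₀) :
    ∃ C : ℝ, 0 < C ∧ ∀ g, g₀ ≤ g → ∀ (x : HypSpace d) (s : ℝ), 0 ≤ s →
      hvol d 1 (hball 1 x s) ≤ ENNReal.ofReal (C * s ^ d * Real.exp (g * s ^ d / 2)) := by
  set k : ℝ := ((d - 1 : ℕ) : ℝ) with hk
  have hk0 : 0 ≤ k := Nat.cast_nonneg _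
  -- Beyond `S` the linear exponent is absorbed, `k * s ≤ g₀ * s ^ 2 / 2 ≤ g * s ^ d / 2`, which
  -- needs `d ≥ 2`; below `S` it goes into the constant.
  set S : ℝ := max 1 (2 * k / g₀) with hS
  have hu := unitBallVol_pos (k := d - 1) (by omega)
  refine ⟨2 * unitBallVol (d - 1) * Real.exp (k * S), by positivity, fun g hg x s hs => ?_⟩
  refine (hvol_hball_le hd x hs).trans (ENNReal.ofReal_le_ofReal ?_)
  rw [← hk]
  have h1 : k * s ≤ k * S + g * s ^ d / 2 := by
    have hsd : 0 ≤ s ^ d := by positivity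
    rcases le_total s S with h | h
    · have : k * s ≤ k * S := by gcongr
      nlinarith
    · have h1s : 1 ≤ s := (le_max_left _ _).trans h
      have h2s : 2 * k / g₀ ≤ s := (le_max_right _ _).trans h
      rw [div_le_iff₀ hg₀] at h2s
      have h3 : s * s ≤ s ^ d := by
        rw [← sq]
        exact pow_le_pow_right₀ h1s hd
      have h4 : 0 ≤ k * S := mul_nonneg hk0 (le_trans zero_le_one (le_max_left _ _))
      have h5 : g₀ * s ^ d ≤ g * s ^ d := by gcongr
      have h6 : 2 * k * s ≤ g₀ * (s * s) := by nlinarith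
      have h7 : g₀ * (s * s) ≤ g₀ * s ^ d := by gcongr
      linarith
  calc 2 * unitBallVol (d - 1) * s ^ d * Real.exp (k * s)
      ≤ 2 * unitBallVol (d - 1) * s ^ d * Real.exp (k * S + g * s ^ d / 2) := by gcongr
    _ = _ := by rw [Real.exp_add]; ring

lemma lintegral_exp_neg_Ioi (a : ℝ) (ha : 0 ≤ a) :
    ENNReal.ofReal (Real.exp (-a)) =
      ∫⁻ w in Ioi (0 : ℝ), (Ioi a).indicator (fun w => ENNReal.ofReal (Real.exp (-w))) w := by
  rw [← integral_exp_neg_Ioi a, ofReal_integral_eq_lintegral_ofReal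
    (integrableOn_exp_neg_Ioi a) (ae_of_all _ fun w => (Real.exp_pos _).le),
    ← lintegral_indicator measurableSet_Ioi, ← lintegral_indicator measurableSet_Ioi]
  congr 1
  funext w
  by_cases h : a < w
  · have h0 : 0 < w := ha.trans_lt h
    simp [indicator, h, h0]
  · simp [indicator, h]

/-- The integral of `exp (-g * d(x, y) ^ d)` is of order `1 / g`. -/
lemma exists_lintegral_exp_hdist_le (hd : 2 ≤ d) {g₀ : ℝ} (hg₀ : 0 < g₀) :
    ∃ C : ℝ, 0 < C ∧ ∀ g, g₀ ≤ g → ∀ x : HypSpace d,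
      ∫⁻ y, ENNReal.ofReal (Real.exp (-(g * hdist 1 x y ^ d))) ∂(hvol d 1) ≤
        ENNReal.ofReal (C / g) := by
  have hσ := sigmaFinite_hvol hd
  obtain ⟨C, hC, hvolC⟩ := exists_hvol_hball_le_exp hd hg₀
  -- The factor is `4 * 4`: one `4` from `w ≤ 4 * exp (w / 4)`, the other from integrating the
  -- remaining `exp (-w / 4)`.
  refine ⟨C * 16, by positivity, fun g hg x => ?_⟩
  have hg0 : 0 < g := hg₀.trans_le hg
  have hd0 : d ≠ 0 := by omega
  have hnn : ∀ y, 0 ≤ g * hdist 1 x y ^ d := fun y =>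
    mul_nonneg hg0.le (pow_nonneg (hdist_nonneg _ _) _)
  simp_rw [fun y => lintegral_exp_neg_Ioi _ (hnn y)]
  have hmh : Measurable fun p : HypSpace d × ℝ => g * hdist (d := d) 1 x p.1 ^ d :=
    ((continuous_hdist_comp continuous_const continuous_fst).measurable.pow_const d).const_mul g
  have hS : MeasurableSet {p : HypSpace d × ℝ | g * hdist 1 x p.1 ^ d < p.2} :=
    measurableSet_lt hmh measurable_snd
  rw [lintegral_lintegral_swap]
  swap
  · have hm : Measurable fun p : HypSpace d × ℝ => ENNReal.ofReal (Real.exp (-p.2)) := by fun_prop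
    have h := (hm.indicator hS).aemeasurable (μ := (hvol d 1).prod (volume.restrict (Ioi 0)))
    refine h.congr (ae_of_all _ fun p => ?_)
    simp [indicator, Function.uncurry]
  have hin : ∀ w : ℝ, w ∈ Ioi (0 : ℝ) → ∫⁻ y, (Ioi (g * hdist 1 x y ^ d)).indicator
      (fun w => ENNReal.ofReal (Real.exp (-w))) w ∂(hvol d 1) ≤
      ENNReal.ofReal (C * 4 / g * Real.exp ((-(1 / 4)) * w)) := by
    intro w hw
    have hw : 0 < w := hw
    -- Layer cake: the superlevel sets of the integrand are balls, and this is the radius at level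
    -- `w`.
    set s := (w / g) ^ ((d : ℝ)⁻¹) with hs
    have hs0 : 0 ≤ s := by positivity
    have hsd : s ^ d = w / g := Real.rpow_inv_natCast_pow (by positivity) hd0
    have e : ∀ y, (Ioi (g * hdist 1 x y ^ d)).indicator
        (fun w => ENNReal.ofReal (Real.exp (-w))) w =
        (hball 1 x s).indicator (fun _ => ENNReal.ofReal (Real.exp (-w))) y := by
      intro y
      have : w ∈ Ioi (g * hdist 1 x y ^ d) ↔ y ∈ hball 1 x s := by
        rw [mem_Ioi, hball, mem_ofPred_eq, ← pow_lt_pow_iff_left₀ (hdist_nonneg _ _) hs0 hd0, hsd,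
          lt_div_iff₀ hg0, mul_comm]
      by_cases h : y ∈ hball 1 x s
      · rw [indicator_of_mem h, indicator_of_mem (this.2 h)]
      · rw [indicator_of_notMem h, indicator_of_notMem (mt this.1 h)]
    simp_rw [e]
    rw [lintegral_indicator_const (measurableSet_hball x s)]
    refine (mul_le_mul_right (hvolC g hg x s hs0) _).trans ?_
    rw [← ENNReal.ofReal_mul (Real.exp_pos _).le]
    refine ENNReal.ofReal_le_ofReal ?_
    have h1 : g * s ^ d / 2 = w / 2 := by rw [hsd]; field_simp
    rw [h1, hsd]
    have h2 : w / 4 ≤ Real.exp (w / 4) := by linarith [Real.add_one_le_exp (w / 4)]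
    have h3 : Real.exp (-w) * Real.exp (w / 2) * Real.exp (w / 4) = Real.exp (-(1 / 4) * w) := by
      rw [← Real.exp_add, ← Real.exp_add]; ring_nf
    calc Real.exp (-w) * (C * (w / g) * Real.exp (w / 2))
        = C * 4 / g * (Real.exp (-w) * Real.exp (w / 2) * (w / 4)) := by ring
      _ ≤ C * 4 / g * (Real.exp (-w) * Real.exp (w / 2) * Real.exp (w / 4)) := by gcongr
      _ = _ := by rw [h3]
  refine (setLIntegral_mono' measurableSet_Ioi hin).trans ?_
  rw [← ofReal_integral_eq_lintegral_ofReal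
    ((integrableOn_exp_mul_Ioi (by norm_num : (-(1 / 4) : ℝ) < 0) 0).const_mul _)
    (ae_of_all _ fun w => by positivity), integral_const_mul,
    integral_exp_mul_Ioi (by norm_num : (-(1 / 4) : ℝ) < 0)]
  refine ENNReal.ofReal_le_ofReal (le_of_eq ?_)
  simp
  ring

lemma exists_integral_exp_hdist_le (hd : 2 ≤ d) {g₀ : ℝ} (hg₀ : 0 < g₀) :
    ∃ C : ℝ, 0 < C ∧ ∀ g, g₀ ≤ g → ∀ x : HypSpace d,
      Integrable (fun y => Real.exp (-(g * hdist 1 x y ^ d))) (hvol d 1) ∧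
      ∫ y, Real.exp (-(g * hdist 1 x y ^ d)) ∂(hvol d 1) ≤ C / g := by
  obtain ⟨C, hC, h⟩ := exists_lintegral_exp_hdist_le hd hg₀
  refine ⟨C, hC, fun g hg x => ?_⟩
  have hm : Measurable fun y : HypSpace d => Real.exp (-(g * hdist (d := d) 1 x y ^ d)) :=
    (((continuous_hdist_comp continuous_const continuous_id).measurable.pow_const d).const_mul
      g).neg.exp
  have hnn : ∀ᵐ y ∂(hvol d 1), 0 ≤ Real.exp (-(g * hdist 1 x y ^ d)) :=
    ae_of_all _ fun y => (Real.exp_pos _).le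
  refine ⟨⟨hm.aestronglyMeasurable, ?_⟩, ?_⟩
  · rw [hasFiniteIntegral_iff_ofReal hnn]
    exact (h g hg x).trans_lt ENNReal.ofReal_lt_top
  · rw [integral_eq_lintegral_of_nonneg_ae hnn hm.aestronglyMeasurable]
    have := ENNReal.toReal_mono ENNReal.ofReal_ne_top (h g hg x)
    rwa [ENNReal.toReal_ofReal (div_nonneg hC.le (hg₀.trans_le hg).le)] at this

lemma integrable_covBound (hd : 2 ≤ d) (hγ : 0 < γ) {β : ℝ} (hβ : 0 < β) (x : HypSpace d) :
    Integrable (covBound d γ β x) ((hvol d 1).prod quadrant) := by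
  have hσ := sigmaFinite_hvol hd
  have hc := lensConst_pos hd
  have hk : 0 < γ * lensConst d := mul_pos hγ hc
  obtain ⟨C, -, h⟩ := exists_integral_exp_hdist_le hd
    (show 0 < γ * lensConst d / 2 ^ (d + 1) by positivity)
  have h1 := integrableOn_exp_rpow_div (b := γ * lensConst d / 4) (β := β) hd (by positivity) hβ
  exact (h _ le_rfl x).1.mul_prod (h1.mul_prod h1)

lemma quadrant_ae (hd : 2 ≤ d) :
    ∀ᵐ p ∂((hvol d 1).prod quadrant), 0 < p.2.1 ∧ 0 < p.2.2 := by
  have hσ := sigmaFinite_hvol hd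
  have h1 : ∀ᵐ q ∂quadrant, 0 < q.1 ∧ 0 < q.2 := by
    rw [quadrant, Measure.prod_restrict]
    exact ae_restrict_mem (measurableSet_Ioi.prod measurableSet_Ioi)
  exact Measure.quasiMeasurePreserving_snd.ae h1

lemma measurable_covKernel (hd : 2 ≤ d) (γ β : ℝ) (o x : HypSpace d) :
    Measurable (covKernel γ β o x) := by
  have hσ := sigmaFinite_hvol hd
  have hS : MeasurableSet {p : HypSpace d × ℝ × ℝ | hdist 1 o p.1 < hdist 1 o x} :=
    measurable_fst (measurableSet_hball o (hdist 1 o x))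
  have hm₂ : Measurable fun p : HypSpace d × ℝ × ℝ =>
      surv₂ γ o x p.1 (p.2.1 ^ β⁻¹) (p.2.2 ^ β⁻¹) := by
    have := (measurable_surv₂_rpow γ β o).comp
      ((measurable_const (a := x)).prodMk measurable_fst |>.prodMk measurable_snd :
        Measurable fun p : HypSpace d × ℝ × ℝ => ((x, p.1), p.2))
    exact this
  have hm₁ : Measurable fun p : HypSpace d × ℝ × ℝ =>
      surv γ o x (p.2.1 ^ β⁻¹) * surv γ o p.1 (p.2.2 ^ β⁻¹) := by
    have h1 := (measurable_surv_left γ β o x).comp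
      (measurable_snd.fst : Measurable fun p : HypSpace d × ℝ × ℝ => p.2.1)
    have h2 := (measurable_surv_rpow γ β o).comp
      (measurable_fst.prodMk measurable_snd.snd :
        Measurable fun p : HypSpace d × ℝ × ℝ => (p.1, p.2.2))
    exact h1.mul h2
  have h := (hm₂.sub hm₁).indicator hS
  exact h

lemma abs_meanDensity_le (hd : 2 ≤ d) (hγ : 0 < γ) {β : ℝ} (hβ : 0 < β) (o x : HypSpace d) :
    |meanDensity γ β o x| ≤
      γ * ((γ * lensConst d) ^ (-(β / d)) * Real.Gamma (β / d + 1)) := by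
  have hσ := sigmaFinite_hvol hd
  have hk : 0 < γ * lensConst d := mul_pos hγ (lensConst_pos hd)
  have h0 : 0 ≤ ∫ u in Ioi (0 : ℝ), surv γ o x (u ^ β⁻¹) :=
    integral_nonneg fun u => surv_nonneg _ _ _ _
  rw [meanDensity, abs_of_nonneg (mul_nonneg hγ.le h0), ← integral_exp_rpow_div hd hk hβ]
  refine mul_le_mul_of_nonneg_left ?_ hγ.le
  refine setIntegral_mono_on (integrable_surv hγ hβ o x) (integrableOn_exp_rpow_div hd hk hβ)
    measurableSet_Ioi fun u hu => ?_
  have hu : 0 < u := hu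
  refine (surv_le_exp hd hγ o x (by positivity)).trans (le_of_eq ?_)
  rw [rpow_inv_pow hu.le]
  ring_nf

/-- A uniform bound for the variance density. -/
lemma exists_abs_varDensity_le (hd : 2 ≤ d) {β γ₀ : ℝ} (hβ : 0 < β) (hγ₀ : 0 < γ₀) :
    ∃ C : ℝ, 0 < C ∧ ∀ γ, γ₀ ≤ γ → ∀ o x : HypSpace d,
      |varDensity γ β o x| ≤ C * γ ^ (1 - 2 * β / d) := by
  have hσ := sigmaFinite_hvol hd
  have hc := lensConst_pos hd
  have hd0 : (0 : ℝ) < d := by exact_mod_cast (by omega : 0 < d)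
  obtain ⟨C, hC, h⟩ := exists_integral_exp_hdist_le hd
    (show 0 < γ₀ * lensConst d / 2 ^ (d + 1) by positivity)
  have hG1 : 0 < Real.Gamma (2 * β / d + 1) := Real.Gamma_pos_of_pos (by positivity)
  have hG2 : 0 < Real.Gamma (β / d + 1) := Real.Gamma_pos_of_pos (by positivity)
  refine ⟨lensConst d ^ (-(2 * β / d)) * Real.Gamma (2 * β / d + 1) +
    2 * (C * 2 ^ (d + 1) / lensConst d) *
      ((lensConst d / 4) ^ (-(β / d)) * Real.Gamma (β / d + 1)) ^ 2, by positivity,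
    fun γ hγγ o x => ?_⟩
  have hγ : 0 < γ := hγ₀.trans_le hγγ
  have hk : 0 < γ * lensConst d := mul_pos hγ hc
  -- The position integral is of order `1 / γ` and each length integral of order `γ ^ (-β / d)`;
  -- with the prefactor `γ ^ 2` this gives `γ ^ (1 - 2 * β / d)`.
  have hcov : |∫ p, covKernel γ β o x p ∂((hvol d 1).prod quadrant)| ≤
      C / (γ * lensConst d / 2 ^ (d + 1)) *
        (((γ * lensConst d / 4) ^ (-(β / d)) * Real.Gamma (β / d + 1)) *
        ((γ * lensConst d / 4) ^ (-(β / d)) * Real.Gamma (β / d + 1))) := by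
    rw [← Real.norm_eq_abs]
    refine (norm_integral_le_of_norm_le (integrable_covBound hd hγ hβ x) ?_).trans ?_
    · filter_upwards [quadrant_ae hd] with p hp
      exact abs_covKernel_le hd hγ β o x hp.1 hp.2
    · have e : ∫ p, covBound d γ β x p ∂((hvol d 1).prod quadrant) =
          (∫ y, Real.exp (-(γ * lensConst d / 2 ^ (d + 1) * hdist 1 x y ^ d)) ∂(hvol d 1)) *
          ((∫ u in Ioi (0 : ℝ), Real.exp (-(γ * lensConst d / 4) * u ^ (d / β))) *
            ∫ u in Ioi (0 : ℝ), Real.exp (-(γ * lensConst d / 4) * u ^ (d / β))) := by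
        rw [← integral_prod_mul, ← quadrant, ← integral_prod_mul]
        rfl
      rw [e, integral_exp_rpow_div hd (by positivity) hβ]
      gcongr
      exact (h _ (by gcongr) x).2
  rw [varDensity]
  refine (abs_add_le _ _).trans ?_
  rw [add_mul]
  refine add_le_add ((abs_meanDensity_le hd hγ (by positivity) o x).trans (le_of_eq ?_)) ?_
  · rw [Real.mul_rpow hγ.le hc.le, Real.rpow_sub hγ, Real.rpow_one, Real.rpow_neg hγ.le]
    ring
  · rw [abs_mul, abs_of_pos (by positivity : 0 < 2 * γ ^ 2)]
    refine (mul_le_mul_of_nonneg_left hcov (by positivity)).trans (le_of_eq ?_)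
    rw [show γ * lensConst d / 4 = γ * (lensConst d / 4) by ring,
      Real.mul_rpow hγ.le (by positivity)]
    have e1 : γ ^ (1 - 2 * β / d) = γ * (γ ^ (-(β / d)) * γ ^ (-(β / d))) := by
      rw [← Real.rpow_add hγ, show 1 - 2 * β / d = 1 + (-(β / d) + -(β / d)) by ring,
        Real.rpow_add hγ, Real.rpow_one]
    rw [e1]
    generalize γ ^ (-(β / (d : ℝ))) = A
    generalize (lensConst d / 4) ^ (-(β / (d : ℝ))) = B
    field_simp

end Domination

end HypRST

/-! ### Limits as the root tends to the ideal point at infinity. -/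

namespace HypRST
set_option linter.unusedSectionVars false

variable {d : ℕ} {γ : ℝ}

section Infinity

/-- The Euclidean norm of a point of the upper half-space. -/
noncomputable def hnorm (o : HypSpace d) : ℝ := √(‖o.1.1‖ ^ 2 + o.1.2 ^ 2)

/-- The neighbourhoods of the ideal point at infinity, at the top of the half-space. -/
noncomputable def idealInfty (d : ℕ) : Filter (HypSpace d) := comap hnorm atTop

instance : (idealInfty d).IsCountablyGenerated := by unfold idealInfty; infer_instance

lemma hnorm_nonneg (o : HypSpace d) : 0 ≤ hnorm o := Real.sqrt_nonneg _

lemma hnorm_sq (o : HypSpace d) : hnorm o ^ 2 = ‖o.1.1‖ ^ 2 + o.1.2 ^ 2 :=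
  Real.sq_sqrt (by positivity)

lemma norm_le_hnorm (o : HypSpace d) : ‖o.1.1‖ ≤ hnorm o :=
  Real.le_sqrt_of_sq_le (by nlinarith [sq_nonneg o.1.2])

lemma height_le_hnorm (o : HypSpace d) : o.1.2 ≤ hnorm o :=
  Real.le_sqrt_of_sq_le (by nlinarith [sq_nonneg ‖o.1.1‖])

lemma eventually_le_hnorm (c : ℝ) : ∀ᶠ o in idealInfty d, c ≤ hnorm o :=
  tendsto_comap.eventually_ge_atTop c

lemma chd_eq_div (o x : HypSpace d) :
    chd o x = (‖o.1.1 - x.1.1‖ ^ 2 + o.1.2 ^ 2 + x.1.2 ^ 2) / (2 * o.1.2 * x.1.2) := by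
  have h1 := o.2
  have h2 := x.2
  rw [chd]
  field_simp
  ring

/-- For a far root, `chd o z` is about `|o|² / (2 o_d z_d)`, so `chd o y / chd o z` tends to the
ratio of heights `z_d / y_d`: closer to the root means higher. -/
lemma eventually_mul_chd_lt {l : ℝ} (hl : 0 < l) {y z : HypSpace d} (h : l * y.1.2 < z.1.2) :
    ∀ᶠ o in idealInfty d, l * chd o z < chd o y := by
  have hy := y.2
  have hz := z.2
  set δ := z.1.2 - l * y.1.2 with hδ
  have hδ0 : 0 < δ := sub_pos.2 h
  set K := 2 * ‖z.1.1‖ * (l * y.1.2) + 2 * ‖y.1.1‖ * z.1.2 with hK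
  set L := (‖z.1.1‖ ^ 2 + z.1.2 ^ 2) * (l * y.1.2) with hL
  filter_upwards [eventually_le_hnorm (K / δ + 1), eventually_le_hnorm (L / δ + 1)] with o h1 h2
  have ho := o.2
  rw [chd_eq_div, chd_eq_div, ← mul_div_assoc, div_lt_div_iff₀ (by positivity) (by positivity)]
  have h3 : K + δ ≤ hnorm o * δ := by
    have := mul_le_mul_of_nonneg_right h1 hδ0.le
    rwa [add_mul, div_mul_cancel₀ _ hδ0.ne', one_mul] at this
  have h4 : L + δ ≤ hnorm o * δ := by
    have := mul_le_mul_of_nonneg_right h2 hδ0.le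
    rwa [add_mul, div_mul_cancel₀ _ hδ0.ne', one_mul] at this
  have hM := hnorm_nonneg o
  have e1 : ‖o.1.1 - z.1.1‖ ≤ ‖o.1.1‖ + ‖z.1.1‖ := norm_sub_le _ _
  have e2 : ‖o.1.1‖ - ‖y.1.1‖ ≤ ‖o.1.1 - y.1.1‖ := norm_sub_norm_le _ _
  have e3 := norm_le_hnorm o
  have e4 := hnorm_sq o
  have f1 : ‖o.1.1 - z.1.1‖ ^ 2 ≤ ‖o.1.1‖ ^ 2 + 2 * hnorm o * ‖z.1.1‖ + ‖z.1.1‖ ^ 2 := by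
    nlinarith [norm_nonneg (o.1.1 - z.1.1), norm_nonneg o.1.1, norm_nonneg z.1.1]
  have f2 : ‖o.1.1‖ ^ 2 - 2 * hnorm o * ‖y.1.1‖ ≤ ‖o.1.1 - y.1.1‖ ^ 2 := by
    have g0 : ‖o.1.1‖ * ‖y.1.1‖ ≤ hnorm o * ‖y.1.1‖ := by gcongr
    rcases le_total ‖y.1.1‖ ‖o.1.1‖ with g1 | g1
    · have g2 := pow_le_pow_left₀ (sub_nonneg.2 g1) e2 2
      nlinarith [sq_nonneg ‖y.1.1‖]
    · nlinarith [norm_nonneg o.1.1, sq_nonneg ‖o.1.1 - y.1.1‖]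
  have g : 0 < hnorm o * (hnorm o * δ - K) - L := by
    have : 1 ≤ hnorm o := by
      have : 0 ≤ K / δ := by positivity
      linarith
    nlinarith
  have key : (‖o.1.1 - z.1.1‖ ^ 2 + o.1.2 ^ 2 + z.1.2 ^ 2) * (l * y.1.2) <
      (‖o.1.1 - y.1.1‖ ^ 2 + o.1.2 ^ 2 + y.1.2 ^ 2) * z.1.2 := by
    have k1 := mul_le_mul_of_nonneg_right f1 (mul_pos hl hy).le
    have k2 := mul_le_mul_of_nonneg_right f2 hz.le
    have k3 : 0 < y.1.2 ^ 2 * z.1.2 := by positivity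
    have k4 : hnorm o * (hnorm o * δ - K) - L =
        (‖o.1.1‖ ^ 2 + o.1.2 ^ 2) * (z.1.2 - l * y.1.2) - hnorm o * K - L := by
      rw [← e4, hδ]; ring
    rw [k4, hK, hL] at g
    linarith
  nlinarith

lemma eventually_hdist_lt {y z : HypSpace d} (h : y.1.2 < z.1.2) :
    ∀ᶠ o in idealInfty d, hdist 1 o z < hdist 1 o y := by
  filter_upwards [eventually_mul_chd_lt one_pos (y := y) (z := z) (by rwa [one_mul])] with o ho
  rwa [hdist_lt_hdist_iff, ← one_mul (chd o z)]

/-- The margin `a` costs a factor `exp a`, because `cosh (r + a) ≤ exp a * cosh r`. It makes the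
order of pattern clusters robust under small displacements of their points. -/
lemma eventually_hdist_add_lt {a : ℝ} (ha : 0 ≤ a) {y z : HypSpace d}
    (h : Real.exp a * y.1.2 < z.1.2) :
    ∀ᶠ o in idealInfty d, hdist 1 o z + a < hdist 1 o y := by
  filter_upwards [eventually_mul_chd_lt (Real.exp_pos a) h] with o ho
  have h1 := hdist_nonneg o z
  have h2 : Real.cosh (hdist 1 o z + a) ≤ Real.exp a * Real.cosh (hdist 1 o z) := by
    rw [Real.cosh_add, ← Real.cosh_add_sinh]
    have h3 := (Real.sinh_lt_cosh (hdist 1 o z)).le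
    have h4 := Real.sinh_nonneg_iff.2 ha
    nlinarith
  have h3 : Real.cosh (hdist 1 o z + a) < Real.cosh (hdist 1 o y) := by
    rw [cosh_hdist o z] at h2
    rw [cosh_hdist o y]
    exact h2.trans_lt ho
  rwa [Real.cosh_lt_cosh, abs_of_nonneg (by positivity), abs_of_nonneg (hdist_nonneg _ _)] at h3

lemma eventually_le_hdist (x : HypSpace d) (s : ℝ) : ∀ᶠ o in idealInfty d, s ≤ hdist 1 o x := by
  filter_upwards [eventually_le_hnorm (2 * Real.cosh (s + hdist 1 (base d) x)),
    eventually_le_hnorm 1] with o h1 h2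
  have ho := o.2
  have h3 : hnorm o / 2 ≤ chd (base d) o := by
    rw [chd_base, ← hnorm_sq, div_le_div_iff₀ (by norm_num) (by positivity)]
    nlinarith [height_le_hnorm o]
  have h4 := hdist_triangle (base d) x o
  rw [hdist_comm x o] at h4
  by_contra hc
  push Not at hc
  have h5 : hdist 1 (base d) o < s + hdist 1 (base d) x := by linarith
  have h6 := (hdist_lt_iff (base d) o ((hdist_nonneg _ _).trans h5.le)).1 h5
  linarith

lemma ae_height_ne (c : ℝ) : ∀ᵐ z ∂(hvol d 1), z.1.2 ≠ c := by
  rw [ae_iff]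
  simpa using hvol_height_eq c

lemma eventually_closer_iff {y z : HypSpace d} (h : z.1.2 ≠ y.1.2) :
    ∀ᶠ o in idealInfty d, hdist 1 o z < hdist 1 o y ↔ y.1.2 < z.1.2 := by
  rcases lt_or_gt_of_ne h with h | h
  · filter_upwards [eventually_hdist_lt h] with o ho
    exact iff_of_false ho.not_gt h.not_gt
  · filter_upwards [eventually_hdist_lt h] with o ho
    exact iff_of_true ho h

/-- The limit of the lenses as the root tends to infinity. -/
def lensLim (x : HypSpace d) (s : ℝ) : Set (HypSpace d) := {z | hdist 1 x z < s ∧ x.1.2 < z.1.2}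

lemma measurableSet_lensLim (x : HypSpace d) (s : ℝ) : MeasurableSet (lensLim x s) :=
  (measurableSet_hball x s).inter
    (measurableSet_lt measurable_const (measurable_snd.comp measurable_subtype_coe))

lemma eventually_mem_lens_iff (x : HypSpace d) (s : ℝ) {z : HypSpace d} (h : z.1.2 ≠ x.1.2) :
    ∀ᶠ o in idealInfty d, z ∈ lens o x s ↔ z ∈ lensLim x s := by
  filter_upwards [eventually_closer_iff h] with o ho
  simp only [lens, lensLim, mem_ofPred_eq, ho]

/-- Off the null horosphere through `x` membership in the lens is eventually constant, and all
lenses lie in one ball of finite volume. -/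
lemma tendsto_lens (hd : 2 ≤ d) (x : HypSpace d) (s : ℝ) :
    Tendsto (fun o => (hvol d 1).real (lens o x s)) (idealInfty d)
      (𝓝 ((hvol d 1).real (lensLim x s))) := by
  have hB := (hvol_hball_lt_top hd x s).ne
  refine (ENNReal.tendsto_toReal (ne_top_of_le_ne_top hB
    (measure_mono fun z hz => hz.1))).comp ?_
  refine tendsto_measure_of_ae_tendsto_indicator _ (measurableSet_lensLim x s)
    (fun o => measurableSet_lens o x s) (measurableSet_hball x s) hB
    (Eventually.of_forall fun o => lens_subset_hball o x s) ?_
  filter_upwards [ae_height_ne x.1.2] with z hz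
  exact eventually_mem_lens_iff x s hz

lemma tendsto_lens_union (hd : 2 ≤ d) (x y : HypSpace d) (s t : ℝ) :
    Tendsto (fun o => (hvol d 1).real (lens o x s ∪ lens o y t)) (idealInfty d)
      (𝓝 ((hvol d 1).real (lensLim x s ∪ lensLim y t))) := by
  have hB : hvol d 1 (hball 1 x s ∪ hball 1 y t) ≠ ∞ :=
    (measure_union_lt_top (hvol_hball_lt_top hd _ _) (hvol_hball_lt_top hd _ _)).ne
  refine (ENNReal.tendsto_toReal (ne_top_of_le_ne_top hB
    (measure_mono (union_subset_union (fun z hz => hz.1) fun z hz => hz.1)))).comp ?_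
  refine tendsto_measure_of_ae_tendsto_indicator _
    ((measurableSet_lensLim x s).union (measurableSet_lensLim y t))
    (fun o => (measurableSet_lens o x s).union (measurableSet_lens o y t))
    ((measurableSet_hball x s).union (measurableSet_hball y t)) hB
    (Eventually.of_forall fun o =>
      union_subset_union (lens_subset_hball o x s) (lens_subset_hball o y t)) ?_
  filter_upwards [ae_height_ne x.1.2, ae_height_ne y.1.2] with z hz hz'
  filter_upwards [eventually_mem_lens_iff x s hz, eventually_mem_lens_iff y t hz'] with o h1 h2
  rw [mem_union, mem_union, h1, h2]

/-- The limit of `surv` as the root tends to infinity. -/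
noncomputable def survLim (γ : ℝ) (x : HypSpace d) (s : ℝ) : ℝ :=
  Real.exp (-(γ * (hvol d 1).real (lensLim x s)))

/-- The limit of `surv₂` as the root tends to infinity. -/
noncomputable def survLim₂ (γ : ℝ) (x y : HypSpace d) (s t : ℝ) : ℝ :=
  {s : ℝ | s ≤ hdist 1 x y}.indicator
    (fun s => Real.exp (-(γ * (hvol d 1).real (lensLim x s ∪ lensLim y t)))) s

lemma tendsto_surv (hd : 2 ≤ d) (γ : ℝ) (x : HypSpace d) (s : ℝ) :
    Tendsto (fun o => surv γ o x s) (idealInfty d) (𝓝 (survLim γ x s)) := by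
  have h1 : Tendsto (fun o => Real.exp (-(γ * (hvol d 1).real (lens o x s)))) (idealInfty d)
      (𝓝 (survLim γ x s)) :=
    (Real.continuous_exp.tendsto _).comp ((tendsto_lens hd x s).const_mul γ).neg
  refine h1.congr' ?_
  filter_upwards [eventually_le_hdist x s] with o ho
  rw [surv, indicator_of_mem (by exact ho)]

lemma tendsto_surv₂ (hd : 2 ≤ d) (γ : ℝ) (x y : HypSpace d) (s t : ℝ) :
    Tendsto (fun o => surv₂ γ o x y s t) (idealInfty d) (𝓝 (survLim₂ γ x y s t)) := by
  by_cases hs : s ≤ hdist 1 x y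
  · have h1 : Tendsto (fun o => Real.exp (-(γ * (hvol d 1).real (lens o x s ∪ lens o y t))))
        (idealInfty d) (𝓝 (survLim₂ γ x y s t)) := by
      rw [survLim₂, indicator_of_mem (by exact hs)]
      exact (Real.continuous_exp.tendsto _).comp ((tendsto_lens_union hd x y s t).const_mul γ).neg
    refine h1.congr' ?_
    filter_upwards [eventually_le_hdist x s, eventually_le_hdist y t] with o ho ho'
    rw [surv₂, indicator_of_mem (by exact ⟨ho, ho', hs⟩)]
  · rw [survLim₂, indicator_of_notMem (by exact hs)]
    refine tendsto_const_nhds.congr fun o => ?_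
    rw [surv₂, indicator_of_notMem (by exact fun h => hs h.2.2)]

/-- The limit of the covariance kernel at the base point as the root tends to infinity. -/
noncomputable def covLim (γ β : ℝ) (p : HypSpace d × ℝ × ℝ) : ℝ :=
  {y : HypSpace d | 1 < y.1.2}.indicator (fun y =>
    survLim₂ γ (base d) y (p.2.1 ^ β⁻¹) (p.2.2 ^ β⁻¹) -
      survLim γ (base d) (p.2.1 ^ β⁻¹) * survLim γ y (p.2.2 ^ β⁻¹)) p.1

lemma tendsto_covKernel (hd : 2 ≤ d) (γ β : ℝ) {p : HypSpace d × ℝ × ℝ} (hp : p.1.1.2 ≠ 1) :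
    Tendsto (fun o => covKernel γ β o (base d) p) (idealInfty d) (𝓝 (covLim γ β p)) := by
  have hc := eventually_closer_iff (y := base d) (z := p.1) hp
  by_cases h : 1 < p.1.1.2
  · rw [covLim, indicator_of_mem (by exact h)]
    refine ((tendsto_surv₂ hd γ (base d) p.1 _ _).sub
      ((tendsto_surv hd γ (base d) _).mul (tendsto_surv hd γ p.1 _))).congr' ?_
    filter_upwards [hc] with o ho
    rw [covKernel, indicator_of_mem (by exact ho.2 h)]
  · rw [covLim, indicator_of_notMem (by exact h)]
    refine tendsto_const_nhds.congr' ?_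
    filter_upwards [hc] with o ho
    rw [covKernel, indicator_of_notMem (by exact fun h' => h (ho.1 h'))]

/-- The limit of the mean density. -/
noncomputable def meanLim (d : ℕ) (γ β : ℝ) : ℝ :=
  γ * ∫ u in Ioi (0 : ℝ), survLim γ (base d) (u ^ β⁻¹)

/-- The limit of the variance density. -/
noncomputable def varLim (d : ℕ) (γ β : ℝ) : ℝ :=
  meanLim d γ (2 * β) + 2 * γ ^ 2 * ∫ p, covLim γ β p ∂((hvol d 1).prod quadrant)

lemma tendsto_meanDensity (hd : 2 ≤ d) (hγ : 0 < γ) {β : ℝ} (hβ : 0 < β) :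
    Tendsto (fun o => meanDensity γ β o (base d)) (idealInfty d) (𝓝 (meanLim d γ β)) := by
  have hσ := sigmaFinite_hvol hd
  have hk : 0 < γ * lensConst d := mul_pos hγ (lensConst_pos hd)
  refine Tendsto.const_mul γ ?_
  refine tendsto_integral_filter_of_dominated_convergence
    (fun u => Real.exp (-(γ * lensConst d) * u ^ (d / β)))
    (Eventually.of_forall fun o => (measurable_surv_left γ β o _).aestronglyMeasurable)
    (Eventually.of_forall fun o => ?_) (integrableOn_exp_rpow_div hd hk hβ)
    (ae_of_all _ fun u => tendsto_surv hd γ _ _)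
  filter_upwards [ae_restrict_mem measurableSet_Ioi] with u hu
  have hu : 0 < u := hu
  rw [Real.norm_of_nonneg (surv_nonneg _ _ _ _)]
  refine (surv_le_exp hd hγ o _ (by positivity)).trans (le_of_eq ?_)
  rw [rpow_inv_pow hu.le]
  ring_nf

/-- Dominated convergence applies because `covBound` does not depend on the root. -/
lemma tendsto_varDensity (hd : 2 ≤ d) (hγ : 0 < γ) {β : ℝ} (hβ : 0 < β) :
    Tendsto (fun o => varDensity γ β o (base d)) (idealInfty d) (𝓝 (varLim d γ β)) := by
  have hσ := sigmaFinite_hvol hd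
  refine (tendsto_meanDensity hd hγ (by positivity)).add (Tendsto.const_mul _ ?_)
  refine tendsto_integral_filter_of_dominated_convergence (covBound d γ β (base d))
    (Eventually.of_forall fun o => (measurable_covKernel hd γ β o _).aestronglyMeasurable)
    (Eventually.of_forall fun o => ?_) (integrable_covBound hd hγ hβ _) ?_
  · filter_upwards [quadrant_ae hd] with p hp
    exact abs_covKernel_le hd hγ β o _ hp.1 hp.2
  · have h1 : ∀ᵐ p ∂((hvol d 1).prod quadrant), p.1.1.2 ≠ 1 :=
      Measure.quasiMeasurePreserving_fst.ae (ae_height_ne 1)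
    filter_upwards [h1] with p hp
    exact tendsto_covKernel hd γ β hp

lemma G_nonneg (hd : 2 ≤ d) {s : ℝ} (hs : 0 ≤ s) : 0 ≤ G d s := by
  refine mul_nonneg (unitBallVol_pos (by omega)).le
    (intervalIntegral.integral_nonneg hs fun t ht => Real.rpow_nonneg ?_ _)
  have : Real.cosh t ≤ Real.cosh s := by
    rw [Real.cosh_le_cosh, abs_of_nonneg ht.1, abs_of_nonneg hs]
    exact ht.2
  exact mul_nonneg (by positivity) (sub_nonneg.2 this)

lemma survLim_base (hd : 2 ≤ d) (γ : ℝ) {s : ℝ} (hs : 0 ≤ s) :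
    survLim γ (base d) s = Real.exp (-(γ * G d s)) := by
  have e : lensLim (base d) s = {y | 1 < y.1.2 ∧ hdist 1 (base d) y < s} := by
    ext y
    exact and_comm
  rw [survLim, measureReal_def, e, hvol_horoball_inter_hball hd hs,
    ENNReal.toReal_ofReal (G_nonneg hd hs)]

lemma survLim_base_le (hd : 2 ≤ d) (hγ : 0 < γ) {s : ℝ} (hs : 0 ≤ s) [(idealInfty d).NeBot] :
    survLim γ (base d) s ≤ Real.exp (-(γ * (lensConst d * s ^ d))) :=
  le_of_tendsto (tendsto_surv hd γ (base d) s)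
    (Eventually.of_forall fun o => surv_le_exp hd hγ o _ hs)

lemma measurable_survLim (hd : 2 ≤ d) (γ : ℝ) (x : HypSpace d) : Measurable (survLim γ x) := by
  have h : Monotone fun s => (hvol d 1).real (lensLim x s) := fun s t hst =>
    measureReal_mono (fun z hz => ⟨hz.1.trans_le hst, hz.2⟩)
      (ne_top_of_le_ne_top (hvol_hball_lt_top hd x t).ne (measure_mono fun z hz => hz.1))
  exact (h.measurable.const_mul γ).neg.exp

instance : (idealInfty d).NeBot := by
  refine comap_neBot fun t ht => ?_
  obtain ⟨c, hc⟩ := mem_atTop_sets.1 ht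
  set p : HypSpace d := ⟨(0, max c 1), lt_max_of_lt_right one_pos⟩
  have h : max c 1 ≤ hnorm p := height_le_hnorm p
  exact ⟨p, hc _ ((le_max_left c 1).trans h)⟩

lemma integrableOn_survLim (hd : 2 ≤ d) (hγ : 0 < γ) {β : ℝ} (hβ : 0 < β) :
    IntegrableOn (fun u : ℝ => survLim γ (base d) (u ^ β⁻¹)) (Ioi 0) := by
  have hk : 0 < γ * lensConst d := mul_pos hγ (lensConst_pos hd)
  refine (integrableOn_exp_rpow_div hd hk hβ).mono'
    ((measurable_survLim hd γ _).comp (measurable_id.pow_const _)).aestronglyMeasurable ?_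
  filter_upwards [ae_restrict_mem measurableSet_Ioi] with u hu
  have hu : 0 < u := hu
  rw [survLim, Real.norm_of_nonneg (Real.exp_pos _).le, ← survLim]
  refine (survLim_base_le hd hγ (by positivity)).trans (le_of_eq ?_)
  rw [rpow_inv_pow hu.le]
  ring_nf

end Infinity

/-! ### Averages over large balls. -/

section Averaging

/-- The exceptional points, from which the root does not look far away, lie in the Euclidean cone of
slope `m` about the vertical line through `o`. -/
lemma hnorm_iact_lt_iff (x o : HypSpace d) {m : ℝ} (hm : 0 ≤ m) :
    hnorm (iact x o) < m ↔ ‖o.1.1 - x.1.1‖ ^ 2 + o.1.2 ^ 2 < (m * x.1.2) ^ 2 := by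
  have hx := x.2
  rw [← sq_lt_sq₀ (hnorm_nonneg _) hm, hnorm_sq]
  have e : ‖(iact x o).1.1‖ ^ 2 + (iact x o).1.2 ^ 2 =
      (‖o.1.1 - x.1.1‖ ^ 2 + o.1.2 ^ 2) / x.1.2 ^ 2 := by
    simp only [iact, norm_smul, norm_inv, Real.norm_of_nonneg hx.le]
    field_simp
  rw [e, div_lt_iff₀ (by positivity), mul_pow]

/-- The points of a ball whose direction to the centre is far from vertical
have volume linear in the radius. -/
lemma hvol_cone_inter_hball_le (hd : 2 ≤ d) (o : HypSpace d) {m R : ℝ} (hm : 0 ≤ m) (hR : 0 < R) :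
    hvol d 1 ({x | hnorm (iact x o) < m} ∩ hball 1 o R) ≤
      ENNReal.ofReal (unitBallVol (d - 1) * m ^ (d - 1) * (2 * R)) := by
  have ho := o.2
  have h := hvol_cone hd o.1.1 (a := o.1.2 * Real.exp (-R)) (b := o.1.2 * Real.exp R) (m := m)
    (by positivity) (by gcongr; linarith) hm
  have e : Real.log (o.1.2 * Real.exp R / (o.1.2 * Real.exp (-R))) = 2 * R := by
    rw [mul_div_mul_left _ _ ho.ne', ← Real.exp_sub, Real.log_exp]
    ring
  rw [e] at h
  rw [← h]
  refine measure_mono ?_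
  rintro x ⟨hx1, hx2⟩
  have hx := x.2
  have hx1 := (hnorm_iact_lt_iff x o hm).1 hx1
  have hlog := abs_log_le_hdist_base (iact o x)
  rw [hdist_base_iact] at hlog
  have hlog2 := abs_lt.1 (hlog.trans_lt hx2)
  have e2 : (iact o x).1.2 = o.1.2⁻¹ * x.1.2 := rfl
  rw [e2] at hlog2
  have hpos : 0 < o.1.2⁻¹ * x.1.2 := by positivity
  have l1 := (Real.lt_log_iff_exp_lt hpos).1 hlog2.1
  have l2 := (Real.log_lt_iff_lt_exp hpos).1 hlog2.2
  rw [inv_mul_eq_div, lt_div_iff₀ ho] at l1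
  rw [inv_mul_eq_div, div_lt_iff₀ ho] at l2
  refine ⟨⟨by linarith, by linarith⟩, ?_⟩
  rw [norm_sub_rev]
  refine lt_of_pow_lt_pow_left₀ 2 (by positivity) (lt_of_le_of_lt ?_ hx1)
  nlinarith [sq_nonneg o.1.2]

lemma ballVol_eq_real (o : HypSpace d) (R : ℝ) : ballVol 1 o R = (hvol d 1).real (hball 1 o R) :=
  rfl

lemma le_ballVol (hd : 2 ≤ d) (o : HypSpace d) {R : ℝ} (hR : 0 ≤ R) :
    unitBallVol (d - 1) * (R / 2) ^ d ≤ ballVol 1 o R := by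
  rw [ballVol, ← ENNReal.ofReal_le_iff_le_toReal (hvol_hball_lt_top hd _ _).ne]
  exact le_hvol_hball hd o hR

lemma measurable_hnorm_iact (o : HypSpace d) (m : ℝ) (hm : 0 ≤ m) :
    MeasurableSet {x : HypSpace d | hnorm (iact x o) < m} := by
  simp_rw [hnorm_iact_lt_iff _ o hm]
  refine measurableSet_lt ?_ ?_ <;> fun_prop

/-- The fraction of the volume of a ball taken by the points whose direction to the centre is far
from vertical vanishes. -/
lemma tendsto_cone_div_ballVol (hd : 2 ≤ d) (o : HypSpace d) {m : ℝ} (hm : 0 ≤ m) :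
    Tendsto (fun R => (hvol d 1).real ({x | hnorm (iact x o) < m} ∩ hball 1 o R) / ballVol 1 o R)
      atTop (𝓝 0) := by
  have hu := unitBallVol_pos (k := d - 1) (by omega)
  -- The cone has volume linear in `R`, and already the lower bound of order `R ^ 2` for the ball
  -- suffices; `8` is the quotient of `2R` by `(R / 2) ^ 2`, times `R`.
  have h0 : Tendsto (fun R : ℝ => (8 * m ^ (d - 1)) * R⁻¹) atTop (𝓝 0) := by
    simpa using tendsto_inv_atTop_zero.const_mul (8 * m ^ (d - 1))
  refine squeeze_zero' (Eventually.of_forall fun R =>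
    div_nonneg measureReal_nonneg measureReal_nonneg) ?_ h0
  filter_upwards [eventually_ge_atTop 2] with R hR
  have hR0 : 0 < R := by linarith
  have h1 : (hvol d 1).real ({x | hnorm (iact x o) < m} ∩ hball 1 o R) ≤
      unitBallVol (d - 1) * m ^ (d - 1) * (2 * R) :=
    ENNReal.toReal_le_of_le_ofReal (by positivity) (hvol_cone_inter_hball_le hd o hm hR0)
  have h2 := le_ballVol hd o hR0.le
  have h3 : unitBallVol (d - 1) * (R / 2) ^ 2 ≤ unitBallVol (d - 1) * (R / 2) ^ d := by
    gcongr
    linarith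
  have hV : 0 < ballVol 1 o R := lt_of_lt_of_le (by positivity) h2
  rw [div_le_iff₀ hV]
  calc (hvol d 1).real ({x | hnorm (iact x o) < m} ∩ hball 1 o R)
      ≤ unitBallVol (d - 1) * m ^ (d - 1) * (2 * R) := h1
    _ = 8 * m ^ (d - 1) * R⁻¹ * (unitBallVol (d - 1) * (R / 2) ^ 2) := by field_simp; ring
    _ ≤ 8 * m ^ (d - 1) * R⁻¹ * ballVol 1 o R := by
        gcongr
        exact h3.trans h2

/-- Averages over large balls converge to the limit at the ideal point. -/
theorem tendsto_average (hd : 2 ≤ d) (o : HypSpace d) {f F : HypSpace d → ℝ} {C L : ℝ}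
    (hf : Measurable f) (hfC : ∀ x, |f x| ≤ C) (hfF : ∀ x, f x = F (iact x o))
    (hF : Tendsto F (idealInfty d) (𝓝 L)) :
    Tendsto (fun R => (∫ x in hball 1 o R, f x ∂(hvol d 1)) / ballVol 1 o R) atTop (𝓝 L) := by
  have hσ := sigmaFinite_hvol hd
  have hu := unitBallVol_pos (k := d - 1) (by omega)
  have hC : 0 ≤ C := (abs_nonneg _).trans (hfC o)
  rw [Metric.tendsto_atTop']
  intro ε hε
  have hev : ∀ᶠ p in idealInfty d, |F p - L| < ε / 2 := by
    simpa [Real.dist_eq] using (Metric.tendsto_nhds.1 hF) (ε / 2) (half_pos hε)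
  obtain ⟨m₀, hm₀⟩ := (eventually_atTop.1 (eventually_comap.1 hev))
  set m := max m₀ 0 with hm
  have hm' : ∀ p : HypSpace d, m ≤ hnorm p → |F p - L| < ε / 2 := fun p hp =>
    hm₀ _ ((le_max_left _ _).trans hp) p rfl
  have hcone := tendsto_cone_div_ballVol hd o (le_max_right m₀ 0)
  rw [← hm] at hcone
  set E : Set (HypSpace d) := {x | hnorm (iact x o) < m} with hE
  have hEm : MeasurableSet E := measurable_hnorm_iact o m (le_max_right _ _)
  have hev2 := (hcone.const_mul (C + |L|)).eventually (gt_mem_nhds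
    (show (C + |L|) * 0 < ε / 2 by rw [mul_zero]; exact half_pos hε))
  obtain ⟨R₀, hR₀⟩ := eventually_atTop.1 hev2
  refine ⟨max R₀ 1, fun R hR => ?_⟩
  have hR1 : 0 < R := lt_trans one_pos ((le_max_right _ _).trans_lt hR)
  have hlt := hR₀ R ((le_max_left _ _).trans hR.le)
  have hV : 0 < ballVol 1 o R := lt_of_lt_of_le (by positivity) (le_ballVol hd o hR1.le)
  have hfin : hvol d 1 (hball 1 o R) ≠ ∞ := (hvol_hball_lt_top hd o R).ne
  have hfi : IntegrableOn f (hball 1 o R) (hvol d 1) :=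
    Measure.integrableOn_of_bounded hfin hf.aestronglyMeasurable (M := C)
      (ae_of_all _ fun x => hfC x)
  have e1 : (∫ x in hball 1 o R, f x ∂(hvol d 1)) / ballVol 1 o R - L =
      (∫ x in hball 1 o R, (f x - L) ∂(hvol d 1)) / ballVol 1 o R := by
    rw [integral_sub hfi (integrableOn_const hfin), setIntegral_const, smul_eq_mul,
      ← ballVol_eq_real]
    field_simp
  rw [Real.dist_eq, e1, abs_div, abs_of_pos hV, div_lt_iff₀ hV]
  -- Off the cone the density is close to its limit; on the cone only the uniform bound is used.
  have hb : ∀ x, ‖f x - L‖ ≤ ε / 2 + E.indicator (fun _ => C + |L|) x := by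
    intro x
    rw [Real.norm_eq_abs]
    by_cases hx : x ∈ E
    · rw [indicator_of_mem hx]
      have := abs_sub (f x) L
      have := hfC x
      linarith
    · rw [indicator_of_notMem hx, add_zero, hfF]
      exact (hm' _ (not_lt.1 hx)).le
  have hg1 : Integrable (fun _ : HypSpace d => ε / 2) ((hvol d 1).restrict (hball 1 o R)) :=
    integrableOn_const hfin
  have hg2 : Integrable (E.indicator fun _ : HypSpace d => C + |L|)
      ((hvol d 1).restrict (hball 1 o R)) :=
    Integrable.indicator (integrableOn_const hfin) hEm
  have hgi : Integrable (fun x => ε / 2 + E.indicator (fun _ => C + |L|) x)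
      ((hvol d 1).restrict (hball 1 o R)) := hg1.add hg2
  rw [← Real.norm_eq_abs]
  refine (norm_integral_le_of_norm_le hgi (ae_of_all _ hb)).trans_lt ?_
  rw [integral_add hg1 hg2,
    setIntegral_const, smul_eq_mul, ← ballVol_eq_real, integral_indicator hEm,
    Measure.restrict_restrict hEm, setIntegral_const, smul_eq_mul]
  rw [mul_div_assoc', div_lt_iff₀ hV] at hlt
  linarith

end Averaging

section Asymptotics

variable {Q : Measure (Conf (HypSpace d))}

lemma measurable_meanDensity (hd : 2 ≤ d) (γ β : ℝ) (o : HypSpace d) :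
    Measurable (meanDensity γ β o) := by
  have hσ := sigmaFinite_hvol hd
  have h := (measurable_meanEdge γ β o).ennreal_toReal.const_mul γ
  convert h using 1
  funext x
  exact meanDensity_eq γ β o x

lemma measurable_varDensity (hd : 2 ≤ d) (hγ : 0 < γ) {β : ℝ} (hβ : 0 < β) (o : HypSpace d) :
    Measurable (varDensity γ β o) := by
  have hσ := sigmaFinite_hvol hd
  have h := ((measurable_meanEdge γ (2 * β) o).ennreal_toReal.const_mul γ).add
    (((measurable_pairMean γ β o).ennreal_toReal.sub
      (measurable_pairProd γ β o).ennreal_toReal).const_mul (2 * γ ^ 2))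
  convert h using 1
  funext x
  exact varDensity_eq hd hγ hβ o x

theorem IsPoissonLaw.tendsto_mean (hd : 2 ≤ d) (hγ : 0 < γ)
    (hQ : IsPoissonLaw (hypExhaustion d) (ENNReal.ofReal γ • hvol d 1) Q) (o : HypSpace d)
    {β : ℝ} (hβ : 0 < β) :
    Tendsto (fun R => (∫ ξ, (edgeSum o β R ξ).toReal ∂Q) / ballVol 1 o R) atTop
      (𝓝 (meanLim d γ β)) := by
  have hσ := sigmaFinite_hvol hd
  simp_rw [hQ.integral_edgeSum hd hγ o hβ]
  exact tendsto_average hd o (measurable_meanDensity hd γ β o) (abs_meanDensity_le hd hγ hβ o)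
    (meanDensity_eq_base (by omega) γ β o) (tendsto_meanDensity hd hγ hβ)

theorem IsPoissonLaw.tendsto_variance (hd : 2 ≤ d) (hγ : 0 < γ)
    (hQ : IsPoissonLaw (hypExhaustion d) (ENNReal.ofReal γ • hvol d 1) Q) (o : HypSpace d)
    {β : ℝ} (hβ : 0 < β) :
    Tendsto (fun R => variance (fun ξ => (edgeSum o β R ξ).toReal) Q / ballVol 1 o R) atTop
      (𝓝 (varLim d γ β)) := by
  have hσ := sigmaFinite_hvol hd
  simp_rw [hQ.variance_edgeSum hd hγ o hβ]
  obtain ⟨C, -, hC⟩ := exists_abs_varDensity_le hd hβ hγ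
  exact tendsto_average hd o (measurable_varDensity hd hγ hβ o) (hC γ le_rfl o)
    (varDensity_eq_base hd γ β o) (tendsto_varDensity hd hγ hβ)

/-- The limit of the variance density is at most of order `γ ^ (1 - 2 * β / d)`. -/
theorem exists_varLim_le (hd : 2 ≤ d) {β γ₀ : ℝ} (hβ : 0 < β) (hγ₀ : 0 < γ₀) :
    ∃ C : ℝ, 0 < C ∧ ∀ γ, γ₀ ≤ γ → varLim d γ β ≤ C * γ ^ (1 - 2 * β / d) := by
  obtain ⟨C, hC, h⟩ := exists_abs_varDensity_le hd hβ hγ₀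
  exact ⟨C, hC, fun γ hγ => le_of_tendsto (tendsto_varDensity hd (hγ₀.trans_le hγ) hβ)
    (Eventually.of_forall fun o => (le_abs_self _).trans (h γ hγ o _))⟩

end Asymptotics

end HypRST

/-! ### Lower bound for the limiting variance by a local event. -/

namespace HypRST
set_option linter.unusedSectionVars false

variable {d : ℕ} {γ : ℝ} {Q : Measure (Conf (HypSpace d))}

section VolumeRatio

/-- Enlarging the radius of a large ball by one multiplies its volume at most by a constant. -/
lemma exists_mul_ballVol_le (hd : 2 ≤ d) :
    ∃ κ : ℝ, 0 < κ ∧ ∀ (o : HypSpace d) (R : ℝ), 2 ≤ R →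
      κ * ballVol 1 o R ≤ ballVol 1 o (R - 1) := by
  have hσ := sigmaFinite_hvol hd
  have hu := unitBallVol_pos (k := d - 1) (by omega)
  set v : ℝ := unitBallVol (d - 1) * (1 / 2 / 2) ^ d with hv
  set V : ℝ := 2 * unitBallVol (d - 1) * 2 ^ d * Real.exp ((d - 1 : ℕ) * 2) with hV
  have hv0 : 0 < v := by positivity
  have hV0 : 0 < V := by positivity
  refine ⟨v / V, by positivity, fun o R hR => ?_⟩
  have hS : MeasurableSet {p : HypSpace d × HypSpace d |
      hdist 1 o p.1 < R ∧ hdist 1 o p.2 < R - 1 ∧ hdist 1 p.1 p.2 < 2} :=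
    (measurableSet_lt (continuous_hdist_comp continuous_const continuous_fst).measurable
      measurable_const).inter ((measurableSet_lt
        (continuous_hdist_comp continuous_const continuous_snd).measurable measurable_const).inter
        (measurableSet_lt (continuous_hdist_comp continuous_fst continuous_snd).measurable
          measurable_const))
  set S := {p : HypSpace d × HypSpace d |
      hdist 1 o p.1 < R ∧ hdist 1 o p.2 < R - 1 ∧ hdist 1 p.1 p.2 < 2} with hSdef
  -- Double counting of pairs at distance below `2`: each `y` in the large ball has a ball of radius
  -- `1 / 2` near it inside the smaller one, centred at `o` or at the point `3 / 2` further towards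
  -- `o`, while each `w` sees only volume `V`.
  have h1 : ENNReal.ofReal v * hvol d 1 (hball 1 o R) ≤ ((hvol d 1).prod (hvol d 1)) S := by
    rw [Measure.prod_apply hS, ← lintegral_indicator_const (measurableSet_hball o R)]
    refine lintegral_mono fun y => ?_
    by_cases hy : y ∈ hball 1 o R
    · rw [indicator_of_mem hy]
      have hy' : hdist 1 o y < R := hy
      rcases lt_or_ge (hdist 1 o y) (3 / 2) with hlt | hge
      · refine (le_hvol_hball hd o (s := 1 / 2) (by norm_num)).trans (measure_mono fun w hw => ?_)
        have hw' : hdist 1 o w < 1 / 2 := hw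
        have h3 := hdist_triangle y o w
        rw [hdist_comm y o] at h3
        exact ⟨hy', by linarith, by linarith⟩
      · obtain ⟨m, hm1, hm2⟩ := exists_between y o (t := 3 / 2) (by norm_num)
          (by rwa [hdist_comm])
        refine (le_hvol_hball hd m (s := 1 / 2) (by norm_num)).trans (measure_mono fun w hw => ?_)
        have hw' : hdist 1 m w < 1 / 2 := hw
        have h3 := hdist_triangle y m w
        have h4 := hdist_triangle o m w
        rw [hdist_comm o m, hm2, hdist_comm y o] at h4
        exact ⟨hy', by linarith, by linarith⟩
    · rw [indicator_of_notMem hy]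
      exact zero_le
  have h2 : ((hvol d 1).prod (hvol d 1)) S ≤ ENNReal.ofReal V * hvol d 1 (hball 1 o (R - 1)) := by
    rw [Measure.prod_apply_symm hS, ← lintegral_indicator_const (measurableSet_hball o (R - 1))]
    refine lintegral_mono fun w => ?_
    by_cases hw : w ∈ hball 1 o (R - 1)
    · rw [indicator_of_mem hw]
      refine (measure_mono fun y hy => ?_).trans (hvol_hball_le hd w (s := 2) (by norm_num))
      have := hy.2.2
      rwa [hdist_comm] at this
    · rw [indicator_of_notMem hw, nonpos_iff_eq_zero]
      refine measure_mono_null (t := ∅) (fun y hy => hw hy.2.1) measure_empty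
  have h3 := ENNReal.toReal_mono (ENNReal.mul_ne_top ENNReal.ofReal_ne_top
    (hvol_hball_lt_top hd o (R - 1)).ne) (h1.trans h2)
  rw [ENNReal.toReal_mul, ENNReal.toReal_mul, ENNReal.toReal_ofReal hv0.le,
    ENNReal.toReal_ofReal hV0.le] at h3
  rw [div_mul_eq_mul_div, div_le_iff₀ hV0, mul_comm _ V]
  exact h3

end VolumeRatio

section LowerBound

/-- A lower bound for the asymptotic variance by the mean of the add-one cost on a local event. -/
lemma IsPoissonLaw.exists_sq_mul_le_varLim (hd : 2 ≤ d) :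
    ∃ κ : ℝ, 0 < κ ∧ ∀ (γ : ℝ) (_ : 0 < γ) (Q : Measure (Conf (HypSpace d)))
      (_ : IsPoissonLaw (hypExhaustion d) (ENNReal.ofReal γ • hvol d 1) Q) (β : ℝ) (_ : 0 < β)
      (D : Set (HypSpace d × Conf (HypSpace d))) (_ : MeasurableSet D)
      (_ : ∀ x ξ, (x, Conf.insert x ξ) ∈ D ↔ (x, ξ) ∈ D) (r u₀ : ℝ) (_ : 0 ≤ u₀)
      (_ : ∀ x : HypSpace d, γ * (hvol d 1).real (hball 1 x r) ≤ u₀)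
      (_ : ∀ x y ξ, r ≤ hdist 1 x y → ((y, Conf.insert x ξ) ∈ D ↔ (y, ξ) ∈ D))
      (σ δ : ℝ) (_ : σ ^ 2 = 1) (_ : 0 ≤ δ)
      (_ : ∀ᶠ p in idealInfty d, ∀ (o x : HypSpace d) (R : ℝ), iact x o = p →
        hdist 1 o x < R - 1 →
        Integrable (fun ξ => D.indicator (fun q =>
          σ * (edgeSum o β R (Conf.insert q.1 q.2)).toReal - σ * (edgeSum o β R q.2).toReal)
            (x, ξ)) Q →
        δ ≤ ∫ ξ, D.indicator (fun q =>
          σ * (edgeSum o β R (Conf.insert q.1 q.2)).toReal - σ * (edgeSum o β R q.2).toReal)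
            (x, ξ) ∂Q),
      δ ^ 2 * (γ * κ) ≤ varLim d γ β * (1 + 2 * u₀) := by
  obtain ⟨κ, hκ, hκV⟩ := exists_mul_ballVol_le hd
  refine ⟨κ, hκ, ?_⟩
  intro γ hγ Q hQ β hβ D hD hDi r u₀ hu₀ hu hDloc σ δ hσ hδ hev
  have hσf := sigmaFinite_hvol hd
  have hu1 := unitBallVol_pos (k := d - 1) (by omega)
  obtain ⟨m₀, hm₀⟩ := (eventually_atTop.1 (eventually_comap.1 hev))
  set m := max m₀ 0 with hm
  set o : HypSpace d := base d
  have hcone := tendsto_cone_div_ballVol hd o (le_max_right m₀ 0)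
  rw [← hm] at hcone
  set E : Set (HypSpace d) := {x | hnorm (iact x o) < m} with hE
  have hEm : MeasurableSet E := measurable_hnorm_iact o m (le_max_right _ _)
  have hlim : Tendsto (fun R => δ ^ 2 * (γ * (κ - (hvol d 1).real (E ∩ hball 1 o R) /
      ballVol 1 o R))) atTop (𝓝 (δ ^ 2 * (γ * (κ - 0)))) :=
    ((tendsto_const_nhds.sub hcone).const_mul γ).const_mul (δ ^ 2)
  rw [sub_zero] at hlim
  refine le_of_tendsto_of_tendsto hlim
    ((hQ.tendsto_variance hd hγ o hβ).mul_const (1 + 2 * u₀)) ?_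
  filter_upwards [eventually_ge_atTop 2] with R hR
  have hR0 : 0 < R := by linarith
  have hV : 0 < ballVol 1 o R := lt_of_lt_of_le (by positivity) (le_ballVol hd o hR0.le)
  -- Removing `E` puts the root, seen from `x`, near the ideal point; removing the outer shell
  -- leaves room for the pattern around `x` inside the ball. A positive fraction of the volume
  -- remains.
  set W : Set (HypSpace d) := hball 1 o (R - 1) \ E with hW
  have hWm : MeasurableSet W := (measurableSet_hball _ _).diff hEm
  have hBfin : hvol d 1 (hball 1 o (R - 1)) ≠ ∞ := (hvol_hball_lt_top hd _ _).ne
  have hWfin : hvol d 1 W < ∞ :=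
    (measure_mono Set.sdiff_subset).trans_lt (hvol_hball_lt_top hd o (R - 1))
  set μ := ENNReal.ofReal γ • hvol d 1 with hμ
  have hμW : μ W < ∞ := ENNReal.mul_lt_top ENNReal.ofReal_lt_top hWfin
  have hvar := hQ.le_variance hWm hμW (D := D ∩ W ×ˢ univ)
    (hD.inter (hWm.prod MeasurableSet.univ)) inter_subset_right
    (by
      intro x ξ
      simp only [mem_inter_iff, Set.mem_prod, mem_univ, and_true, hDi])
    (U := fun x => hball 1 x r) (fun x => measurableSet_hball x r) hu₀
    (fun x => by
      rw [hμ, Measure.smul_apply, smul_eq_mul,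
        ← ENNReal.ofReal_toReal (hvol_hball_lt_top hd x r).ne, ← ENNReal.ofReal_mul hγ.le]
      exact ENNReal.ofReal_le_ofReal (hu x))
    (fun x y ξ hy => by
      have hy' : r ≤ hdist 1 x y := not_lt.1 hy
      simp only [mem_inter_iff, Set.mem_prod, mem_univ, and_true, hDloc x y ξ hy'])
    (F := fun ξ => σ * (edgeSum o β R ξ).toReal)
    ((measurable_edgeSum o β R).ennreal_toReal.const_mul σ)
    ((hQ.memLp_edgeSum hd hγ o hβ R).const_mul σ) hδ
    (by
      intro x hx
      have hx1 : hdist 1 o x < R - 1 := hx.1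
      have hx2 : m ≤ hnorm (iact x o) := not_lt.1 hx.2
      have e : ∀ (f : HypSpace d × Conf (HypSpace d) → ℝ) (ξ : Conf (HypSpace d)),
          (D ∩ W ×ˢ univ).indicator f (x, ξ) = D.indicator f (x, ξ) := by
        intro f ξ
        by_cases hxD : (x, ξ) ∈ D
        · have hxDW : (x, ξ) ∈ D ∩ W ×ˢ univ := ⟨hxD, hx, mem_univ _⟩
          rw [indicator_of_mem hxD, indicator_of_mem hxDW]
        · have hxDW : (x, ξ) ∉ D ∩ W ×ˢ univ := fun h => hxD h.1
          rw [indicator_of_notMem hxD, indicator_of_notMem hxDW]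
      simp_rw [e]
      exact hm₀ _ ((le_max_left _ _).trans hx2) _ rfl o x R rfl hx1)
  -- The sign `σ` serves to treat increasing and decreasing add-one costs alike and does not affect
  -- the variance.
  rw [variance_const_mul, hσ, one_mul] at hvar
  have hμr : μ.real W = γ * (hvol d 1).real W := by
    rw [measureReal_def, hμ, Measure.smul_apply, smul_eq_mul, ENNReal.toReal_mul,
      ENNReal.toReal_ofReal hγ.le, measureReal_def]
  rw [hμr] at hvar
  have hWv : κ * ballVol 1 o R - (hvol d 1).real (E ∩ hball 1 o R) ≤ (hvol d 1).real W := by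
    have h1 := measureReal_inter_add_sdiff hEm (s := hball 1 o (R - 1)) hBfin
    have h2 : (hvol d 1).real (hball 1 o (R - 1) ∩ E) ≤ (hvol d 1).real (E ∩ hball 1 o R) :=
      measureReal_mono (fun x hx => ⟨hx.2, (show hdist 1 o x < R - 1 from hx.1).trans_le (by linarith)⟩)
        (ne_top_of_le_ne_top (hvol_hball_lt_top hd o R).ne (measure_mono inter_subset_right))
    have h3 := hκV o R hR
    rw [ballVol_eq_real o (R - 1)] at h3
    linarith
  rw [div_mul_eq_mul_div, le_div_iff₀ hV]
  refine le_trans (le_of_eq ?_) ((mul_le_mul_of_nonneg_left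
    (mul_le_mul_of_nonneg_left hWv hγ.le) (sq_nonneg δ)).trans hvar)
  field_simp

end LowerBound

/-! ### Local patterns and their probabilities. -/

section Pattern

variable {k : ℕ}

/-- The part of the ball around `x` in which a pattern has no points. -/
def patternVoid (c : Fin k → HypSpace d) (ε r : ℝ) (x : HypSpace d) : Set (HypSpace d) :=
  {y | hdist 1 x y < r ∧ y ≠ x ∧ ∀ i, ε < hdist 1 (act x (c i)) y}

/-- The configurations which, seen from `x`, have points near the centres `c i`, and no other
points except `x` in the ball of radius `r`. -/
def pattern (c : Fin k → HypSpace d) (ε r : ℝ) : Set (HypSpace d × Conf (HypSpace d)) :=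
  {p | (∀ i, (p.2.pts ∩ hball 1 (act p.1 (c i)) ε).Nonempty) ∧
    p.2.pts ∩ patternVoid c ε r p.1 = ∅}

/-- The centres of a pattern are separated, away from the base point, and inside the ball. -/
structure PatternCenters (c : Fin k → HypSpace d) (ε r : ℝ) : Prop where
  pos : 0 < ε
  lt_base : ∀ i, ε < hdist 1 (base d) (c i)
  add_le : ∀ i, hdist 1 (base d) (c i) + ε ≤ r
  separated : ∀ i j, i ≠ j → 2 * ε ≤ hdist 1 (c i) (c j)

lemma continuous_act_left (c : HypSpace d) : Continuous fun x : HypSpace d => act x c := by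
  unfold act
  refine Continuous.subtype_mk ?_ _
  fun_prop

lemma hdist_act_base (x c : HypSpace d) : hdist 1 x (act x c) = hdist 1 (base d) c := by
  conv_lhs => rw [← act_base x, act_base x]
  have := hdist_act x (base d) c
  rwa [act_base] at this

lemma isOpen_hball_act (c : HypSpace d) (ε : ℝ) :
    IsOpen {p : HypSpace d × HypSpace d | p.2 ∈ hball 1 (act p.1 c) ε} :=
  isOpen_lt (continuous_hdist_comp ((continuous_act_left c).comp continuous_fst) continuous_snd)
    continuous_const

lemma isOpen_patternVoid (c : Fin k → HypSpace d) (ε r : ℝ) :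
    IsOpen {p : HypSpace d × HypSpace d | p.2 ∈ patternVoid c ε r p.1} := by
  have e : {p : HypSpace d × HypSpace d | p.2 ∈ patternVoid c ε r p.1} =
      {p | hdist 1 p.1 p.2 < r} ∩ ({p | p.2 ≠ p.1} ∩
        ⋂ i, {p | ε < hdist 1 (act p.1 (c i)) p.2}) := by
    ext p
    simp [patternVoid]
  rw [e]
  refine (isOpen_lt (continuous_hdist_comp continuous_fst continuous_snd) continuous_const).inter
    ((isOpen_ne_fun continuous_snd continuous_fst).inter (isOpen_iInter_of_finite fun i => ?_))
  exact isOpen_lt continuous_const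
    (continuous_hdist_comp ((continuous_act_left (c i)).comp continuous_fst) continuous_snd)

lemma measurableSet_patternVoid (c : Fin k → HypSpace d) (ε r : ℝ) (x : HypSpace d) :
    MeasurableSet (patternVoid c ε r x) :=
  ((isOpen_patternVoid c ε r).preimage (by fun_prop : Continuous fun y : HypSpace d =>
    (x, y))).measurableSet

lemma measurableSet_pattern (c : Fin k → HypSpace d) (ε r : ℝ) :
    MeasurableSet (pattern c ε r) := by
  have e : pattern c ε r = (⋂ i, {p : HypSpace d × Conf (HypSpace d) | p.2.pts ∩ {y | (p.1, y) ∈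
        {p : HypSpace d × HypSpace d | p.2 ∈ hball 1 (act p.1 (c i)) ε}} = ∅}ᶜ) ∩
      {p | p.2.pts ∩ {y | (p.1, y) ∈ {p : HypSpace d × HypSpace d |
        p.2 ∈ patternVoid c ε r p.1}} = ∅} := by
    ext p
    simp only [pattern, mem_ofPred_eq, ofPred_mem_eq, mem_inter_iff, mem_iInter, mem_compl_iff,
      nonempty_iff_ne_empty, ne_eq]
  rw [e]
  exact (MeasurableSet.iInter fun i =>
    (measurableSet_inter_eq_empty (isOpen_hball_act (c i) ε)).compl).inter
    (measurableSet_inter_eq_empty (isOpen_patternVoid c ε r))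

variable {c : Fin k → HypSpace d} {ε r : ℝ}

lemma patternVoid_subset (c : Fin k → HypSpace d) (ε r : ℝ) (x : HypSpace d) :
    patternVoid c ε r x ⊆ hball 1 x r := fun _ h => h.1

lemma PatternCenters.hball_subset (h : PatternCenters c ε r) (i : Fin k) (x : HypSpace d) :
    hball 1 (act x (c i)) ε ⊆ hball 1 x r := by
  intro y hy
  have h1 : hdist 1 (act x (c i)) y < ε := hy
  have h2 := hdist_triangle x (act x (c i)) y
  rw [hdist_act_base] at h2
  have h3 := h.add_le i
  show hdist 1 x y < r
  linarith

/-- A pattern around `y` ignores `y` itself, which lies in no cluster and is exempt from the void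
condition, and everything outside the ball of radius `r`. These are the locality conditions for the
variance bound. -/
lemma PatternCenters.insert_iff (h : PatternCenters c ε r) {x y : HypSpace d}
    (hxy : x = y ∨ r ≤ hdist 1 x y) (ξ : Conf (HypSpace d)) :
    (y, Conf.insert x ξ) ∈ pattern c ε r ↔ (y, ξ) ∈ pattern c ε r := by
  have h1 : ∀ i, x ∉ hball 1 (act y (c i)) ε := by
    intro i hi
    rcases hxy with rfl | hxy
    · have hi' : hdist 1 (act x (c i)) x < ε := hi
      rw [hdist_comm, hdist_act_base] at hi'
      exact absurd hi' (h.lt_base i).not_gt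
    · have := h.hball_subset i y hi
      have h2 : hdist 1 y x < r := this
      rw [hdist_comm] at h2
      exact absurd h2 hxy.not_gt
  have h2 : x ∉ patternVoid c ε r y := by
    intro hx
    rcases hxy with rfl | hxy
    · exact hx.2.1 rfl
    · have := hx.1
      rw [hdist_comm] at this
      exact absurd this hxy.not_gt
  simp only [pattern, mem_ofPred_eq, Conf.insert]
  rw [insert_inter_of_notMem h2]
  simp_rw [insert_inter_of_notMem (h1 _)]

/-- The probability to hit finitely many disjoint sets and to miss another one. -/
lemma IsPoissonLaw.measure_hit_inter_void (hγ : 0 < γ)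
    (hQ : IsPoissonLaw (hypExhaustion d) (ENNReal.ofReal γ • hvol d 1) Q)
    {b : Fin k → Set (HypSpace d)} (hb : ∀ i, MeasurableSet (b i)) {V : Set (HypSpace d)}
    (hV : MeasurableSet V) (hbb : ∀ i j, i ≠ j → Disjoint (b i) (b j))
    (hbV : ∀ i, Disjoint V (b i)) (hVfin : hvol d 1 V ≠ ∞) (hbfin : ∀ i, hvol d 1 (b i) ≠ ∞) :
    Q.real ({ξ | ∀ i, (ξ.pts ∩ b i).Nonempty} ∩ voidEvent V) =
      (∏ i, (1 - Real.exp (-(γ * (hvol d 1).real (b i))))) *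
        Real.exp (-(γ * (hvol d 1).real V)) := by
  have := hQ.isProb
  -- The void set takes index `0` and the sets to be hit follow, so that one independence statement
  -- covers all counts.
  set B : Fin (k + 1) → Set (HypSpace d) := Fin.cons V b with hB
  have hBm : ∀ i, MeasurableSet (B i) := fun i => Fin.cases hV hb i
  have hBd : Pairwise fun i j => Disjoint (B i) (B j) := by
    intro i j hij
    induction i using Fin.cases with
    | zero =>
      induction j using Fin.cases with
      | zero => exact absurd rfl hij
      | succ j => exact hbV j
    | succ i =>
      induction j using Fin.cases with
      | zero => exact (hbV i).symm
      | succ j => exact hbb i j fun h => hij (by rw [h])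
  have hind := hQ.indep (k + 1) B hBm hBd
  set A : Fin (k + 1) → Set ℕ∞ := Fin.cons {0} fun _ => {0}ᶜ with hA
  have h1 := hind.measure_inter_preimage_eq_mul Finset.univ (sets := A)
    (fun i _ => MeasurableSet.of_discrete)
  have hvoid : ∀ S : Set (HypSpace d), (fun ξ : Conf (HypSpace d) => (ξ.pts ∩ S).encard) ⁻¹' {0} =
      voidEvent S := by
    intro S
    ext ξ
    simp [mem_voidEvent]
  have e : (⋂ i ∈ Finset.univ, (fun ξ : Conf (HypSpace d) => (ξ.pts ∩ B i).encard) ⁻¹' A i) =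
      {ξ | ∀ i, (ξ.pts ∩ b i).Nonempty} ∩ voidEvent V := by
    ext ξ
    simp only [Finset.mem_univ, iInter_true, mem_iInter, Fin.forall_fin_succ, mem_inter_iff]
    rw [and_comm]
    refine and_congr ?_ ?_
    · simp [hA, hB, nonempty_iff_ne_empty]
    · simp [hA, hB, mem_voidEvent]
  rw [e, Fin.prod_univ_succ] at h1
  rw [measureReal_def, h1, ENNReal.toReal_mul, mul_comm, ENNReal.toReal_prod]
  congr 1
  · refine Finset.prod_congr rfl fun i _ => ?_
    simp only [hA, hB, Fin.cons_succ, preimage_compl, hvoid]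
    rw [prob_compl_eq_one_sub (measurableSet_voidEvent (hb i)),
      ENNReal.toReal_sub_of_le prob_le_one ENNReal.one_ne_top,
      hQ.measure_voidEvent hγ (hb i) (hbfin i), ENNReal.toReal_ofReal (Real.exp_pos _).le,
      ENNReal.toReal_one]
  · simp only [hA, hB, Fin.cons_zero, hvoid]
    rw [hQ.measure_voidEvent hγ hV hVfin, ENNReal.toReal_ofReal (Real.exp_pos _).le]

/-- The configurations with a given pattern around `x`. -/
def patternAt (c : Fin k → HypSpace d) (ε r : ℝ) (x : HypSpace d) : Set (Conf (HypSpace d)) :=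
  {ξ | (x, ξ) ∈ pattern c ε r}

lemma measurableSet_patternAt (c : Fin k → HypSpace d) (ε r : ℝ) (x : HypSpace d) :
    MeasurableSet (patternAt c ε r x) :=
  (measurable_const.prodMk measurable_id : Measurable fun ξ : Conf (HypSpace d) => (x, ξ))
    (measurableSet_pattern c ε r)

/-- A pattern around `x` is independent of the configuration outside of the ball. -/
lemma PatternCenters.measure_patternAt_inter_void (h : PatternCenters c ε r) (hd : 2 ≤ d)
    (hγ : 0 < γ) (hQ : IsPoissonLaw (hypExhaustion d) (ENNReal.ofReal γ • hvol d 1) Q)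
    (x : HypSpace d) {S : Set (HypSpace d)} (hS : MeasurableSet S) (hSfin : hvol d 1 S ≠ ∞)
    (hSx : Disjoint S (hball 1 x r)) :
    Q.real (patternAt c ε r x ∩ voidEvent S) =
      Q.real (patternAt c ε r x) * Real.exp (-(γ * (hvol d 1).real S)) := by
  have hbm : ∀ i, MeasurableSet (hball 1 (act x (c i)) ε) := fun i => measurableSet_hball _ _
  have hVm := measurableSet_patternVoid c ε r x
  have hVfin : hvol d 1 (patternVoid c ε r x) ≠ ∞ :=
    ne_top_of_le_ne_top (hvol_hball_lt_top hd x r).ne (measure_mono (patternVoid_subset c ε r x))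
  have hbfin : ∀ i, hvol d 1 (hball 1 (act x (c i)) ε) ≠ ∞ := fun i => (hvol_hball_lt_top hd _ _).ne
  have hbb : ∀ i j, i ≠ j → Disjoint (hball 1 (act x (c i)) ε) (hball 1 (act x (c j)) ε) := by
    intro i j hij
    rw [Set.disjoint_left]
    intro y hy hy'
    have h1 : hdist 1 (act x (c i)) y < ε := hy
    have h2 : hdist 1 (act x (c j)) y < ε := hy'
    have h3 := hdist_triangle (act x (c i)) y (act x (c j))
    rw [hdist_act, hdist_comm y] at h3
    linarith [h.separated i j hij]
  have hbV : ∀ i, Disjoint (patternVoid c ε r x) (hball 1 (act x (c i)) ε) := by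
    intro i
    rw [Set.disjoint_left]
    intro y hy hy'
    exact absurd hy' (hy.2.2 i).not_gt
  have hVS : Disjoint (patternVoid c ε r x) S :=
    (hSx.mono_right (patternVoid_subset c ε r x)).symm
  have hbS : ∀ i, Disjoint (patternVoid c ε r x ∪ S) (hball 1 (act x (c i)) ε) := fun i =>
    (hbV i).union_left (hSx.mono_right (h.hball_subset i x))
  have e : patternAt c ε r x = {ξ | ∀ i, (ξ.pts ∩ hball 1 (act x (c i)) ε).Nonempty} ∩
      voidEvent (patternVoid c ε r x) := rfl
  have e2 : voidEvent (patternVoid c ε r x) ∩ voidEvent S =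
      voidEvent (patternVoid c ε r x ∪ S) := by
    ext ξ
    simp only [mem_inter_iff, mem_voidEvent, inter_union_distrib_left, union_empty_iff]
  rw [e, inter_assoc, e2, hQ.measure_hit_inter_void hγ hbm hVm hbb hbV hVfin hbfin,
    hQ.measure_hit_inter_void hγ hbm (hVm.union hS) hbb hbS
      (measure_union_lt_top (lt_top_iff_ne_top.2 hVfin) (lt_top_iff_ne_top.2 hSfin)).ne hbfin,
    measureReal_union hVS hS hVfin hSfin, mul_assoc, ← Real.exp_add]
  congr 2
  ring

/-- Voiding the whole ball rather than `patternVoid` costs only a constant and gives a bound that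
does not depend on the centres of the pattern. -/
lemma PatternCenters.le_measure_patternAt (h : PatternCenters c ε r) (hd : 2 ≤ d)
    (hγ : 0 < γ) (hQ : IsPoissonLaw (hypExhaustion d) (ENNReal.ofReal γ • hvol d 1) Q)
    (x : HypSpace d) :
    (1 - Real.exp (-(γ * (unitBallVol (d - 1) * (ε / 2) ^ d)))) ^ k *
      Real.exp (-(γ * (hvol d 1).real (hball 1 x r))) ≤ Q.real (patternAt c ε r x) := by
  have hu := unitBallVol_pos (k := d - 1) (by omega)
  have hbm : ∀ i, MeasurableSet (hball 1 (act x (c i)) ε) := fun i => measurableSet_hball _ _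
  have hVm := measurableSet_patternVoid c ε r x
  have hVfin : hvol d 1 (patternVoid c ε r x) ≠ ∞ :=
    ne_top_of_le_ne_top (hvol_hball_lt_top hd x r).ne (measure_mono (patternVoid_subset c ε r x))
  have hbfin : ∀ i, hvol d 1 (hball 1 (act x (c i)) ε) ≠ ∞ := fun i => (hvol_hball_lt_top hd _ _).ne
  have hbb : ∀ i j, i ≠ j → Disjoint (hball 1 (act x (c i)) ε) (hball 1 (act x (c j)) ε) := by
    intro i j hij
    rw [Set.disjoint_left]
    intro y hy hy'
    have h1 : hdist 1 (act x (c i)) y < ε := hy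
    have h2 : hdist 1 (act x (c j)) y < ε := hy'
    have h3 := hdist_triangle (act x (c i)) y (act x (c j))
    rw [hdist_act, hdist_comm y] at h3
    linarith [h.separated i j hij]
  have hbV : ∀ i, Disjoint (patternVoid c ε r x) (hball 1 (act x (c i)) ε) := by
    intro i
    rw [Set.disjoint_left]
    intro y hy hy'
    exact absurd hy' (hy.2.2 i).not_gt
  have e : patternAt c ε r x = {ξ | ∀ i, (ξ.pts ∩ hball 1 (act x (c i)) ε).Nonempty} ∩
      voidEvent (patternVoid c ε r x) := rfl
  rw [e, hQ.measure_hit_inter_void hγ hbm hVm hbb hbV hVfin hbfin]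
  have hpos := h.pos
  have h1 : ∀ i, 1 - Real.exp (-(γ * (unitBallVol (d - 1) * (ε / 2) ^ d))) ≤
      1 - Real.exp (-(γ * (hvol d 1).real (hball 1 (act x (c i)) ε))) := by
    intro i
    have := le_ballVol hd (act x (c i)) hpos.le
    rw [ballVol_eq_real] at this
    gcongr
  have h0 : 0 ≤ 1 - Real.exp (-(γ * (unitBallVol (d - 1) * (ε / 2) ^ d))) := by
    rw [sub_nonneg, Real.exp_le_one_iff, neg_nonpos]
    positivity
  have h2 : (1 - Real.exp (-(γ * (unitBallVol (d - 1) * (ε / 2) ^ d)))) ^ k ≤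
      ∏ i, (1 - Real.exp (-(γ * (hvol d 1).real (hball 1 (act x (c i)) ε)))) := by
    calc _ = ∏ _i : Fin k, (1 - Real.exp (-(γ * (unitBallVol (d - 1) * (ε / 2) ^ d)))) := by simp
      _ ≤ _ := Finset.prod_le_prod (fun _ _ => h0) fun i _ => h1 i
  have h3 : (hvol d 1).real (patternVoid c ε r x) ≤ (hvol d 1).real (hball 1 x r) :=
    measureReal_mono (patternVoid_subset c ε r x) (hvol_hball_lt_top hd x r).ne
  refine mul_le_mul h2 ?_ (Real.exp_pos _).le (Finset.prod_nonneg fun i _ => h0.trans (h1 i))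
  gcongr

end Pattern

end HypRST

/-! ### Add-one costs, and the reduction to patterns at the scale of the typical spacing. -/

namespace HypRST
set_option linter.unusedSectionVars false

variable {d : ℕ} {γ : ℝ} {Q : Measure (Conf (HypSpace d))}

section AddOne

lemma edgeLength_le_hdist {o y w : HypSpace d} {ξ : Set (HypSpace d)} (hw : w ∈ ξ)
    (h : hdist 1 o w < hdist 1 o y) : edgeLength 1 o ξ y ≤ hdist 1 y w := by
  refine csInf_le ⟨0, ?_⟩ (mem_image_of_mem _ ⟨mem_insert_of_mem _ hw, h⟩)
  rintro _ ⟨z, -, rfl⟩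
  exact hdist_nonneg _ _

lemma le_edgeLength {o y : HypSpace d} {ξ : Set (HypSpace d)} {s : ℝ} (hy : y ≠ o)
    (ho : s ≤ hdist 1 o y) (h : ∀ w ∈ ξ, hdist 1 o w < hdist 1 o y → s ≤ hdist 1 y w) :
    s ≤ edgeLength 1 o ξ y := by
  rw [le_edgeLength_iff hy]
  refine ⟨ho, eq_empty_of_forall_notMem fun w hw => ?_⟩
  exact absurd hw.2.1 (h w hw.1 hw.2.2).not_gt

lemma edgeLength_insert_le (o x y : HypSpace d) (ξ : Set (HypSpace d)) :
    edgeLength 1 o (insert x ξ) y ≤ edgeLength 1 o ξ y := by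
  rcases eq_or_ne y o with rfl | hy
  · rw [edgeLength_self, edgeLength_self]
  · have h := (le_edgeLength_iff hy (insert x ξ) _).1 le_rfl
    refine (le_edgeLength_iff hy ξ _).2 ⟨h.1, subset_empty_iff.1 ?_⟩
    rw [← h.2]
    exact inter_subset_inter_left _ (subset_insert _ _)

/-- A new point shortens an edge only if it lies closer to the root. -/
lemma lt_of_edgeLength_insert_ne {o x y : HypSpace d} {ξ : Set (HypSpace d)}
    (h : edgeLength 1 o (insert x ξ) y ≠ edgeLength 1 o ξ y) : hdist 1 o x < hdist 1 o y := by
  by_contra hc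
  exact h (edgeLength_insert_of_le (not_lt.1 hc) ξ)

/-- A shortened edge ends in the new point. -/
lemma le_edgeLength_of_insert_ne {o x y : HypSpace d} {ξ : Set (HypSpace d)}
    (h : edgeLength 1 o (insert x ξ) y ≠ edgeLength 1 o ξ y) :
    hdist 1 x y ≤ edgeLength 1 o (insert x ξ) y := by
  have hlt := lt_of_edgeLength_insert_ne h
  have hy : y ≠ o := by
    rintro rfl
    rw [hdist_self] at hlt
    exact absurd hlt (hdist_nonneg _ _).not_gt
  by_contra hc
  push Not at hc
  refine h (le_antisymm (edgeLength_insert_le o x y ξ) ?_)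
  -- The new point is outside the lens of `y` of any radius `s ≤ hdist 1 x y`, so it cannot destroy
  -- such a lower bound.
  have h2 : ∀ s, s ≤ hdist 1 x y → s ≤ edgeLength 1 o ξ y → s ≤ edgeLength 1 o (insert x ξ) y := by
    intro s hs1 hs2
    rw [le_edgeLength_iff hy] at hs2 ⊢
    refine ⟨hs2.1, ?_⟩
    rw [insert_inter_of_notMem (fun hx => ?_), hs2.2]
    have h3 := hx.1
    rw [hdist_comm] at h3
    exact absurd h3 hs1.not_gt
  rcases le_total (hdist 1 x y) (edgeLength 1 o ξ y) with h3 | h3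
  · exact absurd (h2 _ le_rfl h3) hc.not_ge
  · exact h2 _ h3 le_rfl

lemma toReal_edgeSum {ξ : Conf (HypSpace d)} (h : LocFin (hypExhaustion d) ξ) (o : HypSpace d)
    (β R : ℝ) : (edgeSum o β R ξ).toReal =
      ∑ y ∈ (locFin_inter_hball h o R).toFinset, edgeLength 1 o ξ.pts y ^ β := by
  rw [edgeSum, lintegral_pointKernel_indicator h, ENNReal.toReal_sum (by simp)]
  refine Finset.sum_congr rfl fun y _ => ?_
  rw [ENNReal.toReal_ofReal (Real.rpow_nonneg (edgeLength_nonneg _ _ _) _)]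

lemma toReal_edgeSum_insert {ξ : Conf (HypSpace d)} (h : LocFin (hypExhaustion d) ξ)
    {o x : HypSpace d} (hx : x ∉ ξ.pts) {R : ℝ} (hxR : hdist 1 o x < R) (β : ℝ) :
    (edgeSum o β R (Conf.insert x ξ)).toReal = edgeLength 1 o ξ.pts x ^ β +
      ∑ y ∈ (locFin_inter_hball h o R).toFinset, edgeLength 1 o (insert x ξ.pts) y ^ β := by
  classical
  have e : (locFin_inter_hball (h.insert x) o R).toFinset =
      insert x (locFin_inter_hball h o R).toFinset := by
    ext y
    simp only [Finite.mem_toFinset, Finset.mem_insert, Conf.insert, mem_inter_iff,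
      mem_insert_iff]
    constructor
    · rintro ⟨rfl | hy, hy2⟩
      · exact .inl rfl
      · exact .inr ⟨hy, hy2⟩
    · rintro (rfl | hy)
      · exact ⟨.inl rfl, hxR⟩
      · exact ⟨.inr hy.1, hy.2⟩
  rw [toReal_edgeSum (h.insert x), e, Finset.sum_insert (by simp [hx])]
  simp only [Conf.insert, edgeLength_insert_of_le (le_refl (hdist 1 o x))]

/-- The add-one cost of the edge sum. -/
lemma edgeSum_insert_sub {ξ : Conf (HypSpace d)} (h : LocFin (hypExhaustion d) ξ)
    {o x : HypSpace d} (hx : x ∉ ξ.pts) {R : ℝ} (hxR : hdist 1 o x < R) (β : ℝ) :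
    (edgeSum o β R (Conf.insert x ξ)).toReal - (edgeSum o β R ξ).toReal =
      edgeLength 1 o ξ.pts x ^ β - ∑ y ∈ (locFin_inter_hball h o R).toFinset,
        (edgeLength 1 o ξ.pts y ^ β - edgeLength 1 o (insert x ξ.pts) y ^ β) := by
  rw [toReal_edgeSum_insert h hx hxR, toReal_edgeSum h, Finset.sum_sub_distrib]
  ring

lemma edgeLength_insert_rpow_le {β : ℝ} (hβ : 0 < β) (o x y : HypSpace d)
    (ξ : Set (HypSpace d)) :
    edgeLength 1 o (insert x ξ) y ^ β ≤ edgeLength 1 o ξ y ^ β :=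
  Real.rpow_le_rpow (edgeLength_nonneg _ _ _) (edgeLength_insert_le o x y ξ) hβ.le

end AddOne

section Reduction

/-- A lower bound for the asymptotic variance from patterns of the size of the typical distance
between points. -/
lemma exists_le_varLim_of_pattern (hd : 2 ≤ d) {β : ℝ} (hβ : 0 < β) {γ₀ : ℝ} (hγ₀ : 0 < γ₀)
    (k : ℕ) {l σ η : ℝ} (hl : 0 < l) (hσ : σ ^ 2 = 1) (hη : 0 < η)
    (H : ∀ γ, γ₀ ≤ γ → ∀ Q : Measure (Conf (HypSpace d)),
      IsPoissonLaw (hypExhaustion d) (ENNReal.ofReal γ • hvol d 1) Q →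
      ∀ ρ, ρ = l * γ ^ (-(1 / (d : ℝ))) →
      ∃ c : Fin k → HypSpace d, PatternCenters c (ρ / 100) (4 * ρ) ∧
        ∀ᶠ p in idealInfty d, ∀ (o x : HypSpace d) (R : ℝ), iact x o = p → hdist 1 o x < R - 1 →
        Integrable (fun ξ => (pattern c (ρ / 100) (4 * ρ)).indicator (fun q =>
          σ * (edgeSum o β R (Conf.insert q.1 q.2)).toReal - σ * (edgeSum o β R q.2).toReal)
            (x, ξ)) Q →
        η * ρ ^ β * Q.real (patternAt c (ρ / 100) (4 * ρ) x) ≤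
          ∫ ξ, (pattern c (ρ / 100) (4 * ρ)).indicator (fun q =>
          σ * (edgeSum o β R (Conf.insert q.1 q.2)).toReal - σ * (edgeSum o β R q.2).toReal)
            (x, ξ) ∂Q) :
    ∃ C : ℝ, 0 < C ∧ ∀ γ, γ₀ ≤ γ → ∀ Q : Measure (Conf (HypSpace d)),
      IsPoissonLaw (hypExhaustion d) (ENNReal.ofReal γ • hvol d 1) Q →
      C * γ ^ (1 - 2 * β / d) ≤ varLim d γ β := by
  obtain ⟨κ, hκ, hmain⟩ := IsPoissonLaw.exists_sq_mul_le_varLim hd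
  have hu := unitBallVol_pos (k := d - 1) (by omega)
  have hd0 : (0 : ℝ) < d := by positivity
  -- Bounds the mean number of points in a ball of radius `4ρ`: `γ * ρ ^ d = l ^ d`, and the
  -- exponential factor is controlled by the largest `ρ`, attained at `γ₀`.
  set u₀ : ℝ := 2 * unitBallVol (d - 1) * (4 * l) ^ d *
    Real.exp ((d - 1 : ℕ) * (4 * (l * γ₀ ^ (-(1 / (d : ℝ)))))) with hu₀
  have hu₀0 : 0 < u₀ := by positivity
  -- A lower bound for the probability of the pattern that is free of `γ`; `l / 200` stems from half
  -- the cluster radius `ρ / 100`.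
  set q₀ : ℝ := (1 - Real.exp (-(unitBallVol (d - 1) * (l / 200) ^ d))) ^ k * Real.exp (-u₀) with hq₀
  have hq₀0 : 0 < q₀ := by
    refine mul_pos (pow_pos ?_ _) (Real.exp_pos _)
    rw [sub_pos, Real.exp_lt_one_iff, neg_lt_zero]
    positivity
  refine ⟨(η * l ^ β * q₀) ^ 2 * κ / (1 + 2 * u₀), by positivity, fun γ hγ Q hQ => ?_⟩
  have hγ0 : 0 < γ := hγ₀.trans_le hγ
  set ρ : ℝ := l * γ ^ (-(1 / (d : ℝ))) with hρ
  have hρ0 : 0 < ρ := by positivity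
  have hρd : γ * ρ ^ d = l ^ d := by
    rw [hρ, mul_pow, ← Real.rpow_natCast (γ ^ _), ← Real.rpow_mul hγ0.le, neg_mul,
      one_div_mul_cancel hd0.ne', Real.rpow_neg hγ0.le, Real.rpow_one]
    field_simp
  have hρle : ρ ≤ l * γ₀ ^ (-(1 / (d : ℝ))) :=
    mul_le_mul_of_nonneg_left (Real.rpow_le_rpow_of_nonpos hγ₀ hγ
      (by rw [neg_nonpos]; positivity)) hl.le
  have hvol : ∀ x : HypSpace d, γ * (hvol d 1).real (hball 1 x (4 * ρ)) ≤ u₀ := by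
    intro x
    have h1 := ENNReal.toReal_mono ENNReal.ofReal_ne_top
      (hvol_hball_le hd x (s := 4 * ρ) (by positivity))
    rw [ENNReal.toReal_ofReal (by positivity)] at h1
    calc γ * (hvol d 1).real (hball 1 x (4 * ρ))
        ≤ γ * (2 * unitBallVol (d - 1) * (4 * ρ) ^ d * Real.exp ((d - 1 : ℕ) * (4 * ρ))) :=
          mul_le_mul_of_nonneg_left h1 hγ0.le
      _ = 2 * unitBallVol (d - 1) * (4 ^ d * (γ * ρ ^ d)) * Real.exp ((d - 1 : ℕ) * (4 * ρ)) := by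
          rw [mul_pow]; ring
      _ ≤ u₀ := by
          rw [hρd, ← mul_pow, hu₀]
          gcongr
  obtain ⟨c, hc, hev⟩ := H γ hγ Q hQ ρ rfl
  have hq : ∀ x, q₀ ≤ Q.real (patternAt c (ρ / 100) (4 * ρ) x) := by
    intro x
    refine le_trans ?_ (hc.le_measure_patternAt hd hγ0 hQ x)
    have e : γ * (unitBallVol (d - 1) * (ρ / 100 / 2) ^ d) =
        unitBallVol (d - 1) * (l / 200) ^ d := by
      rw [show ρ / 100 / 2 = ρ / 200 by ring, div_pow, div_pow, ← hρd]
      ring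
    rw [e, hq₀]
    refine mul_le_mul_of_nonneg_left (Real.exp_le_exp.2 (neg_le_neg (hvol x))) (pow_nonneg ?_ _)
    rw [sub_nonneg, Real.exp_le_one_iff, neg_nonpos]
    positivity
  have h := hmain γ hγ0 Q hQ β hβ (pattern c (ρ / 100) (4 * ρ)) (measurableSet_pattern _ _ _)
    (fun x ξ => hc.insert_iff (Or.inl rfl) ξ) (4 * ρ) u₀ hu₀0.le hvol
    (fun x y ξ hxy => hc.insert_iff (Or.inr hxy) ξ) σ (η * ρ ^ β * q₀) hσ (by positivity)
    (by
      filter_upwards [hev] with p hp o x R ho hR hint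
      refine le_trans ?_ (hp o x R ho hR hint)
      exact mul_le_mul_of_nonneg_left (hq x) (by positivity))
  rw [div_mul_eq_mul_div, div_le_iff₀ (by positivity)]
  refine le_trans (le_of_eq ?_) h
  -- An add-one cost of order `ρ ^ β` produces exactly the claimed power of the intensity.
  have e1 : (ρ ^ β) ^ 2 * γ = (l ^ β) ^ 2 * γ ^ (1 - 2 * β / d) := by
    rw [hρ, Real.mul_rpow hl.le (by positivity), mul_pow, ← Real.rpow_natCast (_ ^ β),
      ← Real.rpow_natCast ((γ ^ _) ^ β), ← Real.rpow_mul hγ0.le, ← Real.rpow_mul hγ0.le,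
      mul_assoc]
    rw [Real.rpow_natCast, show 1 - 2 * β / d = -(1 / (d : ℝ)) * β * (2 : ℕ) + 1 by
      push_cast; field_simp; ring, Real.rpow_add hγ0, Real.rpow_one]
  calc (η * l ^ β * q₀) ^ 2 * κ * γ ^ (1 - 2 * β / d)
      = η ^ 2 * q₀ ^ 2 * κ * ((l ^ β) ^ 2 * γ ^ (1 - 2 * β / d)) := by ring
    _ = _ := by rw [← e1]; ring

end Reduction

end HypRST

/-! ### Exponents at least one: a new point shortens two edges. -/

namespace HypRST
set_option linter.unusedSectionVars false

variable {d : ℕ} {γ : ℝ} {Q : Measure (Conf (HypSpace d))}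

section Centers

lemma hdist_le_of_chd_sub_one_le {x y : HypSpace d} {s : ℝ} (hs : 0 ≤ s)
    (h : chd x y - 1 ≤ s ^ 2 / 2) : hdist 1 x y ≤ s :=
  (hdist_le_iff x y hs).2 (by linarith [one_add_sq_div_two_le_cosh' hs])

lemma le_hdist_of_le_chd_sub_one {x y : HypSpace d} {s : ℝ} (hs : 0 ≤ s)
    (h : s ^ 2 * Real.exp s / 2 ≤ chd x y - 1) : s ≤ hdist 1 x y :=
  not_lt.1 fun hc => by
    have := (hdist_lt_iff x y hs).1 hc
    linarith [cosh_sub_one_le hs]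

/-- Three points around the base point, one of them above and two below, which are farther from
each other than from the base point. -/
lemma exists_centers (hd : 2 ≤ d) {ρ : ℝ} (hρ : 0 < ρ) (hρ' : ρ ≤ 1 / 100) :
    ∃ z y y' : HypSpace d, (98 / 100 * ρ ≤ hdist 1 (base d) z ∧ hdist 1 (base d) z ≤ ρ ∧
        Real.exp (ρ / 100) < z.1.2) ∧
      (∀ w ∈ ({y, y'} : Set (HypSpace d)), 98 / 100 * ρ ≤ hdist 1 (base d) w ∧
        hdist 1 (base d) w ≤ 101 / 100 * ρ ∧ Real.exp (ρ / 100) * w.1.2 < 1 ∧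
        17 / 10 * ρ ≤ hdist 1 z w) ∧ 17 / 10 * ρ ≤ hdist 1 y y' := by
  -- `17 / 1000` is the largest exponent needed, `17 / 10 * ρ` with `ρ ≤ 1 / 100`; at this scale the
  -- geometry is nearly Euclidean.
  have hexp : ∀ t, 0 ≤ t → t ≤ 17 / 1000 → Real.exp t ≤ 102 / 100 := by
    intro t h0 h1
    refine (Real.exp_bound_div_one_sub_of_interval h0 (by linarith)).trans ?_
    rw [div_le_iff₀ (by linarith)]
    linarith
  have hexp' : Real.exp (ρ / 100) ≤ 1 / (1 - ρ / 100) :=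
    Real.exp_bound_div_one_sub_of_interval (by positivity) (by linarith)
  have he17 := hexp (17 / 10 * ρ) (by positivity) (by linarith)
  have he98 := hexp (98 / 100 * ρ) (by positivity) (by linarith)
  -- The offsets `(0, 1)`, `(±0.87, -1/2)` in units of `ρ` approximate an equilateral triangle with
  -- unit circumradius, whose sides `√3 > 1.7` exceed the distance to the centre.
  set v : EuclideanSpace ℝ (Fin (d - 1)) := EuclideanSpace.single ⟨0, by omega⟩ (87 / 100 * ρ) with hv
  have hvn : ‖v‖ = 87 / 100 * ρ := by
    rw [hv, PiLp.norm_single, Real.norm_of_nonneg (by positivity)]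
  have h1 : 0 < 1 - ρ / 2 := by linarith
  have h2 : 0 < 1 + ρ := by linarith
  have hlow : ∀ u : EuclideanSpace ℝ (Fin (d - 1)), ‖u‖ = 87 / 100 * ρ →
      98 / 100 * ρ ≤ hdist 1 (base d) ⟨(u, 1 - ρ / 2), h1⟩ ∧
        hdist 1 (base d) ⟨(u, 1 - ρ / 2), h1⟩ ≤ 101 / 100 * ρ ∧
        Real.exp (ρ / 100) * (1 - ρ / 2) < 1 ∧
        17 / 10 * ρ ≤ hdist 1 ⟨(0, 1 + ρ), h2⟩ ⟨(u, 1 - ρ / 2), h1⟩ := by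
    intro u hu
    refine ⟨le_hdist_of_le_chd_sub_one (by positivity) ?_,
      hdist_le_of_chd_sub_one_le (by positivity) ?_, ?_,
      le_hdist_of_le_chd_sub_one (by positivity) ?_⟩
    · simp only [chd, base, zero_sub, norm_neg, hu, add_sub_cancel_left]
      rw [le_div_iff₀ (by linarith)]
      have : (98 / 100 * ρ) ^ 2 * Real.exp (98 / 100 * ρ) ≤ (98 / 100 * ρ) ^ 2 * (102 / 100) := by
        gcongr
      nlinarith [mul_nonneg (mul_nonneg (sq_nonneg (98 / 100 * ρ))
        (Real.exp_pos (98 / 100 * ρ)).le) hρ.le, sq_nonneg ρ]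
    · simp only [chd, base, zero_sub, norm_neg, hu, add_sub_cancel_left]
      rw [div_le_iff₀ (by linarith)]
      nlinarith [mul_nonneg (sq_nonneg ρ) (by linarith : 0 ≤ 1 / 100 - ρ)]
    · refine (mul_le_mul_of_nonneg_right hexp' h1.le).trans_lt ?_
      rw [one_div_mul_eq_div, div_lt_one (by linarith)]
      linarith
    · simp only [chd, zero_sub, norm_neg, hu, add_sub_cancel_left]
      rw [le_div_iff₀ (by positivity)]
      have h3 : (17 / 10 * ρ) ^ 2 * Real.exp (17 / 10 * ρ) ≤ (17 / 10 * ρ) ^ 2 * (102 / 100) := by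
        gcongr
      have h4 : 2 * (1 + ρ) * (1 - ρ / 2) ≤ 201 / 100 := by nlinarith
      have h5 : (17 / 10 * ρ) ^ 2 * Real.exp (17 / 10 * ρ) / 2 * (2 * (1 + ρ) * (1 - ρ / 2)) ≤
          (17 / 10 * ρ) ^ 2 * (102 / 100) / 2 * (201 / 100) := by gcongr
      refine h5.trans ?_
      nlinarith [sq_nonneg ρ]
  refine ⟨⟨(0, 1 + ρ), h2⟩, ⟨(v, 1 - ρ / 2), h1⟩, ⟨(-v, 1 - ρ / 2), h1⟩, ⟨?_, ?_, ?_⟩, ?_, ?_⟩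
  · refine le_hdist_of_le_chd_sub_one (by positivity) ?_
    simp only [chd, base, sub_self, norm_zero, add_sub_cancel_left]
    rw [le_div_iff₀ (by positivity)]
    have h3 : (98 / 100 * ρ) ^ 2 * Real.exp (98 / 100 * ρ) ≤ (98 / 100 * ρ) ^ 2 * (102 / 100) := by
      gcongr
    have h5 : (98 / 100 * ρ) ^ 2 * Real.exp (98 / 100 * ρ) / 2 * (2 * 1 * (1 + ρ)) ≤
        (98 / 100 * ρ) ^ 2 * (102 / 100) / 2 * (2 * 1 * (1 + 1 / 100)) := by gcongr
    refine h5.trans ?_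
    nlinarith [sq_nonneg ρ]
  · refine hdist_le_of_chd_sub_one_le hρ.le ?_
    simp only [chd, base, sub_self, norm_zero, add_sub_cancel_left]
    rw [div_le_iff₀ (by positivity)]
    nlinarith [mul_nonneg (sq_nonneg ρ) hρ.le]
  · refine hexp'.trans_lt ?_
    rw [div_lt_iff₀ (by linarith)]
    nlinarith
  · rintro w (rfl | rfl)
    · exact hlow v hvn
    · exact hlow (-v) (by rw [norm_neg, hvn])
  · refine le_hdist_of_le_chd_sub_one (by positivity) ?_
    have hvv : ‖v - -v‖ = 174 / 100 * ρ := by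
      rw [sub_neg_eq_add, ← two_smul ℝ v, norm_smul, hvn, Real.norm_of_nonneg (by norm_num)]
      ring
    simp only [chd, hvv, sub_self, add_sub_cancel_left]
    rw [le_div_iff₀ (by positivity)]
    have h3 : (17 / 10 * ρ) ^ 2 * Real.exp (17 / 10 * ρ) ≤ (17 / 10 * ρ) ^ 2 * (102 / 100) := by
      gcongr
    have h4 : 2 * (1 - ρ / 2) * (1 - ρ / 2) ≤ 2 := by nlinarith
    have h5 : (17 / 10 * ρ) ^ 2 * Real.exp (17 / 10 * ρ) / 2 * (2 * (1 - ρ / 2) * (1 - ρ / 2)) ≤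
        (17 / 10 * ρ) ^ 2 * (102 / 100) / 2 * 2 := by gcongr
    refine h5.trans ?_
    nlinarith [sq_nonneg ρ]

end Centers

section Shortening

/-- A point of a configuration near `Y` with a long edge. -/
lemma exists_le_edgeLength {ξ : Set (HypSpace d)} {o x Y : HypSpace d} {ρ : ℝ} (hρ : 0 < ρ)
    (hfin : (ξ ∩ hball 1 x (4 * ρ)).Finite) (hne : (ξ ∩ hball 1 Y (ρ / 100)).Nonempty)
    (hxY : hdist 1 x Y ≤ 101 / 100 * ρ)
    (hother : ∀ w ∈ ξ, hdist 1 x w < 4 * ρ → hdist 1 Y w ≤ ρ / 100 ∨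
      ∃ C, 17 / 10 * ρ ≤ hdist 1 C Y ∧ hdist 1 C w ≤ ρ / 100)
    (ho : 4 * ρ ≤ hdist 1 o x) (hlt : hdist 1 o x + ρ / 100 < hdist 1 o Y) :
    ∃ w ∈ ξ, hdist 1 Y w ≤ ρ / 100 ∧ hdist 1 x w ≤ 102 / 100 * ρ ∧
      hdist 1 o x < hdist 1 o w ∧ 168 / 100 * ρ ≤ edgeLength 1 o ξ w := by
  set A := ξ ∩ {w | hdist 1 Y w ≤ ρ / 100} with hA
  have hxw : ∀ w, hdist 1 Y w ≤ ρ / 100 → hdist 1 x w ≤ 102 / 100 * ρ := by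
    intro w hw
    linarith [hdist_triangle x Y w]
  have hAfin : A.Finite := hfin.subset fun w hw =>
    ⟨hw.1, show hdist 1 x w < 4 * ρ by linarith [hxw w hw.2]⟩
  have hAne : A.Nonempty := by
    obtain ⟨w, hw1, hw2⟩ := hne
    have : hdist 1 Y w < ρ / 100 := hw2
    exact ⟨w, hw1, this.le⟩
  -- A cluster may hold several points. The one closest to the root cannot use the others, so its
  -- edge must leave the cluster.
  obtain ⟨w, hwA, hwmin⟩ := hAfin.exists_minimalFor (fun w => hdist 1 o w) A hAne
  have hw : hdist 1 Y w ≤ ρ / 100 := hwA.2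
  have how : hdist 1 o x < hdist 1 o w := by
    have := hdist_triangle o w Y
    rw [hdist_comm w Y] at this
    linarith
  have hwo : w ≠ o := by
    rintro rfl
    rw [hdist_self] at how
    exact absurd how (hdist_nonneg _ _).not_gt
  -- Another cluster is at distance at least `1.70ρ` minus two cluster radii `0.01ρ`, hence `1.68ρ`;
  -- the root and the points outside the ball are farther.
  refine ⟨w, hwA.1, hw, hxw w hw, how, le_edgeLength hwo (by linarith) fun v hv hvlt => ?_⟩
  have h1 := hxw w hw
  have h2 := hdist_triangle x w v
  rcases lt_or_ge (hdist 1 x v) (4 * ρ) with h4 | h4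
  · rcases hother v hv h4 with h5 | ⟨C, h5, h6⟩
    · exact absurd (hwmin ⟨hv, h5⟩ hvlt.le) hvlt.not_ge
    · have h7 := hdist_triangle C v Y
      have h8 := hdist_triangle v w Y
      rw [hdist_comm w Y, hdist_comm v w] at h8
      linarith
  · linarith

lemma not_lt_of_notMem_patternVoid {k : ℕ} {c : Fin k → HypSpace d} {ε r : ℝ} {x : HypSpace d}
    {ξ : Conf (HypSpace d)} (h : ξ ∈ patternAt c ε r x) (hx : x ∉ ξ.pts) {w : HypSpace d}
    (hw : w ∈ ξ.pts) (hxw : hdist 1 x w < r) : ∃ i, hdist 1 (act x (c i)) w ≤ ε := by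
  by_contra hc
  push Not at hc
  have h2 : ξ.pts ∩ patternVoid c ε r x = ∅ := h.2
  exact (h2 ▸ (⟨hw, hxw, fun e => hx (e ▸ hw), hc⟩ : w ∈ ξ.pts ∩ patternVoid c ε r x) :
    w ∈ (∅ : Set (HypSpace d)))

/-- A point near `Z` bounds the length of the edge of `x`. -/
lemma edgeLength_le_of_nonempty {ξ : Set (HypSpace d)} {o x Z : HypSpace d} {ρ ε : ℝ}
    (hne : (ξ ∩ hball 1 Z ε).Nonempty) (hxZ : hdist 1 x Z ≤ ρ)
    (hlt : hdist 1 o Z + ε < hdist 1 o x) : edgeLength 1 o ξ x ≤ ρ + ε := by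
  obtain ⟨w, hw1, hw2⟩ := hne
  have h1 : hdist 1 Z w < ε := hw2
  have h2 := hdist_triangle x Z w
  have h3 := hdist_triangle o Z w
  exact (edgeLength_le_hdist hw1 (by linarith)).trans (by linarith)

/-- On the pattern, the insertion of a point decreases the edge sum. -/
lemma le_edgeSum_sub_insert {β : ℝ} (hβ : 1 ≤ β) {ρ : ℝ} (hρ : 0 < ρ) (hρ' : ρ ≤ 1 / 100)
    {c : Fin 3 → HypSpace d} {o x : HypSpace d} {R : ℝ} {ξ : Conf (HypSpace d)}
    (h : LocFin (hypExhaustion d) ξ) (hx : x ∉ ξ.pts) (hxR : hdist 1 o x < R - 1)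
    (hξ : ξ ∈ patternAt c (ρ / 100) (4 * ρ) x)
    (hc0 : hdist 1 (base d) (c 0) ≤ ρ) (hc1 : hdist 1 (base d) (c 1) ≤ 101 / 100 * ρ)
    (hc2 : hdist 1 (base d) (c 2) ≤ 101 / 100 * ρ) (hc01 : 17 / 10 * ρ ≤ hdist 1 (c 0) (c 1))
    (hc02 : 17 / 10 * ρ ≤ hdist 1 (c 0) (c 2)) (hc12 : 17 / 10 * ρ ≤ hdist 1 (c 1) (c 2))
    (ho : 4 * ρ ≤ hdist 1 o x) (ho0 : hdist 1 o (act x (c 0)) + ρ / 100 < hdist 1 o x)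
    (ho1 : hdist 1 o x + ρ / 100 < hdist 1 o (act x (c 1)))
    (ho2 : hdist 1 o x + ρ / 100 < hdist 1 o (act x (c 2))) :
    1 / 4 * ρ ^ β ≤ (edgeSum o β R ξ).toReal - (edgeSum o β R (Conf.insert x ξ)).toReal := by
  have hβ0 : 0 < β := by linarith
  have hhit : ∀ i, (ξ.pts ∩ hball 1 (act x (c i)) (ρ / 100)).Nonempty := hξ.1
  have hfin := locFin_inter_hball h x (4 * ρ)
  have hℓx : edgeLength 1 o ξ.pts x ≤ 101 / 100 * ρ := by
    have := edgeLength_le_of_nonempty (ρ := ρ) (hhit 0) (by rwa [hdist_act_base]) ho0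
    linarith
  obtain ⟨w₁, hw₁, hw₁Y, hxw₁, how₁, hℓ₁⟩ := exists_le_edgeLength hρ hfin (hhit 1)
    (by rwa [hdist_act_base]) (fun w hw hxw => by
      obtain ⟨i, hi⟩ := not_lt_of_notMem_patternVoid hξ hx hw hxw
      fin_cases i
      · exact .inr ⟨_, by rw [hdist_act]; exact hc01, hi⟩
      · exact .inl hi
      · exact .inr ⟨_, by rw [hdist_act, hdist_comm]; exact hc12, hi⟩) ho ho1
  obtain ⟨w₂, hw₂, hw₂Y, hxw₂, how₂, hℓ₂⟩ := exists_le_edgeLength hρ hfin (hhit 2)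
    (by rwa [hdist_act_base]) (fun w hw hxw => by
      obtain ⟨i, hi⟩ := not_lt_of_notMem_patternVoid hξ hx hw hxw
      fin_cases i
      · exact .inr ⟨_, by rw [hdist_act]; exact hc02, hi⟩
      · exact .inr ⟨_, by rw [hdist_act]; exact hc12, hi⟩
      · exact .inl hi) ho ho2
  have hne : w₁ ≠ w₂ := by
    rintro rfl
    have h1 := hdist_triangle (act x (c 1)) w₁ (act x (c 2))
    rw [hdist_act, hdist_comm w₁] at h1
    linarith
  have hmem : ∀ w ∈ ξ.pts, hdist 1 x w ≤ 102 / 100 * ρ →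
      w ∈ (locFin_inter_hball h o R).toFinset := by
    intro w hw hxw
    rw [Finite.mem_toFinset]
    refine ⟨hw, show hdist 1 o w < R from ?_⟩
    linarith [hdist_triangle o x w]
  have hgain : ∀ w, hdist 1 x w ≤ 102 / 100 * ρ → hdist 1 o x < hdist 1 o w →
      168 / 100 * ρ ≤ edgeLength 1 o ξ.pts w →
      (168 / 100 * ρ) ^ β - (102 / 100 * ρ) ^ β ≤
        edgeLength 1 o ξ.pts w ^ β - edgeLength 1 o (insert x ξ.pts) w ^ β := by
    intro w hxw how hℓ
    have h1 : edgeLength 1 o (insert x ξ.pts) w ≤ 102 / 100 * ρ :=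
      (edgeLength_le_hdist (mem_insert _ _) how).trans (by rwa [hdist_comm])
    exact sub_le_sub (Real.rpow_le_rpow (by positivity) hℓ hβ0.le)
      (Real.rpow_le_rpow (edgeLength_nonneg _ _ _) h1 hβ0.le)
  have hsum : ((168 / 100 * ρ) ^ β - (102 / 100 * ρ) ^ β) +
      ((168 / 100 * ρ) ^ β - (102 / 100 * ρ) ^ β) ≤
      ∑ y ∈ (locFin_inter_hball h o R).toFinset,
        (edgeLength 1 o ξ.pts y ^ β - edgeLength 1 o (insert x ξ.pts) y ^ β) := by
    classical
    refine (add_le_add (hgain w₁ hxw₁ how₁ hℓ₁) (hgain w₂ hxw₂ how₂ hℓ₂)).trans ?_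
    rw [← Finset.sum_pair hne (f := fun y => edgeLength 1 o ξ.pts y ^ β -
      edgeLength 1 o (insert x ξ.pts) y ^ β)]
    refine Finset.sum_le_sum_of_subset_of_nonneg ?_
      fun y _ _ => sub_nonneg.2 (edgeLength_insert_rpow_le hβ0 o x y ξ.pts)
    intro w hw
    rcases Finset.mem_insert.1 hw with rfl | hw
    · exact hmem _ hw₁ hxw₁
    · rw [Finset.mem_singleton.1 hw]
      exact hmem _ hw₂ hxw₂
  have hdiff := edgeSum_insert_sub h hx (R := R) (by linarith) β (o := o)
  have h1 : edgeLength 1 o ξ.pts x ^ β ≤ (102 / 100 * ρ) ^ β :=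
    Real.rpow_le_rpow (edgeLength_nonneg _ _ _) (by linarith) hβ0.le
  -- As `168 / 102 > 1.64` and `β ≥ 1`, each shortened edge gains `0.64 (1.02ρ) ^ β`. Two of them
  -- outweigh the new edge, which costs at most `(1.02ρ) ^ β`, leaving `0.28`; a single one would
  -- not.
  have h2 : 164 / 100 * (102 / 100 * ρ) ^ β ≤ (168 / 100 * ρ) ^ β := by
    rw [show 168 / 100 * ρ = (168 / 102) * (102 / 100 * ρ) by ring,
      Real.mul_rpow (x := 168 / 102) (by norm_num) (by positivity)]
    have h5 := Real.rpow_le_rpow_of_exponent_le (by norm_num : (1 : ℝ) ≤ 168 / 102) hβ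
    rw [Real.rpow_one] at h5
    exact mul_le_mul_of_nonneg_right (by linarith) (by positivity)
  have h3 : ρ ^ β ≤ (102 / 100 * ρ) ^ β := Real.rpow_le_rpow hρ.le (by linarith) hβ0.le
  have h4 : 0 < ρ ^ β := Real.rpow_pos_of_pos hρ β
  linarith

/-- For a far root the cluster above `x` is closer to the root than `x`, giving `x` a short edge,
and the two clusters below are farther, so that `x` becomes a better neighbour for one point in
each. -/
lemma exists_le_varLim_of_one_le (hd : 2 ≤ d) {β : ℝ} (hβ : 1 ≤ β) {γ₀ : ℝ} (hγ₀ : 0 < γ₀) :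
    ∃ C : ℝ, 0 < C ∧ ∀ γ, γ₀ ≤ γ → ∀ Q : Measure (Conf (HypSpace d)),
      IsPoissonLaw (hypExhaustion d) (ENNReal.ofReal γ • hvol d 1) Q →
      C * γ ^ (1 - 2 * β / d) ≤ varLim d γ β := by
  -- The value of `l` makes `ρ ≤ 1 / 100` for every `γ ≥ γ₀`; the sign is `-1` because the
  -- functional decreases.
  refine exists_le_varLim_of_pattern hd (by linarith) hγ₀ 3
    (l := 1 / 100 / γ₀ ^ (-(1 / (d : ℝ)))) (σ := -1) (η := 1 / 4) (by positivity) (by norm_num)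
    (by norm_num) ?_
  intro γ hγ Q hQ ρ hρ
  have hγ0 : 0 < γ := hγ₀.trans_le hγ
  have := hQ.isProb
  have hρ0 : 0 < ρ := by rw [hρ]; positivity
  have hρ1 : ρ ≤ 1 / 100 := by
    rw [hρ, div_mul_eq_mul_div, div_le_iff₀ (by positivity)]
    exact mul_le_mul_of_nonneg_left (Real.rpow_le_rpow_of_nonpos hγ₀ hγ
      (by rw [neg_nonpos]; positivity)) (by norm_num)
  obtain ⟨z, y, y', ⟨hz1, hz2, hz3⟩, hy, hyy⟩ := exists_centers hd hρ0 hρ1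
  obtain ⟨hy1, hy2, hy3, hy4⟩ := hy y (by simp)
  obtain ⟨hw1, hw2, hw3, hw4⟩ := hy y' (by simp)
  refine ⟨![z, y, y'], ⟨by positivity, ?_, ?_, ?_⟩, ?_⟩
  · intro i
    fin_cases i <;> simp <;> linarith
  · intro i
    fin_cases i <;> simp <;> linarith
  · intro i j hij
    have h1 := hdist_comm z y
    have h2 := hdist_comm z y'
    have h3 := hdist_comm y y'
    fin_cases i <;> fin_cases j <;> simp at hij ⊢ <;> linarith
  · filter_upwards [eventually_hdist_add_lt (a := ρ / 100) (y := base d) (z := z) (by positivity)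
        (by simpa [base] using hz3),
      eventually_hdist_add_lt (a := ρ / 100) (y := y) (z := base d) (by positivity)
        (by simpa [base] using hy3),
      eventually_hdist_add_lt (a := ρ / 100) (y := y') (z := base d) (by positivity)
        (by simpa [base] using hw3), eventually_le_hdist (base d) (4 * ρ)]
      with p hp1 hp2 hp3 hp4 o x R ho hR hint
    have hpo : ∀ w : HypSpace d, hdist 1 p w = hdist 1 o (act x w) := by
      intro w
      rw [← ho, ← hdist_act x, act_iact]
    simp only [hpo, act_base] at hp1 hp2 hp3 hp4
    have hle : ∀ᵐ ξ ∂Q, (patternAt ![z, y, y'] (ρ / 100) (4 * ρ) x).indicator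
        (fun _ => 1 / 4 * ρ ^ β) ξ ≤ (pattern ![z, y, y'] (ρ / 100) (4 * ρ)).indicator (fun q =>
          -1 * (edgeSum o β R (Conf.insert q.1 q.2)).toReal - -1 * (edgeSum o β R q.2).toReal)
            (x, ξ) := by
      filter_upwards [hQ.locFin, hQ.notMem x] with ξ hξ hxξ
      by_cases hpat : ξ ∈ patternAt ![z, y, y'] (ρ / 100) (4 * ρ) x
      · have hpat' : (x, ξ) ∈ pattern ![z, y, y'] (ρ / 100) (4 * ρ) := hpat
        rw [indicator_of_mem hpat, indicator_of_mem hpat']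
        have := le_edgeSum_sub_insert hβ hρ0 hρ1 hξ hxξ hR hpat hz2 hy2 hw2 hy4 hw4 hyy hp4 hp1
          hp2 hp3
        simp only
        linarith
      · have hpat' : (x, ξ) ∉ pattern ![z, y, y'] (ρ / 100) (4 * ρ) := hpat
        rw [indicator_of_notMem hpat, indicator_of_notMem hpat']
    have hint2 := integral_mono_ae (integrable_indicator_iff
      (measurableSet_patternAt _ _ _ _) |>.2 (integrable_const _).integrableOn) hint hle
    rw [integral_indicator_const _ (measurableSet_patternAt _ _ _ _), smul_eq_mul, mul_comm] at hint2
    exact hint2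

end Shortening

end HypRST

/-! ### Exponents below one: a new point creates an edge at little loss elsewhere. -/

namespace HypRST
set_option linter.unusedSectionVars false

variable {d : ℕ} {γ : ℝ} {Q : Measure (Conf (HypSpace d))}

section Lengthening

variable {β ρ : ℝ}

/-- Bernoulli's inequality for the concave power: shortening a long edge by `a` costs little, since
`D ^ (β - 1)` is small for large `D`. -/
lemma add_rpow_sub_rpow_le (hβ0 : 0 ≤ β) (hβ1 : β ≤ 1) {a D : ℝ} (ha : 0 ≤ a) (hD : 0 < D) :
    (D + a) ^ β - D ^ β ≤ a * D ^ (β - 1) := by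
  have h1 := rpow_one_add_le_one_add_mul_self (s := a / D)
    (by linarith [div_nonneg ha hD.le]) hβ0 hβ1
  have h2 : β * (a / D) ≤ a / D := mul_le_of_le_one_left (by positivity) hβ1
  rw [show D + a = D * (1 + a / D) by field_simp, Real.mul_rpow hD.le (by positivity),
    Real.rpow_sub_one hD.ne']
  have h3 : D ^ β * (1 + a / D) ^ β ≤ D ^ β * (1 + a / D) :=
    mul_le_mul_of_nonneg_left (by linarith) (by positivity)
  calc _ ≤ D ^ β * (1 + a / D) - D ^ β := by linarith
    _ = _ := by field_simp; ring

/-- The pairs of a configuration with a pattern around `x` and a point `y` for which `x` may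
become the radial nearest neighbour. -/
def lossSet {k : ℕ} (c : Fin k → HypSpace d) (ε r : ℝ) (o x : HypSpace d) :
    Set (HypSpace d × Conf (HypSpace d)) :=
  {p | p.2 ∈ patternAt c ε r x ∧ (r ≤ hdist 1 x p.1 ∧ hdist 1 o x < hdist 1 o p.1) ∧
    p.2.pts ∩ lens o p.1 (hdist 1 x p.1) = ∅}

lemma measurableSet_lossSet {k : ℕ} (c : Fin k → HypSpace d) (ε r : ℝ) (o x : HypSpace d) :
    MeasurableSet (lossSet c ε r o x) := by
  have h1 : MeasurableSet {p : HypSpace d × Conf (HypSpace d) | p.2 ∈ patternAt c ε r x} :=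
    measurable_snd (measurableSet_patternAt c ε r x)
  have h2 : MeasurableSet {p : HypSpace d × Conf (HypSpace d) |
      r ≤ hdist 1 x p.1 ∧ hdist 1 o x < hdist 1 o p.1} := by
    have hx : Measurable fun y : HypSpace d => hdist 1 x y :=
      (continuous_hdist_comp continuous_const continuous_id).measurable
    have ho : Measurable fun y : HypSpace d => hdist 1 o y :=
      (continuous_hdist_comp continuous_const continuous_id).measurable
    exact (measurableSet_le measurable_const (hx.comp measurable_fst)).inter
      (measurableSet_lt measurable_const (ho.comp measurable_fst))
  have hA : IsOpen {p : HypSpace d × HypSpace d | p.2 ∈ lens o p.1 (hdist 1 x p.1)} :=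
    (isOpen_lt (continuous_hdist_comp continuous_fst continuous_snd)
      (continuous_hdist_comp continuous_const continuous_fst)).inter
      (isOpen_lt (continuous_hdist_comp continuous_const continuous_snd)
        (continuous_hdist_comp continuous_const continuous_fst))
  exact h1.inter (h2.inter (measurableSet_inter_eq_empty hA))

/-- An upper bound for the loss of edge length at `y` by the insertion of `x`. -/
noncomputable def loss {k : ℕ} (c : Fin k → HypSpace d) (β ρ : ℝ) (o x : HypSpace d)
    (p : HypSpace d × Conf (HypSpace d)) : ℝ :=
  (lossSet c (ρ / 100) (4 * ρ) o x).indicator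
    (fun p => 101 / 100 * ρ * hdist 1 x p.1 ^ (β - 1)) p

lemma measurable_loss {k : ℕ} (c : Fin k → HypSpace d) (β ρ : ℝ) (o x : HypSpace d) :
    Measurable (loss c β ρ o x) := by
  have hx : Measurable fun y : HypSpace d => hdist 1 x y :=
    (continuous_hdist_comp continuous_const continuous_id).measurable
  exact (((hx.comp measurable_fst).pow_const (β - 1)).const_mul (101 / 100 * ρ)).indicator
    (measurableSet_lossSet _ _ _ _ _)

lemma loss_nonneg {k : ℕ} (c : Fin k → HypSpace d) (β : ℝ) (hρ : 0 ≤ ρ) (o x : HypSpace d)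
    (p : HypSpace d × Conf (HypSpace d)) : 0 ≤ loss c β ρ o x p :=
  indicator_nonneg (fun _ _ => mul_nonneg (by positivity)
    (Real.rpow_nonneg (hdist_nonneg _ _) _)) _

variable {c : Fin 1 → HypSpace d} {o x : HypSpace d} {ξ : Conf (HypSpace d)}

/-- The points of a configuration with a pattern which are farther from the root than `x` are
not close to `x`. -/
lemma le_hdist_of_pattern (hx : x ∉ ξ.pts) (hξ : ξ ∈ patternAt c (ρ / 100) (4 * ρ) x)
    (ho0 : hdist 1 o (act x (c 0)) + ρ / 100 < hdist 1 o x) {y : HypSpace d} (hy : y ∈ ξ.pts)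
    (hlt : hdist 1 o x < hdist 1 o y) : 4 * ρ ≤ hdist 1 x y := by
  by_contra hc
  obtain ⟨i, hi⟩ := not_lt_of_notMem_patternVoid hξ hx hy (not_le.1 hc)
  rw [Subsingleton.elim i 0] at hi
  linarith [hdist_triangle o (act x (c 0)) y]

/-- A shortened edge at `y` now ends in `x` and has length at least `hdist 1 x y`. Before the
insertion the cluster next to `x` already offered a neighbour at most `1.01ρ` farther away. -/
lemma edgeLength_rpow_sub_le (hβ0 : 0 ≤ β) (hβ1 : β ≤ 1) (hρ : 0 < ρ) (hx : x ∉ ξ.pts)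
    (hξ : ξ ∈ patternAt c (ρ / 100) (4 * ρ) x) (hc0 : hdist 1 (base d) (c 0) ≤ ρ)
    (ho0 : hdist 1 o (act x (c 0)) + ρ / 100 < hdist 1 o x) {y : HypSpace d} (hy : y ∈ ξ.pts) :
    edgeLength 1 o ξ.pts y ^ β - edgeLength 1 o (insert x ξ.pts) y ^ β ≤
      loss c β ρ o x (y, ξ) := by
  by_cases hne : edgeLength 1 o (insert x ξ.pts) y = edgeLength 1 o ξ.pts y
  · rw [hne, sub_self]
    exact loss_nonneg c β hρ.le o x _
  have hlt := lt_of_edgeLength_insert_ne hne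
  have hD := le_hdist_of_pattern hx hξ ho0 hy hlt
  have hle := le_edgeLength_of_insert_ne hne
  have hD0 : 0 < hdist 1 x y := by linarith
  have hyo : y ≠ o := by
    rintro rfl
    rw [hdist_self] at hlt
    exact absurd hlt (hdist_nonneg _ _).not_gt
  have hmem : (y, ξ) ∈ lossSet c (ρ / 100) (4 * ρ) o x :=
    ⟨hξ, ⟨hD, hlt⟩, ((le_edgeLength_iff hyo _ _).1
      (hle.trans (edgeLength_insert_le o x y ξ.pts))).2⟩
  obtain ⟨w, hw1, hw2⟩ := hξ.1 0
  have hw3 : hdist 1 (act x (c 0)) w < ρ / 100 := hw2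
  have hw4 := hdist_triangle o (act x (c 0)) w
  have hw5 := hdist_triangle x (act x (c 0)) w
  have hw6 := hdist_triangle y x w
  rw [hdist_act_base] at hw5
  rw [hdist_comm y x] at hw6
  have h1 : edgeLength 1 o ξ.pts y ≤ hdist 1 x y + 101 / 100 * ρ :=
    (edgeLength_le_hdist hw1 (by linarith)).trans (by linarith)
  rw [loss, indicator_of_mem hmem]
  refine le_trans ?_ (add_rpow_sub_rpow_le hβ0 hβ1 (by positivity) hD0)
  exact sub_le_sub (Real.rpow_le_rpow (edgeLength_nonneg _ _ _) h1 hβ0)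
    (Real.rpow_le_rpow hD0.le hle hβ0)

/-- On the pattern, the insertion of a point increases the edge sum up to the loss. -/
lemma sub_loss_le_edgeSum_insert_sub (hβ0 : 0 < β) (hβ1 : β ≤ 1) (hρ : 0 < ρ) {R : ℝ}
    (h : LocFin (hypExhaustion d) ξ) (hx : x ∉ ξ.pts) (hxR : hdist 1 o x < R)
    (hξ : ξ ∈ patternAt c (ρ / 100) (4 * ρ) x)
    (hc0 : hdist 1 (base d) (c 0) ≤ ρ) (hc0' : 98 / 100 * ρ ≤ hdist 1 (base d) (c 0))
    (ho : 4 * ρ ≤ hdist 1 o x) (ho0 : hdist 1 o (act x (c 0)) + ρ / 100 < hdist 1 o x)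
    (hfin : ∫⁻ y, ENNReal.ofReal (loss c β ρ o x (y, ξ)) ∂(pointKernel (hypExhaustion d) ξ) ≠ ∞) :
    97 / 100 * ρ ^ β -
      (∫⁻ y, ENNReal.ofReal (loss c β ρ o x (y, ξ)) ∂(pointKernel (hypExhaustion d) ξ)).toReal ≤
      (edgeSum o β R (Conf.insert x ξ)).toReal - (edgeSum o β R ξ).toReal := by
  rw [edgeSum_insert_sub h hx hxR]
  have hxo : x ≠ o := by
    rintro rfl
    rw [hdist_self] at ho
    linarith
  -- The only points within `4ρ` of `x` belong to the cluster, whose centre is at distance at least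
  -- `0.98ρ` and whose radius is `0.01ρ`.
  have h1 : 97 / 100 * ρ ≤ edgeLength 1 o ξ.pts x := by
    refine le_edgeLength hxo (by linarith) fun w hw hwlt => ?_
    rcases lt_or_ge (hdist 1 x w) (4 * ρ) with h4 | h4
    · obtain ⟨i, hi⟩ := not_lt_of_notMem_patternVoid hξ hx hw h4
      rw [Subsingleton.elim i 0] at hi
      have := hdist_triangle x w (act x (c 0))
      rw [hdist_act_base, hdist_comm w] at this
      linarith
    · linarith
  have h2 : 97 / 100 * ρ ^ β ≤ edgeLength 1 o ξ.pts x ^ β := by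
    refine le_trans ?_ (Real.rpow_le_rpow (by positivity) h1 hβ0.le)
    rw [Real.mul_rpow (by norm_num) hρ.le]
    refine mul_le_mul_of_nonneg_right ?_ (by positivity)
    have h5 := Real.rpow_le_rpow_of_exponent_ge (by norm_num : (0 : ℝ) < 97 / 100) (by norm_num) hβ1
    rwa [Real.rpow_one] at h5
  have h3 : ∑ y ∈ (locFin_inter_hball h o R).toFinset,
      (edgeLength 1 o ξ.pts y ^ β - edgeLength 1 o (insert x ξ.pts) y ^ β) ≤
      ∑ y ∈ (locFin_inter_hball h o R).toFinset, loss c β ρ o x (y, ξ) := by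
    refine Finset.sum_le_sum fun y hy => ?_
    exact edgeLength_rpow_sub_le hβ0.le hβ1 hρ hx hξ hc0 ho0 ((Finite.mem_toFinset _).1 hy).1
  have h4 : ∑ y ∈ (locFin_inter_hball h o R).toFinset, loss c β ρ o x (y, ξ) ≤
      (∫⁻ y, ENNReal.ofReal (loss c β ρ o x (y, ξ))
        ∂(pointKernel (hypExhaustion d) ξ)).toReal := by
    have h5 := lintegral_mono (μ := pointKernel (hypExhaustion d) ξ)
      (f := (hball 1 o R).indicator fun y => ENNReal.ofReal (loss c β ρ o x (y, ξ)))
      (g := fun y => ENNReal.ofReal (loss c β ρ o x (y, ξ))) (indicator_le_self _ _)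
    rw [lintegral_pointKernel_indicator h] at h5
    have h6 := ENNReal.toReal_mono hfin h5
    rw [ENNReal.toReal_sum (by simp)] at h6
    refine le_trans (le_of_eq (Finset.sum_congr rfl fun y _ => ?_)) h6
    rw [ENNReal.toReal_ofReal (loss_nonneg c β hρ.le o x _)]
  linarith

/-- The pattern is likely to be accompanied by points near far away vertices. -/
lemma PatternCenters.measure_patternAt_inter_void_lens_le {k : ℕ} {c : Fin k → HypSpace d}
    {ε r : ℝ} (h : PatternCenters c ε r) (hd : 2 ≤ d) (hγ : 0 < γ)
    (hQ : IsPoissonLaw (hypExhaustion d) (ENNReal.ofReal γ • hvol d 1) Q)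
    {o x y : HypSpace d} (hr : 2 * r ≤ hdist 1 x y) (hlt : hdist 1 o x < hdist 1 o y) :
    Q.real (patternAt c ε r x ∩ voidEvent (lens o y (hdist 1 x y))) ≤
      Q.real (patternAt c ε r x) *
        Real.exp (-(γ * (unitBallVol (d - 1) / 8 ^ d) * hdist 1 x y ^ d)) := by
  have := hQ.isProb
  have hD := hdist_nonneg x y
  set D := hdist 1 x y with hDdef
  have h1 := hdist_triangle x o y
  rw [← hDdef, hdist_comm x o] at h1
  -- The ball of radius `D / 4` around `m` lies in the lens of `y` and within `D / 2` of `y`, so it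
  -- misses the ball of radius `r ≤ D / 2` around `x` and its void event is independent of the
  -- pattern.
  obtain ⟨m, hm1, hm2⟩ := exists_between y o (t := D / 4) (by positivity)
    (by rw [hdist_comm]; linarith)
  have hsub : hball 1 m (D / 4) ⊆ lens o y D := by
    intro v hv
    have hv' : hdist 1 m v < D / 4 := hv
    have h2 := hdist_triangle y m v
    have h3 := hdist_triangle o m v
    rw [hdist_comm o m, hm2, hdist_comm y o] at h3
    exact ⟨by linarith, by linarith⟩
  have hdisj : Disjoint (hball 1 m (D / 4)) (hball 1 x r) := by
    rw [Set.disjoint_left]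
    intro v hv hv2
    have hv' : hdist 1 m v < D / 4 := hv
    have hv2' : hdist 1 x v < r := hv2
    have h2 := hdist_triangle y m v
    have h3 := hdist_triangle x v y
    rw [hdist_comm v y, ← hDdef] at h3
    linarith
  calc _ ≤ Q.real (patternAt c ε r x ∩ voidEvent (hball 1 m (D / 4))) := by
        refine measureReal_mono (inter_subset_inter_right _ fun ξ hξ => ?_)
        rw [mem_voidEvent] at hξ ⊢
        exact subset_empty_iff.1 (hξ ▸ inter_subset_inter_right _ hsub)
    _ = _ := h.measure_patternAt_inter_void hd hγ hQ x (measurableSet_hball _ _)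
        (hvol_hball_lt_top hd _ _).ne hdisj
    _ ≤ _ := by
        refine mul_le_mul_of_nonneg_left (Real.exp_le_exp.2 (neg_le_neg ?_)) measureReal_nonneg
        rw [mul_assoc]
        refine mul_le_mul_of_nonneg_left ?_ hγ.le
        have h4 := le_ballVol hd m (R := D / 4) (by positivity)
        rw [ballVol_eq_real] at h4
        refine le_trans (le_of_eq ?_) h4
        rw [show D / 4 / 2 = D / 8 by ring, div_pow]
        ring

end Lengthening

end HypRST

/-! ### The expected loss, and the lower bound for all exponents. -/

namespace HypRST
set_option linter.unusedSectionVars false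

variable {d : ℕ} {γ : ℝ} {Q : Measure (Conf (HypSpace d))}

section ExpectedLoss

variable {k : ℕ} {c : Fin k → HypSpace d}

/-- The point `y` inserted by the Mecke formula is outside the pattern's ball and can only make void
conditions harder, so it may be dropped. -/
lemma insert_mem_lossSet {ε r : ℝ} (h : PatternCenters c ε r) {o x y : HypSpace d}
    {ξ : Conf (HypSpace d)} (hy : (y, Conf.insert y ξ) ∈ lossSet c ε r o x) :
    ξ ∈ patternAt c ε r x ∩ voidEvent (lens o y (hdist 1 x y)) ∧
      r ≤ hdist 1 x y ∧ hdist 1 o x < hdist 1 o y := by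
  obtain ⟨h1, h2, h3⟩ := hy
  refine ⟨⟨(h.insert_iff (Or.inr (by rw [hdist_comm]; exact h2.1)) ξ).1 h1, ?_⟩, h2⟩
  rw [mem_voidEvent]
  exact subset_empty_iff.1 (h3 ▸ inter_subset_inter_left _ (subset_insert _ _))

/-- The expected loss at a point `y`. -/
lemma lintegral_loss_insert_le {β : ℝ} (hβ1 : β ≤ 1) {ρ s : ℝ} (hρ : 0 < ρ) (hs : 0 < s)
    (hs' : s ≤ 1 / 8) (h : PatternCenters c (ρ / 100) (4 * ρ)) (hd : 2 ≤ d) (hγ : 0 < γ)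
    (hQ : IsPoissonLaw (hypExhaustion d) (ENNReal.ofReal γ • hvol d 1) Q) (o x y : HypSpace d) :
    ∫⁻ ξ, ENNReal.ofReal (loss c β ρ o x (y, Conf.insert y ξ)) ∂Q ≤
      ENNReal.ofReal (101 / 100 * ρ ^ β * Q.real (patternAt c (ρ / 100) (4 * ρ) x)) *
        ((hball 1 x (ρ / s)).indicator 1 y + ENNReal.ofReal (s ^ (1 - β)) *
          ENNReal.ofReal (Real.exp (-(γ * (unitBallVol (d - 1) / 8 ^ d) * hdist 1 x y ^ d)))) := by
  have := hQ.isProb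
  set q := Q.real (patternAt c (ρ / 100) (4 * ρ) x) with hq
  have hq0 : 0 ≤ q := measureReal_nonneg
  set D := hdist 1 x y with hD
  set A := patternAt c (ρ / 100) (4 * ρ) x ∩ voidEvent (lens o y D) with hA
  by_cases hy : 4 * ρ ≤ D ∧ hdist 1 o x < hdist 1 o y
  swap
  · refine le_trans (le_of_eq ?_) zero_le
    rw [← lintegral_zero (μ := Q)]
    refine lintegral_congr fun ξ => ?_
    have hne : (y, Conf.insert y ξ) ∉ lossSet c (ρ / 100) (4 * ρ) o x :=
      fun hc => hy (insert_mem_lossSet h hc).2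
    simp [loss, indicator_of_notMem hne]
  have hDpos : 0 < D := by linarith [hy.1]
  have hAm : MeasurableSet A := (measurableSet_patternAt _ _ _ _).inter
    (measurableSet_voidEvent (isOpen_lens o y D).measurableSet)
  have h1 : ∫⁻ ξ, ENNReal.ofReal (loss c β ρ o x (y, Conf.insert y ξ)) ∂Q ≤
      ENNReal.ofReal (101 / 100 * ρ * D ^ (β - 1) * Q.real A) := by
    calc _ ≤ ∫⁻ ξ, A.indicator (fun _ => ENNReal.ofReal (101 / 100 * ρ * D ^ (β - 1))) ξ ∂Q := by
          refine lintegral_mono fun ξ => ?_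
          by_cases hξ : (y, Conf.insert y ξ) ∈ lossSet c (ρ / 100) (4 * ρ) o x
          · rw [loss, indicator_of_mem hξ, indicator_of_mem (insert_mem_lossSet h hξ).1]
          · rw [loss, indicator_of_notMem hξ, ENNReal.ofReal_zero]
            exact zero_le
      _ = _ := by
          rw [lintegral_indicator_const hAm,
            ENNReal.ofReal_mul (p := 101 / 100 * ρ * D ^ (β - 1)) (by positivity), measureReal_def,
            ENNReal.ofReal_toReal (measure_ne_top _ _)]
  refine h1.trans ?_
  -- Near points are bounded by `D ^ (β - 1) ≤ ρ ^ (β - 1)` and will be few. For far points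
  -- concavity gives the factor `s ^ (1 - β)` and the void lens gives exponential decay.
  rcases lt_or_ge D (ρ / s) with hT | hT
  · have hyT : y ∈ hball 1 x (ρ / s) := hT
    rw [indicator_of_mem hyT, Pi.one_apply]
    refine le_trans ?_ (mul_le_mul_of_nonneg_left (le_add_of_nonneg_right zero_le) zero_le)
    rw [mul_one]
    refine ENNReal.ofReal_le_ofReal (mul_le_mul ?_ (measureReal_mono inter_subset_left)
      measureReal_nonneg (by positivity))
    have h2 : D ^ (β - 1) ≤ ρ ^ (β - 1) :=
      Real.rpow_le_rpow_of_nonpos hρ (by linarith [hy.1]) (by linarith)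
    have h3 : ρ ^ β = ρ * ρ ^ (β - 1) := by
      rw [Real.rpow_sub_one hρ.ne']
      field_simp
    rw [h3, ← mul_assoc]
    gcongr
  · refine le_trans ?_ (mul_le_mul_of_nonneg_left (le_add_of_nonneg_left zero_le) zero_le)
    have h8 : 8 * ρ ≤ D := by
      refine le_trans ?_ hT
      rw [le_div_iff₀ hs]
      nlinarith
    rw [← ENNReal.ofReal_mul (by positivity), ← ENNReal.ofReal_mul (by positivity)]
    refine ENNReal.ofReal_le_ofReal ?_
    have h2 : ρ * D ^ (β - 1) ≤ ρ ^ β * s ^ (1 - β) := by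
      have h3 : D ^ (β - 1) ≤ (ρ / s) ^ (β - 1) :=
        Real.rpow_le_rpow_of_nonpos (by positivity) hT (by linarith)
      refine (mul_le_mul_of_nonneg_left h3 hρ.le).trans (le_of_eq ?_)
      rw [Real.div_rpow hρ.le hs.le, Real.rpow_sub_one hρ.ne', show 1 - β = -(β - 1) by ring,
        Real.rpow_neg hs.le]
      field_simp
    have h4 := h.measure_patternAt_inter_void_lens_le hd hγ hQ (o := o) (x := x) (y := y)
      (by linarith) hy.2
    rw [← hD, ← hA, ← hq] at h4
    calc 101 / 100 * ρ * D ^ (β - 1) * Q.real A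
        = 101 / 100 * (ρ * D ^ (β - 1)) * Q.real A := by ring
      _ ≤ 101 / 100 * (ρ ^ β * s ^ (1 - β)) *
          (q * Real.exp (-(γ * (unitBallVol (d - 1) / 8 ^ d) * D ^ d))) := by gcongr
      _ = _ := by ring

/-- The expected total loss is small compared to the probability of the pattern. -/
lemma exists_lintegral_loss_le (hd : 2 ≤ d) {γ₀ : ℝ} (hγ₀ : 0 < γ₀) : ∃ C : ℝ, 0 < C ∧
    ∀ β ≤ 1, ∀ γ, γ₀ ≤ γ → ∀ Q : Measure (Conf (HypSpace d)),
      IsPoissonLaw (hypExhaustion d) (ENNReal.ofReal γ • hvol d 1) Q →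
      ∀ s, 0 < s → s ≤ 1 / 8 → s * γ₀ ^ (-(1 / (d : ℝ))) ≤ 1 →
      ∀ ρ, ρ = s ^ 2 * γ ^ (-(1 / (d : ℝ))) → ∀ (c : Fin k → HypSpace d),
      PatternCenters c (ρ / 100) (4 * ρ) → ∀ o x : HypSpace d,
      ∫⁻ ξ, ∫⁻ y, ENNReal.ofReal (loss c β ρ o x (y, ξ)) ∂(pointKernel (hypExhaustion d) ξ) ∂Q ≤
        ENNReal.ofReal (C * (s + s ^ (1 - β)) *
          (ρ ^ β * Q.real (patternAt c (ρ / 100) (4 * ρ) x))) := by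
  have hu := unitBallVol_pos (k := d - 1) (by omega)
  have hσ := sigmaFinite_hvol hd
  set v := unitBallVol (d - 1) / 8 ^ d with hv
  have hv0 : 0 < v := by positivity
  obtain ⟨C, hC, hCle⟩ := exists_lintegral_exp_hdist_le hd (mul_pos hγ₀ hv0)
  set A := 2 * unitBallVol (d - 1) * Real.exp ((d - 1 : ℕ) * 1) with hA
  have hA0 : 0 < A := by positivity
  refine ⟨101 / 100 * (A + C / v), by positivity, ?_⟩
  intro β hβ1 γ hγ Q hQ s hs hs8 hsγ ρ hρ c hc o x
  have := hQ.isProb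
  have hγ0 : 0 < γ := hγ₀.trans_le hγ
  have hd0 : (0 : ℝ) < d := by positivity
  have hρ0 : 0 < ρ := by rw [hρ]; positivity
  set q := Q.real (patternAt c (ρ / 100) (4 * ρ) x) with hq
  have hq0 : 0 ≤ q := measureReal_nonneg
  -- With `ρ` of order `s ^ 2` spacings, the cut-off radius is still only `s` spacings, so the mean
  -- number of near points is of order `s ^ d ≤ s`.
  have hT : ρ / s = s * γ ^ (-(1 / (d : ℝ))) := by
    rw [hρ]
    field_simp
  have hT1 : ρ / s ≤ 1 := by
    rw [hT]
    refine le_trans (mul_le_mul_of_nonneg_left ?_ hs.le) hsγ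
    exact Real.rpow_le_rpow_of_nonpos hγ₀ hγ (by rw [neg_nonpos]; positivity)
  have hTd : γ * (ρ / s) ^ d = s ^ d := by
    rw [hT, mul_pow, ← Real.rpow_natCast (γ ^ _), ← Real.rpow_mul hγ0.le, neg_mul,
      one_div_mul_cancel hd0.ne', Real.rpow_neg hγ0.le, Real.rpow_one]
    field_simp
  have hmf : Measurable fun p : HypSpace d × Conf (HypSpace d) =>
      ENNReal.ofReal (loss c β ρ o x p) := (measurable_loss c β ρ o x).ennreal_ofReal
  rw [hQ.mecke hmf]
  have hxm : Measurable fun y : HypSpace d => ENNReal.ofReal (Real.exp (-(γ * v * hdist 1 x y ^ d))) := by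
    have : Measurable fun y : HypSpace d => hdist 1 x y :=
      (continuous_hdist_comp continuous_const continuous_id).measurable
    fun_prop
  have hvolball : ENNReal.ofReal γ * hvol d 1 (hball 1 x (ρ / s)) ≤ ENNReal.ofReal (A * s) := by
    calc _ ≤ ENNReal.ofReal γ * ENNReal.ofReal (2 * unitBallVol (d - 1) * (ρ / s) ^ d *
          Real.exp ((d - 1 : ℕ) * (ρ / s))) := by
          gcongr
          exact hvol_hball_le hd x (by positivity)
      _ = ENNReal.ofReal (2 * unitBallVol (d - 1) * (γ * (ρ / s) ^ d) *
          Real.exp ((d - 1 : ℕ) * (ρ / s))) := by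
          rw [← ENNReal.ofReal_mul hγ0.le]
          congr 1
          ring
      _ ≤ _ := by
          refine ENNReal.ofReal_le_ofReal ?_
          rw [hTd, hA]
          have h1 : s ^ d ≤ s := pow_le_of_le_one hs.le (by linarith) (by omega)
          calc _ ≤ 2 * unitBallVol (d - 1) * s * Real.exp ((d - 1 : ℕ) * 1) := by gcongr
            _ = _ := by ring
  have hexp : ENNReal.ofReal γ * (ENNReal.ofReal (s ^ (1 - β)) *
      ∫⁻ y, ENNReal.ofReal (Real.exp (-(γ * v * hdist 1 x y ^ d))) ∂(hvol d 1)) ≤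
      ENNReal.ofReal (C / v * s ^ (1 - β)) := by
    calc _ ≤ ENNReal.ofReal γ * (ENNReal.ofReal (s ^ (1 - β)) * ENNReal.ofReal (C / (γ * v))) := by
          gcongr
          exact hCle (γ * v) (by gcongr) x
      _ = _ := by
          rw [← ENNReal.ofReal_mul (by positivity), ← ENNReal.ofReal_mul hγ0.le]
          congr 1
          field_simp
  calc _ ≤ ∫⁻ y, ENNReal.ofReal (101 / 100 * ρ ^ β * q) *
        ((hball 1 x (ρ / s)).indicator 1 y + ENNReal.ofReal (s ^ (1 - β)) *
          ENNReal.ofReal (Real.exp (-(γ * v * hdist 1 x y ^ d))))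
          ∂(ENNReal.ofReal γ • hvol d 1) :=
        lintegral_mono fun y => lintegral_loss_insert_le hβ1 hρ0 hs hs8 hc hd hγ0 hQ o x y
    _ = ENNReal.ofReal (101 / 100 * ρ ^ β * q) *
        (ENNReal.ofReal γ * hvol d 1 (hball 1 x (ρ / s)) + ENNReal.ofReal γ *
          (ENNReal.ofReal (s ^ (1 - β)) *
            ∫⁻ y, ENNReal.ofReal (Real.exp (-(γ * v * hdist 1 x y ^ d))) ∂(hvol d 1))) := by
        rw [lintegral_smul_measure, smul_eq_mul, lintegral_const_mul' _ _ ENNReal.ofReal_ne_top,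
          lintegral_add_right _ (hxm.const_mul _), lintegral_const_mul' _ _ ENNReal.ofReal_ne_top,
          lintegral_indicator_one (measurableSet_hball _ _)]
        ring
    _ ≤ ENNReal.ofReal (101 / 100 * ρ ^ β * q) *
        (ENNReal.ofReal (A * s) + ENNReal.ofReal (C / v * s ^ (1 - β))) := by gcongr
    _ = ENNReal.ofReal (101 / 100 * ρ ^ β * q * (A * s + C / v * s ^ (1 - β))) := by
        rw [← ENNReal.ofReal_add (by positivity) (by positivity),
          ← ENNReal.ofReal_mul (by positivity)]
    _ ≤ _ := by
        refine ENNReal.ofReal_le_ofReal ?_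
        have h1 : 0 < s ^ (1 - β) := by positivity
        have h2 : A * s + C / v * s ^ (1 - β) ≤ (A + C / v) * (s + s ^ (1 - β)) := by
          have : 0 < C / v := by positivity
          nlinarith [mul_pos hA0 h1, mul_pos this hs]
        calc _ ≤ 101 / 100 * ρ ^ β * q * ((A + C / v) * (s + s ^ (1 - β))) := by gcongr
          _ = _ := by ring

/-- The new edge gains at least `0.97 * ρ ^ β` on the pattern. Since `s + s ^ (1 - β)` tends to `0`,
which uses `β < 1`, a small `s` keeps the expected loss below half of `ρ ^ β` times the probability
of the pattern. -/
lemma exists_le_varLim_of_lt_one (hd : 2 ≤ d) {β : ℝ} (hβ0 : 0 < β) (hβ1 : β < 1) {γ₀ : ℝ}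
    (hγ₀ : 0 < γ₀) : ∃ C : ℝ, 0 < C ∧ ∀ γ, γ₀ ≤ γ → ∀ Q : Measure (Conf (HypSpace d)),
      IsPoissonLaw (hypExhaustion d) (ENNReal.ofReal γ • hvol d 1) Q →
      C * γ ^ (1 - 2 * β / d) ≤ varLim d γ β := by
  obtain ⟨C, hC, hloss⟩ := exists_lintegral_loss_le (k := 1) hd hγ₀
  have hg : 0 < γ₀ ^ (-(1 / (d : ℝ))) := by positivity
  obtain ⟨s, hs0, hs8, hs1, hs2, hs3⟩ : ∃ s : ℝ, 0 < s ∧ s ≤ 1 / 8 ∧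
      s * γ₀ ^ (-(1 / (d : ℝ))) ≤ 1 ∧ s ^ 2 * γ₀ ^ (-(1 / (d : ℝ))) ≤ 1 / 100 ∧
      C * (s + s ^ (1 - β)) ≤ 1 / 2 := by
    have hcont : ContinuousAt (fun s : ℝ => C * (s + s ^ (1 - β))) 0 :=
      continuousAt_const.mul (continuousAt_id.add
        (Real.continuousAt_rpow_const _ _ (Or.inr (by linarith))))
    have h0 : C * ((0 : ℝ) + 0 ^ (1 - β)) < 1 / 2 := by
      rw [Real.zero_rpow (by linarith)]
      norm_num
    have e1 : ∀ᶠ s : ℝ in 𝓝 0, C * (s + s ^ (1 - β)) < 1 / 2 := hcont.eventually_lt_const h0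
    have e2 : ∀ᶠ s : ℝ in 𝓝 0, s < 1 / 8 := eventually_lt_nhds (by norm_num)
    have e3 : ∀ᶠ s : ℝ in 𝓝 0, s * γ₀ ^ (-(1 / (d : ℝ))) < 1 :=
      (by fun_prop : ContinuousAt (fun s : ℝ => s * γ₀ ^ (-(1 / (d : ℝ)))) 0).eventually_lt_const
        (by simp)
    have e4 : ∀ᶠ s : ℝ in 𝓝 0, s ^ 2 * γ₀ ^ (-(1 / (d : ℝ))) < 1 / 100 :=
      (by fun_prop : ContinuousAt (fun s : ℝ => s ^ 2 * γ₀ ^ (-(1 / (d : ℝ)))) 0).eventually_lt_const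
        (by simp)
    obtain ⟨s, ⟨h1, h2, h3, h4⟩, h5⟩ := (((e1.and (e2.and (e3.and e4))).filter_mono
      (nhdsWithin_le_nhds (s := Ioi 0))).and self_mem_nhdsWithin).exists
    exact ⟨s, h5, h2.le, h3.le, h4.le, h1.le⟩
  refine exists_le_varLim_of_pattern hd hβ0 hγ₀ 1 (l := s ^ 2) (σ := 1) (η := 1 / 4)
    (by positivity) (by norm_num) (by norm_num) ?_
  intro γ hγ Q hQ ρ hρ
  have hγ0 : 0 < γ := hγ₀.trans_le hγ
  have := hQ.isProb
  have hρ0 : 0 < ρ := by rw [hρ]; positivity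
  have hρ1 : ρ ≤ 1 / 100 := by
    rw [hρ]
    refine le_trans (mul_le_mul_of_nonneg_left ?_ (by positivity)) hs2
    exact Real.rpow_le_rpow_of_nonpos hγ₀ hγ (by rw [neg_nonpos]; positivity)
  obtain ⟨z, -, -, ⟨hz1, hz2, hz3⟩, -, -⟩ := exists_centers hd hρ0 hρ1
  have hc : PatternCenters ![z] (ρ / 100) (4 * ρ) := by
    refine ⟨by positivity, ?_, ?_, ?_⟩
    · intro i
      simp only [Matrix.cons_val_fin_one]
      linarith
    · intro i
      simp only [Matrix.cons_val_fin_one]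
      linarith
    · intro i j hij
      exact absurd (Subsingleton.elim i j) hij
  refine ⟨![z], hc, ?_⟩
  filter_upwards [eventually_hdist_add_lt (a := ρ / 100) (y := base d) (z := z) (by positivity)
    (by simpa [base] using hz3), eventually_le_hdist (base d) (4 * ρ)]
    with p hp1 hp4 o x R ho hR hint
  have hpo : ∀ w : HypSpace d, hdist 1 p w = hdist 1 o (act x w) := by
    intro w
    rw [← ho, ← hdist_act x, act_iact]
  simp only [hpo, act_base] at hp1 hp4
  set q := Q.real (patternAt ![z] (ρ / 100) (4 * ρ) x) with hq
  have hq0 : 0 ≤ q := measureReal_nonneg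
  set L : Conf (HypSpace d) → ℝ≥0∞ := fun ξ =>
    ∫⁻ y, ENNReal.ofReal (loss ![z] β ρ o x (y, ξ)) ∂(pointKernel (hypExhaustion d) ξ) with hL
  have hLle := hloss β hβ1.le γ hγ Q hQ s hs0 hs8 hs1 ρ hρ ![z] hc o x
  have hLm : Measurable L := by
    have h2 := measurable_lintegral_pointKernel (E := hypExhaustion d)
      (((measurable_loss ![z] β ρ o x).ennreal_ofReal).comp measurable_swap) measurable_id
    exact h2
  have hLfin : ∫⁻ ξ, L ξ ∂Q ≠ ∞ := ne_top_of_le_ne_top ENNReal.ofReal_ne_top hLle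
  have hLint : Integrable (fun ξ => (L ξ).toReal) Q :=
    integrable_toReal_of_lintegral_ne_top hLm.aemeasurable hLfin
  have hLmean : ∫ ξ, (L ξ).toReal ∂Q ≤ 1 / 2 * (ρ ^ β * q) := by
    rw [integral_toReal hLm.aemeasurable (ae_lt_top hLm hLfin)]
    refine (ENNReal.toReal_mono ENNReal.ofReal_ne_top hLle).trans ?_
    rw [ENNReal.toReal_ofReal (by positivity)]
    gcongr
  have hP := measurableSet_patternAt ![z] (ρ / 100) (4 * ρ) x
  have hle : ∀ᵐ ξ ∂Q, (patternAt ![z] (ρ / 100) (4 * ρ) x).indicator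
      (fun _ => 97 / 100 * ρ ^ β) ξ - (L ξ).toReal ≤
        (pattern ![z] (ρ / 100) (4 * ρ)).indicator (fun q =>
          1 * (edgeSum o β R (Conf.insert q.1 q.2)).toReal - 1 * (edgeSum o β R q.2).toReal)
            (x, ξ) := by
    filter_upwards [hQ.locFin, hQ.notMem x, ae_lt_top hLm hLfin] with ξ hξ hxξ hLξ
    by_cases hpat : ξ ∈ patternAt ![z] (ρ / 100) (4 * ρ) x
    · have hpat' : (x, ξ) ∈ pattern ![z] (ρ / 100) (4 * ρ) := hpat
      rw [indicator_of_mem hpat, indicator_of_mem hpat']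
      simp only [one_mul]
      exact sub_loss_le_edgeSum_insert_sub hβ0 hβ1.le hρ0 hξ hxξ (by linarith) hpat hz2 hz1 hp4 hp1
        hLξ.ne
    · have hpat' : (x, ξ) ∉ pattern ![z] (ρ / 100) (4 * ρ) := hpat
      rw [indicator_of_notMem hpat, indicator_of_notMem hpat', zero_sub, neg_nonpos]
      exact ENNReal.toReal_nonneg
  have hPint : Integrable ((patternAt ![z] (ρ / 100) (4 * ρ) x).indicator
      fun _ => 97 / 100 * ρ ^ β) Q := (integrable_const _).indicator hP
  have hint2 := integral_mono_ae (hPint.sub hLint) hint hle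
  rw [integral_sub' hPint hLint, integral_indicator_const _ hP, smul_eq_mul, ← hq] at hint2
  refine le_trans ?_ hint2
  have h0 : 0 ≤ ρ ^ β * q := by positivity
  linarith

/-- The lower bound for the asymptotic variance. -/
lemma exists_le_varLim (hd : 2 ≤ d) {β : ℝ} (hβ0 : 0 < β) {γ₀ : ℝ} (hγ₀ : 0 < γ₀) :
    ∃ C : ℝ, 0 < C ∧ ∀ γ, γ₀ ≤ γ → ∀ Q : Measure (Conf (HypSpace d)),
      IsPoissonLaw (hypExhaustion d) (ENNReal.ofReal γ • hvol d 1) Q →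
      C * γ ^ (1 - 2 * β / d) ≤ varLim d γ β := by
  rcases lt_or_ge β 1 with h | h
  · exact exists_le_varLim_of_lt_one hd hβ0 h hγ₀
  · exact exists_le_varLim_of_one_le hd h hγ₀

end ExpectedLoss

end HypRST

/-! ### Scaling to arbitrary curvature. -/

namespace HypRST
set_option linter.unusedSectionVars false

variable {d : ℕ}

section Scaling

variable {κ : ℝ}

/-- The curvature changes only the unit of length on the same half-space, so a process of intensity
`γ` is, in curvature `-1`, one of intensity `γ * κ ^ (-d / 2)`. -/
lemma hdist_eq_mul (κ : ℝ) (x y : HypSpace d) : hdist κ x y = 1 / Real.sqrt κ * hdist 1 x y := by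
  simp [hdist]

lemma hball_eq (hκ : 0 < κ) (x : HypSpace d) (r : ℝ) :
    hball κ x r = hball 1 x (Real.sqrt κ * r) := by
  have h := Real.sqrt_pos.2 hκ
  ext y
  simp only [hball, mem_ofPred_eq]
  rw [hdist_eq_mul, one_div, inv_mul_lt_iff₀ h]

lemma hvol_eq_smul (hκ : 0 < κ) :
    hvol d κ = ENNReal.ofReal (κ ^ (-(d : ℝ) / 2)) • hvol d 1 := by
  have hm : Measurable fun x : HypSpace d =>
      ENNReal.ofReal ((1 : ℝ) ^ (-(d : ℝ) / 2) / x.1.2 ^ d) := by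
    fun_prop
  rw [hvol, hvol, ← withDensity_smul _ hm]
  congr 1
  ext x
  have hx := x.2
  rw [Pi.smul_apply, smul_eq_mul, ← ENNReal.ofReal_mul (by positivity), Real.one_rpow,
    mul_one_div]

lemma ballVol_eq (hκ : 0 < κ) (o : HypSpace d) (R : ℝ) :
    ballVol κ o R = κ ^ (-(d : ℝ) / 2) * ballVol 1 o (Real.sqrt κ * R) := by
  rw [ballVol, ballVol, hball_eq hκ, hvol_eq_smul hκ, Measure.smul_apply, smul_eq_mul,
    ENNReal.toReal_mul, ENNReal.toReal_ofReal (by positivity)]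

open scoped Pointwise in
lemma edgeLength_eq_mul (hκ : 0 < κ) (o x : HypSpace d) (ξ : Set (HypSpace d)) :
    edgeLength κ o ξ x = 1 / Real.sqrt κ * edgeLength 1 o ξ x := by
  have h := Real.sqrt_pos.2 hκ
  have hc : 0 < 1 / Real.sqrt κ := by positivity
  have e : closerVertices κ o ξ x = closerVertices 1 o ξ x := by
    ext y
    simp only [closerVertices, mem_ofPred_eq, hdist_eq_mul κ, mul_lt_mul_iff_right₀ hc]
  have e2 : hdist κ x '' closerVertices 1 o ξ x =
      (1 / Real.sqrt κ) • (hdist 1 x '' closerVertices 1 o ξ x) := by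
    rw [← image_smul, image_image]
    exact image_congr fun y _ => hdist_eq_mul κ x y
  rw [edgeLength, e, e2, Real.sInf_smul_of_nonneg hc.le, smul_eq_mul, edgeLength]

lemma edgeFunctional_eq_mul (hκ : 0 < κ) (o : HypSpace d) (α R : ℝ) {ξ : Set (HypSpace d)}
    (hξ : (ξ ∩ hball κ o R).Finite) : edgeFunctional κ o α R ξ =
      κ ^ (-α / 2) * edgeFunctional 1 o α (Real.sqrt κ * R) ξ := by
  have h := Real.sqrt_pos.2 hκ
  rw [edgeFunctional, edgeFunctional, ← hball_eq hκ, finsum_mem_eq_finite_toFinset_sum _ hξ,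
    finsum_mem_eq_finite_toFinset_sum _ hξ, Finset.mul_sum]
  refine Finset.sum_congr rfl fun x _ => ?_
  rw [edgeLength_eq_mul hκ, Real.mul_rpow (by positivity) (edgeLength_nonneg _ _ _)]
  congr 1
  rw [one_div, Real.sqrt_eq_rpow, ← Real.rpow_neg hκ.le, ← Real.rpow_mul hκ.le]
  congr 1
  ring

/-- A Poisson process for the curvature `-κ` is one for the curvature `-1`. -/
lemma IsPoissonProcess.curvature_one (hκ : 0 < κ) {γ : ℝ} (hγ : 0 < γ) {Ω : Type u}
    [MeasurableSpace Ω] {P : Measure Ω} {η : Ω → Set (HypSpace d)}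
    (h : IsPoissonProcess κ (ENNReal.ofReal γ • hvol d κ) P η) :
    IsPoissonProcess 1 (ENNReal.ofReal (γ * κ ^ (-(d : ℝ) / 2)) • hvol d 1) P η := by
  have e : ENNReal.ofReal γ • hvol d κ =
      ENNReal.ofReal (γ * κ ^ (-(d : ℝ) / 2)) • hvol d 1 := by
    rw [hvol_eq_smul hκ, smul_smul, ENNReal.ofReal_mul hγ.le]
  rw [e] at h
  refine ⟨fun ω x r => ?_, h.measurable_count, h.poisson_count, h.infinite_count, h.indep_count⟩
  have h2 := h.locallyFinite ω x (r / Real.sqrt κ)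
  rwa [hball_eq hκ, mul_div_cancel₀ _ (Real.sqrt_pos.2 hκ).ne'] at h2

lemma IsPoissonProcess.edgeFunctional_eq (hκ : 0 < κ) {μ : Measure (HypSpace d)} {Ω : Type u}
    [MeasurableSpace Ω] {P : Measure Ω} {η : Ω → Set (HypSpace d)}
    (h : IsPoissonProcess 1 μ P η) (o : HypSpace d) (α R : ℝ) (ω : Ω) :
    edgeFunctional κ o α R (η ω) =
      κ ^ (-α / 2) * (edgeSum o α (Real.sqrt κ * R) ⟨η ω⟩).toReal := by
  have hloc : LocFin (hypExhaustion d) (⟨η ω⟩ : Conf (HypSpace d)) :=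
    fun k => h.locallyFinite ω (base d) k
  have hfin : (η ω ∩ hball κ o R).Finite := by
    rw [hball_eq hκ]
    exact h.locallyFinite ω o _
  rw [edgeSum_eq hloc, ENNReal.toReal_ofReal, edgeFunctional_eq_mul hκ o α R hfin]
  exact finsum_mem_induction (0 ≤ ·) le_rfl (fun _ _ => add_nonneg)
    fun x _ => Real.rpow_nonneg (edgeLength_nonneg _ _ _) _

end Scaling

section Limits

variable {κ γ α : ℝ} {Ω : Type u} [MeasurableSpace Ω] {P : Measure Ω} [IsProbabilityMeasure P]
  {η : Ω → Set (HypSpace d)}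

lemma IsPoissonProcess.memLp_edgeFunctional (hd : 2 ≤ d) (hα : 0 < α) (hκ : 0 < κ) (hγ : 0 < γ)
    (h : IsPoissonProcess κ (ENNReal.ofReal γ • hvol d κ) P η) (o : HypSpace d) (R : ℝ) :
    MemLp (fun ω => edgeFunctional κ o α R (η ω)) 2 P := by
  have h1 := h.curvature_one hκ hγ
  obtain ⟨hm, hQ⟩ := h1.isPoissonLaw hd
  have hσ := sigmaFinite_hvol hd
  have h2 := (hQ.memLp_edgeSum hd (by positivity) o hα (Real.sqrt κ * R)).comp_measurePreserving
    ⟨hm, rfl⟩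
  simp_rw [h1.edgeFunctional_eq hκ]
  exact h2.const_mul (κ ^ (-α / 2))

/-- The mean of the edge functional in terms of the limit for the curvature `-1`. -/
lemma IsPoissonProcess.tendsto_mean (hd : 2 ≤ d) (hα : 0 < α) (hκ : 0 < κ) (hγ : 0 < γ)
    (h : IsPoissonProcess κ (ENNReal.ofReal γ • hvol d κ) P η) (o : HypSpace d) :
    Tendsto (fun R : ℝ => (∫ ω, edgeFunctional κ o α R (η ω) ∂P) / ballVol κ o R) atTop
      (𝓝 (κ ^ (-α / 2) / κ ^ (-(d : ℝ) / 2) * meanLim d (γ * κ ^ (-(d : ℝ) / 2)) α)) := by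
  have h1 := h.curvature_one hκ hγ
  obtain ⟨hm, hQ⟩ := h1.isPoissonLaw hd
  have h2 := ((hQ.tendsto_mean hd (by positivity) o hα).comp
    (tendsto_id.const_mul_atTop (Real.sqrt_pos.2 hκ))).const_mul
      (κ ^ (-α / 2) / κ ^ (-(d : ℝ) / 2))
  refine h2.congr fun R => ?_
  simp only [Function.comp_apply, id]
  rw [integral_map hm.aemeasurable
      (measurable_edgeSum o α _).ennreal_toReal.aestronglyMeasurable, ballVol_eq hκ]
  simp_rw [h1.edgeFunctional_eq hκ]
  rw [integral_const_mul, mul_div_mul_comm]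

lemma IsPoissonProcess.tendsto_variance (hd : 2 ≤ d) (hα : 0 < α) (hκ : 0 < κ) (hγ : 0 < γ)
    (h : IsPoissonProcess κ (ENNReal.ofReal γ • hvol d κ) P η) (o : HypSpace d) :
    Tendsto (fun R : ℝ => variance (fun ω => edgeFunctional κ o α R (η ω)) P / ballVol κ o R) atTop
      (𝓝 ((κ ^ (-α / 2)) ^ 2 / κ ^ (-(d : ℝ) / 2) *
        varLim d (γ * κ ^ (-(d : ℝ) / 2)) α)) := by
  have h1 := h.curvature_one hκ hγ
  obtain ⟨hm, hQ⟩ := h1.isPoissonLaw hd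
  have h2 := ((hQ.tendsto_variance hd (by positivity) o hα).comp
    (tendsto_id.const_mul_atTop (Real.sqrt_pos.2 hκ))).const_mul
      ((κ ^ (-α / 2)) ^ 2 / κ ^ (-(d : ℝ) / 2))
  refine h2.congr fun R => ?_
  simp only [Function.comp_apply, id]
  rw [variance_map (measurable_edgeSum o α _).ennreal_toReal.aemeasurable hm.aemeasurable,
    ballVol_eq hκ]
  simp_rw [h1.edgeFunctional_eq hκ]
  rw [variance_const_mul, mul_div_mul_comm]
  rfl

/-- The edge length in the limit has the given survival function. -/
lemma survLim_base_rescaled (hd : 2 ≤ d) (hα : 0 < α) (hκ : 0 < κ) (γ : ℝ) {u : ℝ} (hu : 0 < u) :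
    Real.exp (-(γ * G d (Real.sqrt κ * u ^ (1 / α)))) =
      survLim γ (base d) ((κ ^ (α / 2) * u) ^ α⁻¹) := by
  rw [survLim_base hd γ (by positivity), Real.mul_rpow (by positivity) hu.le,
    ← Real.rpow_mul hκ.le, Real.sqrt_eq_rpow, one_div α]
  congr 5
  field_simp

lemma integrableOn_exp_G (hd : 2 ≤ d) (hα : 0 < α) (hκ : 0 < κ) {γ : ℝ} (hγ : 0 < γ) :
    IntegrableOn (fun u : ℝ => Real.exp (-(γ * G d (Real.sqrt κ * u ^ (1 / α))))) (Ioi 0) := by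
  have hc : 0 < κ ^ (α / 2) := by positivity
  have h1 := (integrableOn_Ioi_comp_mul_left_iff
    (fun u : ℝ => survLim γ (base d) (u ^ α⁻¹)) 0 hc).2
      (by rw [mul_zero]; exact integrableOn_survLim hd hγ hα)
  exact h1.congr_fun (fun u hu => (survLim_base_rescaled hd hα hκ γ hu).symm) measurableSet_Ioi

/-- The substitution of `κ ^ (α / 2) * u` for `u` absorbs the factor `κ ^ (-α / 2)`; the volume
factor cancels against the rescaled intensity. -/
lemma meanLim_eq (hd : 2 ≤ d) (hα : 0 < α) (hκ : 0 < κ) (γ : ℝ) :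
    κ ^ (-α / 2) / κ ^ (-(d : ℝ) / 2) * meanLim d (γ * κ ^ (-(d : ℝ) / 2)) α =
      γ * ∫ u in Ioi (0 : ℝ),
        Real.exp (-(γ * κ ^ (-(d : ℝ) / 2) * G d (Real.sqrt κ * u ^ (1 / α)))) := by
  have hc : 0 < κ ^ (α / 2) := by positivity
  rw [setIntegral_congr_fun measurableSet_Ioi
    (fun u hu => survLim_base_rescaled hd hα hκ (γ * κ ^ (-(d : ℝ) / 2)) hu),
    integral_comp_mul_left_Ioi (fun u => survLim (γ * κ ^ (-(d : ℝ) / 2)) (base d) (u ^ α⁻¹)) 0 hc,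
    mul_zero, smul_eq_mul, meanLim, neg_div, Real.rpow_neg hκ.le (α / 2)]
  have : 0 < κ ^ (-(d : ℝ) / 2) := by positivity
  field_simp

end Limits

/-! ### The asymptotic variance and its two-sided bounds. -/

section AsymptoticVariance

open scoped Classical in
/-- The asymptotic variance for the intensity `γ` and the curvature `-κ`, defined whenever a Poisson
process with these parameters exists. -/
noncomputable def asymptoticVariance (d : ℕ) (α γ κ : ℝ) : ℝ :=
  if ∃ Q : Measure (Conf (HypSpace d)), IsPoissonLaw (hypExhaustion d)
      (ENNReal.ofReal (γ * κ ^ (-(d : ℝ) / 2)) • hvol d 1) Q then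
    (κ ^ (-α / 2)) ^ 2 / κ ^ (-(d : ℝ) / 2) * varLim d (γ * κ ^ (-(d : ℝ) / 2)) α
  -- The lower bound on `varLim` needs an actual Poisson law. Without one the convergence claim is
  -- vacuous, and this value makes the normalised variance equal to `1`.
  else γ ^ (1 - 2 * α / d)

/-- The scaling factor `κ ^ (d / 2 - α)` is exactly what turns the power of `γ` into the same power
of the rescaled intensity; hence the bounds depend on `γ` and `κ` only through the lower bound `c₀`.
-/
lemma rpow_mul_varLim_eq {α γ κ : ℝ} (hd : 2 ≤ d) (hγ : 0 < γ) (hκ : 0 < κ) (V : ℝ) :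
    γ ^ (2 * α / (d : ℝ) - 1) * ((κ ^ (-α / 2)) ^ 2 / κ ^ (-(d : ℝ) / 2) * V) =
      (γ * κ ^ (-(d : ℝ) / 2)) ^ (2 * α / (d : ℝ) - 1) * V := by
  have hd0 : (0 : ℝ) < d := by positivity
  rw [Real.mul_rpow hγ.le (by positivity), ← Real.rpow_natCast, ← Real.rpow_mul hκ.le,
    ← Real.rpow_sub hκ, ← Real.rpow_mul hκ.le, mul_assoc]
  congr 3
  push_cast
  field_simp
  ring

lemma exists_asymptoticVariance_bounds (hd : 2 ≤ d) {α c₀ : ℝ} (hα : 0 < α) (hc₀ : 0 < c₀) :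
    ∃ c C : ℝ, 0 < c ∧ 0 < C ∧ ∀ γ κ : ℝ, 0 < γ → 0 < κ → c₀ ≤ κ ^ (-(d : ℝ) / 2) * γ →
      c ≤ γ ^ (2 * α / (d : ℝ) - 1) * asymptoticVariance d α γ κ ∧
      γ ^ (2 * α / (d : ℝ) - 1) * asymptoticVariance d α γ κ ≤ C := by
  obtain ⟨C, hC, hCle⟩ := exists_varLim_le hd hα hc₀
  obtain ⟨c, hc, hcle⟩ := exists_le_varLim hd hα hc₀
  have hpow : ∀ g : ℝ, 0 < g → g ^ (2 * α / (d : ℝ) - 1) * g ^ (1 - 2 * α / (d : ℝ)) = 1 := by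
    intro g hg
    rw [← Real.rpow_add hg, sub_add_sub_cancel, sub_self, Real.rpow_zero]
  -- The comparison with `1` accommodates the default value of `asymptoticVariance`.
  refine ⟨min c 1, max C 1, by positivity, by positivity, fun γ κ hγ hκ hγκ => ?_⟩
  rw [asymptoticVariance]
  split_ifs with h
  · obtain ⟨Q, hQ⟩ := h
    rw [mul_comm] at hγκ
    set g := γ * κ ^ (-(d : ℝ) / 2) with hg
    have hg0 : 0 < g := hc₀.trans_le hγκ
    rw [rpow_mul_varLim_eq hd hγ hκ, ← hg]
    constructor
    · refine (min_le_left _ _).trans ?_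
      have := mul_le_mul_of_nonneg_left (hcle g hγκ Q hQ)
        (Real.rpow_nonneg hg0.le (2 * α / (d : ℝ) - 1))
      rwa [mul_left_comm, hpow g hg0, mul_one] at this
    · refine le_trans ?_ (le_max_left _ _)
      have := mul_le_mul_of_nonneg_left (hCle g hγκ)
        (Real.rpow_nonneg hg0.le (2 * α / (d : ℝ) - 1))
      rwa [mul_left_comm _ C, hpow g hg0, mul_one] at this
  · rw [hpow γ hγ]
    exact ⟨min_le_right _ _, le_max_right _ _⟩

lemma IsPoissonProcess.tendsto_asymptoticVariance {κ γ α : ℝ} {Ω : Type u} [MeasurableSpace Ω]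
    {P : Measure Ω} [IsProbabilityMeasure P] {η : Ω → Set (HypSpace d)} (hd : 2 ≤ d) (hα : 0 < α)
    (hκ : 0 < κ) (hγ : 0 < γ) (h : IsPoissonProcess κ (ENNReal.ofReal γ • hvol d κ) P η)
    (o : HypSpace d) :
    Tendsto (fun R : ℝ => variance (fun ω => edgeFunctional κ o α R (η ω)) P / ballVol κ o R) atTop
      (𝓝 (asymptoticVariance d α γ κ)) := by
  rw [asymptoticVariance, if_pos ⟨_, ((h.curvature_one hκ hγ).isPoissonLaw hd).2⟩]
  exact h.tendsto_variance hd hα hκ hγ o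

end AsymptoticVariance

end HypRST

theorem theorem1p2 (d : ℕ) (hd : 2 ≤ d) (α : ℝ) (hα : 0 < α) :
    -- (a), together with the square integrability of the functional
    (∀ (κ γ : ℝ), 0 < κ → 0 < γ → ∀ (o : HypRST.HypSpace d)
      (Ω : Type u) [MeasurableSpace Ω] (P : Measure Ω) [IsProbabilityMeasure P]
      (η : Ω → Set (HypRST.HypSpace d)),
      HypRST.IsPoissonProcess κ (ENNReal.ofReal γ • HypRST.hvol d κ) P η →
      (∀ R : ℝ, 0 < R → MemLp (fun ω => HypRST.edgeFunctional κ o α R (η ω)) 2 P) ∧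
      IntegrableOn (fun u : ℝ =>
        Real.exp (-(γ * κ ^ (-(d : ℝ) / 2) * HypRST.G d (Real.sqrt κ * u ^ (1 / α))))) (Ioi 0) ∧
      Tendsto (fun R : ℝ =>
          (∫ ω, HypRST.edgeFunctional κ o α R (η ω) ∂P) / HypRST.ballVol κ o R) atTop
        (𝓝 (γ * ∫ u in Ioi (0 : ℝ),
          Real.exp (-(γ * κ ^ (-(d : ℝ) / 2) * HypRST.G d (Real.sqrt κ * u ^ (1 / α))))))) ∧
    -- (b)
    (∃ V : ℝ → ℝ → ℝ,
      (∀ (κ γ : ℝ), 0 < κ → 0 < γ → ∀ (o : HypRST.HypSpace d)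
        (Ω : Type u) [MeasurableSpace Ω] (P : Measure Ω) [IsProbabilityMeasure P]
        (η : Ω → Set (HypRST.HypSpace d)),
        HypRST.IsPoissonProcess κ (ENNReal.ofReal γ • HypRST.hvol d κ) P η →
        Tendsto (fun R : ℝ =>
            variance (fun ω => HypRST.edgeFunctional κ o α R (η ω)) P / HypRST.ballVol κ o R)
          atTop (𝓝 (V γ κ))) ∧
      ∀ c₀ : ℝ, 0 < c₀ → ∃ c C : ℝ, 0 < c ∧ 0 < C ∧
        ∀ (γ κ : ℝ), 0 < γ → 0 < κ → c₀ ≤ κ ^ (-(d : ℝ) / 2) * γ →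
          c ≤ γ ^ (2 * α / (d : ℝ) - 1) * V γ κ ∧
          γ ^ (2 * α / (d : ℝ) - 1) * V γ κ ≤ C) := by
  refine ⟨fun κ γ hκ hγ o Ω _ P _ η h => ⟨fun R _ => h.memLp_edgeFunctional hd hα hκ hγ o R,
    HypRST.integrableOn_exp_G hd hα hκ (by positivity), ?_⟩,
    HypRST.asymptoticVariance d α,
    fun κ γ hκ hγ o Ω _ P _ η h => h.tendsto_asymptoticVariance hd hα hκ hγ o,
    fun c₀ hc₀ => HypRST.exists_asymptoticVariance_bounds hd hα hc₀⟩
  rw [← HypRST.meanLim_eq hd hα hκ γ]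
  exact h.tendsto_mean hd hα hκ hγ o
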